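/- **Conventions.** Vocabularies are many-sorted: a set of sorts, relation symbols with the finite sequence of sorts of their places, and function symbols (including constants) with the sorts of their arguments and of their value. In a structure every sort has a nonempty domain; $|\mathcal A|$ is the cardinality of the disjoint union of the domains. Vocabularies, structures and sentences are coded as sets in a standard way. For $\tau\subseteq\tau'$ and a $\tau'$-structure $\mathcal B$, the reduct $\mathcal B{\upharpoonright}\tau$ keeps only the domains of the sorts in $\tau$ and the interpretations of the symbols of $\tau$. $\mathcal L_{\omega\omega}$ is many-sorted first-order logic, and $\mathcal L_{\mathsf{WF}}$ is its extension by the quantifier $\mathsf{WF}xy\,\varphi(x,y)$ ($x,y$ distinct variables of the same sort $s$), which holds in $\mathcal A$ if and only if the relation $\{(a,b)\in A_s\times A_s : \mathcal A\models\varphi(a,b)\}$ is well-founded. *Bounded axiomatisability.* A class $\mathcal K$ of $\tau$-structures is $\Sigma^{B}(\mathcal L)$-axiomatisable if there are $\tau'\supseteq\tau$ and an $\mathcal L$-sentence $\varphi$ of $\tau'$ such that $\mathcal K=\{\mathcal B{\upharpoonright}\tau:\mathcal B\models\varphi\}$ and for every $\tau$-structure $\mathcal A$ there is a cardinal $\lambda_{\mathcal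 A}$ with $|\mathcal B|\le\lambda_{\mathcal A}$ for all $\mathcal B\models\varphi$ with $\mathcal B{\upharpoonright}\tau=\mathcal A$. It is $\Delta^{B}(\mathcal L)$-axiomatisable if both $\mathcal K$ and its complement among the $\tau$-structures are $\Sigma^{B}(\mathcal L)$-axiomatisable. A non-decreasing function $F$ from cardinals to cardinals is *definably bounding* if the class of two-sorted structures $(A,B)$ without symbols such that $|B|\le F(|A|)$ is $\Sigma^{B}(\mathcal L_{\omega\omega})$-axiomatisable. *Bounded definability.* For a set $x$ let $\rho_{\mathbf H}(x)=\max(\aleph_0,|\mathrm{trcl}(x)|)$. A class $X$ of sets is $\Sigma_1^F$ if there is a $\Delta_0$ formula $\psi(x,y)$ of the language $\{\in\}$, without parameters, such that for all $x$: $x\in X\leftrightarrow\exists y\,\psi(x,y)$, and if $x\in X$ then $\psi(x,y)$ holds for some $y$ with $\rho_{\mathbf H}(y)\le F(\rho_{\mathbf H}(x))$. It is $\Delta_1^F$ if both $X$ and its complement (in the class of all sets) are $\Sigma_1^F$. **Proposition 5.1.** The logic $\mathcal L_{\mathsf{WF}}$ and $\varnothing$ (no predicates) are boundedly symbiotic;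 that is: 1. the satisfaction relation $\{(\mathcal A,\varphi):\mathcal A\models_{\mathcal L_{\mathsf{WF}}}\varphi\}$ (structures of arbitrary vocabularies, sentences of the same vocabulary) is $\Delta_1^F$ for some definably bounding $F$; and 2. for every definably bounding $F$ and every finite vocabulary $\tau$ (with hereditarily finite names for its sorts and symbols), every class of $\tau$-structures that is closed under isomorphisms and $\Delta_1^F$ is $\Delta^{B}(\mathcal L_{\mathsf{WF}})$-axiomatisable. Moreover, the identity function $\mathrm{id}$ is definably bounding and the satisfaction relation of $\mathcal L_{\mathsf{WF}}$ is $\Delta_1^{\mathrm{id}}$. The class $\mathcal Q_\varnothing$ of all structures $(A,E)$ with one binary relation that are isomorphic to $(M,\in)$ for some transitive set $M$ consists exactly of the well-founded extensional structures $(A,E)$, and it is $\mathcal L_{\mathsf{WF}}$-axiomatisable, i.e. it is the class of models of a single $\mathcal L_{\mathsf{WF}}$-sentence. -/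

import Mathlib

universe u

open Cardinal

noncomputable section

namespace Symbiosis

/-! ### Finite sequences, transitive closure, hereditary size -/

/-- The natural number `n` as a von Neumann ordinal. -/
def num : ℕ → ZFSet.{u}
  | 0 => ∅
  | n + 1 => insert (num n) (num n)

/-- Finite sequences as sets, by iterated ordered pairs ending in the empty set:
`(v 0, (v 1, (..., (v (k-1), ∅))))`. -/
def tuple {k : ℕ} (v : Fin k → ZFSet.{u}) : ZFSet.{u} :=
  (List.ofFn v).foldr ZFSet.pair ∅

/-- The transitive closure of `x` (the least transitive set that includes `x`). -/
def trcl (x : ZFSet.{u}) : ZFSet.{u} :=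
  ZFSet.sep (fun y => Relation.TransGen (· ∈ ·) y x) (ZFSet.vonNeumann (ZFSet.rank x))

theorem mem_trcl {x y : ZFSet.{u}} : y ∈ trcl x ↔ Relation.TransGen (· ∈ ·) y x := by
  unfold trcl
  rw [ZFSet.mem_sep, ZFSet.mem_vonNeumann]
  refine ⟨fun h => h.2, fun h => ⟨?_, h⟩⟩
  induction h with
  | single h => exact ZFSet.rank_lt_of_mem h
  | tail _ h ih => exact ih.trans (ZFSet.rank_lt_of_mem h)

/-- The hereditary rank of `x`: the least infinite cardinal `κ` with `|trcl x| ≤ κ`,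
i.e. with `x` in `H (κ⁺)`. -/
def hrank (x : ZFSet.{u}) : Cardinal.{u} := max ℵ₀ (trcl x).card

/-- Hereditarily finite sets. -/
def HereditarilyFinite (x : ZFSet.{u}) : Prop := (trcl x).card < ℵ₀

/-! ### Bounded (Lévy) formulas and bounded `Σ₁` classes -/

/-- A family of additional predicates in the language of set theory. A single predicate is a
family indexed by a one-element type. -/
structure Predicates where
  ι : Type
  arity : ι → ℕ
  holds : (i : ι) → (Fin (arity i) → ZFSet.{u}) → Prop

/-- No predicates at all. -/
def noPredicates : Predicates.{u} where
  ι := Empty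
  arity := fun i => i.elim
  holds := fun i => i.elim

/-- `Δ₀` formulas in the language `∈`, `R`, with free variables `x_0, ..., x_{n-1}`; every
quantifier is bounded. In `ball i φ`, meaning `∀ z ∈ x_i, φ`, the bound variable `z` is variable
`0` of `φ`, and `x_j` is variable `j + 1` of `φ`. There are no parameters. -/
inductive Delta0 (R : Predicates.{u}) : ℕ → Type
  | mem {n : ℕ} (i j : Fin n) : Delta0 R n
  | eq {n : ℕ} (i j : Fin n) : Delta0 R n
  | pred {n : ℕ} (k : R.ι) (v : Fin (R.arity k) → Fin n) : Delta0 R n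
  | neg {n : ℕ} (φ : Delta0 R n) : Delta0 R n
  | and {n : ℕ} (φ ψ : Delta0 R n) : Delta0 R n
  | ball {n : ℕ} (i : Fin n) (φ : Delta0 R (n + 1)) : Delta0 R n

/-- Truth of a `Δ₀` formula in the universe of sets. -/
def Delta0.Realize {R : Predicates.{u}} : {n : ℕ} → Delta0 R n → (Fin n → ZFSet.{u}) → Prop
  | _, .mem i j, v => v i ∈ v j
  | _, .eq i j, v => v i = v j
  | _, .pred k w, v => R.holds k (fun i => v (w i))
  | _, .neg φ, v => ¬ φ.Realize v
  | _, .and φ ψ, v => φ.Realize v ∧ ψ.Realize v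
  | _, .ball i φ, v => ∀ z ∈ v i, φ.Realize (Matrix.vecCons z v)

/-- The class `X` is (lightface) `Σ₁^F(R)`-definable: it is `{x | ∃ y, ψ(x, y)}` with `ψ` a
`Δ₀(R)` formula, and for `x` in the class some witness `y` has hereditary rank at most
`F (hrank x)`. -/
def IsSigma1 (R : Predicates.{u}) (F : Cardinal.{u} → Cardinal.{u}) (X : Set ZFSet.{u}) : Prop :=
  ∃ ψ : Delta0 R 2,
    (∀ x, x ∈ X ↔ ∃ y, ψ.Realize ![x, y]) ∧
    (∀ x, x ∈ X → ∃ y, hrank y ≤ F (hrank x) ∧ ψ.Realize ![x, y])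

/-- `Δ₁^F(R)`-definable classes: both the class and its complement (in the universe of all sets)
are `Σ₁^F(R)`. -/
def IsDelta1 (R : Predicates.{u}) (F : Cardinal.{u} → Cardinal.{u}) (X : Set ZFSet.{u}) : Prop :=
  IsSigma1 R F X ∧ IsSigma1 R F Xᶜ

/-! ### Many-sorted vocabularies and structures, as sets -/

/-- A relation symbol is a name together with the finite sequence of the sorts of its places. -/
def relSym (name : ZFSet.{u}) {k : ℕ} (σ : Fin k → ZFSet.{u}) : ZFSet.{u} :=
  ZFSet.pair name (tuple σ)

/-- A function symbol is a name together with the sorts of its arguments and the sort of its value.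
Constant symbols are function symbols with `k = 0`. -/
def funSym (name : ZFSet.{u}) {k : ℕ} (σ : Fin k → ZFSet.{u}) (s : ZFSet.{u}) : ZFSet.{u} :=
  ZFSet.pair name (ZFSet.pair (tuple σ) s)

/-- Many-sorted vocabularies, with arbitrary sets as names of sorts and symbols. -/
structure Vocab where
  sorts : ZFSet.{u}
  rels : ZFSet.{u}
  funs : ZFSet.{u}
  rels_typed : ∀ r ∈ rels, ∃ (name : ZFSet.{u}) (k : ℕ) (σ : Fin k → ZFSet.{u}),
    (∀ i, σ i ∈ sorts) ∧ r = relSym name σ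
  funs_typed : ∀ f ∈ funs, ∃ (name : ZFSet.{u}) (k : ℕ) (σ : Fin k → ZFSet.{u}) (s : ZFSet.{u}),
    (∀ i, σ i ∈ sorts) ∧ s ∈ sorts ∧ f = funSym name σ s

/-- The vocabulary as a set. -/
def Vocab.code (τ : Vocab.{u}) : ZFSet.{u} :=
  ZFSet.pair τ.sorts (ZFSet.pair τ.rels τ.funs)

/-- `τ ⊆ τ'`. -/
def Vocab.Sub (τ τ' : Vocab.{u}) : Prop :=
  τ.sorts ⊆ τ'.sorts ∧ τ.rels ⊆ τ'.rels ∧ τ.funs ⊆ τ'.funs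

/-- Structures of a many-sorted vocabulary; every sort has a nonempty domain. The data are sets:
* `dom` is the set of the pairs `(s, a)` with `a` in the domain of sort `s`,
* `rel` is the set of the pairs `(r, (a_1, ..., a_k))` where `r` holds at `(a_1, ..., a_k)`,
* `fn` is the set of the `(f, ((a_1, ..., a_k), b))` where `f` has the value `b` at
  `(a_1, ..., a_k)`. -/
structure Struc (τ : Vocab.{u}) where
  dom : ZFSet.{u}
  rel : ZFSet.{u}
  fn : ZFSet.{u}
  dom_typed : ∀ p ∈ dom, ∃ s ∈ τ.sorts, ∃ a, p = ZFSet.pair s a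
  dom_nonempty : ∀ s ∈ τ.sorts, ∃ a, ZFSet.pair s a ∈ dom
  rel_typed : ∀ p ∈ rel, ∃ (name : ZFSet.{u}) (k : ℕ) (σ a : Fin k → ZFSet.{u}),
    relSym name σ ∈ τ.rels ∧ (∀ i, ZFSet.pair (σ i) (a i) ∈ dom) ∧
      p = ZFSet.pair (relSym name σ) (tuple a)
  fn_typed : ∀ p ∈ fn, ∃ (name : ZFSet.{u}) (k : ℕ) (σ : Fin k → ZFSet.{u}) (s : ZFSet.{u})
      (a : Fin k → ZFSet.{u}) (b : ZFSet.{u}),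
    funSym name σ s ∈ τ.funs ∧ (∀ i, ZFSet.pair (σ i) (a i) ∈ dom) ∧ ZFSet.pair s b ∈ dom ∧
      p = ZFSet.pair (funSym name σ s) (ZFSet.pair (tuple a) b)
  fn_total : ∀ (name : ZFSet.{u}) (k : ℕ) (σ : Fin k → ZFSet.{u}) (s : ZFSet.{u}),
    funSym name σ s ∈ τ.funs → ∀ a : Fin k → ZFSet.{u}, (∀ i, ZFSet.pair (σ i) (a i) ∈ dom) →
      ∃! b, ZFSet.pair (funSym name σ s) (ZFSet.pair (tuple a) b) ∈ fn

namespace Struc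

variable {τ τ' : Vocab.{u}}

/-- The structure (with its vocabulary) as a set. -/
def code (A : Struc τ) : ZFSet.{u} :=
  ZFSet.pair τ.code (ZFSet.pair A.dom (ZFSet.pair A.rel A.fn))

/-- The domain of sort `s`. -/
def carrier (A : Struc τ) (s : ZFSet.{u}) : ZFSet.{u} :=
  ZFSet.sep (fun a => ZFSet.pair s a ∈ A.dom) (ZFSet.sUnion (ZFSet.sUnion A.dom))

theorem mem_carrier {A : Struc τ} {s a : ZFSet.{u}} :
    a ∈ A.carrier s ↔ ZFSet.pair s a ∈ A.dom := by
  unfold carrier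
  rw [ZFSet.mem_sep]
  refine ⟨fun h => h.2, fun h => ⟨?_, h⟩⟩
  refine ZFSet.mem_sUnion.2 ⟨{s, a}, ZFSet.mem_sUnion.2 ⟨_, h, ?_⟩, ?_⟩
  · simp [ZFSet.pair]
  · simp

/-- The cardinality of a structure: that of the disjoint union of its domains. -/
def card (A : Struc τ) : Cardinal.{u} := A.dom.card

/-- `A = B ↾ τ`. -/
def IsReduct (A : Struc τ) (B : Struc τ') : Prop :=
  τ.Sub τ' ∧
  (∀ s ∈ τ.sorts, ∀ a, ZFSet.pair s a ∈ A.dom ↔ ZFSet.pair s a ∈ B.dom) ∧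
  (∀ r ∈ τ.rels, ∀ a, ZFSet.pair r a ∈ A.rel ↔ ZFSet.pair r a ∈ B.rel) ∧
  (∀ f ∈ τ.funs, ∀ a, ZFSet.pair f a ∈ A.fn ↔ ZFSet.pair f a ∈ B.fn)

/-- Isomorphism of `τ`-structures; `e s` is the bijection between the domains of sort `s`. -/
def Isomorphic (A B : Struc τ) : Prop :=
  ∃ e : ZFSet.{u} → ZFSet.{u} → ZFSet.{u},
    (∀ s ∈ τ.sorts, Set.BijOn (e s) {a | a ∈ A.carrier s} {b | b ∈ B.carrier s}) ∧
    (∀ (name : ZFSet.{u}) (k : ℕ) (σ a : Fin k → ZFSet.{u}), relSym name σ ∈ τ.rels →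
      (∀ i, a i ∈ A.carrier (σ i)) →
      (ZFSet.pair (relSym name σ) (tuple a) ∈ A.rel ↔
        ZFSet.pair (relSym name σ) (tuple fun i => e (σ i) (a i)) ∈ B.rel)) ∧
    (∀ (name : ZFSet.{u}) (k : ℕ) (σ a : Fin k → ZFSet.{u}) (s b : ZFSet.{u}),
      funSym name σ s ∈ τ.funs → (∀ i, a i ∈ A.carrier (σ i)) → b ∈ A.carrier s →
      (ZFSet.pair (funSym name σ s) (ZFSet.pair (tuple a) b) ∈ A.fn ↔
        ZFSet.pair (funSym name σ s) (ZFSet.pair (tuple fun i => e (σ i) (a i)) (e s b)) ∈ B.fn))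

end Struc

/-- A class of `τ`-structures closed under isomorphisms. -/
def IsoClosed {τ : Vocab.{u}} (K : Set (Struc τ)) : Prop :=
  ∀ A B : Struc τ, A.Isomorphic B → A ∈ K → B ∈ K

/-! ### First-order logic with the well-foundedness quantifier -/

/-- Terms. `var s n` is the `n`-th variable of sort `s`; `f` in `app` is a function symbol. -/
inductive Term : Type (u + 1)
  | var (s : ZFSet.{u}) (n : ℕ) : Term
  | app (f : ZFSet.{u}) (k : ℕ) (ts : Fin k → Term) : Term

/-- Formulas. `all s n φ` is `∀ x φ` for the `n`-th variable `x` of sort `s`; `wf s m n φ` is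
`WF x y φ` for the `m`-th and the `n`-th variable `x`, `y` of sort `s`. -/
inductive Formula : Type (u + 1)
  | eq (t t' : Term.{u}) : Formula
  | rel (r : ZFSet.{u}) (k : ℕ) (ts : Fin k → Term.{u}) : Formula
  | neg (φ : Formula) : Formula
  | and (φ ψ : Formula) : Formula
  | all (s : ZFSet.{u}) (n : ℕ) (φ : Formula) : Formula
  | wf (s : ZFSet.{u}) (m n : ℕ) (φ : Formula) : Formula

/-- `t` is a `τ`-term of sort `s`. -/
inductive Term.HasSort (τ : Vocab.{u}) : Term.{u} → ZFSet.{u} → Prop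
  | var (s : ZFSet.{u}) (n : ℕ) (hs : s ∈ τ.sorts) : HasSort τ (.var s n) s
  | app (name : ZFSet.{u}) (k : ℕ) (σ : Fin k → ZFSet.{u}) (s : ZFSet.{u}) (ts : Fin k → Term.{u})
      (hf : funSym name σ s ∈ τ.funs) (hts : ∀ i, HasSort τ (ts i) (σ i)) :
      HasSort τ (.app (funSym name σ s) k ts) s

/-- `φ` is a (well-sorted) formula of the vocabulary `τ`. -/
def Formula.IsFormula (τ : Vocab.{u}) : Formula.{u} → Prop
  | .eq t t' => ∃ s, t.HasSort τ s ∧ t'.HasSort τ s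
  | .rel r k ts => ∃ (name : ZFSet.{u}) (σ : Fin k → ZFSet.{u}),
      r = relSym name σ ∧ r ∈ τ.rels ∧ ∀ i, (ts i).HasSort τ (σ i)
  | .neg φ => φ.IsFormula τ
  | .and φ ψ => φ.IsFormula τ ∧ ψ.IsFormula τ
  | .all s _ φ => s ∈ τ.sorts ∧ φ.IsFormula τ
  | .wf s m n φ => s ∈ τ.sorts ∧ m ≠ n ∧ φ.IsFormula τ

/-- The variables of a term. -/
def Term.vars : Term.{u} → Set (ZFSet.{u} × ℕ)
  | .var s n => {(s, n)}
  | .app _ _ ts => ⋃ i, (ts i).vars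

/-- The free variables of a formula. -/
def Formula.free : Formula.{u} → Set (ZFSet.{u} × ℕ)
  | .eq t t' => t.vars ∪ t'.vars
  | .rel _ _ ts => ⋃ i, (ts i).vars
  | .neg φ => φ.free
  | .and φ ψ => φ.free ∪ ψ.free
  | .all s n φ => φ.free \ {(s, n)}
  | .wf s m n φ => φ.free \ {(s, m), (s, n)}

/-- Sentences of the vocabulary `τ`. -/
def Formula.IsSentence (τ : Vocab.{u}) (φ : Formula.{u}) : Prop :=
  φ.IsFormula τ ∧ φ.free = ∅

/-- The formula is first-order: the quantifier `WF` does not occur. -/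
def Formula.IsFO : Formula.{u} → Prop
  | .eq _ _ => True
  | .rel _ _ _ => True
  | .neg φ => φ.IsFO
  | .and φ ψ => φ.IsFO ∧ ψ.IsFO
  | .all _ _ φ => φ.IsFO
  | .wf _ _ _ _ => False

/-- Terms as sets. -/
def Term.code : Term.{u} → ZFSet.{u}
  | .var s n => ZFSet.pair (num 0) (ZFSet.pair s (num n))
  | .app f _ ts => ZFSet.pair (num 1) (ZFSet.pair f (tuple fun i => (ts i).code))

/-- Formulas as sets. -/
def Formula.code : Formula.{u} → ZFSet.{u}
  | .eq t t' => ZFSet.pair (num 0) (ZFSet.pair t.code t'.code)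
  | .rel r _ ts => ZFSet.pair (num 1) (ZFSet.pair r (tuple fun i => (ts i).code))
  | .neg φ => ZFSet.pair (num 2) φ.code
  | .and φ ψ => ZFSet.pair (num 3) (ZFSet.pair φ.code ψ.code)
  | .all s n φ => ZFSet.pair (num 4) (ZFSet.pair s (ZFSet.pair (num n) φ.code))
  | .wf s m n φ =>
      ZFSet.pair (num 5) (ZFSet.pair s (ZFSet.pair (num m) (ZFSet.pair (num n) φ.code)))

/-- Assignments of values to the variables; `v s n` is the value of the `n`-th variable of
sort `s`. -/
abbrev Assignment : Type (u + 1) := ZFSet.{u} → ℕ → ZFSet.{u}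

open Classical in
/-- Change the value of the `n`-th variable of sort `s` to `a`. -/
def Assignment.set (v : Assignment.{u}) (s : ZFSet.{u}) (n : ℕ) (a : ZFSet.{u}) :
    Assignment.{u} :=
  fun s' n' => if s' = s ∧ n' = n then a else v s' n'

/-- The value of a term (for well-sorted terms, the element `b` in the `app` clause exists and is
unique). -/
def Term.val {τ : Vocab.{u}} (A : Struc τ) (v : Assignment.{u}) : Term.{u} → ZFSet.{u}
  | .var s n => v s n
  | .app f _ ts => Classical.epsilon fun b =>
      ZFSet.pair f (ZFSet.pair (tuple fun i => (ts i).val A v) b) ∈ A.fn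

/-- Satisfaction. `WF x y φ` holds when the relation that `φ(x, y)` defines on the domain of the
sort of `x`, `y` is well-founded. -/
def Formula.Sat {τ : Vocab.{u}} (A : Struc τ) : Formula.{u} → Assignment.{u} → Prop
  | .eq t t', v => t.val A v = t'.val A v
  | .rel r _ ts, v => ZFSet.pair r (tuple fun i => (ts i).val A v) ∈ A.rel
  | .neg φ, v => ¬ φ.Sat A v
  | .and φ ψ, v => φ.Sat A v ∧ ψ.Sat A v
  | .all s n φ, v => ∀ a ∈ A.carrier s, φ.Sat A (v.set s n a)
  | .wf s m n φ, v => WellFounded fun a b : {a : ZFSet.{u} // a ∈ A.carrier s} =>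
      φ.Sat A ((v.set s m a).set s n b)

/-- `A ⊨ φ`, for a sentence `φ`. -/
def Formula.TrueIn {τ : Vocab.{u}} (A : Struc τ) (φ : Formula.{u}) : Prop :=
  ∀ v : Assignment.{u}, (∀ s ∈ τ.sorts, ∀ n, v s n ∈ A.carrier s) → φ.Sat A v

/-! ### Logics and bounded symbiosis -/

/-- A logic: for each vocabulary a class of sentences, which are sets, and a satisfaction
relation. -/
structure Logic where
  Sentence : Vocab.{u} → ZFSet.{u} → Prop
  Models : {τ : Vocab.{u}} → Struc τ → ZFSet.{u} → Prop

/-- First-order logic extended by the quantifier `WF`. -/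
def LWF : Logic.{u} where
  Sentence τ c := ∃ φ : Formula.{u}, φ.IsSentence τ ∧ φ.code = c
  Models {τ} A c := ∃ φ : Formula.{u}, φ.IsSentence τ ∧ φ.code = c ∧ φ.TrueIn A

/-- Many-sorted first-order logic. -/
def LFO : Logic.{u} where
  Sentence τ c := ∃ φ : Formula.{u}, φ.IsFO ∧ φ.IsSentence τ ∧ φ.code = c
  Models {τ} A c := ∃ φ : Formula.{u}, φ.IsFO ∧ φ.IsSentence τ ∧ φ.code = c ∧ φ.TrueIn A

/-- The satisfaction relation of `L`, as a class of pairs `(A, φ)`; `A` carries its vocabulary. -/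
def Logic.satRel (L : Logic.{u}) : Set ZFSet.{u} :=
  {x | ∃ (τ : Vocab.{u}) (A : Struc τ) (c : ZFSet.{u}),
    L.Sentence τ c ∧ L.Models A c ∧ x = ZFSet.pair A.code c}

/-- `K` is `L`-axiomatisable. -/
def Axiomatisable (L : Logic.{u}) {τ : Vocab.{u}} (K : Set (Struc τ)) : Prop :=
  ∃ c, L.Sentence τ c ∧ ∀ A : Struc τ, A ∈ K ↔ L.Models A c

/-- `K` is `Σ^B(L)`-axiomatisable: it is a bounded projection of the class of models of an
`L`-sentence. -/
def SigmaB (L : Logic.{u}) {τ : Vocab.{u}} (K : Set (Struc τ)) : Prop :=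
  ∃ (τ' : Vocab.{u}) (c : ZFSet.{u}), τ.Sub τ' ∧ L.Sentence τ' c ∧
    (∀ A : Struc τ, A ∈ K ↔ ∃ B : Struc τ', L.Models B c ∧ A.IsReduct B) ∧
    (∀ A : Struc τ, ∃ μ : Cardinal.{u}, ∀ B : Struc τ',
      L.Models B c → A.IsReduct B → B.card ≤ μ)

/-- `K` is `Δ^B(L)`-axiomatisable; the complement is taken among the `τ`-structures. -/
def DeltaB (L : Logic.{u}) {τ : Vocab.{u}} (K : Set (Struc τ)) : Prop :=
  SigmaB L K ∧ SigmaB L Kᶜ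

/-- The vocabulary with two sorts `0`, `1` and no symbols. -/
def twoSorts : Vocab.{u} where
  sorts := {num 0, num 1}
  rels := ∅
  funs := ∅
  rels_typed := fun _ h => absurd h (ZFSet.notMem_empty _)
  funs_typed := fun _ h => absurd h (ZFSet.notMem_empty _)

/-- Definably bounding functions: `F` is non-decreasing, and the class of the two-sorted structures
`(A, B)` with `|B| ≤ F |A|` is `Σ^B`-axiomatisable in first-order logic. -/
def DefinablyBounding (F : Cardinal.{u} → Cardinal.{u}) : Prop :=
  Monotone F ∧
  SigmaB LFO.{u} {A : Struc twoSorts.{u} | (A.carrier (num 1)).card ≤ F (A.carrier (num 0)).card}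

/-- The logic `L` and the predicate(s) `R` are boundedly symbiotic. Definability is without
parameters, so the finite vocabularies in the second clause are those that are hereditarily finite
sets (their sorts and symbols have hereditarily finite names). -/
def BoundedlySymbiotic (L : Logic.{u}) (R : Predicates.{u}) : Prop :=
  (∃ F : Cardinal.{u} → Cardinal.{u}, DefinablyBounding F ∧ IsDelta1 R F L.satRel) ∧
  (∀ F : Cardinal.{u} → Cardinal.{u}, DefinablyBounding F →
    ∀ τ : Vocab.{u}, HereditarilyFinite τ.code →
      ∀ K : Set (Struc τ), IsoClosed K → IsDelta1 R F (Struc.code '' K) → DeltaB L K)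

/-! ### The class `Q_∅` -/

/-- The one-sorted vocabulary with one binary relation symbol `E`. -/
def oneBinary : Vocab.{u} where
  sorts := {num 0}
  rels := {relSym (num 0) ![num 0, num 0]}
  funs := ∅
  rels_typed := fun r h => ⟨num 0, 2, ![num 0, num 0],
    fun i => by fin_cases i <;> simp, ZFSet.mem_singleton.1 h⟩
  funs_typed := fun _ h => absurd h (ZFSet.notMem_empty _)

/-- The relation `E` of a structure `(A, E)`. -/
def Struc.E (A : Struc oneBinary.{u}) (a b : ZFSet.{u}) : Prop :=
  ZFSet.pair (relSym (num 0) ![num 0, num 0]) (tuple ![a, b]) ∈ A.rel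

/-- `Q_∅`: the structures `(A, E)` that are isomorphic to `(M, ∈)` for a transitive set `M`. -/
def QEmpty : Set (Struc oneBinary.{u}) :=
  {A | ∃ M : ZFSet.{u}, M.IsTransitive ∧ ∃ e : ZFSet.{u} → ZFSet.{u},
    Set.BijOn e {a | a ∈ A.carrier (num 0)} {b | b ∈ M} ∧
    ∀ a ∈ A.carrier (num 0), ∀ b ∈ A.carrier (num 0), A.E a b ↔ e a ∈ e b}

/-- `(A, E)` is well-founded and extensional. -/
def Struc.IsWellFoundedExtensional (A : Struc oneBinary.{u}) : Prop :=
  (WellFounded fun a b : {a : ZFSet.{u} // a ∈ A.carrier (num 0)} => A.E a b) ∧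
  ∀ a ∈ A.carrier (num 0), ∀ b ∈ A.carrier (num 0),
    (∀ z ∈ A.carrier (num 0), A.E z a ↔ A.E z b) → a = b

end Symbiosis

end

open Symbiosis

namespace Symbiosis

/-! ### Tuples, numerals and ordered pairs -/

/-- The tuple of a list. -/
def tup (l : List ZFSet.{u}) : ZFSet.{u} := l.foldr ZFSet.pair ∅

@[simp] theorem tup_nil : tup ([] : List ZFSet.{u}) = ∅ := rfl

@[simp] theorem tup_cons (a : ZFSet.{u}) (l : List ZFSet.{u}) :
    tup (a :: l) = ZFSet.pair a (tup l) := rfl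

theorem tuple_succ {k : ℕ} (v : Fin (k + 1) → ZFSet.{u}) :
    tuple v = ZFSet.pair (v 0) (tuple fun i => v i.succ) := by
  simp [tuple, List.ofFn_succ]

@[simp] theorem tuple_cons {k : ℕ} (a : ZFSet.{u}) (v : Fin k → ZFSet.{u}) :
    tuple (Matrix.vecCons a v) = ZFSet.pair a (tuple v) := by
  rw [tuple_succ]; rfl

@[simp] theorem pair_ne_empty (a b : ZFSet.{u}) : ZFSet.pair a b ≠ ∅ := by
  intro h
  have : ({a} : ZFSet.{u}) ∈ ZFSet.pair a b := by simp [ZFSet.pair]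
  rw [h] at this
  exact ZFSet.notMem_empty _ this

@[simp] theorem empty_ne_pair (a b : ZFSet.{u}) : ∅ ≠ ZFSet.pair a b := (pair_ne_empty a b).symm

theorem tup_injective : Function.Injective (tup.{u}) := by
  intro l
  induction l with
  | nil => intro l' h; cases l' <;> simp_all
  | cons a l ih =>
    intro l' h
    cases l' with
    | nil => simp at h
    | cons b l' =>
      simp only [tup_cons, ZFSet.pair_inj] at h
      rw [h.1, ih h.2]

theorem tuple_sigma {k k' : ℕ} {v : Fin k → ZFSet.{u}} {w : Fin k' → ZFSet.{u}}
    (h : tuple v = tuple w) : (⟨k, v⟩ : Σ k, Fin k → ZFSet.{u}) = ⟨k', w⟩ :=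
  List.ofFn_inj'.1 (tup_injective h)

theorem tuple_length {k k' : ℕ} {v : Fin k → ZFSet.{u}} {w : Fin k' → ZFSet.{u}}
    (h : tuple v = tuple w) : k = k' := (Sigma.mk.inj_iff.1 (tuple_sigma h)).1

theorem tuple_injective {k : ℕ} : Function.Injective (tuple : (Fin k → ZFSet.{u}) → _) := by
  intro v w h
  exact eq_of_heq (Sigma.mk.inj_iff.1 (tuple_sigma h)).2

@[simp] theorem tuple_inj {k : ℕ} {v w : Fin k → ZFSet.{u}} : tuple v = tuple w ↔ v = w :=
  tuple_injective.eq_iff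

theorem relSym_inj {n n' : ZFSet.{u}} {k k' : ℕ} {σ : Fin k → ZFSet.{u}} {σ' : Fin k' → ZFSet.{u}} :
    relSym n σ = relSym n' σ' ↔ n = n' ∧ tuple σ = tuple σ' := ZFSet.pair_inj

theorem funSym_inj {n n' : ZFSet.{u}} {k k' : ℕ} {σ : Fin k → ZFSet.{u}} {σ' : Fin k' → ZFSet.{u}}
    {s s' : ZFSet.{u}} :
    funSym n σ s = funSym n' σ' s' ↔ n = n' ∧ tuple σ = tuple σ' ∧ s = s' := by
  simp [funSym, ZFSet.pair_inj]

theorem rank_lt_pair_left (a b : ZFSet.{u}) : a.rank < (ZFSet.pair a b).rank :=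
  (ZFSet.rank_lt_of_mem (ZFSet.mem_singleton.2 rfl : a ∈ ({a} : ZFSet.{u}))).trans
    (ZFSet.rank_lt_of_mem (by simp [ZFSet.pair]))

theorem rank_lt_pair_right (a b : ZFSet.{u}) : b.rank < (ZFSet.pair a b).rank :=
  (ZFSet.rank_lt_of_mem (by simp : b ∈ ({a, b} : ZFSet.{u}))).trans
    (ZFSet.rank_lt_of_mem (by simp [ZFSet.pair]))

theorem notMem_pair_self (a b : ZFSet.{u}) : ZFSet.pair a b ∉ a := fun h =>
  ((ZFSet.rank_lt_of_mem h).trans (rank_lt_pair_left a b)).false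

theorem rank_num (n : ℕ) : (num n : ZFSet.{u}).rank = n := by
  induction n with
  | zero => simp [num]
  | succ n ih => simp [num, ZFSet.rank_insert, ih]

theorem num_injective : Function.Injective (num.{u}) := fun m n h => by
  have := congrArg ZFSet.rank h
  simpa [rank_num] using this

@[simp] theorem num_inj {m n : ℕ} : (num m : ZFSet.{u}) = num n ↔ m = n := num_injective.eq_iff

/-! ### Transitive closure -/

theorem subset_trcl (x : ZFSet.{u}) : x ⊆ trcl x := fun _ h => mem_trcl.2 (.single h)

theorem trcl_transitive (x : ZFSet.{u}) : (trcl x).IsTransitive := fun _ hy _ hz =>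
  mem_trcl.2 (.head hz (mem_trcl.1 hy))

theorem trcl_subset {x M : ZFSet.{u}} (h : x ⊆ M) (hM : M.IsTransitive) : trcl x ⊆ M := by
  intro y hy
  rw [mem_trcl] at hy
  induction hy using Relation.TransGen.head_induction_on with
  | single h' => exact h h'
  | head h' _ ih => exact hM _ ih h'

theorem aleph0_le_hrank (x : ZFSet.{u}) : ℵ₀ ≤ hrank x := le_max_left _ _

theorem hrank_le {x M : ZFSet.{u}} {κ : Cardinal.{u}} (h : x ⊆ M) (hM : M.IsTransitive)
    (hκ : ℵ₀ ≤ κ) (hc : M.card ≤ κ) : hrank x ≤ κ :=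
  max_le hκ ((ZFSet.card_mono (trcl_subset h hM)).trans hc)

theorem isTransitive_insert {M x : ZFSet.{u}} (hM : M.IsTransitive) (h : x ⊆ M) :
    (insert x M : ZFSet.{u}).IsTransitive := by
  intro y hy z hz
  rcases ZFSet.mem_insert_iff.1 hy with rfl | hy
  · exact ZFSet.mem_insert_of_mem _ (h hz)
  · exact ZFSet.mem_insert_of_mem _ (hM _ hy hz)

theorem trcl_singleton (x : ZFSet.{u}) : trcl {x} = insert x (trcl x) := by
  apply ZFSet.ext
  intro z
  constructor
  · intro h
    refine trcl_subset ?_ (isTransitive_insert (trcl_transitive x) (subset_trcl x)) h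
    intro y hy
    rw [ZFSet.mem_singleton] at hy
    simp [hy]
  · intro h
    rcases ZFSet.mem_insert_iff.1 h with rfl | h
    · exact subset_trcl _ (ZFSet.mem_singleton.2 rfl)
    · exact mem_trcl.2 ((mem_trcl.1 h).tail (ZFSet.mem_singleton.2 rfl))

theorem card_insert_le_of_infinite {x y : ZFSet.{u}} {κ : Cardinal.{u}} (hκ : ℵ₀ ≤ κ)
    (h : y.card ≤ κ) : (insert x y : ZFSet.{u}).card ≤ κ :=
  ZFSet.card_insert_le.trans (Cardinal.add_le_of_le hκ h (Cardinal.one_le_aleph0.trans hκ))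

theorem card_union_le_of_infinite {x y : ZFSet.{u}} {κ : Cardinal.{u}} (hκ : ℵ₀ ≤ κ)
    (hx : x.card ≤ κ) (h : y.card ≤ κ) : (x ∪ y : ZFSet.{u}).card ≤ κ :=
  ZFSet.card_union_le.trans (Cardinal.add_le_of_le hκ hx h)

theorem card_trcl_singleton_le (x : ZFSet.{u}) : (trcl {x}).card ≤ hrank x := by
  rw [trcl_singleton]
  exact card_insert_le_of_infinite (aleph0_le_hrank x) (le_max_right _ _)

theorem mem_of_pair_mem {M a b : ZFSet.{u}} (hM : M.IsTransitive) (h : ZFSet.pair a b ∈ M) :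
    a ∈ M ∧ b ∈ M := by
  have h1 : ({a, b} : ZFSet.{u}) ∈ M := hM _ h (by simp [ZFSet.pair])
  exact ⟨hM _ h1 (by simp), hM _ h1 (by simp)⟩

/-! ### Sets from small classes -/

/-- The set with the elements of a small class. -/
noncomputable def ofSet (s : Set ZFSet.{u}) [Small.{u} s] : ZFSet.{u} :=
  ZFSet.range (Subtype.val : s → ZFSet.{u})

@[simp] theorem mem_ofSet {s : Set ZFSet.{u}} [Small.{u} s] {x : ZFSet.{u}} :
    x ∈ ofSet s ↔ x ∈ s := by simp [ofSet]

theorem card_ofSet_le {α : Type u} (f : α → ZFSet.{u}) {x : ZFSet.{u}}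
    (h : ∀ y ∈ x, ∃ a, f a = y) : x.card ≤ #α := by
  have h1 : x ⊆ ZFSet.range f := fun y hy => ZFSet.mem_range.2 (h y hy)
  refine (ZFSet.card_mono h1).trans ?_
  have := ZFSet.lift_card_range_le (f := f)
  simpa using this

theorem card_le_of_surj {x y : ZFSet.{u}} (f : ZFSet.{u} → ZFSet.{u})
    (h : ∀ b ∈ y, ∃ a ∈ x, f a = b) : y.card ≤ x.card := by
  refine card_ofSet_le (fun a : Shrink x => f ((equivShrink x).symm a)) fun b hb => ?_
  obtain ⟨a, ha, rfl⟩ := h b hb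
  exact ⟨equivShrink x ⟨a, ha⟩, by simp⟩

theorem card_le_of_inj {x y : ZFSet.{u}} (f : ZFSet.{u} → ZFSet.{u})
    (hf : ∀ a ∈ x, f a ∈ y) (hi : ∀ a ∈ x, ∀ b ∈ x, f a = f b → a = b) : x.card ≤ y.card := by
  rw [ZFSet.card, ZFSet.card, Cardinal.le_def]
  refine ⟨⟨fun a => equivShrink y ⟨f ((equivShrink x).symm a), hf _ (Subtype.prop _)⟩, ?_⟩⟩
  intro a b h
  have h1 := congrArg Subtype.val ((equivShrink y).injective h)
  exact (equivShrink x).symm.injective (Subtype.ext (hi _ (Subtype.prop _) _ (Subtype.prop _) h1))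

theorem exists_surj_of_card_le {x y : ZFSet.{u}} (h : y.card ≤ x.card) (hy : ∃ b, b ∈ y) :
    ∃ f : ZFSet.{u} → ZFSet.{u}, (∀ a, f a ∈ y) ∧ ∀ b ∈ y, ∃ a ∈ x, f a = b := by
  classical
  obtain ⟨e⟩ := h
  obtain ⟨b₀, hb₀⟩ := hy
  let g : y → x := fun b => (equivShrink x).symm (e (equivShrink y b))
  have hg : Function.Injective g := by
    intro b b' h
    simpa [g] using h
  refine ⟨fun a => if h : ∃ b : y, (g b : ZFSet.{u}) = a then h.choose else b₀, ?_, ?_⟩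
  · intro a
    dsimp only
    split_ifs with h
    · exact h.choose.2
    · exact hb₀
  · intro b hb
    refine ⟨g ⟨b, hb⟩, (g ⟨b, hb⟩).2, ?_⟩
    have h : ∃ b' : y, (g b' : ZFSet.{u}) = g ⟨b, hb⟩ := ⟨_, rfl⟩
    dsimp only
    rw [dif_pos h, hg (Subtype.ext h.choose_spec)]

theorem card_num_union_le {x : ZFSet.{u}} (f : ℕ → ZFSet.{u}) (h : ∀ y ∈ x, ∃ n, f n = y) :
    x.card ≤ ℵ₀ := by
  refine (card_ofSet_le (fun n : ULift.{u} ℕ => f n.down) fun y hy => ?_).trans (by simp)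
  obtain ⟨n, hn⟩ := h y hy
  exact ⟨⟨n⟩, hn⟩

/-! ### Closure under adjoining an element -/

/-- The arities of the operations that generate `insClosure U`. -/
def InsArity (U : ZFSet.{u}) : Option (Option (Shrink.{u} U)) → Type u
  | none => ULift Bool
  | some _ => PEmpty

instance (U : ZFSet.{u}) (o : Option (Option (Shrink.{u} U))) : Finite (InsArity U o) := by
  cases o <;> simp only [InsArity] <;> infer_instance

/-- The value of a term built from elements of `U` and the empty set by adjoining an element. -/
noncomputable def insEval (U : ZFSet.{u}) : WType (InsArity U) → ZFSet.{u}
  | ⟨none, f⟩ => insert (insEval U (f ⟨true⟩)) (insEval U (f ⟨false⟩))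
  | ⟨some none, _⟩ => ∅
  | ⟨some (some a), _⟩ => (equivShrink U).symm a

/-- The closure of `U ∪ {∅}` under `(a, b) ↦ {a} ∪ b`. -/
noncomputable def insClosure (U : ZFSet.{u}) : ZFSet.{u} := ZFSet.range (insEval U)

theorem subset_insClosure (U : ZFSet.{u}) : U ⊆ insClosure U := fun a ha =>
  ZFSet.mem_range.2 ⟨⟨some (some (equivShrink U ⟨a, ha⟩)), PEmpty.elim⟩, by simp [insEval]⟩

theorem card_insClosure_le (U : ZFSet.{u}) {κ : Cardinal.{u}} (hκ : ℵ₀ ≤ κ) (hU : U.card ≤ κ) :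
    (insClosure U).card ≤ κ := by
  have h1 : (insClosure U).card ≤ #(WType (InsArity U)) :=
    card_ofSet_le (insEval U) fun y hy => ZFSet.mem_range.1 hy
  refine h1.trans ((WType.cardinalMk_le_max_aleph0_of_finite).trans (max_le ?_ hκ))
  have h2 : #(Shrink.{u} U) ≤ κ := hU
  rw [Cardinal.mk_option, Cardinal.mk_option]
  have := Cardinal.one_le_aleph0.trans hκ
  exact Cardinal.add_le_of_le hκ (Cardinal.add_le_of_le hκ h2 this) this

/-- Transitive sets that contain the empty set and are closed under `(a, b) ↦ {a} ∪ b`. -/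
structure Adequate (M : ZFSet.{u}) : Prop where
  trans : M.IsTransitive
  empty : ∅ ∈ M
  ins : ∀ a ∈ M, ∀ b ∈ M, insert a b ∈ M

theorem adequate_insClosure {U : ZFSet.{u}} (hU : U.IsTransitive) : Adequate (insClosure U) where
  trans := by
    intro x hx
    obtain ⟨w, rfl⟩ := ZFSet.mem_range.1 hx
    clear hx
    induction w with
    | mk o f ih =>
      intro z hz
      match o, f, ih with
      | none, f, ih =>
        simp only [insEval, ZFSet.mem_insert_iff] at hz
        rcases hz with rfl | hz
        · exact ZFSet.mem_range.2 ⟨_, rfl⟩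
        · exact ih _ hz
      | some none, _, _ => simp [insEval] at hz
      | some (some a), _, _ =>
        simp only [insEval] at hz
        exact subset_insClosure U (hU _ (Subtype.prop _) hz)
  empty := ZFSet.mem_range.2 ⟨⟨some none, PEmpty.elim⟩, by simp [insEval]⟩
  ins := by
    intro a ha b hb
    obtain ⟨v, rfl⟩ := ZFSet.mem_range.1 ha
    obtain ⟨w, rfl⟩ := ZFSet.mem_range.1 hb
    exact ZFSet.mem_range.2 ⟨⟨none, fun i => if i.down then v else w⟩, by simp [insEval]⟩

namespace Adequate

variable {M : ZFSet.{u}} (hM : Adequate M)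
include hM

theorem singleton {a : ZFSet.{u}} (ha : a ∈ M) : ({a} : ZFSet.{u}) ∈ M := by
  have := hM.ins a ha ∅ hM.empty
  rwa [insert_empty_eq] at this

theorem pair {a b : ZFSet.{u}} (ha : a ∈ M) (hb : b ∈ M) : ZFSet.pair a b ∈ M :=
  hM.ins _ (hM.singleton ha) _ (hM.singleton (hM.ins _ ha _ (hM.singleton hb)))

theorem num (n : ℕ) : num n ∈ M := by
  induction n with
  | zero => exact hM.empty
  | succ n ih => exact hM.ins _ ih _ ih

theorem tuple {k : ℕ} {v : Fin k → ZFSet.{u}} (h : ∀ i, v i ∈ M) : tuple v ∈ M := by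
  induction k with
  | zero => exact hM.empty
  | succ k ih =>
    rw [tuple_succ]
    exact hM.pair (h 0) (ih fun i => h i.succ)

theorem left {a b : ZFSet.{u}} (h : ZFSet.pair a b ∈ M) : a ∈ M := (mem_of_pair_mem hM.trans h).1

theorem right {a b : ZFSet.{u}} (h : ZFSet.pair a b ∈ M) : b ∈ M := (mem_of_pair_mem hM.trans h).2

end Adequate

theorem mem_of_tuple_mem {M : ZFSet.{u}} (hM : M.IsTransitive) {k : ℕ} {v : Fin k → ZFSet.{u}}
    (h : tuple v ∈ M) (i : Fin k) : v i ∈ M := by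
  induction k with
  | zero => exact i.elim0
  | succ k ih =>
    rw [tuple_succ] at h
    obtain ⟨h0, h1⟩ := mem_of_pair_mem hM h
    exact Fin.cases h0 (fun j => ih h1 j) i

/-! ### The collapse of a well-founded relation -/

section Collapse

variable {α : Type*} [Small.{u} α] {r : α → α → Prop} (h : WellFounded r)

/-- The Mostowski collapse of a well-founded relation. -/
noncomputable def coll : α → ZFSet.{u} :=
  h.fix fun a ih => ZFSet.range fun b : {b // r b a} => ih b.1 b.2

theorem mem_coll {a : α} {z : ZFSet.{u}} : z ∈ coll h a ↔ ∃ b, r b a ∧ coll h b = z := by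
  rw [coll, h.fix_eq, ZFSet.mem_range]
  exact ⟨fun ⟨b, hb⟩ => ⟨b.1, b.2, hb⟩, fun ⟨b, hb, hz⟩ => ⟨⟨b, hb⟩, hz⟩⟩

theorem coll_mem {a b : α} (hab : r a b) : coll h a ∈ coll h b := (mem_coll h).2 ⟨a, hab, rfl⟩

theorem coll_injective (hext : ∀ a b, (∀ z, r z a ↔ r z b) → a = b) :
    Function.Injective (coll h) := by
  intro a
  induction a using h.induction with
  | _ a ih =>
    intro b hab
    refine hext a b fun z => ⟨fun hz => ?_, fun hz => ?_⟩
    · obtain ⟨c, hc, hcz⟩ := (mem_coll h).1 (hab ▸ coll_mem h hz)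
      rwa [ih z hz hcz.symm]
    · obtain ⟨c, hc, hcz⟩ := (mem_coll h).1 (hab ▸ coll_mem h hz)
      rwa [← ih c hc hcz]

theorem coll_mem_iff (hext : ∀ a b, (∀ z, r z a ↔ r z b) → a = b) {a b : α} :
    coll h a ∈ coll h b ↔ r a b := by
  refine ⟨fun hab => ?_, coll_mem h⟩
  obtain ⟨c, hc, hca⟩ := (mem_coll h).1 hab
  rwa [← coll_injective h hext hca]

theorem range_coll_transitive : (ZFSet.range (coll h)).IsTransitive := by
  intro x hx z hz
  obtain ⟨a, rfl⟩ := ZFSet.mem_range.1 hx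
  obtain ⟨b, _, rfl⟩ := (mem_coll h).1 hz
  exact ZFSet.mem_range.2 ⟨b, rfl⟩

end Collapse

/-! ### Predicates defined by `Δ₀` formulas -/

/-- The predicate `P` on `n`-tuples of sets is defined by a `Δ₀` formula. -/
class D0 {n : ℕ} (P : (Fin n → ZFSet.{u}) → Prop) : Prop where
  out : ∃ φ : Delta0 noPredicates.{u} n, ∀ v, φ.Realize v ↔ P v

namespace D0

variable {n : ℕ} {P Q : (Fin n → ZFSet.{u}) → Prop}

theorem congr (h : D0 P) (hPQ : ∀ v, Q v ↔ P v) : D0 Q :=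
  have : Q = P := funext fun v => propext (hPQ v)
  this ▸ h

instance mem (i j : Fin n) : D0 fun v : Fin n → ZFSet.{u} => v i ∈ v j :=
  ⟨.mem i j, fun _ => Iff.rfl⟩

instance eq (i j : Fin n) : D0 fun v : Fin n → ZFSet.{u} => v i = v j :=
  ⟨.eq i j, fun _ => Iff.rfl⟩

instance not [D0 P] : D0 fun v => ¬ P v :=
  let ⟨φ, h⟩ := out (P := P)
  ⟨.neg φ, fun v => not_congr (h v)⟩

instance and [D0 P] [D0 Q] : D0 fun v => P v ∧ Q v :=
  let ⟨φ, h⟩ := out (P := P)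
  let ⟨ψ, h'⟩ := out (P := Q)
  ⟨.and φ ψ, fun v => and_congr (h v) (h' v)⟩

instance or [D0 P] [D0 Q] : D0 fun v => P v ∨ Q v :=
  congr (P := fun v => ¬ (¬ P v ∧ ¬ Q v)) inferInstance fun v => by tauto

instance imp [D0 P] [D0 Q] : D0 fun v => P v → Q v :=
  congr (P := fun v => ¬ P v ∨ Q v) inferInstance fun v => by tauto

instance iff [D0 P] [D0 Q] : D0 fun v => P v ↔ Q v :=
  congr (P := fun v => (P v → Q v) ∧ (Q v → P v)) inferInstance fun v => by tauto

instance ball (i : Fin n) {P : ZFSet.{u} → (Fin n → ZFSet.{u}) → Prop}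
    [D0 fun w : Fin (n + 1) → ZFSet.{u} => P (w 0) fun i => w i.succ] :
    D0 fun v => ∀ z ∈ v i, P z v :=
  let ⟨φ, h⟩ := out (P := fun w : Fin (n + 1) → ZFSet.{u} => P (w 0) fun i => w i.succ)
  ⟨.ball i φ, fun v => forall_congr' fun z => imp_congr Iff.rfl (h (Matrix.vecCons z v))⟩

instance bex (i : Fin n) {P : ZFSet.{u} → (Fin n → ZFSet.{u}) → Prop}
    [D0 fun w : Fin (n + 1) → ZFSet.{u} => P (w 0) fun i => w i.succ] :
    D0 fun v => ∃ z ∈ v i, P z v :=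
  congr (P := fun v => ¬ ∀ z ∈ v i, ¬ P z v) inferInstance fun v => by simp

instance const_false : D0 fun _ : Fin (n + 1) → ZFSet.{u} => False :=
  congr (P := fun v : Fin (n + 1) → ZFSet.{u} => ¬ v 0 = v 0) inferInstance fun v => by simp

instance subset (i j : Fin n) : D0 fun v : Fin n → ZFSet.{u} => v i ⊆ v j :=
  inferInstanceAs (D0 fun v : Fin n → ZFSet.{u} => ∀ z ∈ v i, z ∈ v j)

instance eq_empty (i : Fin n) : D0 fun v : Fin n → ZFSet.{u} => v i = ∅ :=
  congr (P := fun v : Fin n → ZFSet.{u} => ∀ z ∈ v i, ¬ z = z) inferInstance fun v => by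
    simp [ZFSet.eq_empty]

instance empty_mem (i : Fin n) : D0 fun v : Fin n → ZFSet.{u} => ∅ ∈ v i :=
  congr (P := fun v : Fin n → ZFSet.{u} => ∃ z ∈ v i, z = ∅) inferInstance fun v => by
    simp

instance eq_insert (i j k : Fin n) :
    D0 fun v : Fin n → ZFSet.{u} => v i = insert (v j) (v k) :=
  congr (P := fun v : Fin n → ZFSet.{u} =>
    v j ∈ v i ∧ v k ⊆ v i ∧ ∀ z ∈ v i, z = v j ∨ z ∈ v k) inferInstance fun v => by
    constructor
    · intro h
      rw [h]
      exact ⟨ZFSet.mem_insert _ _, fun z hz => ZFSet.mem_insert_of_mem _ hz,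
        fun z hz => ZFSet.mem_insert_iff.1 hz⟩
    · rintro ⟨h1, h2, h3⟩
      apply ZFSet.ext
      intro z
      rw [ZFSet.mem_insert_iff]
      exact ⟨h3 z, fun h => h.elim (fun h => h ▸ h1) fun h => h2 h⟩

instance insert_mem (i j k : Fin n) :
    D0 fun v : Fin n → ZFSet.{u} => insert (v i) (v j) ∈ v k :=
  congr (P := fun v : Fin n → ZFSet.{u} => ∃ z ∈ v k, z = insert (v i) (v j)) inferInstance
    fun v => by simp

theorem eq_doubleton_iff {x a b : ZFSet.{u}} :
    x = {a, b} ↔ a ∈ x ∧ b ∈ x ∧ ∀ z ∈ x, z = a ∨ z = b := by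
  constructor
  · rintro rfl; simp
  · rintro ⟨h1, h2, h3⟩
    apply ZFSet.ext
    intro z
    rw [ZFSet.mem_pair]
    exact ⟨h3 z, fun h => h.elim (fun h => h ▸ h1) fun h => h ▸ h2⟩

instance eq_doubleton (i j k : Fin n) :
    D0 fun v : Fin n → ZFSet.{u} => v i = {v j, v k} :=
  congr (P := fun v : Fin n → ZFSet.{u} =>
    v j ∈ v i ∧ v k ∈ v i ∧ ∀ z ∈ v i, z = v j ∨ z = v k) inferInstance fun _ =>
    eq_doubleton_iff

instance eq_pair (i j k : Fin n) :
    D0 fun v : Fin n → ZFSet.{u} => v i = ZFSet.pair (v j) (v k) :=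
  congr (P := fun v : Fin n → ZFSet.{u} =>
    (∃ z ∈ v i, z = {v j, v j}) ∧ (∃ z ∈ v i, z = {v j, v k}) ∧
      ∀ z ∈ v i, z = {v j, v j} ∨ z = {v j, v k}) inferInstance fun v => by
    simp only [exists_eq_right]
    rw [ZFSet.pair, ← eq_doubleton_iff, ZFSet.pair_eq_singleton]

instance pair_mem (i j k : Fin n) :
    D0 fun v : Fin n → ZFSet.{u} => ZFSet.pair (v i) (v j) ∈ v k :=
  congr (P := fun v : Fin n → ZFSet.{u} => ∃ p ∈ v k, p = ZFSet.pair (v i) (v j)) inferInstance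
    fun v => by simp

theorem pair_exists_iff {p : ZFSet.{u}} {P : ZFSet.{u} → ZFSet.{u} → Prop} :
    (∃ x ∈ p, ∃ a ∈ x, ∃ y ∈ p, ∃ b ∈ y, p = ZFSet.pair a b ∧ P a b) ↔
      ∃ a b, p = ZFSet.pair a b ∧ P a b := by
  constructor
  · rintro ⟨_, _, a, _, _, _, b, _, h⟩
    exact ⟨a, b, h⟩
  · rintro ⟨a, b, rfl, h⟩
    exact ⟨{a}, by simp [ZFSet.pair], a, by simp, {a, b}, by simp [ZFSet.pair], b, by simp, rfl, h⟩

/-- Unpacking an ordered pair. -/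
instance exists_pair (i : Fin n) {P : ZFSet.{u} → ZFSet.{u} → (Fin n → ZFSet.{u}) → Prop}
    [D0 fun w : Fin (n + 4) → ZFSet.{u} =>
      P (w (Fin.succ (Fin.succ 0))) (w 0) fun i => w i.succ.succ.succ.succ] :
    D0 fun v => ∃ a b, v i = ZFSet.pair a b ∧ P a b v :=
  congr (P := fun v : Fin n → ZFSet.{u} =>
    ∃ x ∈ v i, ∃ a ∈ x, ∃ y ∈ v i, ∃ b ∈ y, v i = ZFSet.pair a b ∧ P a b v) inferInstance
    fun _ => pair_exists_iff.symm

instance triple_mem (i j k l : Fin n) :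
    D0 fun v : Fin n → ZFSet.{u} => ZFSet.pair (v i) (ZFSet.pair (v j) (v k)) ∈ v l :=
  congr (P := fun v : Fin n → ZFSet.{u} => ∃ p ∈ v l, ∃ a b, p = ZFSet.pair a b ∧
      (a = v i ∧ b = ZFSet.pair (v j) (v k))) inferInstance
    fun v => by
      constructor
      · intro h; exact ⟨_, h, _, _, rfl, rfl, rfl⟩
      · rintro ⟨p, h, a, b, rfl, rfl, rfl⟩; exact h

instance quad_mem (i j k l m : Fin n) :
    D0 fun v : Fin n → ZFSet.{u} =>
      ZFSet.pair (v i) (ZFSet.pair (v j) (ZFSet.pair (v k) (v l))) ∈ v m :=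
  congr (P := fun v : Fin n → ZFSet.{u} => ∃ p ∈ v m, ∃ a b, p = ZFSet.pair a b ∧
      (a = v i ∧ ∃ c d, b = ZFSet.pair c d ∧ (c = v j ∧ d = ZFSet.pair (v k) (v l)))) inferInstance
    fun v => by
      constructor
      · intro h; exact ⟨_, h, _, _, rfl, rfl, _, _, rfl, rfl, rfl⟩
      · rintro ⟨p, h, a, b, rfl, rfl, c, d, rfl, rfl, rfl⟩; exact h

instance eq_num (m : ℕ) (i : Fin n) : D0 fun v : Fin n → ZFSet.{u} => v i = num m := by
  clear P Q
  induction m generalizing n with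
  | zero => exact inferInstanceAs (D0 fun v : Fin n → ZFSet.{u} => v i = ∅)
  | succ m ih =>
    refine congr (P := fun v : Fin n → ZFSet.{u} => ∃ z ∈ v i, z = num m ∧ v i = insert z z) ?_ ?_
    · have := fun i => @ih (n + 1) i
      infer_instance
    · intro v
      constructor
      · intro h
        exact ⟨num m, by rw [h]; exact ZFSet.mem_insert _ _, rfl, h⟩
      · rintro ⟨z, _, rfl, h⟩
        exact h

instance isTransitive (i : Fin n) : D0 fun v : Fin n → ZFSet.{u} => (v i).IsTransitive :=
  inferInstanceAs (D0 fun v : Fin n → ZFSet.{u} => ∀ z ∈ v i, z ⊆ v i)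

instance adequate (i : Fin n) : D0 fun v : Fin n → ZFSet.{u} => Adequate (v i) :=
  congr (P := fun v : Fin n → ZFSet.{u} => (v i).IsTransitive ∧ ∅ ∈ v i ∧
    ∀ a ∈ v i, ∀ b ∈ v i, insert a b ∈ v i) inferInstance
    fun _ => ⟨fun h => ⟨h.1, h.2, h.3⟩, fun h => ⟨h.1, h.2.1, h.2.2⟩⟩

end D0

/-- `z` is a natural number, in a form that refers only to elements of `z`. -/
def IsNum (z : ZFSet.{u}) : Prop :=
  (z = ∅ ∨ ∃ w ∈ z, z = insert w w) ∧ ∀ x ∈ z, x = ∅ ∨ ∃ w ∈ x, x = insert w w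

theorem isNum_iff {z : ZFSet.{u}} : IsNum z ↔ ∃ n, z = num n := by
  constructor
  · induction z using ZFSet.inductionOn with
    | _ z ih =>
      rintro ⟨rfl | ⟨w, hw, h⟩, h2⟩
      · exact ⟨0, rfl⟩
      · obtain ⟨n, rfl⟩ := ih w hw ⟨h2 w hw, fun x hx => h2 x (h ▸ ZFSet.mem_insert_of_mem _ hx)⟩
        exact ⟨n + 1, h⟩
  · rintro ⟨n, rfl⟩
    have key : ∀ n, (num n : ZFSet.{u}) = ∅ ∨ ∃ w ∈ (num n : ZFSet.{u}), num n = insert w w := by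
      intro n
      cases n with
      | zero => exact .inl rfl
      | succ n => exact .inr ⟨num n, ZFSet.mem_insert _ _, rfl⟩
    refine ⟨key n, ?_⟩
    induction n with
    | zero => intro x hx; exact absurd hx (ZFSet.notMem_empty _)
    | succ n ih =>
      intro x hx
      rcases ZFSet.mem_insert_iff.1 hx with rfl | hx
      · exact key n
      · exact ih x hx

theorem isNum_num (n : ℕ) : IsNum (num n : ZFSet.{u}) := isNum_iff.2 ⟨n, rfl⟩

instance {n : ℕ} (i : Fin n) : D0 fun v : Fin n → ZFSet.{u} => IsNum (v i) := by
  unfold IsNum; infer_instance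

/-! ### Hereditarily finite sets are `Δ₀`-definable -/

theorem D0.finite_or {n : ℕ} {ι : Type*} {s : Set ι} (hs : s.Finite)
    {P : ι → (Fin (n + 1) → ZFSet.{u}) → Prop} (h : ∀ i ∈ s, D0 (P i)) :
    D0 fun v => ∃ i ∈ s, P i v := by
  induction s, hs using Set.Finite.induction_on with
  | empty => simpa using D0.const_false
  | @insert a s _ _ ih =>
    have h1 := h a (Set.mem_insert _ _)
    have h2 := ih fun i hi => h i (Set.mem_insert_of_mem _ hi)
    exact D0.congr (P := fun v => P a v ∨ ∃ i ∈ s, P i v) inferInstance fun v => by simp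

theorem D0.finite_and {n : ℕ} {ι : Type*} {s : Set ι} (hs : s.Finite)
    {P : ι → (Fin (n + 1) → ZFSet.{u}) → Prop} (h : ∀ i ∈ s, D0 (P i)) :
    D0 fun v => ∀ i ∈ s, P i v := by
  have := D0.finite_or hs (P := fun i v => ¬ P i v) fun i hi => by
    have := h i hi
    infer_instance
  exact D0.congr (P := fun v => ¬ ∃ i ∈ s, ¬ P i v) inferInstance fun v => by simp

theorem finite_of_card_lt {x : ZFSet.{u}} (h : x.card < ℵ₀) : {y | y ∈ x}.Finite := by
  have h1 : #x < ℵ₀ := by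
    rw [ZFSet.cardinalMk_coe_sort]
    simpa using h
  rw [Cardinal.lt_aleph0_iff_finite] at h1
  exact @Set.toFinite _ {y | y ∈ x} h1

theorem HereditarilyFinite.finite {x : ZFSet.{u}} (h : HereditarilyFinite x) :
    {y | y ∈ x}.Finite :=
  (finite_of_card_lt h).subset fun _ hy => subset_trcl x hy

theorem HereditarilyFinite.mem {x y : ZFSet.{u}} (h : HereditarilyFinite x) (hy : y ∈ x) :
    HereditarilyFinite y :=
  (ZFSet.card_mono fun _ hz => mem_trcl.2 ((mem_trcl.1 hz).tail hy)).trans_lt h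

theorem HereditarilyFinite.of_pair {a b : ZFSet.{u}} (h : HereditarilyFinite (ZFSet.pair a b)) :
    HereditarilyFinite a ∧ HereditarilyFinite b := by
  have h1 : HereditarilyFinite ({a, b} : ZFSet.{u}) := h.mem (by simp [ZFSet.pair])
  exact ⟨h1.mem (by simp), h1.mem (by simp)⟩

theorem HereditarilyFinite.d0 {x : ZFSet.{u}} (hx : HereditarilyFinite x) {n : ℕ} (i : Fin n) :
    D0 fun v : Fin n → ZFSet.{u} => v i = x := by
  induction x using ZFSet.inductionOn generalizing n with
  | _ x ih =>
    obtain _ | n := n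
    · exact i.elim0
    have h1 : D0 fun v : Fin (n + 1) → ZFSet.{u} => ∀ y ∈ {y | y ∈ x}, ∃ z ∈ v i, z = y :=
      D0.finite_and hx.finite fun y hy => by
        have := @ih y hy (hx.mem hy) (n + 1 + 1) 0
        infer_instance
    have h2 : D0 fun w : Fin (n + 1 + 1) → ZFSet.{u} => ∃ y ∈ {y | y ∈ x}, w 0 = y :=
      D0.finite_or hx.finite fun y hy => ih y hy (hx.mem hy) 0
    refine D0.congr (P := fun v : Fin (n + 1) → ZFSet.{u} =>
      (∀ y ∈ {y | y ∈ x}, ∃ z ∈ v i, z = y) ∧ ∀ z ∈ v i, ∃ y ∈ {y | y ∈ x}, z = y)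
      inferInstance fun v => ?_
    constructor
    · intro h
      rw [h]
      exact ⟨fun y hy => ⟨y, hy, rfl⟩, fun z hz => ⟨z, hz, rfl⟩⟩
    · rintro ⟨h1, h2⟩
      apply ZFSet.ext
      intro z
      constructor
      · intro hz
        obtain ⟨y, hy, rfl⟩ := h2 z hz
        exact hy
      · intro hz
        obtain ⟨y, hy, rfl⟩ := h1 z hz
        exact hy

/-! ### Recursion clauses for relations on a transitive set -/

/-- The ternary relation with the graph `T`. -/
def Tri (T a b c : ZFSet.{u}) : Prop := ZFSet.pair a (ZFSet.pair b c) ∈ T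

instance {n : ℕ} (i j k l : Fin n) :
    D0 fun v : Fin n → ZFSet.{u} => Tri (v i) (v j) (v k) (v l) := by
  unfold Tri; infer_instance

/-- The graph of a relation on `M`. -/
def graph₃ (M : ZFSet.{u}) (R : ZFSet.{u} → ZFSet.{u} → ZFSet.{u} → Prop) : ZFSet.{u} :=
  ZFSet.sep (fun p => ∃ a b c, p = ZFSet.pair a (ZFSet.pair b c) ∧ R a b c) M

theorem graph₃_subset (M : ZFSet.{u}) (R : ZFSet.{u} → ZFSet.{u} → ZFSet.{u} → Prop) :
    graph₃ M R ⊆ M := ZFSet.sep_subset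

theorem tri_graph₃ {M : ZFSet.{u}} (hM : Adequate M)
    {R : ZFSet.{u} → ZFSet.{u} → ZFSet.{u} → Prop} {a b c : ZFSet.{u}} (ha : a ∈ M) (hb : b ∈ M)
    (hc : c ∈ M) : Tri (graph₃ M R) a b c ↔ R a b c := by
  rw [Tri, graph₃, ZFSet.mem_sep]
  constructor
  · rintro ⟨_, a', b', c', h, hR⟩
    simp only [ZFSet.pair_inj] at h
    obtain ⟨rfl, rfl, rfl⟩ := h
    exact hR
  · exact fun h => ⟨hM.pair ha (hM.pair hb hc), a, b, c, rfl, h⟩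

/-- `Z p q u` holds when `p`, `q` are tuples of the same length with entries related by `R · · u`:
the recursion clause for elements of `M`. -/
def ZipSys (M : ZFSet.{u}) (R Z : ZFSet.{u} → ZFSet.{u} → ZFSet.{u} → Prop) : Prop :=
  ∀ p ∈ M, ∀ q ∈ M, ∀ u ∈ M, (Z p q u ↔ (p = ∅ ∧ q = ∅) ∨
    ∃ a p', p = ZFSet.pair a p' ∧ ∃ b q', q = ZFSet.pair b q' ∧ (R a b u ∧ Z p' q' u))

/-- The recursion clauses for a relation `T` between terms `t` and values `s`, with parameter `u`:
`B` gives the values of variables and `Ap f q s` says that `s` is the value of the symbol `f` at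
the tuple of values `q`. -/
def TermSys (M : ZFSet.{u}) (B Ap T Z : ZFSet.{u} → ZFSet.{u} → ZFSet.{u} → Prop) : Prop :=
  ZipSys M T Z ∧ ∀ t ∈ M, ∀ s ∈ M, ∀ u ∈ M, (T t s u ↔ B t s u ∨
    ∃ o p, t = ZFSet.pair o p ∧ (o = num 1 ∧ ∃ f ts, p = ZFSet.pair f ts ∧
      ∃ q ∈ M, Ap f q s ∧ Z ts q u))

/-- Tuples with related entries. -/
def ZipRel (R : ZFSet.{u} → ZFSet.{u} → ZFSet.{u} → Prop) (p q u : ZFSet.{u}) : Prop :=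
  ∃ (k : ℕ) (a b : Fin k → ZFSet.{u}), p = tuple a ∧ q = tuple b ∧ ∀ i, R (a i) (b i) u

theorem zipRel_iff {R : ZFSet.{u} → ZFSet.{u} → ZFSet.{u} → Prop} {p q u : ZFSet.{u}} :
    ZipRel R p q u ↔ (p = ∅ ∧ q = ∅) ∨
      ∃ a p', p = ZFSet.pair a p' ∧ ∃ b q', q = ZFSet.pair b q' ∧ (R a b u ∧ ZipRel R p' q' u) := by
  constructor
  · rintro ⟨k, a, b, rfl, rfl, h⟩
    cases k with
    | zero => exact .inl ⟨rfl, rfl⟩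
    | succ k =>
      exact .inr ⟨_, _, tuple_succ a, _, _, tuple_succ b, h 0, k, _, _, rfl, rfl, fun i => h i.succ⟩
  · rintro (⟨rfl, rfl⟩ | ⟨a, _, rfl, b, _, rfl, h, k, a', b', rfl, rfl, h'⟩)
    · exact ⟨0, ![], ![], rfl, rfl, fun i => i.elim0⟩
    · exact ⟨k + 1, Matrix.vecCons a a', Matrix.vecCons b b', (tuple_cons _ _).symm,
        (tuple_cons _ _).symm, Fin.cases h h'⟩

theorem zipRel_tuple {R : ZFSet.{u} → ZFSet.{u} → ZFSet.{u} → Prop} {k : ℕ}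
    {a b : Fin k → ZFSet.{u}} {u : ZFSet.{u}} :
    ZipRel R (tuple a) (tuple b) u ↔ ∀ i, R (a i) (b i) u := by
  constructor
  · rintro ⟨k', a', b', h1, h2, h⟩
    obtain rfl := tuple_length h1
    obtain rfl := tuple_injective h1
    obtain rfl := tuple_injective h2
    exact h
  · exact fun h => ⟨k, a, b, rfl, rfl, h⟩

theorem ZipRel.exists_right {R : ZFSet.{u} → ZFSet.{u} → ZFSet.{u} → Prop} {k : ℕ}
    {a : Fin k → ZFSet.{u}} {q u : ZFSet.{u}} (h : ZipRel R (tuple a) q u) :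
    ∃ b : Fin k → ZFSet.{u}, q = tuple b ∧ ∀ i, R (a i) (b i) u := by
  obtain ⟨k', a', b', h1, h2, h⟩ := h
  obtain rfl := tuple_length h1
  obtain rfl := tuple_injective h1
  exact ⟨b', h2, h⟩

theorem rank_lt_tuple {k : ℕ} (a : Fin k → ZFSet.{u}) (i : Fin k) : (a i).rank < (tuple a).rank := by
  induction k with
  | zero => exact i.elim0
  | succ k ih =>
    rw [tuple_succ]
    exact Fin.cases (rank_lt_pair_left _ _)
      (fun j => (ih (fun i => a i.succ) j).trans (rank_lt_pair_right _ _)) i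

theorem ZipSys.spec {M : ZFSet.{u}} (hM : M.IsTransitive)
    {R Z : ZFSet.{u} → ZFSet.{u} → ZFSet.{u} → Prop} (h : ZipSys M R Z) {p q u : ZFSet.{u}}
    (hp : p ∈ M) (hq : q ∈ M) (hu : u ∈ M) : Z p q u ↔ ZipRel R p q u := by
  suffices ∀ α : Ordinal.{u}, ∀ p ∈ M, p.rank = α → ∀ q ∈ M, (Z p q u ↔ ZipRel R p q u) from
    this _ p hp rfl q hq
  clear hp hq p q
  intro α
  induction α using WellFoundedLT.induction with
  | _ α ih =>
    rintro p hp rfl q hq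
    rw [h p hp q hq u hu, zipRel_iff]
    refine or_congr Iff.rfl (exists_congr fun a => exists_congr fun p' => and_congr_right ?_)
    rintro rfl
    refine exists_congr fun b => exists_congr fun q' => and_congr_right ?_
    rintro rfl
    rw [ih _ (rank_lt_pair_right _ _) p' (mem_of_pair_mem hM hp).2 rfl q' (mem_of_pair_mem hM hq).2]

theorem ZipSys.congr {M : ZFSet.{u}} (hM : M.IsTransitive)
    {R R' Z Z' : ZFSet.{u} → ZFSet.{u} → ZFSet.{u} → Prop} (h : ZipSys M R Z)
    (hR : ∀ a ∈ M, ∀ b ∈ M, ∀ u ∈ M, (R' a b u ↔ R a b u))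
    (hZ : ∀ a ∈ M, ∀ b ∈ M, ∀ u ∈ M, (Z' a b u ↔ Z a b u)) : ZipSys M R' Z' := by
  intro p hp q hq u hu
  rw [hZ p hp q hq u hu, h p hp q hq u hu]
  refine or_congr Iff.rfl (exists_congr fun a => exists_congr fun p' => and_congr_right ?_)
  rintro rfl
  refine exists_congr fun b => exists_congr fun q' => and_congr_right ?_
  rintro rfl
  have h1 := mem_of_pair_mem hM hp
  have h2 := mem_of_pair_mem hM hq
  rw [hR a h1.1 b h2.1 u hu, hZ _ h1.2 _ h2.2 u hu]

theorem zipSys_zipRel (M : ZFSet.{u}) (R : ZFSet.{u} → ZFSet.{u} → ZFSet.{u} → Prop) :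
    ZipSys M R (ZipRel R) := fun _ _ _ _ _ _ => zipRel_iff

/-- The least relation that satisfies the clauses of `TermSys`. -/
inductive TermEval (B Ap : ZFSet.{u} → ZFSet.{u} → ZFSet.{u} → Prop) (u : ZFSet.{u}) :
    ZFSet.{u} → ZFSet.{u} → Prop
  | base {t s : ZFSet.{u}} (h : B t s u) : TermEval B Ap u t s
  | app {f s : ZFSet.{u}} {k : ℕ} {a b : Fin k → ZFSet.{u}} (h : ∀ i, TermEval B Ap u (a i) (b i))
      (hf : Ap f (tuple b) s) : TermEval B Ap u (ZFSet.pair (num 1) (ZFSet.pair f (tuple a))) s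

section TermSys

variable {M : ZFSet.{u}} {B Ap T Z : ZFSet.{u} → ZFSet.{u} → ZFSet.{u} → Prop}

theorem termSys_termEval (hAp : ∀ f q, ∀ s ∈ M, Ap f q s → q ∈ M) :
    TermSys M B Ap (fun t s u => TermEval B Ap u t s)
      (ZipRel fun t s u => TermEval B Ap u t s) := by
  refine ⟨zipSys_zipRel _ _, fun t _ s hs u _ => ⟨fun h => ?_, ?_⟩⟩
  · cases h with
    | base h => exact .inl h
    | app h hf =>
      exact .inr ⟨_, _, rfl, rfl, _, _, rfl, _, hAp _ _ _ hs hf, hf, zipRel_tuple.2 h⟩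
  · rintro (h | ⟨_, _, rfl, rfl, f, _, rfl, _, _, hf, k, a, b, rfl, rfl, h⟩)
    · exact .base h
    · exact .app h hf

theorem TermSys.spec (hM : M.IsTransitive) (hAp : ∀ f q, ∀ s ∈ M, Ap f q s → q ∈ M)
    (h : TermSys M B Ap T Z) {t s u : ZFSet.{u}} (ht : t ∈ M) (hs : s ∈ M) (hu : u ∈ M) :
    T t s u ↔ TermEval B Ap u t s := by
  suffices ∀ α : Ordinal.{u}, ∀ t ∈ M, t.rank = α → ∀ s ∈ M, (T t s u ↔ TermEval B Ap u t s) from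
    this _ t ht rfl s hs
  clear hs ht s t
  intro α
  induction α using WellFoundedLT.induction with
  | _ α ih =>
    rintro t ht rfl s hs
    rw [h.2 t ht s hs u hu]
    refine Iff.trans ?_ ((termSys_termEval (B := B) hAp).2 t ht s hs u hu).symm
    refine or_congr Iff.rfl (exists_congr fun o => exists_congr fun p => and_congr_right ?_)
    rintro rfl
    refine and_congr_right fun _ => exists_congr fun f => exists_congr fun ts => and_congr_right ?_
    rintro rfl
    have hts : ts ∈ M := (mem_of_pair_mem hM (mem_of_pair_mem hM ht).2).2
    refine exists_congr fun q => and_congr_right fun hq => and_congr_right fun _ => ?_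
    rw [h.1.spec hM hts hq hu]
    refine exists_congr fun k => exists_congr fun a => exists_congr fun b => and_congr_right ?_
    rintro rfl
    refine and_congr_right ?_
    rintro rfl
    refine forall_congr' fun i => ih _ ?_ _ (mem_of_tuple_mem hM hts i) rfl _
      (mem_of_tuple_mem hM hq i)
    exact (rank_lt_tuple a i).trans ((rank_lt_pair_right _ _).trans (rank_lt_pair_right _ _))

theorem TermSys.zip_spec (hM : M.IsTransitive) (hAp : ∀ f q, ∀ s ∈ M, Ap f q s → q ∈ M)
    (h : TermSys M B Ap T Z) {p q u : ZFSet.{u}} (hp : p ∈ M) (hq : q ∈ M) (hu : u ∈ M) :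
    Z p q u ↔ ZipRel (fun t s u => TermEval B Ap u t s) p q u := by
  rw [h.1.spec hM hp hq hu]
  refine exists_congr fun k => exists_congr fun a => exists_congr fun b => and_congr_right ?_
  rintro rfl
  refine and_congr_right ?_
  rintro rfl
  exact forall_congr' fun i => h.spec hM hAp (mem_of_tuple_mem hM hp i) (mem_of_tuple_mem hM hq i) hu

theorem TermSys.congr (hM : M.IsTransitive) {T' Z' : ZFSet.{u} → ZFSet.{u} → ZFSet.{u} → Prop}
    (h : TermSys M B Ap T Z)
    (hT : ∀ a ∈ M, ∀ b ∈ M, ∀ u ∈ M, (T' a b u ↔ T a b u))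
    (hZ : ∀ a ∈ M, ∀ b ∈ M, ∀ u ∈ M, (Z' a b u ↔ Z a b u)) : TermSys M B Ap T' Z' := by
  refine ⟨h.1.congr hM hT hZ, fun t ht s hs u hu => ?_⟩
  rw [hT t ht s hs u hu, h.2 t ht s hs u hu]
  refine or_congr Iff.rfl (exists_congr fun o => exists_congr fun p => and_congr_right ?_)
  rintro rfl
  refine and_congr_right fun _ => exists_congr fun f => exists_congr fun ts => and_congr_right ?_
  rintro rfl
  have hts : ts ∈ M := (mem_of_pair_mem hM (mem_of_pair_mem hM ht).2).2
  exact exists_congr fun q => and_congr_right fun hq => by rw [hZ ts hts q hq u hu]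

end TermSys

/-! ### The clauses for the syntax and the satisfaction relation -/

/-- The base clause for sorts of terms: `t` is a variable of sort `s` that belongs to `u`. -/
def SortBase (sorts t s u : ZFSet.{u}) : Prop :=
  ∃ o z, t = ZFSet.pair o z ∧ (o = num 0 ∧ ∃ s' n, z = ZFSet.pair s' n ∧
    (s' = s ∧ IsNum n ∧ s ∈ sorts ∧ z ∈ u))

/-- `f` is a function symbol with argument sorts `q` and value sort `s`. -/
def SortApp (funs f q s : ZFSet.{u}) : Prop :=
  f ∈ funs ∧ ∃ nm r, f = ZFSet.pair nm r ∧ r = ZFSet.pair q s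

/-- The base clause for values of terms: `t` is a variable with the value `b` under `w`. -/
def ValBase (t b w : ZFSet.{u}) : Prop :=
  ∃ o z, t = ZFSet.pair o z ∧ (o = num 0 ∧ ZFSet.pair z b ∈ w)

instance {n : ℕ} (i j k l : Fin n) :
    D0 fun v : Fin n → ZFSet.{u} => SortBase (v i) (v j) (v k) (v l) := by
  unfold SortBase; infer_instance

instance {n : ℕ} (i j k l : Fin n) :
    D0 fun v : Fin n → ZFSet.{u} => SortApp (v i) (v j) (v k) (v l) := by
  unfold SortApp; infer_instance

instance {n : ℕ} (i j k : Fin n) :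
    D0 fun v : Fin n → ZFSet.{u} => ValBase (v i) (v j) (v k) := by
  unfold ValBase; infer_instance

/-- `TT` is the relation of being tuples of sorts and of elements of these sorts. -/
def TypedSys (M dom TT : ZFSet.{u}) : Prop :=
  ZipSys M (fun s a _ => ZFSet.pair s a ∈ dom) (Tri TT)

/-- `HS` is the relation of terms and their sorts, with all variables in a given set. -/
def SortSys (M sorts funs HS ZHS : ZFSet.{u}) : Prop :=
  TermSys M (SortBase sorts) (SortApp funs) (Tri HS) (Tri ZHS)

/-- `Vl` is the relation of terms and their values under an assignment. -/
def ValSys (M fn Vl ZVl : ZFSet.{u}) : Prop :=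
  TermSys M ValBase (Tri fn) (Tri Vl) (Tri ZVl)

instance {n : ℕ} (i j k : Fin n) :
    D0 fun v : Fin n → ZFSet.{u} => TypedSys (v i) (v j) (v k) := by
  unfold TypedSys ZipSys; infer_instance

instance {n : ℕ} (i j k l m : Fin n) :
    D0 fun v : Fin n → ZFSet.{u} => SortSys (v i) (v j) (v k) (v l) (v m) := by
  unfold SortSys TermSys ZipSys; infer_instance

instance {n : ℕ} (i j k l : Fin n) :
    D0 fun v : Fin n → ZFSet.{u} => ValSys (v i) (v j) (v k) (v l) := by
  unfold ValSys TermSys ZipSys; infer_instance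

/-- The clauses for codes of formulas with free variables in `u`. -/
def FmlClause (M sorts rels : ZFSet.{u}) (HS ZHS : ZFSet.{u} → ZFSet.{u} → ZFSet.{u} → Prop)
    (Fm : ZFSet.{u} → ZFSet.{u} → Prop) (c u : ZFSet.{u}) : Prop :=
  ∃ o p, c = ZFSet.pair o p ∧
    ((o = num 0 ∧ ∃ t t', p = ZFSet.pair t t' ∧ ∃ s ∈ M, HS t s u ∧ HS t' s u) ∨
     (o = num 1 ∧ ∃ r ts, p = ZFSet.pair r ts ∧
        (r ∈ rels ∧ ∃ nm σ, r = ZFSet.pair nm σ ∧ ZHS ts σ u)) ∨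
     (o = num 2 ∧ Fm p u) ∨
     (o = num 3 ∧ ∃ d e, p = ZFSet.pair d e ∧ (Fm d u ∧ Fm e u)) ∨
     (o = num 4 ∧ ∃ s q, p = ZFSet.pair s q ∧ ∃ n d, q = ZFSet.pair n d ∧
        (s ∈ sorts ∧ IsNum n ∧ ∃ z ∈ M, ∃ u' ∈ M, z = ZFSet.pair s n ∧ u' = insert z u ∧ Fm d u')) ∨
     (o = num 5 ∧ ∃ s q, p = ZFSet.pair s q ∧ ∃ m q', q = ZFSet.pair m q' ∧
        ∃ n d, q' = ZFSet.pair n d ∧ (s ∈ sorts ∧ IsNum m ∧ IsNum n ∧ ¬ m = n ∧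
          ∃ z ∈ M, ∃ z' ∈ M, ∃ u' ∈ M, ∃ u'' ∈ M, z = ZFSet.pair s m ∧ z' = ZFSet.pair s n ∧
            u' = insert z u ∧ u'' = insert z' u' ∧ Fm d u'')))

/-- The recursion clauses for codes of formulas. -/
def FmlSys (M sorts rels HS ZHS Fm : ZFSet.{u}) : Prop :=
  ∀ c ∈ M, ∀ u ∈ M, (ZFSet.pair c u ∈ Fm ↔
    FmlClause M sorts rels (Tri HS) (Tri ZHS) (fun c u => ZFSet.pair c u ∈ Fm) c u)

instance {n : ℕ} (i j k l m o : Fin n) :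
    D0 fun v : Fin n → ZFSet.{u} => FmlSys (v i) (v j) (v k) (v l) (v m) (v o) := by
  unfold FmlSys FmlClause; infer_instance

/-- `(sorts, rels, funs)` is a vocabulary and `(dom, rel, fn)` a structure of this vocabulary. -/
def StrucClause (M sorts rels funs dom rel fn TT : ZFSet.{u}) : Prop :=
  (∀ r ∈ rels, ∃ nm σ, r = ZFSet.pair nm σ ∧ ∃ a ∈ M, ∃ u ∈ M, Tri TT σ a u) ∧
  (∀ f ∈ funs, ∃ nm p, f = ZFSet.pair nm p ∧ ∃ σ s, p = ZFSet.pair σ s ∧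
    (s ∈ sorts ∧ ∃ a ∈ M, ∃ u ∈ M, Tri TT σ a u)) ∧
  (∀ p ∈ dom, ∃ s a, p = ZFSet.pair s a ∧ s ∈ sorts) ∧
  (∀ s ∈ sorts, ∃ a ∈ M, ZFSet.pair s a ∈ dom) ∧
  (∀ p ∈ rel, ∃ r a, p = ZFSet.pair r a ∧ (r ∈ rels ∧ ∃ nm σ, r = ZFSet.pair nm σ ∧
    ∃ u ∈ M, Tri TT σ a u)) ∧
  (∀ p ∈ fn, ∃ f q, p = ZFSet.pair f q ∧ (f ∈ funs ∧ ∃ a b, q = ZFSet.pair a b ∧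
    ∃ nm r, f = ZFSet.pair nm r ∧ ∃ σ s, r = ZFSet.pair σ s ∧
      (ZFSet.pair s b ∈ dom ∧ ∃ u ∈ M, Tri TT σ a u))) ∧
  (∀ f ∈ funs, ∀ a ∈ M, (∃ nm r, f = ZFSet.pair nm r ∧ ∃ σ s, r = ZFSet.pair σ s ∧
    ∃ u ∈ M, Tri TT σ a u) → ∃ b ∈ M, Tri fn f a b ∧ ∀ b' ∈ M, Tri fn f a b' → b' = b)

instance {n : ℕ} (i j k l m o p q : Fin n) : D0 fun v : Fin n → ZFSet.{u} =>
    StrucClause (v i) (v j) (v k) (v l) (v m) (v o) (v p) (v q) := by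
  unfold StrucClause; infer_instance

/-- The assignment `w'` differs from `w` only in the value `a` for the `n`-th variable of sort `s`. -/
def Upd (M sorts w s n a w' : ZFSet.{u}) : Prop :=
  ∀ s' ∈ sorts, ∀ n' ∈ M, IsNum n' → ∀ z ∈ M, z = ZFSet.pair s' n' → ∀ b ∈ M,
    (ZFSet.pair z b ∈ w' ↔ ((s' = s ∧ n' = n) ∧ b = a) ∨ (¬ (s' = s ∧ n' = n) ∧ ZFSet.pair z b ∈ w))

instance {n : ℕ} (i j k l m o p : Fin n) : D0 fun v : Fin n → ZFSet.{u} =>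
    Upd (v i) (v j) (v k) (v l) (v m) (v o) (v p) := by
  unfold Upd; infer_instance

/-- `V` is a nonempty set of assignments that is closed under changes of single values. -/
def AsgSys (M sorts dom V : ZFSet.{u}) : Prop :=
  V ⊆ M ∧ (∃ w ∈ V, w = w) ∧
  (∀ w ∈ V, ∀ s ∈ sorts, ∀ n ∈ M, IsNum n → ∃ a ∈ M, ZFSet.pair s a ∈ dom ∧
    ∀ z ∈ M, z = ZFSet.pair s n → ∀ b ∈ M, (ZFSet.pair z b ∈ w ↔ b = a)) ∧
  (∀ w ∈ V, ∀ s ∈ sorts, ∀ n ∈ M, IsNum n → ∀ a ∈ M, ZFSet.pair s a ∈ dom →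
    ∃ w' ∈ V, Upd M sorts w s n a w')

instance {n : ℕ} (i j k l : Fin n) : D0 fun v : Fin n → ZFSet.{u} =>
    AsgSys (v i) (v j) (v k) (v l) := by
  unfold AsgSys; infer_instance

/-- The relation that the formula `d` defines, for the assignment `w`, in the `m`-th and `n`-th
variables of sort `s`, according to `S`. -/
def DefRel (M sorts V S w s m n d a b : ZFSet.{u}) : Prop :=
  ∃ w' ∈ V, ∃ w'' ∈ V, Upd M sorts w s m a w' ∧ Upd M sorts w' s n b w'' ∧ ZFSet.pair d w'' ∈ S

instance {n : ℕ} (i j k l m o p q r s t : Fin n) : D0 fun v : Fin n → ZFSet.{u} =>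
    DefRel (v i) (v j) (v k) (v l) (v m) (v o) (v p) (v q) (v r) (v s) (v t) := by
  unfold DefRel; infer_instance

/-- The clause for the quantifier `WF`: `G` gives values that increase along the relation when it is
well-founded, and `D` gives a nonempty set without a minimal element when it is not. -/
def WfClause (M sorts dom V S G D c w s m n d : ZFSet.{u}) : Prop :=
  (ZFSet.pair c w ∈ S →
    (∀ a ∈ M, ZFSet.pair s a ∈ dom →
      ∃ α ∈ M, ZFSet.pair c (ZFSet.pair w (ZFSet.pair a α)) ∈ G) ∧
    ∀ a ∈ M, ∀ b ∈ M, ZFSet.pair s a ∈ dom → ZFSet.pair s b ∈ dom → ∀ α ∈ M, ∀ β ∈ M,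
      ZFSet.pair c (ZFSet.pair w (ZFSet.pair a α)) ∈ G →
      ZFSet.pair c (ZFSet.pair w (ZFSet.pair b β)) ∈ G →
      DefRel M sorts V S w s m n d a b → α ∈ β) ∧
  (¬ ZFSet.pair c w ∈ S →
    (∃ a ∈ M, Tri D c w a) ∧ ∀ a ∈ M, Tri D c w a → ZFSet.pair s a ∈ dom ∧
      ∃ b ∈ M, Tri D c w b ∧ DefRel M sorts V S w s m n d b a)

instance {n : ℕ} (i j k l m o p q r s t x y : Fin n) : D0 fun v : Fin n → ZFSet.{u} =>
    WfClause (v i) (v j) (v k) (v l) (v m) (v o) (v p) (v q) (v r) (v s) (v t) (v x) (v y) := by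
  unfold WfClause; infer_instance

/-- The clauses for the satisfaction relation at the formula `c` and the assignment `w`. -/
def SatClause (M sorts dom rel V Vl ZVl S G D c w : ZFSet.{u}) : Prop :=
  ∃ o p, c = ZFSet.pair o p ∧
    ((o = num 0 → (ZFSet.pair c w ∈ S ↔ ∃ t t', p = ZFSet.pair t t' ∧
        ∃ b ∈ M, Tri Vl t b w ∧ Tri Vl t' b w)) ∧
     (o = num 1 → (ZFSet.pair c w ∈ S ↔ ∃ r ts, p = ZFSet.pair r ts ∧
        ∃ bs ∈ M, Tri ZVl ts bs w ∧ ZFSet.pair r bs ∈ rel)) ∧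
     (o = num 2 → (ZFSet.pair c w ∈ S ↔ ¬ ZFSet.pair p w ∈ S)) ∧
     (o = num 3 → (ZFSet.pair c w ∈ S ↔ ∃ d e, p = ZFSet.pair d e ∧
        (ZFSet.pair d w ∈ S ∧ ZFSet.pair e w ∈ S))) ∧
     (o = num 4 → (ZFSet.pair c w ∈ S ↔ ∃ s q, p = ZFSet.pair s q ∧ ∃ n d, q = ZFSet.pair n d ∧
        ∀ a ∈ M, ZFSet.pair s a ∈ dom → ∃ w' ∈ V, Upd M sorts w s n a w' ∧ ZFSet.pair d w' ∈ S)) ∧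
     (o = num 5 → ∃ s q, p = ZFSet.pair s q ∧ ∃ m q', q = ZFSet.pair m q' ∧
        ∃ n d, q' = ZFSet.pair n d ∧ WfClause M sorts dom V S G D c w s m n d))

instance {n : ℕ} (i j k l m o p q r s t x : Fin n) : D0 fun v : Fin n → ZFSet.{u} =>
    SatClause (v i) (v j) (v k) (v l) (v m) (v o) (v p) (v q) (v r) (v s) (v t) (v x) := by
  unfold SatClause; infer_instance

/-- The clauses for the satisfaction relation. -/
def SatSys (M X Fm sorts dom rel V Vl ZVl S G D : ZFSet.{u}) : Prop :=
  ∀ c ∈ X, ∀ u ∈ M, ZFSet.pair c u ∈ Fm → ∀ w ∈ V,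
    SatClause M sorts dom rel V Vl ZVl S G D c w

instance {n : ℕ} (i j k l m o p q r s t x : Fin n) : D0 fun v : Fin n → ZFSet.{u} =>
    SatSys (v i) (v j) (v k) (v l) (v m) (v o) (v p) (v q) (v r) (v s) (v t) (v x) := by
  unfold SatSys; infer_instance

/-! ### Codes of terms and formulas -/

theorem Term.code_injective : Function.Injective (Term.code.{u}) := by
  intro t
  induction t with
  | var s n =>
    intro t' h
    cases t' with
    | var s' n' =>
      simp only [Term.code, ZFSet.pair_inj, num_inj] at h
      rw [h.2.1, h.2.2]
    | app => simp [Term.code, ZFSet.pair_inj] at h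
  | app f k ts ih =>
    intro t' h
    cases t' with
    | var s' n' => simp [Term.code, ZFSet.pair_inj] at h
    | app f' k' ts' =>
      simp only [Term.code, ZFSet.pair_inj, true_and] at h
      obtain ⟨rfl, h⟩ := h
      obtain rfl := tuple_length h
      have := tuple_injective h
      congr 1
      funext i
      exact ih i (congrFun this i)

theorem Term.tuple_code_inj {k k' : ℕ} {ts : Fin k → Term.{u}} {ts' : Fin k' → Term.{u}}
    (h : (tuple fun i => (ts i).code) = tuple fun i => (ts' i).code) :
    ∃ e : k = k', ts' = e ▸ ts := by
  obtain rfl := tuple_length h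
  exact ⟨rfl, funext fun i => (Term.code_injective (congrFun (tuple_injective h) i)).symm⟩

theorem Formula.code_injective : Function.Injective (Formula.code.{u}) := by
  intro φ
  induction φ with
  | eq t t' =>
    intro ψ h
    cases ψ <;> simp only [Formula.code, ZFSet.pair_inj, num_inj, true_and] at h <;>
      try exact absurd h.1 (by decide)
    rw [Term.code_injective h.1, Term.code_injective h.2]
  | rel r k ts =>
    intro ψ h
    cases ψ <;> simp only [Formula.code, ZFSet.pair_inj, num_inj, true_and] at h <;>
      try exact absurd h.1 (by decide)
    obtain ⟨rfl, h⟩ := h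
    obtain ⟨rfl, rfl⟩ := Term.tuple_code_inj h
    rfl
  | neg φ ih =>
    intro ψ h
    cases ψ <;> simp only [Formula.code, ZFSet.pair_inj, num_inj, true_and] at h <;>
      try exact absurd h.1 (by decide)
    rw [ih h]
  | and φ φ' ih ih' =>
    intro ψ h
    cases ψ <;> simp only [Formula.code, ZFSet.pair_inj, num_inj, true_and] at h <;>
      try exact absurd h.1 (by decide)
    rw [ih h.1, ih' h.2]
  | all s n φ ih =>
    intro ψ h
    cases ψ <;> simp only [Formula.code, ZFSet.pair_inj, num_inj, true_and] at h <;>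
      try exact absurd h.1 (by decide)
    rw [h.1, h.2.1, ih h.2.2]
  | wf s m n φ ih =>
    intro ψ h
    cases ψ <;> simp only [Formula.code, ZFSet.pair_inj, num_inj, true_and] at h <;>
      try exact absurd h.1 (by decide)
    rw [h.1, h.2.1, h.2.2.1, ih h.2.2.2]

theorem LWF_models {τ : Vocab.{u}} {A : Struc τ} {φ : Formula.{u}} (hφ : φ.IsSentence τ) :
    LWF.Models A φ.code ↔ φ.TrueIn A :=
  ⟨fun ⟨_, _, h, h'⟩ => Formula.code_injective h ▸ h', fun h => ⟨φ, hφ, rfl, h⟩⟩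

theorem LFO_models {τ : Vocab.{u}} {A : Struc τ} {φ : Formula.{u}} (hφ : φ.IsSentence τ)
    (hfo : φ.IsFO) : LFO.Models A φ.code ↔ φ.TrueIn A :=
  ⟨fun ⟨_, _, _, h, h'⟩ => Formula.code_injective h ▸ h', fun h => ⟨φ, hfo, hφ, rfl, h⟩⟩

/-! ### Values and satisfaction depend only on the free variables -/

theorem Term.val_congr {τ : Vocab.{u}} (A : Struc τ) {v v' : Assignment.{u}} (t : Term.{u})
    (h : ∀ z ∈ t.vars, v z.1 z.2 = v' z.1 z.2) : t.val A v = t.val A v' := by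
  induction t with
  | var s n => exact h (s, n) rfl
  | app f k ts ih =>
    have : (fun i => (ts i).val A v) = fun i => (ts i).val A v' :=
      funext fun i => ih i fun z hz => h z (Set.mem_iUnion.2 ⟨i, hz⟩)
    simp only [Term.val, this]

theorem Formula.sat_congr {τ : Vocab.{u}} (A : Struc τ) (φ : Formula.{u}) {v v' : Assignment.{u}}
    (h : ∀ z ∈ φ.free, v z.1 z.2 = v' z.1 z.2) : φ.Sat A v ↔ φ.Sat A v' := by
  induction φ generalizing v v' with
  | eq t t' =>
    simp only [Formula.Sat]
    rw [t.val_congr A fun z hz => h z (.inl hz), t'.val_congr A fun z hz => h z (.inr hz)]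
  | rel r k ts =>
    have : (fun i => (ts i).val A v) = fun i => (ts i).val A v' :=
      funext fun i => (ts i).val_congr A fun z hz => h z (Set.mem_iUnion.2 ⟨i, hz⟩)
    simp only [Formula.Sat, this]
  | neg φ ih => exact not_congr (ih h)
  | and φ ψ ih ih' => exact and_congr (ih fun z hz => h z (.inl hz)) (ih' fun z hz => h z (.inr hz))
  | all s n φ ih =>
    refine forall_congr' fun a => imp_congr Iff.rfl (ih fun z hz => ?_)
    by_cases hz' : z = (s, n)
    · simp [Assignment.set, hz']
    · have := h z ⟨hz, hz'⟩
      simp [Assignment.set, this]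
  | wf s m n φ ih =>
    have : (fun a b : {a : ZFSet.{u} // a ∈ A.carrier s} => φ.Sat A ((v.set s m a).set s n b)) =
        fun a b : {a : ZFSet.{u} // a ∈ A.carrier s} => φ.Sat A ((v'.set s m a).set s n b) := by
      funext a b
      refine propext (ih fun z hz => ?_)
      by_cases hz' : z = (s, n)
      · simp [Assignment.set, hz']
      by_cases hz'' : z = (s, m)
      · simp [Assignment.set, hz'']
      · have := h z ⟨hz, by simp [hz', hz'']⟩
        simp [Assignment.set, this]
    simp only [Formula.Sat, this]

theorem Struc.exists_assignment {τ : Vocab.{u}} (A : Struc τ) :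
    ∃ v : Assignment.{u}, ∀ s ∈ τ.sorts, ∀ n, v s n ∈ A.carrier s := by
  classical
  refine ⟨fun s _ => if h : ∃ a, ZFSet.pair s a ∈ A.dom then h.choose else ∅, fun s hs n => ?_⟩
  have h := A.dom_nonempty s hs
  rw [Struc.mem_carrier]
  simp only [dif_pos h]
  exact h.choose_spec

theorem Formula.IsSentence.trueIn_iff {τ : Vocab.{u}} {φ : Formula.{u}} (hφ : φ.IsSentence τ)
    (A : Struc τ) (v : Assignment.{u}) : φ.TrueIn A ↔ φ.Sat A v := by
  have key : ∀ v v' : Assignment.{u}, φ.Sat A v ↔ φ.Sat A v' := fun v v' =>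
    φ.sat_congr A fun z hz => by simp [hφ.2] at hz
  constructor
  · intro h
    obtain ⟨v', hv'⟩ := A.exists_assignment
    exact (key v' v).1 (h v' hv')
  · exact fun h v' _ => (key v v').1 h

theorem Term.HasSort.sort_mem {τ : Vocab.{u}} {t : Term.{u}} {s : ZFSet.{u}} (h : t.HasSort τ s) :
    s ∈ τ.sorts := by
  cases h with
  | var s n hs => exact hs
  | app name k σ s ts hf hts =>
    obtain ⟨name', k', σ', s', _, hs', e⟩ := τ.funs_typed _ hf
    rwa [(funSym_inj.1 e).2.2]

theorem Term.HasSort.vars_sorts {τ : Vocab.{u}} {t : Term.{u}} {s : ZFSet.{u}}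
    (h : t.HasSort τ s) : ∀ z ∈ t.vars, z.1 ∈ τ.sorts := by
  induction h with
  | var s n hs => rintro z rfl; exact hs
  | app name k σ s ts hf hts ih =>
    intro z hz
    obtain ⟨i, hi⟩ := Set.mem_iUnion.1 hz
    exact ih i z hi

theorem Formula.IsFormula.free_sorts {τ : Vocab.{u}} {φ : Formula.{u}} (h : φ.IsFormula τ) :
    ∀ z ∈ φ.free, z.1 ∈ τ.sorts := by
  induction φ with
  | eq t t' =>
    obtain ⟨s, h, h'⟩ := h
    rintro z (hz | hz)
    exacts [h.vars_sorts z hz, h'.vars_sorts z hz]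
  | rel r k ts =>
    obtain ⟨_, σ, _, _, h⟩ := h
    intro z hz
    obtain ⟨i, hi⟩ := Set.mem_iUnion.1 hz
    exact (h i).vars_sorts z hi
  | neg φ ih => exact ih h
  | and φ ψ ih ih' =>
    rintro z (hz | hz)
    exacts [ih h.1 z hz, ih' h.2 z hz]
  | all s n φ ih => exact fun z hz => ih h.2 z hz.1
  | wf s m n φ ih => exact fun z hz => ih h.2.2 z hz.1

theorem Formula.IsFormula.sat_congr {τ : Vocab.{u}} {φ : Formula.{u}} (h : φ.IsFormula τ)
    (A : Struc τ) {v v' : Assignment.{u}} (hv : ∀ s ∈ τ.sorts, ∀ n, v s n = v' s n) :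
    φ.Sat A v ↔ φ.Sat A v' :=
  φ.sat_congr A fun z hz => hv _ (h.free_sorts z hz) _

/-- The assignment has values in the right domains. -/
def Struc.WellSorted {τ : Vocab.{u}} (A : Struc τ) (v : Assignment.{u}) : Prop :=
  ∀ s ∈ τ.sorts, ∀ n, v s n ∈ A.carrier s

theorem Struc.WellSorted.set {τ : Vocab.{u}} {A : Struc τ} {v : Assignment.{u}}
    (h : A.WellSorted v) {s a : ZFSet.{u}} (ha : a ∈ A.carrier s) (n : ℕ) :
    A.WellSorted (v.set s n a) := by
  intro s' hs' n'
  unfold Assignment.set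
  split_ifs with h'
  · rw [h'.1]; exact ha
  · exact h s' hs' n'

theorem Struc.fn_value_mem {τ : Vocab.{u}} (A : Struc τ) {name : ZFSet.{u}} {k : ℕ}
    {σ : Fin k → ZFSet.{u}} {s a b : ZFSet.{u}}
    (h : ZFSet.pair (funSym name σ s) (ZFSet.pair a b) ∈ A.fn) : b ∈ A.carrier s := by
  obtain ⟨name', k', σ', s', a', b', _, _, h3, h4⟩ := A.fn_typed _ h
  simp only [ZFSet.pair_inj, funSym_inj] at h4
  rw [h4.1.2.2, h4.2.2, Struc.mem_carrier]
  exact h3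

theorem Term.HasSort.val_spec {τ : Vocab.{u}} {A : Struc τ} {v : Assignment.{u}}
    {name : ZFSet.{u}} {k : ℕ} {σ : Fin k → ZFSet.{u}} {s : ZFSet.{u}} {ts : Fin k → Term.{u}}
    (hf : funSym name σ s ∈ τ.funs) (hts : ∀ i, (ts i).val A v ∈ A.carrier (σ i)) (b : ZFSet.{u}) :
    ZFSet.pair (funSym name σ s) (ZFSet.pair (tuple fun i => (ts i).val A v) b) ∈ A.fn ↔
      b = (Term.app (funSym name σ s) k ts).val A v := by
  have h := A.fn_total name k σ s hf (fun i => (ts i).val A v) fun i => Struc.mem_carrier.1 (hts i)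
  have h' := Classical.epsilon_spec h.exists
  constructor
  · exact fun hb => h.unique hb h'
  · rintro rfl; exact h'

theorem Term.HasSort.val_mem {τ : Vocab.{u}} {A : Struc τ} {v : Assignment.{u}}
    (hv : A.WellSorted v) {t : Term.{u}} {s : ZFSet.{u}} (h : t.HasSort τ s) :
    t.val A v ∈ A.carrier s := by
  induction h with
  | var s n hs => exact hv s hs n
  | app name k σ s ts hf hts ih => exact A.fn_value_mem ((Term.HasSort.val_spec hf ih _).2 rfl)

theorem Struc.rel_typed' {τ : Vocab.{u}} (A : Struc τ) {name : ZFSet.{u}} {k : ℕ}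
    {σ : Fin k → ZFSet.{u}} {p : ZFSet.{u}} (h : ZFSet.pair (relSym name σ) p ∈ A.rel) :
    ∃ a : Fin k → ZFSet.{u}, p = tuple a ∧ ∀ i, a i ∈ A.carrier (σ i) := by
  obtain ⟨name', k', σ', a, _, h2, h3⟩ := A.rel_typed _ h
  simp only [ZFSet.pair_inj, relSym_inj] at h3
  obtain ⟨⟨rfl, h3⟩, rfl⟩ := h3
  obtain rfl := tuple_length h3
  obtain rfl := tuple_injective h3
  exact ⟨a, rfl, fun i => Struc.mem_carrier.2 (h2 i)⟩

theorem Struc.fn_typed' {τ : Vocab.{u}} (A : Struc τ) {name : ZFSet.{u}} {k : ℕ}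
    {σ : Fin k → ZFSet.{u}} {s p : ZFSet.{u}} (h : ZFSet.pair (funSym name σ s) p ∈ A.fn) :
    ∃ (a : Fin k → ZFSet.{u}) (b : ZFSet.{u}), p = ZFSet.pair (tuple a) b ∧
      (∀ i, a i ∈ A.carrier (σ i)) ∧ b ∈ A.carrier s := by
  obtain ⟨name', k', σ', s', a, b, _, h2, h3, h4⟩ := A.fn_typed _ h
  simp only [ZFSet.pair_inj, funSym_inj] at h4
  obtain ⟨⟨rfl, h4, rfl⟩, rfl⟩ := h4
  obtain rfl := tuple_length h4
  obtain rfl := tuple_injective h4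
  exact ⟨a, b, rfl, fun i => Struc.mem_carrier.2 (h2 i), Struc.mem_carrier.2 h3⟩

theorem Vocab.ext {τ τ' : Vocab.{u}} (h1 : τ.sorts = τ'.sorts) (h2 : τ.rels = τ'.rels)
    (h3 : τ.funs = τ'.funs) : τ = τ' := by
  cases τ; cases τ'; simp_all

theorem Struc.ext {τ : Vocab.{u}} {A B : Struc τ} (h1 : A.dom = B.dom) (h2 : A.rel = B.rel)
    (h3 : A.fn = B.fn) : A = B := by
  cases A; cases B; simp_all

theorem Vocab.code_injective : Function.Injective (Vocab.code.{u}) := fun τ τ' h => by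
  simp only [Vocab.code, ZFSet.pair_inj] at h
  exact Vocab.ext h.1 h.2.1 h.2.2

theorem Struc.code_injective {τ : Vocab.{u}} : Function.Injective (Struc.code (τ := τ)) :=
  fun A B h => by
  simp only [Struc.code, ZFSet.pair_inj, true_and] at h
  exact Struc.ext h.1 h.2.1 h.2.2

theorem Term.vars_finite (t : Term.{u}) : t.vars.Finite := by
  induction t with
  | var s n => exact Set.finite_singleton _
  | app f k ts ih => exact Set.finite_iUnion ih

theorem Formula.free_finite (φ : Formula.{u}) : φ.free.Finite := by
  induction φ with
  | eq t t' => exact t.vars_finite.union t'.vars_finite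
  | rel r k ts => exact Set.finite_iUnion fun i => (ts i).vars_finite
  | neg φ ih => exact ih
  | and φ ψ ih ih' => exact ih.union ih'
  | all s n φ ih => exact ih.subset Set.sdiff_subset
  | wf s m n φ ih => exact ih.subset Set.sdiff_subset

/-! ### The recursion clauses define the syntax -/

section Systems

variable {M : ZFSet.{u}}

/-- The graph of a binary relation on `M`. -/
def graph₂ (M : ZFSet.{u}) (R : ZFSet.{u} → ZFSet.{u} → Prop) : ZFSet.{u} :=
  ZFSet.sep (fun p => ∃ a b, p = ZFSet.pair a b ∧ R a b) M

theorem pair_mem_graph₂ (hM : Adequate M) {R : ZFSet.{u} → ZFSet.{u} → Prop} {a b : ZFSet.{u}}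
    (ha : a ∈ M) (hb : b ∈ M) : ZFSet.pair a b ∈ graph₂ M R ↔ R a b := by
  rw [graph₂, ZFSet.mem_sep]
  constructor
  · rintro ⟨_, a', b', h, hR⟩
    obtain ⟨rfl, rfl⟩ := ZFSet.pair_inj.1 h
    exact hR
  · exact fun h => ⟨hM.pair ha hb, a, b, rfl, h⟩

theorem termEval_iff {B Ap : ZFSet.{u} → ZFSet.{u} → ZFSet.{u} → Prop} {u t s : ZFSet.{u}} :
    TermEval B Ap u t s ↔ B t s u ∨ ∃ (f : ZFSet.{u}) (k : ℕ) (a b : Fin k → ZFSet.{u}),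
      t = ZFSet.pair (num 1) (ZFSet.pair f (tuple a)) ∧ (∀ i, TermEval B Ap u (a i) (b i)) ∧
        Ap f (tuple b) s := by
  constructor
  · rintro (h | ⟨h, hf⟩)
    exacts [.inl h, .inr ⟨_, _, _, _, rfl, h, hf⟩]
  · rintro (h | ⟨f, k, a, b, rfl, h, hf⟩)
    exacts [.base h, .app h hf]

/-- `t` is the code of a term of sort `s` with all variables in `u`. -/
def SortP (τ : Vocab.{u}) (t s u : ZFSet.{u}) : Prop :=
  ∃ T : Term.{u}, T.code = t ∧ T.HasSort τ s ∧ ∀ z ∈ T.vars, ZFSet.pair z.1 (num z.2) ∈ u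

theorem sortEval_iff {τ : Vocab.{u}} {t s u : ZFSet.{u}} :
    TermEval (SortBase τ.sorts) (SortApp τ.funs) u t s ↔ SortP τ t s u := by
  constructor
  · intro h
    induction h with
    | base h =>
      obtain ⟨o, z, rfl, rfl, s', n, rfl, rfl, hn, hs, hz⟩ := h
      obtain ⟨k, rfl⟩ := isNum_iff.1 hn
      exact ⟨.var s' k, rfl, .var _ _ hs, by rintro z rfl; exact hz⟩
    | @app f s k a b _ hf ih =>
      choose T hT hT' hT'' using ih
      obtain ⟨hf, nm, r, rfl, rfl⟩ := hf
      refine ⟨.app (funSym nm b s) k T, ?_, .app nm k b s T hf hT', ?_⟩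
      · simp only [Term.code, hT]; rfl
      · intro z hz
        obtain ⟨i, hi⟩ := Set.mem_iUnion.1 hz
        exact hT'' i z hi
  · rintro ⟨T, rfl, hT, hv⟩
    induction hT with
    | var s n hs => exact .base ⟨_, _, rfl, rfl, _, _, rfl, rfl, isNum_num n, hs, hv (s, n) rfl⟩
    | app nm k σ s ts hf hts ih =>
      exact .app (fun i => ih i fun z hz => hv z (Set.mem_iUnion.2 ⟨i, hz⟩)) ⟨hf, nm, _, rfl, rfl⟩

theorem sortApp_mem {τ : Vocab.{u}} (hM : M.IsTransitive) (hf : τ.funs ∈ M) (f q s : ZFSet.{u})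
    (_ : s ∈ M) (h : SortApp τ.funs f q s) : q ∈ M := by
  obtain ⟨h, _, _, rfl, rfl⟩ := h
  exact (mem_of_pair_mem hM (mem_of_pair_mem hM (hM _ hf h)).2).1

theorem SortSys.spec {τ : Vocab.{u}} (hM : M.IsTransitive) (hf : τ.funs ∈ M) {HS ZHS : ZFSet.{u}}
    (h : SortSys M τ.sorts τ.funs HS ZHS) {t s u : ZFSet.{u}} (ht : t ∈ M) (hs : s ∈ M)
    (hu : u ∈ M) : Tri HS t s u ↔ SortP τ t s u :=
  (TermSys.spec hM (sortApp_mem hM hf) h ht hs hu).trans sortEval_iff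

theorem SortSys.zip_spec {τ : Vocab.{u}} (hM : M.IsTransitive) (hf : τ.funs ∈ M)
    {HS ZHS : ZFSet.{u}} (h : SortSys M τ.sorts τ.funs HS ZHS) {t s u : ZFSet.{u}} (ht : t ∈ M)
    (hs : s ∈ M) (hu : u ∈ M) : Tri ZHS t s u ↔ ZipRel (SortP τ) t s u := by
  rw [TermSys.zip_spec hM (sortApp_mem hM hf) h ht hs hu]
  simp only [sortEval_iff]

theorem exists_sortSys {τ : Vocab.{u}} (hM : Adequate M) (hf : τ.funs ∈ M) :
    ∃ HS ZHS, HS ⊆ M ∧ ZHS ⊆ M ∧ SortSys M τ.sorts τ.funs HS ZHS :=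
  ⟨_, _, graph₃_subset _ _, graph₃_subset _ _, (termSys_termEval (sortApp_mem hM.trans hf)).congr hM.trans
    (fun _ ha _ hb _ hu => tri_graph₃ hM ha hb hu) fun _ ha _ hb _ hu => tri_graph₃ hM ha hb hu⟩

theorem FmlClause.imp (hM : M.IsTransitive) {sorts rels : ZFSet.{u}}
    {HS HS' ZHS ZHS' : ZFSet.{u} → ZFSet.{u} → ZFSet.{u} → Prop}
    {Fm Fm' : ZFSet.{u} → ZFSet.{u} → Prop} (hr : rels ⊆ M)
    (h1 : ∀ t ∈ M, ∀ s ∈ M, ∀ u ∈ M, HS t s u → HS' t s u)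
    (h2 : ∀ t ∈ M, ∀ s ∈ M, ∀ u ∈ M, ZHS t s u → ZHS' t s u) {c u : ZFSet.{u}} (hc : c ∈ M)
    (hu : u ∈ M) (h3 : ∀ d ∈ M, ∀ u ∈ M, d.rank < c.rank → Fm d u → Fm' d u)
    (h : FmlClause M sorts rels HS ZHS Fm c u) : FmlClause M sorts rels HS' ZHS' Fm' c u := by
  obtain ⟨o, p, rfl, h⟩ := h
  have hp := (mem_of_pair_mem hM hc).2
  have hr0 := rank_lt_pair_right o p
  refine ⟨o, p, rfl, ?_⟩
  rcases h with ⟨rfl, t, t', rfl, s, hs, h, h'⟩ | ⟨rfl, r, ts, rfl, hrm, nm, σ, rfl, h⟩ | ⟨rfl, h⟩ |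
    ⟨rfl, d, e, rfl, h, h'⟩ | ⟨rfl, s, q, rfl, n, d, rfl, hs, hn, z, hz, u', hu', rfl, rfl, h⟩ |
    ⟨rfl, s, q, rfl, m, q', rfl, n, d, rfl, hs, hm, hn, hmn, z, hz, z', hz', u', hu', u'', hu'',
      rfl, rfl, rfl, rfl, h⟩
  · obtain ⟨ht, ht'⟩ := mem_of_pair_mem hM hp
    exact .inl ⟨rfl, t, t', rfl, s, hs, h1 _ ht _ hs _ hu h, h1 _ ht' _ hs _ hu h'⟩
  · obtain ⟨_, hts⟩ := mem_of_pair_mem hM hp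
    have hσ := (mem_of_pair_mem hM (hr hrm)).2
    exact .inr (.inl ⟨rfl, _, ts, rfl, hrm, nm, σ, rfl, h2 _ hts _ hσ _ hu h⟩)
  · exact .inr (.inr (.inl ⟨rfl, h3 _ hp _ hu hr0 h⟩))
  · obtain ⟨hd, he⟩ := mem_of_pair_mem hM hp
    exact .inr (.inr (.inr (.inl ⟨rfl, d, e, rfl,
      h3 _ hd _ hu ((rank_lt_pair_left _ _).trans hr0) h,
      h3 _ he _ hu ((rank_lt_pair_right _ _).trans hr0) h'⟩)))
  · have hd := (mem_of_pair_mem hM (mem_of_pair_mem hM hp).2).2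
    have hrk := ((rank_lt_pair_right _ _).trans (rank_lt_pair_right s (ZFSet.pair n d))).trans hr0
    exact .inr (.inr (.inr (.inr (.inl ⟨rfl, s, _, rfl, n, d, rfl, hs, hn, _, hz, _, hu', rfl, rfl,
      h3 _ hd _ hu' hrk h⟩))))
  · have hd := (mem_of_pair_mem hM (mem_of_pair_mem hM (mem_of_pair_mem hM hp).2).2).2
    have hrk := (((rank_lt_pair_right _ _).trans (rank_lt_pair_right m (ZFSet.pair n d))).trans
      (rank_lt_pair_right s _)).trans hr0
    exact .inr (.inr (.inr (.inr (.inr ⟨rfl, s, _, rfl, m, _, rfl, n, d, rfl, hs, hm, hn, hmn,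
      _, hz, _, hz', _, hu', _, hu'', rfl, rfl, rfl, rfl, h3 _ hd _ hu'' hrk h⟩))))

/-- `c` is the code of a formula with all free variables in `u`. -/
def FmlP (τ : Vocab.{u}) (c u : ZFSet.{u}) : Prop :=
  ∃ φ : Formula.{u}, φ.code = c ∧ φ.IsFormula τ ∧ ∀ z ∈ φ.free, ZFSet.pair z.1 (num z.2) ∈ u

theorem fmlP_iff {τ : Vocab.{u}} (hM : Adequate M) (hs : τ.sorts ∈ M) {c u : ZFSet.{u}} (hu : u ∈ M) :
    FmlP τ c u ↔ FmlClause M τ.sorts τ.rels (SortP τ) (ZipRel (SortP τ)) (FmlP τ) c u := by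
  have hsM : ∀ s ∈ τ.sorts, s ∈ M := fun s h => hM.trans _ hs h
  have hvar : ∀ s ∈ τ.sorts, ∀ n, ZFSet.pair s (num n) ∈ M := fun s h n =>
    hM.pair (hsM s h) (hM.num n)
  constructor
  · rintro ⟨φ, rfl, hφ, hfree⟩
    cases φ with
    | eq t t' =>
      obtain ⟨s, h, h'⟩ := hφ
      exact ⟨_, _, rfl, .inl ⟨rfl, _, _, rfl, s, hsM s h.sort_mem,
        ⟨t, rfl, h, fun z hz => hfree z (.inl hz)⟩, ⟨t', rfl, h', fun z hz => hfree z (.inr hz)⟩⟩⟩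
    | rel r k ts =>
      obtain ⟨nm, σ, rfl, hr, h⟩ := hφ
      exact ⟨_, _, rfl, .inr (.inl ⟨rfl, _, _, rfl, hr, nm, _, rfl, zipRel_tuple.2 fun i =>
        ⟨ts i, rfl, h i, fun z hz => hfree z (Set.mem_iUnion.2 ⟨i, hz⟩)⟩⟩)⟩
    | neg φ => exact ⟨_, _, rfl, .inr (.inr (.inl ⟨rfl, φ, rfl, hφ, hfree⟩))⟩
    | and φ ψ =>
      exact ⟨_, _, rfl, .inr (.inr (.inr (.inl ⟨rfl, _, _, rfl,
        ⟨φ, rfl, hφ.1, fun z hz => hfree z (.inl hz)⟩,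
        ⟨ψ, rfl, hφ.2, fun z hz => hfree z (.inr hz)⟩⟩)))⟩
    | all s n φ =>
      refine ⟨_, _, rfl, .inr (.inr (.inr (.inr (.inl ⟨rfl, _, _, rfl, _, _, rfl, hφ.1, isNum_num n,
        _, hvar s hφ.1 n, _, hM.ins _ (hvar s hφ.1 n) _ hu, rfl, rfl, φ, rfl, hφ.2, ?_⟩))))⟩
      intro z hz
      by_cases h : z = (s, n)
      · rw [h]; exact ZFSet.mem_insert _ _
      · exact ZFSet.mem_insert_of_mem _ (hfree z ⟨hz, h⟩)
    | wf s m n φ =>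
      have hu' := hM.ins _ (hvar s hφ.1 m) _ hu
      refine ⟨_, _, rfl, .inr (.inr (.inr (.inr (.inr ⟨rfl, _, _, rfl, _, _, rfl, _, _, rfl, hφ.1,
        isNum_num m, isNum_num n, fun h => hφ.2.1 (num_injective h),
        _, hvar s hφ.1 m, _, hvar s hφ.1 n, _, hu', _, hM.ins _ (hvar s hφ.1 n) _ hu', rfl, rfl,
        rfl, rfl, φ, rfl, hφ.2.2, ?_⟩))))⟩
      intro z hz
      by_cases h : z = (s, n)
      · rw [h]; exact ZFSet.mem_insert _ _
      by_cases h' : z = (s, m)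
      · rw [h']; exact ZFSet.mem_insert_of_mem _ (ZFSet.mem_insert _ _)
      · exact ZFSet.mem_insert_of_mem _ (ZFSet.mem_insert_of_mem _ (hfree z ⟨hz, by simp [h, h']⟩))
  · rintro ⟨o, p, rfl, h⟩
    rcases h with ⟨rfl, t, t', rfl, s, hs, ⟨T, rfl, h, hv⟩, ⟨T', rfl, h', hv'⟩⟩ |
      ⟨rfl, r, ts, rfl, hr, nm, σ, rfl, k, a, b, rfl, rfl, h⟩ | ⟨rfl, φ, rfl, h, h'⟩ |
      ⟨rfl, d, e, rfl, ⟨φ, rfl, h, hv⟩, ⟨ψ, rfl, h', hv'⟩⟩ |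
      ⟨rfl, s, q, rfl, n, d, rfl, hs, hn, z, hz, u', hu', rfl, rfl, φ, rfl, h, hv⟩ |
      ⟨rfl, s, q, rfl, m, q', rfl, n, d, rfl, hs, hm, hn, hmn, z, hz, z', hz', u', hu', u'', hu'',
        rfl, rfl, rfl, rfl, φ, rfl, h, hv⟩
    · exact ⟨.eq T T', rfl, ⟨s, h, h'⟩, fun z hz => hz.elim (hv z) (hv' z)⟩
    · choose T hT h hv using h
      refine ⟨.rel (relSym nm b) k T, ?_, ⟨nm, b, rfl, hr, h⟩, fun z hz => ?_⟩
      · simp only [Formula.code, hT]; rfl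
      · obtain ⟨i, hi⟩ := Set.mem_iUnion.1 hz
        exact hv i z hi
    · exact ⟨.neg φ, rfl, h, h'⟩
    · exact ⟨.and φ ψ, rfl, ⟨h, h'⟩, fun z hz => hz.elim (hv z) (hv' z)⟩
    · obtain ⟨n, rfl⟩ := isNum_iff.1 hn
      refine ⟨.all s n φ, rfl, ⟨hs, h⟩, fun z hz => ?_⟩
      rcases ZFSet.mem_insert_iff.1 (hv z hz.1) with h | h
      · simp only [ZFSet.pair_inj, num_inj] at h
        exact absurd (Prod.ext h.1 h.2) hz.2
      · exact h
    · obtain ⟨m, rfl⟩ := isNum_iff.1 hm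
      obtain ⟨n, rfl⟩ := isNum_iff.1 hn
      refine ⟨.wf s m n φ, rfl, ⟨hs, fun h => hmn (by rw [h]), h⟩, fun z hz => ?_⟩
      rcases ZFSet.mem_insert_iff.1 (hv z hz.1) with h | h
      · simp only [ZFSet.pair_inj, num_inj] at h
        exact absurd (.inr (Prod.ext h.1 h.2)) hz.2
      · rcases ZFSet.mem_insert_iff.1 h with h | h
        · simp only [ZFSet.pair_inj, num_inj] at h
          exact absurd (.inl (Prod.ext h.1 h.2)) hz.2
        · exact h

theorem FmlSys.spec {τ : Vocab.{u}} (hM : Adequate M) (hs : τ.sorts ∈ M) (hr : τ.rels ∈ M)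
    (hf : τ.funs ∈ M) {HS ZHS Fm : ZFSet.{u}} (h : SortSys M τ.sorts τ.funs HS ZHS)
    (hF : FmlSys M τ.sorts τ.rels HS ZHS Fm) {c u : ZFSet.{u}} (hc : c ∈ M) (hu : u ∈ M) :
    ZFSet.pair c u ∈ Fm ↔ FmlP τ c u := by
  have hrM : τ.rels ⊆ M := hM.trans _ hr
  suffices ∀ α : Ordinal.{u}, ∀ c ∈ M, c.rank = α → ∀ u ∈ M,
      (ZFSet.pair c u ∈ Fm ↔ FmlP τ c u) from this _ c hc rfl u hu
  clear hc hu c u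
  intro α
  induction α using WellFoundedLT.induction with
  | _ α ih =>
    rintro c hc rfl u hu
    rw [hF c hc u hu, fmlP_iff hM hs hu]
    constructor
    · exact FmlClause.imp hM.trans hrM (fun t ht s hs u hu => (h.spec hM.trans hf ht hs hu).1)
        (fun t ht s hs u hu => (h.zip_spec hM.trans hf ht hs hu).1) hc hu
        fun d hd u hu hdc => (ih _ hdc d hd rfl u hu).1
    · exact FmlClause.imp hM.trans hrM (fun t ht s hs u hu => (h.spec hM.trans hf ht hs hu).2)
        (fun t ht s hs u hu => (h.zip_spec hM.trans hf ht hs hu).2) hc hu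
        fun d hd u hu hdc => (ih _ hdc d hd rfl u hu).2

theorem exists_fmlSys {τ : Vocab.{u}} (hM : Adequate M) (hs : τ.sorts ∈ M) (hr : τ.rels ∈ M)
    (hf : τ.funs ∈ M) {HS ZHS : ZFSet.{u}} (h : SortSys M τ.sorts τ.funs HS ZHS) :
    ∃ Fm, Fm ⊆ M ∧ FmlSys M τ.sorts τ.rels HS ZHS Fm := by
  have hrM : τ.rels ⊆ M := hM.trans _ hr
  refine ⟨graph₂ M (FmlP τ), ZFSet.sep_subset, fun c hc u hu => ?_⟩
  rw [pair_mem_graph₂ hM hc hu, fmlP_iff hM hs hu]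
  constructor
  · exact FmlClause.imp hM.trans hrM (fun t ht s hs u hu => (h.spec hM.trans hf ht hs hu).2)
      (fun t ht s hs u hu => (h.zip_spec hM.trans hf ht hs hu).2) hc hu
      fun d hd u hu _ => (pair_mem_graph₂ hM hd hu).2
  · exact FmlClause.imp hM.trans hrM (fun t ht s hs u hu => (h.spec hM.trans hf ht hs hu).1)
      (fun t ht s hs u hu => (h.zip_spec hM.trans hf ht hs hu).1) hc hu
      fun d hd u hu _ => (pair_mem_graph₂ hM hd hu).1

theorem exists_fmlP {τ : Vocab.{u}} (hM : Adequate M) (hs : τ.sorts ∈ M) {φ : Formula.{u}}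
    (hφ : φ.IsFormula τ) : ∃ u ∈ M, FmlP τ φ.code u := by
  suffices ∀ F : Set (ZFSet.{u} × ℕ), F.Finite → (∀ z ∈ F, z.1 ∈ τ.sorts) →
      ∃ u ∈ M, ∀ z ∈ F, ZFSet.pair z.1 (num z.2) ∈ u by
    obtain ⟨u, hu, h⟩ := this _ φ.free_finite hφ.free_sorts
    exact ⟨u, hu, φ, rfl, hφ, h⟩
  intro F hF
  induction F, hF using Set.Finite.induction_on with
  | empty => exact fun _ => ⟨∅, hM.empty, by simp⟩
  | @insert a F _ _ ih =>
    intro h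
    obtain ⟨u, hu, hu'⟩ := ih fun z hz => h z (.inr hz)
    refine ⟨_, hM.ins _ (hM.pair (hM.trans _ hs (h a (.inl rfl))) (hM.num a.2)) _ hu, ?_⟩
    rintro z (rfl | hz)
    · exact ZFSet.mem_insert _ _
    · exact ZFSet.mem_insert_of_mem _ (hu' z hz)

theorem fmlP_empty {τ : Vocab.{u}} {c : ZFSet.{u}} :
    FmlP τ c ∅ ↔ ∃ φ : Formula.{u}, φ.IsSentence τ ∧ φ.code = c := by
  constructor
  · rintro ⟨φ, h, h', h''⟩
    refine ⟨φ, ⟨h', ?_⟩, h⟩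
    ext z
    exact ⟨fun hz => absurd (h'' z hz) (ZFSet.notMem_empty _), fun hz => hz.elim⟩
  · rintro ⟨φ, ⟨h', h''⟩, h⟩
    exact ⟨φ, h, h', by simp [h'']⟩

/-! ### Codes of structures -/

theorem exists_typedSys (hM : Adequate M) (dom : ZFSet.{u}) : ∃ TT, TT ⊆ M ∧ TypedSys M dom TT :=
  ⟨_, graph₃_subset _ _, (zipSys_zipRel M _).congr hM.trans (fun _ _ _ _ _ _ => Iff.rfl)
    fun _ ha _ hb _ hu => tri_graph₃ hM ha hb hu⟩

theorem TypedSys.spec (hM : M.IsTransitive) {dom TT : ZFSet.{u}} (h : TypedSys M dom TT)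
    {σ a u : ZFSet.{u}} (hσ : σ ∈ M) (ha : a ∈ M) (hu : u ∈ M) :
    Tri TT σ a u ↔ ∃ (k : ℕ) (σ' a' : Fin k → ZFSet.{u}), σ = tuple σ' ∧ a = tuple a' ∧
      ∀ i, ZFSet.pair (σ' i) (a' i) ∈ dom := ZipSys.spec hM h hσ ha hu

theorem strucClause_iff (hM : Adequate M) {sorts rels funs dom rel fn TT : ZFSet.{u}}
    (hr : rels ∈ M) (hf : funs ∈ M) (hdom : dom ∈ M) (hrel : rel ∈ M)
    (hfn : fn ∈ M) (hTT : TypedSys M dom TT) :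
    StrucClause M sorts rels funs dom rel fn TT ↔ ∃ (τ : Vocab.{u}) (A : Struc τ),
      τ.sorts = sorts ∧ τ.rels = rels ∧ τ.funs = funs ∧ A.dom = dom ∧ A.rel = rel ∧ A.fn = fn := by
  have hM' := hM.trans
  constructor
  · rintro ⟨h1, h2, h3, h4, h5, h6, h7⟩
    have hs : ∀ s a, ZFSet.pair s a ∈ dom → s ∈ sorts := by
      intro s a h
      obtain ⟨s', a', h, hs⟩ := h3 _ h
      rwa [(ZFSet.pair_inj.1 h).1]
    let τ : Vocab.{u} :=
      { sorts := sorts, rels := rels, funs := funs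
        rels_typed := by
          intro r hr'
          obtain ⟨nm, σ, rfl, a, ha, u, hu, h⟩ := h1 r hr'
          obtain ⟨k, σ', a', rfl, rfl, hd⟩ :=
            (hTT.spec hM' (hM.right (hM' _ hr hr')) ha hu).1 h
          exact ⟨nm, k, σ', fun i => hs _ _ (hd i), rfl⟩
        funs_typed := by
          intro f hf'
          obtain ⟨nm, p, rfl, σ, s, rfl, hs', a, ha, u, hu, h⟩ := h2 f hf'
          obtain ⟨k, σ', a', rfl, rfl, hd⟩ :=
            (hTT.spec hM' (hM.left (hM.right (hM' _ hf hf'))) ha hu).1 h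
          exact ⟨nm, k, σ', s, fun i => hs _ _ (hd i), hs', rfl⟩ }
    let A : Struc τ :=
      { dom := dom, rel := rel, fn := fn
        dom_typed := by
          intro p hp
          obtain ⟨s, a, rfl, h⟩ := h3 p hp
          exact ⟨s, h, a, rfl⟩
        dom_nonempty := fun s hs => let ⟨a, _, h⟩ := h4 s hs; ⟨a, h⟩
        rel_typed := by
          intro p hp
          obtain ⟨r, a, rfl, hr', nm, σ, rfl, u, hu, h⟩ := h5 p hp
          obtain ⟨k, σ', a', rfl, rfl, hd⟩ := (hTT.spec hM' (hM.right (hM' _ hr hr'))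
            (hM.right (hM' _ hrel hp)) hu).1 h
          exact ⟨nm, k, σ', a', hr', hd, rfl⟩
        fn_typed := by
          intro p hp
          obtain ⟨f, q, rfl, hf', a, b, rfl, nm, r, rfl, σ, s, rfl, hb, u, hu, h⟩ := h6 p hp
          obtain ⟨k, σ', a', rfl, rfl, hd⟩ := (hTT.spec hM' (hM.left (hM.right (hM' _ hf hf')))
            (hM.left (hM.right (hM' _ hfn hp))) hu).1 h
          exact ⟨nm, k, σ', s, a', b, hf', hd, hb, rfl⟩
        fn_total := by
          intro nm k σ s hf' a ha
          have haM : tuple a ∈ M := hM.tuple fun i => hM.right (hM' _ hdom (ha i))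
          have hσM : tuple σ ∈ M := hM.left (hM.right (hM' _ hf hf'))
          obtain ⟨b, hb, hb', h⟩ := h7 _ hf' (tuple a) haM ⟨nm, _, rfl, _, _, rfl, ∅, hM.empty,
            (hTT.spec hM' hσM haM hM.empty).2 ⟨k, σ, a, rfl, rfl, ha⟩⟩
          exact ⟨b, hb', fun b' hb' => h b' (hM.right (hM.right (hM' _ hfn hb'))) hb'⟩ }
    exact ⟨τ, A, rfl, rfl, rfl, rfl, rfl, rfl⟩
  · rintro ⟨τ, A, rfl, rfl, rfl, rfl, rfl, rfl⟩
    have hne : ∀ s ∈ τ.sorts, ∃ a ∈ M, ZFSet.pair s a ∈ A.dom := fun s hs =>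
      let ⟨a, ha⟩ := A.dom_nonempty s hs
      ⟨a, hM.right (hM' _ hdom ha), ha⟩
    have hTT' : ∀ {k : ℕ} (σ : Fin k → ZFSet.{u}), tuple σ ∈ M → (∀ i, σ i ∈ τ.sorts) →
        ∃ a ∈ M, ∃ u ∈ M, Tri TT (tuple σ) a u := by
      intro k σ hσ h
      choose a ha ha' using fun i => hne (σ i) (h i)
      exact ⟨tuple a, hM.tuple ha, ∅, hM.empty,
        (hTT.spec hM' hσ (hM.tuple ha) hM.empty).2 ⟨k, σ, a, rfl, rfl, ha'⟩⟩
    refine ⟨?_, ?_, ?_, hne, ?_, ?_, ?_⟩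
    · intro r hr'
      obtain ⟨nm, k, σ, hσ, rfl⟩ := τ.rels_typed r hr'
      exact ⟨nm, _, rfl, hTT' σ (hM.right (hM' _ hr hr')) hσ⟩
    · intro f hf'
      obtain ⟨nm, k, σ, s, hσ, hs, rfl⟩ := τ.funs_typed f hf'
      exact ⟨nm, _, rfl, _, s, rfl, hs, hTT' σ (hM.left (hM.right (hM' _ hf hf'))) hσ⟩
    · intro p hp
      obtain ⟨s, hs, a, rfl⟩ := A.dom_typed p hp
      exact ⟨s, a, rfl, hs⟩
    · intro p hp
      obtain ⟨nm, k, σ, a, hr', h, rfl⟩ := A.rel_typed p hp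
      exact ⟨_, _, rfl, hr', nm, _, rfl, ∅, hM.empty,
        (hTT.spec hM' (hM.right (hM' _ hr hr')) (hM.right (hM' _ hrel hp)) hM.empty).2
          ⟨k, σ, a, rfl, rfl, h⟩⟩
    · intro p hp
      obtain ⟨nm, k, σ, s, a, b, hf', h, hb, rfl⟩ := A.fn_typed p hp
      exact ⟨_, _, rfl, hf', _, _, rfl, nm, _, rfl, _, s, rfl, hb, ∅, hM.empty,
        (hTT.spec hM' (hM.left (hM.right (hM' _ hf hf'))) (hM.left (hM.right (hM' _ hfn hp)))
          hM.empty).2 ⟨k, σ, a, rfl, rfl, h⟩⟩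
    · rintro f hf' a ha ⟨nm, r, rfl, σ, s, rfl, u, hu, h⟩
      obtain ⟨k, σ, a, rfl, rfl, hd⟩ := (hTT.spec hM' (hM.left (hM.right (hM' _ hf hf'))) ha hu).1 h
      obtain ⟨b, hb, hb'⟩ := A.fn_total nm k σ s hf' a hd
      exact ⟨b, hM.right (hM.right (hM' _ hfn hb)), hb, fun b' _ h => hb' b' h⟩

end Systems

/-! ### The recursion clauses define satisfaction -/

/-- The set `w` represents the assignment `v`. -/
def Represents (τ : Vocab.{u}) (w : ZFSet.{u}) (v : Assignment.{u}) : Prop :=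
  ∀ s ∈ τ.sorts, ∀ (n : ℕ) (b : ZFSet.{u}), ZFSet.pair (ZFSet.pair s (num n)) b ∈ w ↔ b = v s n

theorem Represents.unique {τ : Vocab.{u}} {w : ZFSet.{u}} {v v' : Assignment.{u}}
    (h : Represents τ w v) (h' : Represents τ w v') {s : ZFSet.{u}} (hs : s ∈ τ.sorts) (n : ℕ) :
    v s n = v' s n := (h' s hs n _).1 ((h s hs n _).2 rfl)

/-- A transitive set `M` with the sets that occur in the clauses for satisfaction in `A`. -/
structure SatContext {τ : Vocab.{u}} (A : Struc τ) (M X V Vl ZVl : ZFSet.{u}) : Prop where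
  hM : Adequate M
  hX : X.IsTransitive
  hXM : X ⊆ M
  sorts : τ.sorts ∈ M
  dom : A.dom ∈ M
  fn : A.fn ∈ M
  asg : AsgSys M τ.sorts A.dom V
  val : ValSys M A.fn Vl ZVl

namespace SatContext

variable {τ : Vocab.{u}} {A : Struc τ} {M X V Vl ZVl : ZFSet.{u}}
  (C : SatContext A M X V Vl ZVl)
include C

theorem sort_mem {s : ZFSet.{u}} (hs : s ∈ τ.sorts) : s ∈ M := C.hM.trans _ C.sorts hs

theorem carrier_mem {s a : ZFSet.{u}} (ha : a ∈ A.carrier s) : a ∈ M :=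
  C.hM.right (C.hM.trans _ C.dom (Struc.mem_carrier.1 ha))

theorem asg_mem {w : ZFSet.{u}} (hw : w ∈ V) : w ∈ M := C.asg.1 hw

theorem exists_represents {w : ZFSet.{u}} (hw : w ∈ V) :
    ∃ v : Assignment.{u}, A.WellSorted v ∧ Represents τ w v := by
  classical
  have h : ∀ s ∈ τ.sorts, ∀ n, ∃ a, a ∈ A.carrier s ∧
      ∀ b, ZFSet.pair (ZFSet.pair s (num n)) b ∈ w ↔ b = a := by
    intro s hs n
    obtain ⟨a, _, ha, h⟩ := C.asg.2.2.1 w hw s hs _ (C.hM.num n) (isNum_num n)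
    refine ⟨a, Struc.mem_carrier.2 ha, fun b => ?_⟩
    have h' := h _ (C.hM.pair (C.sort_mem hs) (C.hM.num n)) rfl
    constructor
    · intro hb
      exact (h' b (C.hM.right (C.hM.trans _ (C.asg_mem hw) hb))).1 hb
    · rintro rfl
      exact (h' b (C.carrier_mem (Struc.mem_carrier.2 ha))).2 rfl
  refine ⟨fun s n => if hs : s ∈ τ.sorts then (h s hs n).choose else ∅, fun s hs n => ?_,
    fun s hs n => ?_⟩
  · simp only [dif_pos hs]; exact (h s hs n).choose_spec.1
  · simp only [dif_pos hs]; exact (h s hs n).choose_spec.2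

theorem represents_upd {w w' s a : ZFSet.{u}} {n : ℕ} {v : Assignment.{u}} (hw' : w' ∈ V)
    (hv : Represents τ w v) (hva : A.WellSorted v) (ha : a ∈ A.carrier s)
    (h : Upd M τ.sorts w s (num n) a w') :
    Represents τ w' (v.set s n a) := by
  intro s' hs' n' b
  have hz := C.hM.pair (C.sort_mem hs') (C.hM.num n')
  have key : ∀ b ∈ M, (ZFSet.pair (ZFSet.pair s' (num n')) b ∈ w' ↔ b = v.set s n a s' n') := by
    intro b hb
    rw [h s' hs' _ (C.hM.num n') (isNum_num n') _ hz rfl b hb, num_inj]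
    unfold Assignment.set
    split_ifs with hsn
    · simp [hsn]
    · simp only [hsn, false_and, not_false_eq_true, true_and, false_or]
      exact hv s' hs' n' b
  constructor
  · exact fun hb => (key b (C.hM.right (C.hM.trans _ (C.asg_mem hw') hb))).1 hb
  · rintro rfl
    exact (key _ (C.carrier_mem (hva.set ha n s' hs' n'))).2 rfl

theorem exists_upd {w s a : ZFSet.{u}} (hw : w ∈ V) (n : ℕ) (hs : s ∈ τ.sorts)
    (ha : a ∈ A.carrier s) : ∃ w' ∈ V, Upd M τ.sorts w s (num n) a w' :=
  C.asg.2.2.2 w hw s hs _ (C.hM.num n) (isNum_num n) a (C.carrier_mem ha) (Struc.mem_carrier.1 ha)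

theorem valApp_mem (f q s : ZFSet.{u}) (_ : s ∈ M) (h : Tri A.fn f q s) : q ∈ M :=
  C.hM.left (C.hM.right (C.hM.trans _ C.fn h))

omit C in
theorem valEval_iff {w : ZFSet.{u}} {v : Assignment.{u}} (hva : A.WellSorted v)
    (hv : Represents τ w v) {t : Term.{u}} {s : ZFSet.{u}} (ht : t.HasSort τ s) (b : ZFSet.{u}) :
    TermEval ValBase (Tri A.fn) w t.code b ↔ b = t.val A v := by
  induction ht generalizing b with
  | var s n hs =>
    rw [termEval_iff]
    constructor
    · rintro (⟨o, z, h, rfl, hb⟩ | ⟨f, k, a, b, h, _⟩)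
      · simp only [Term.code, ZFSet.pair_inj, true_and] at h
        subst h
        exact (hv s hs n b).1 hb
      · simp [Term.code, ZFSet.pair_inj] at h
    · intro h
      exact .inl ⟨_, _, rfl, rfl, (hv s hs n b).2 h⟩
  | app nm k σ s ts hf hts ih =>
    have hval : ∀ i, (ts i).val A v ∈ A.carrier (σ i) := fun i => (hts i).val_mem hva
    rw [termEval_iff, ← Term.HasSort.val_spec hf hval]
    constructor
    · rintro (⟨o, z, h, rfl, hb⟩ | ⟨f, k', a, b', h, h', h''⟩)
      · simp [Term.code, ZFSet.pair_inj] at h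
      · simp only [Term.code, ZFSet.pair_inj, true_and] at h
        obtain ⟨rfl, h⟩ := h
        obtain rfl := tuple_length h
        obtain rfl := tuple_injective h
        have : b' = fun i => (ts i).val A v := funext fun i => (ih i _).1 (h' i)
        rw [this] at h''
        exact h''
    · intro h
      exact .inr ⟨_, k, _, fun i => (ts i).val A v, rfl, fun i => (ih i _).2 rfl, h⟩

theorem tri_val_iff {w : ZFSet.{u}} {v : Assignment.{u}} (hw : w ∈ V) (hva : A.WellSorted v)
    (hv : Represents τ w v) {t : Term.{u}} {s : ZFSet.{u}} (ht : t.HasSort τ s) (htM : t.code ∈ M)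
    {b : ZFSet.{u}} (hb : b ∈ M) : Tri Vl t.code b w ↔ b = t.val A v := by
  rw [C.val.spec C.hM.trans C.valApp_mem htM hb (C.asg_mem hw)]
  exact valEval_iff hva hv ht b

theorem zip_val_iff {w : ZFSet.{u}} {v : Assignment.{u}} (hw : w ∈ V) (hva : A.WellSorted v)
    (hv : Represents τ w v) {k : ℕ} {ts : Fin k → Term.{u}} {σ : Fin k → ZFSet.{u}}
    (ht : ∀ i, (ts i).HasSort τ (σ i)) (htM : (tuple fun i => (ts i).code) ∈ M)
    {b : ZFSet.{u}} (hb : b ∈ M) :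
    Tri ZVl (tuple fun i => (ts i).code) b w ↔ b = tuple fun i => (ts i).val A v := by
  rw [C.val.zip_spec C.hM.trans C.valApp_mem htM hb (C.asg_mem hw)]
  constructor
  · intro h
    obtain ⟨b', rfl, h'⟩ := h.exists_right
    rw [tuple_inj]
    exact funext fun i => (valEval_iff hva hv (ht i) _).1 (h' i)
  · rintro rfl
    exact zipRel_tuple.2 fun i => (valEval_iff hva hv (ht i) _).2 rfl

/-- `S` is correct for the formula `φ`. -/
abbrev Correct (_ : SatContext A M X V Vl ZVl) (S : ZFSet.{u}) (φ : Formula.{u}) : Prop :=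
  ∀ w ∈ V, ∀ v, A.WellSorted v → Represents τ w v → (ZFSet.pair φ.code w ∈ S ↔ φ.Sat A v)

variable {S G D w : ZFSet.{u}} {v : Assignment.{u}}

theorem satClause_eq (hw : w ∈ V) (hva : A.WellSorted v) (hv : Represents τ w v)
    {t t' : Term.{u}} (hφ : (Formula.eq t t').IsFormula τ) (hX : (Formula.eq t t').code ∈ X) :
    SatClause M τ.sorts A.dom A.rel V Vl ZVl S G D (Formula.eq t t').code w ↔
      (ZFSet.pair (Formula.eq t t').code w ∈ S ↔ (Formula.eq t t').Sat A v) := by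
  obtain ⟨s, h, h'⟩ := hφ
  have hp := C.hM.right (C.hXM hX)
  have hval : (Formula.eq t t').Sat A v ↔
      ∃ b ∈ M, Tri Vl t.code b w ∧ Tri Vl t'.code b w := by
    constructor
    · intro e
      have hb := C.carrier_mem (h.val_mem hva)
      exact ⟨_, hb, (C.tri_val_iff hw hva hv h (C.hM.left hp) hb).2 rfl,
        (C.tri_val_iff hw hva hv h' (C.hM.right hp) hb).2 e⟩
    · rintro ⟨b, hb, h1, h2⟩
      rw [C.tri_val_iff hw hva hv h (C.hM.left hp) hb] at h1
      rw [C.tri_val_iff hw hva hv h' (C.hM.right hp) hb] at h2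
      exact h1.symm.trans h2
  rw [hval]
  simp [SatClause, Formula.code, ZFSet.pair_inj]

theorem satClause_rel (hw : w ∈ V) (hva : A.WellSorted v) (hv : Represents τ w v)
    {r : ZFSet.{u}} {k : ℕ} {ts : Fin k → Term.{u}} (hφ : (Formula.rel r k ts).IsFormula τ)
    (hX : (Formula.rel r k ts).code ∈ X) :
    SatClause M τ.sorts A.dom A.rel V Vl ZVl S G D (Formula.rel r k ts).code w ↔
      (ZFSet.pair (Formula.rel r k ts).code w ∈ S ↔ (Formula.rel r k ts).Sat A v) := by
  obtain ⟨nm, σ, rfl, hr, h⟩ := hφ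
  have hts := C.hM.right (C.hM.right (C.hXM hX))
  have hval : (Formula.rel (relSym nm σ) k ts).Sat A v ↔
      ∃ bs ∈ M, Tri ZVl (tuple fun i => (ts i).code) bs w ∧
        ZFSet.pair (relSym nm σ) bs ∈ A.rel := by
    constructor
    · intro e
      have hb := C.hM.tuple fun i => C.carrier_mem ((h i).val_mem hva)
      exact ⟨_, hb, (C.zip_val_iff hw hva hv h hts hb).2 rfl, e⟩
    · rintro ⟨b, hb, h1, h2⟩
      rw [C.zip_val_iff hw hva hv h hts hb] at h1
      rw [h1] at h2
      exact h2
  rw [hval]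
  simp [SatClause, Formula.code, ZFSet.pair_inj]

theorem satClause_neg (hw : w ∈ V) (hva : A.WellSorted v) (hv : Represents τ w v)
    {φ : Formula.{u}} (hS : C.Correct S φ) :
    SatClause M τ.sorts A.dom A.rel V Vl ZVl S G D φ.neg.code w ↔
      (ZFSet.pair φ.neg.code w ∈ S ↔ φ.neg.Sat A v) := by
  rw [Formula.Sat, ← hS w hw v hva hv]
  simp [SatClause, Formula.code, ZFSet.pair_inj]

theorem satClause_and (hw : w ∈ V) (hva : A.WellSorted v) (hv : Represents τ w v)
    {φ ψ : Formula.{u}} (hS : C.Correct S φ) (hS' : C.Correct S ψ) :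
    SatClause M τ.sorts A.dom A.rel V Vl ZVl S G D (φ.and ψ).code w ↔
      (ZFSet.pair (φ.and ψ).code w ∈ S ↔ (φ.and ψ).Sat A v) := by
  rw [Formula.Sat, ← hS w hw v hva hv, ← hS' w hw v hva hv]
  simp [SatClause, Formula.code, ZFSet.pair_inj]

theorem satClause_all (hw : w ∈ V) (hva : A.WellSorted v) (hv : Represents τ w v)
    {s : ZFSet.{u}} {n : ℕ} {φ : Formula.{u}} (hs : s ∈ τ.sorts) (hS : C.Correct S φ) :
    SatClause M τ.sorts A.dom A.rel V Vl ZVl S G D (φ.all s n).code w ↔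
      (ZFSet.pair (φ.all s n).code w ∈ S ↔ (φ.all s n).Sat A v) := by
  have hval : (φ.all s n).Sat A v ↔ ∀ a ∈ M, ZFSet.pair s a ∈ A.dom →
      ∃ w' ∈ V, Upd M τ.sorts w s (num n) a w' ∧ ZFSet.pair φ.code w' ∈ S := by
    constructor
    · intro h a _ ha
      rw [← Struc.mem_carrier] at ha
      obtain ⟨w', hw', hu⟩ := C.exists_upd hw n hs ha
      exact ⟨w', hw', hu, (hS w' hw' _ (hva.set ha n)
        (C.represents_upd hw' hv hva ha hu)).2 (h a ha)⟩
    · intro h a ha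
      obtain ⟨w', hw', hu, h'⟩ := h a (C.carrier_mem ha) (Struc.mem_carrier.1 ha)
      exact (hS w' hw' _ (hva.set ha n) (C.represents_upd hw' hv hva ha hu)).1 h'
  rw [hval]
  simp [SatClause, Formula.code, ZFSet.pair_inj]

theorem defRel_iff (hw : w ∈ V) (hva : A.WellSorted v) (hv : Represents τ w v)
    {s : ZFSet.{u}} {m n : ℕ} {φ : Formula.{u}} (hs : s ∈ τ.sorts) (hS : C.Correct S φ)
    {a b : ZFSet.{u}} (ha : a ∈ A.carrier s) (hb : b ∈ A.carrier s) :
    DefRel M τ.sorts V S w s (num m) (num n) φ.code a b ↔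
      φ.Sat A ((v.set s m a).set s n b) := by
  constructor
  · rintro ⟨w', hw', w'', hw'', h', h'', h⟩
    have hv' := C.represents_upd hw' hv hva ha h'
    exact (hS w'' hw'' _ ((hva.set ha m).set hb n)
      (C.represents_upd hw'' hv' (hva.set ha m) hb h'')).1 h
  · intro h
    obtain ⟨w', hw', h'⟩ := C.exists_upd hw m hs ha
    obtain ⟨w'', hw'', h''⟩ := C.exists_upd hw' n hs hb
    have hv' := C.represents_upd hw' hv hva ha h'
    exact ⟨w', hw', w'', hw'', h', h'', (hS w'' hw'' _ ((hva.set ha m).set hb n)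
      (C.represents_upd hw'' hv' (hva.set ha m) hb h'')).2 h⟩

omit C in
theorem satClause_wf_iff {s : ZFSet.{u}} {m n : ℕ} {φ : Formula.{u}} :
    SatClause M τ.sorts A.dom A.rel V Vl ZVl S G D (φ.wf s m n).code w ↔
      WfClause M τ.sorts A.dom V S G D (φ.wf s m n).code w s (num m) (num n) φ.code := by
  simp [SatClause, Formula.code, ZFSet.pair_inj]

theorem wfClause_sound (hw : w ∈ V) (hva : A.WellSorted v) (hv : Represents τ w v)
    {s : ZFSet.{u}} {m n : ℕ} {φ : Formula.{u}} (hs : s ∈ τ.sorts) (hS : C.Correct S φ)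
    (h : WfClause M τ.sorts A.dom V S G D (φ.wf s m n).code w s (num m) (num n) φ.code) :
    ZFSet.pair (φ.wf s m n).code w ∈ S ↔ (φ.wf s m n).Sat A v := by
  obtain ⟨h1, h2⟩ := h
  constructor
  · intro hT
    obtain ⟨h1, h1'⟩ := h1 hT
    have hd : ∀ a : {a : ZFSet.{u} // a ∈ A.carrier s}, ZFSet.pair s a.1 ∈ A.dom := fun a =>
      Struc.mem_carrier.1 a.2
    choose g hgM hg using fun a : {a : ZFSet.{u} // a ∈ A.carrier s} =>
      h1 a (C.carrier_mem a.2) (hd a)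
    refine Subrelation.wf (r := InvImage (· ∈ ·) g) ?_ (InvImage.wf g ZFSet.mem_wf)
    intro a b hab
    exact h1' a (C.carrier_mem a.2) b (C.carrier_mem b.2) (hd a) (hd b) _ (hgM a) _ (hgM b)
      (hg a) (hg b) ((C.defRel_iff hw hva hv hs hS a.2 b.2).2 hab)
  · intro hwf
    by_contra hF
    obtain ⟨⟨a, haM, ha⟩, h2⟩ := h2 hF
    have key : ∀ a : {a : ZFSet.{u} // a ∈ A.carrier s}, ¬ Tri D (φ.wf s m n).code w a.1 := by
      intro a
      induction a using WellFounded.induction hwf with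
      | _ a ih =>
        intro ha
        obtain ⟨_, b, hbM, hb, hba⟩ := h2 a (C.carrier_mem a.2) ha
        have hbs := Struc.mem_carrier.2 (h2 b hbM hb).1
        exact ih ⟨b, hbs⟩ ((C.defRel_iff hw hva hv hs hS hbs a.2).1 hba) hb
    exact key ⟨a, Struc.mem_carrier.2 (h2 a haM ha).1⟩ ha

/-- A set that satisfies the clauses for satisfaction is correct. -/
theorem sound {Fm : ZFSet.{u}} (hFm : ∀ c ∈ M, ∀ u ∈ M, (ZFSet.pair c u ∈ Fm ↔ FmlP τ c u))
    (h : SatSys M X Fm τ.sorts A.dom A.rel V Vl ZVl S G D) (φ : Formula.{u})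
    (hφ : φ.IsFormula τ) (hφX : φ.code ∈ X) : C.Correct S φ := by
  intro w hw v hva hv
  obtain ⟨u, hu, hu'⟩ := exists_fmlP C.hM C.sorts hφ
  have hcl := h _ hφX u hu ((hFm _ (C.hXM hφX) u hu).2 hu') w hw
  have hr : ∀ a b, ZFSet.pair a b ∈ X → b ∈ X := fun a b h => (mem_of_pair_mem C.hX h).2
  have hl : ∀ a b, ZFSet.pair a b ∈ X → a ∈ X := fun a b h => (mem_of_pair_mem C.hX h).1
  clear hu' hu u
  induction φ generalizing w v with
  | eq t t' => exact (C.satClause_eq hw hva hv hφ hφX).1 hcl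
  | rel r k ts => exact (C.satClause_rel hw hva hv hφ hφX).1 hcl
  | neg φ ih =>
    have hX' := hr _ _ hφX
    obtain ⟨u, hu, hu'⟩ := exists_fmlP C.hM C.sorts (show φ.IsFormula τ from hφ)
    exact (C.satClause_neg hw hva hv fun w hw v hva hv => ih hφ hX' w hw v hva hv
      (h _ hX' u hu ((hFm _ (C.hXM hX') u hu).2 hu') w hw)).1 hcl
  | and φ ψ ih ih' =>
    have hX' := hl _ _ (hr _ _ hφX)
    have hX'' := hr _ _ (hr _ _ hφX)
    obtain ⟨u, hu, hu'⟩ := exists_fmlP C.hM C.sorts hφ.1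
    obtain ⟨u₂, hu₂, hu₂'⟩ := exists_fmlP C.hM C.sorts hφ.2
    exact (C.satClause_and hw hva hv
      (fun w hw v hva hv => ih hφ.1 hX' w hw v hva hv
        (h _ hX' u hu ((hFm _ (C.hXM hX') u hu).2 hu') w hw))
      (fun w hw v hva hv => ih' hφ.2 hX'' w hw v hva hv
        (h _ hX'' u₂ hu₂ ((hFm _ (C.hXM hX'') u₂ hu₂).2 hu₂') w hw))).1 hcl
  | all s n φ ih =>
    have hX' := hr _ _ (hr _ _ (hr _ _ hφX))
    obtain ⟨u, hu, hu'⟩ := exists_fmlP C.hM C.sorts hφ.2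
    exact (C.satClause_all hw hva hv hφ.1 fun w hw v hva hv => ih hφ.2 hX' w hw v hva hv
      (h _ hX' u hu ((hFm _ (C.hXM hX') u hu).2 hu') w hw)).1 hcl
  | wf s m n φ ih =>
    have hX' := hr _ _ (hr _ _ (hr _ _ (hr _ _ hφX)))
    obtain ⟨u, hu, hu'⟩ := exists_fmlP C.hM C.sorts hφ.2.2
    exact C.wfClause_sound hw hva hv hφ.1 (fun w hw v hva hv => ih hφ.2.2 hX' w hw v hva hv
      (h _ hX' u hu ((hFm _ (C.hXM hX') u hu).2 hu') w hw)) (satClause_wf_iff.1 hcl)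

end SatContext

/-! ### Existence of the sets in the clauses for satisfaction -/

theorem upd_of_represents {τ : Vocab.{u}} {M w w' s a : ZFSet.{u}} {n : ℕ} {v : Assignment.{u}}
    (hv : Represents τ w v) (hv' : Represents τ w' (v.set s n a)) :
    Upd M τ.sorts w s (num n) a w' := by
  rintro s' hs' n' _ hn' z _ rfl b _
  obtain ⟨n', rfl⟩ := isNum_iff.1 hn'
  rw [hv' s' hs', hv s' hs', num_inj]
  unfold Assignment.set
  split_ifs with h
  · simp [h]
  · simp [h]

section

variable {τ : Vocab.{u}} (A : Struc τ)

/-- `c` is the code of a formula that holds under the assignment represented by `w`. -/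
def TrueP (c w : ZFSet.{u}) : Prop :=
  ∃ φ : Formula.{u}, φ.code = c ∧ φ.IsFormula τ ∧
    ∃ v, A.WellSorted v ∧ Represents τ w v ∧ φ.Sat A v

theorem trueP_iff {φ : Formula.{u}} (hφ : φ.IsFormula τ) {w : ZFSet.{u}} {v : Assignment.{u}}
    (hva : A.WellSorted v) (hv : Represents τ w v) : TrueP A φ.code w ↔ φ.Sat A v := by
  constructor
  · rintro ⟨φ', h, _, v', _, hv', h'⟩
    obtain rfl := Formula.code_injective h
    exact (hφ.sat_congr A fun s hs n => hv'.unique hv hs n).1 h'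
  · exact fun h => ⟨φ, rfl, hφ, v, hva, hv, h⟩

/-- The relation to which the formula `WF x y φ` with the code `c` refers. -/
def RelP (c w a b : ZFSet.{u}) : Prop :=
  ∃ (s : ZFSet.{u}) (m n : ℕ) (φ : Formula.{u}) (v : Assignment.{u}), c = (φ.wf s m n).code ∧
    (φ.wf s m n).IsFormula τ ∧ a ∈ A.carrier s ∧ b ∈ A.carrier s ∧ A.WellSorted v ∧
      Represents τ w v ∧ φ.Sat A ((v.set s m a).set s n b)

theorem relP_iff {s : ZFSet.{u}} {m n : ℕ} {φ : Formula.{u}} (hφ : (φ.wf s m n).IsFormula τ)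
    {w : ZFSet.{u}} {v : Assignment.{u}} (hva : A.WellSorted v) (hv : Represents τ w v)
    {a b : ZFSet.{u}} : RelP A (φ.wf s m n).code w a b ↔
      a ∈ A.carrier s ∧ b ∈ A.carrier s ∧ φ.Sat A ((v.set s m a).set s n b) := by
  constructor
  · rintro ⟨s', m', n', φ', v', h, _, ha, hb, _, hv', h'⟩
    have h := Formula.code_injective h
    simp only [Formula.wf.injEq] at h
    obtain ⟨rfl, rfl, rfl, rfl⟩ := h
    refine ⟨ha, hb, (hφ.2.2.sat_congr A fun s hs n => ?_).1 h'⟩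
    simp only [Assignment.set, hv'.unique hv hs]
  · rintro ⟨ha, hb, h⟩
    exact ⟨s, m, n, φ, v, rfl, hφ, ha, hb, hva, hv, h⟩

/-- The union of the well-founded relations to which true formulas `WF x y φ` refer. -/
def WfStep (x y : ZFSet.{u} × ZFSet.{u} × ZFSet.{u}) : Prop :=
  x.1 = y.1 ∧ x.2.1 = y.2.1 ∧ TrueP A y.1 y.2.1 ∧ RelP A y.1 y.2.1 x.2.2 y.2.2

theorem wfStep_wellFounded : WellFounded (WfStep A) := by
  refine ⟨fun ⟨c, w, a⟩ => ?_⟩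
  by_cases h : ∃ x, WfStep A x (c, w, a)
  · obtain ⟨_, _, _, hT, s, m, n, φ, v, h1, hφ, _, ha, hva, hv, _⟩ := h
    dsimp only at h1 hT hv ha
    subst h1
    have hwf := (trueP_iff A hφ hva hv).1 hT
    suffices ∀ a : {a : ZFSet.{u} // a ∈ A.carrier s},
        Acc (WfStep A) ((φ.wf s m n).code, w, a.1) from this ⟨a, ha⟩
    intro a
    induction a using WellFounded.induction hwf with
    | _ a ih =>
      refine ⟨_, ?_⟩
      rintro ⟨c', w', b⟩ ⟨h1, h2, _, hR⟩
      dsimp only at h1 h2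
      subst h1 h2
      obtain ⟨hb, _, hR⟩ := (relP_iff A hφ hva hv).1 hR
      exact ih ⟨b, hb⟩ hR
  · exact ⟨_, fun x hx => absurd ⟨x, hx⟩ h⟩

/-- `a` is not accessible in the relation to which the formula `WF x y φ` with the code `c`
refers. -/
def BadP (c w a : ZFSet.{u}) : Prop :=
  ∃ (s : ZFSet.{u}) (m n : ℕ) (φ : Formula.{u}) (v : Assignment.{u}), c = (φ.wf s m n).code ∧
    (φ.wf s m n).IsFormula τ ∧ A.WellSorted v ∧ Represents τ w v ∧ ∃ ha : a ∈ A.carrier s,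
      ¬ Acc (fun a b : {a : ZFSet.{u} // a ∈ A.carrier s} =>
        φ.Sat A ((v.set s m a).set s n b)) ⟨a, ha⟩

theorem badP_iff {s : ZFSet.{u}} {m n : ℕ} {φ : Formula.{u}} (hφ : (φ.wf s m n).IsFormula τ)
    {w : ZFSet.{u}} {v : Assignment.{u}} (hva : A.WellSorted v) (hv : Represents τ w v)
    {a : ZFSet.{u}} : BadP A (φ.wf s m n).code w a ↔ ∃ ha : a ∈ A.carrier s,
      ¬ Acc (fun a b : {a : ZFSet.{u} // a ∈ A.carrier s} =>
        φ.Sat A ((v.set s m a).set s n b)) ⟨a, ha⟩ := by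
  constructor
  · rintro ⟨s', m', n', φ', v', h, _, _, hv', h'⟩
    have h := Formula.code_injective h
    simp only [Formula.wf.injEq] at h
    obtain ⟨rfl, rfl, rfl, rfl⟩ := h
    have : (fun a b : {a : ZFSet.{u} // a ∈ A.carrier s} =>
        φ.Sat A ((v.set s m a).set s n b)) =
        fun a b : {a : ZFSet.{u} // a ∈ A.carrier s} => φ.Sat A ((v'.set s m a).set s n b) := by
      funext a b
      refine propext (hφ.2.2.sat_congr A fun s hs n => ?_)
      simp only [Assignment.set, hv.unique hv' hs]
    rw [this]
    exact h'
  · exact fun h => ⟨s, m, n, φ, v, rfl, hφ, hva, hv, h⟩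

variable (X : ZFSet.{u}) (v₀ : Assignment.{u})

/-- Finitely many changes of an assignment. -/
noncomputable def asgOfList : List (Shrink.{u} X × ℕ × Shrink.{u} X) → Assignment.{u}
  | [] => v₀
  | p :: l => (asgOfList l).set ((equivShrink X).symm p.1) p.2.1 ((equivShrink X).symm p.2.2)

variable (τ) in
/-- The set that represents an assignment. -/
def asgSet (M : ZFSet.{u}) (v : Assignment.{u}) : ZFSet.{u} :=
  ZFSet.sep (fun p => ∃ s ∈ τ.sorts, ∃ n : ℕ, p = ZFSet.pair (ZFSet.pair s (num n)) (v s n)) M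

theorem represents_asgSet {M : ZFSet.{u}} (hM : Adequate M) (hs : τ.sorts ∈ M) (hd : A.dom ∈ M)
    {v : Assignment.{u}} (hv : A.WellSorted v) : Represents τ (asgSet τ M v) v := by
  intro s hs' n b
  rw [asgSet, ZFSet.mem_sep]
  constructor
  · rintro ⟨_, s', _, n', h⟩
    simp only [ZFSet.pair_inj, num_inj] at h
    obtain ⟨⟨rfl, rfl⟩, h⟩ := h
    exact h
  · rintro rfl
    exact ⟨hM.pair (hM.pair (hM.trans _ hs hs') (hM.num n))
      (hM.right (hM.trans _ hd (Struc.mem_carrier.1 (hv s hs' n)))), s, hs', n, rfl⟩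

end

theorem exists_satContext {τ : Vocab.{u}} (A : Struc τ) {X : ZFSet.{u}} (hX : X.IsTransitive)
    (hs : τ.sorts ∈ X) (hd : A.dom ∈ X) (hf : A.fn ∈ X) {κ : Cardinal.{u}} (hκ : ℵ₀ ≤ κ)
    (hXκ : X.card ≤ κ) :
    ∃ M V Vl ZVl S G D : ZFSet.{u}, M.card ≤ κ ∧ SatContext A M X V Vl ZVl ∧ Vl ⊆ M ∧ ZVl ⊆ M ∧
      S ⊆ M ∧ G ⊆ M ∧ D ⊆ M ∧
      ∀ Fm, (∀ c ∈ M, ∀ u ∈ M, (ZFSet.pair c u ∈ Fm ↔ FmlP τ c u)) →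
        SatSys M X Fm τ.sorts A.dom A.rel V Vl ZVl S G D := by
  obtain ⟨v₀, hv₀⟩ := A.exists_assignment
  let M₀ := insClosure X
  have hM₀ : Adequate M₀ := adequate_insClosure hX
  have hXM₀ : X ⊆ M₀ := subset_insClosure X
  have hrep : ∀ {v}, A.WellSorted v → Represents τ (asgSet τ M₀ v) v := fun h =>
    represents_asgSet A hM₀ (hXM₀ hs) (hXM₀ hd) h
  let V : ZFSet.{u} := ZFSet.range fun L : {L // A.WellSorted (asgOfList X v₀ L)} =>
    asgSet τ M₀ (asgOfList X v₀ L.1)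
  have hVM₀ : ∀ w ∈ V, w ⊆ M₀ := by
    intro w hw
    obtain ⟨L, rfl⟩ := ZFSet.mem_range.1 hw
    exact ZFSet.sep_subset
  let Ω := Shrink.{u} X × Shrink.{u} V × Shrink.{u} X
  let tr : Ω → ZFSet.{u} × ZFSet.{u} × ZFSet.{u} := fun x =>
    ((equivShrink X).symm x.1, (equivShrink V).symm x.2.1, (equivShrink X).symm x.2.2)
  have hwf : WellFounded (InvImage (WfStep A) tr) := InvImage.wf tr (wfStep_wellFounded A)
  let N := ZFSet.range (coll hwf)
  let M := insClosure (M₀ ∪ V ∪ N)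
  have hU : (M₀ ∪ V ∪ N).IsTransitive := by
    intro x hx y hy
    simp only [ZFSet.mem_union] at hx ⊢
    rcases hx with (hx | hx) | hx
    · exact .inl (.inl (hM₀.trans _ hx hy))
    · exact .inl (.inl (hVM₀ _ hx hy))
    · exact .inr (range_coll_transitive hwf _ hx hy)
  have hM : Adequate M := adequate_insClosure hU
  have hUM : M₀ ∪ V ∪ N ⊆ M := subset_insClosure _
  have hXM : X ⊆ M := fun x hx => hUM (ZFSet.mem_union.2 (.inl (ZFSet.mem_union.2 (.inl (hXM₀ hx)))))
  have hVM : V ⊆ M := fun x hx => hUM (ZFSet.mem_union.2 (.inl (ZFSet.mem_union.2 (.inr hx))))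
  have hNM : N ⊆ M := fun x hx => hUM (ZFSet.mem_union.2 (.inr hx))
  have hX' : #(Shrink.{u} X) ≤ κ := hXκ
  have hVκ : V.card ≤ κ := by
    refine (card_ofSet_le _ fun y hy => ZFSet.mem_range.1 hy).trans ?_
    refine (Cardinal.mk_subtype_le _).trans ((Cardinal.mk_list_le_max _).trans (max_le hκ ?_))
    simp only [Cardinal.mk_prod, Cardinal.lift_id, Cardinal.lift_uzero, Cardinal.mk_nat,
      Cardinal.lift_aleph0]
    exact Cardinal.mul_le_of_le hκ hX' (Cardinal.mul_le_of_le hκ hκ hX')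
  have hNκ : N.card ≤ κ := by
    refine (card_ofSet_le _ fun y hy => ZFSet.mem_range.1 hy).trans ?_
    simp only [Ω, Cardinal.mk_prod, Cardinal.lift_id]
    exact Cardinal.mul_le_of_le hκ hX' (Cardinal.mul_le_of_le hκ hVκ hX')
  have hMκ : M.card ≤ κ := card_insClosure_le _ hκ (card_union_le_of_infinite hκ
    (card_union_le_of_infinite hκ (card_insClosure_le _ hκ hXκ) hVκ) hNκ)
  have hVrep : ∀ w ∈ V, ∃ L, A.WellSorted (asgOfList X v₀ L) ∧ w = asgSet τ M₀ (asgOfList X v₀ L) := by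
    intro w hw
    obtain ⟨L, rfl⟩ := ZFSet.mem_range.1 hw
    exact ⟨L.1, L.2, rfl⟩
  have hasg : AsgSys M τ.sorts A.dom V := by
    refine ⟨hVM, ⟨_, ZFSet.mem_range.2 ⟨⟨[], hv₀⟩, rfl⟩, rfl⟩, ?_, ?_⟩
    · rintro w hw s hs' n _ hn
      obtain ⟨n, rfl⟩ := isNum_iff.1 hn
      obtain ⟨L, hL, rfl⟩ := hVrep w hw
      have h := Struc.mem_carrier.1 (hL s hs' n)
      refine ⟨_, hM.right (hM.trans _ (hXM hd) h), h, ?_⟩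
      rintro z _ rfl b _
      exact hrep hL s hs' n b
    · rintro w hw s hs' n _ hn a _ ha
      obtain ⟨n, rfl⟩ := isNum_iff.1 hn
      obtain ⟨L, hL, rfl⟩ := hVrep w hw
      have hsX : s ∈ X := hX _ hs hs'
      have haX : a ∈ X := (mem_of_pair_mem hX (hX _ hd ha)).2
      have hL' : A.WellSorted
          (asgOfList X v₀ ((equivShrink X ⟨s, hsX⟩, n, equivShrink X ⟨a, haX⟩) :: L)) := by
        simp only [asgOfList, Equiv.symm_apply_apply]
        exact hL.set (Struc.mem_carrier.2 ha) n
      refine ⟨_, ZFSet.mem_range.2 ⟨⟨_, hL'⟩, rfl⟩, upd_of_represents (hrep hL) ?_⟩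
      have h := hrep hL'
      simpa only [asgOfList, Equiv.symm_apply_apply] using h
  obtain ⟨Vl, ZVl, hVl, hZVl, hval⟩ : ∃ Vl ZVl, Vl ⊆ M ∧ ZVl ⊆ M ∧ ValSys M A.fn Vl ZVl :=
    ⟨_, _, graph₃_subset _ _, graph₃_subset _ _, (termSys_termEval fun f q s _ h =>
      hM.left (hM.right (hM.trans _ (hXM hf) h))).congr hM.trans
        (fun _ ha _ hb _ hu => tri_graph₃ hM ha hb hu) fun _ ha _ hb _ hu => tri_graph₃ hM ha hb hu⟩
  have C : SatContext A M X V Vl ZVl := ⟨hM, hX, hXM, hXM hs, hXM hd, hXM hf, hasg, hval⟩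
  let G : ZFSet.{u} := ZFSet.sep (fun p => ∃ x : Ω, p = ZFSet.pair (tr x).1
    (ZFSet.pair (tr x).2.1 (ZFSet.pair (tr x).2.2 (coll hwf x)))) M
  refine ⟨M, V, Vl, ZVl, graph₂ M (TrueP A), G, graph₃ M (BadP A), hMκ, C, hVl, hZVl,
    ZFSet.sep_subset, ZFSet.sep_subset, graph₃_subset _ _, fun Fm hFm c hc u hu hcu w hw => ?_⟩
  obtain ⟨φ, rfl, hφ, -⟩ := (hFm c (hXM hc) u hu).1 hcu
  clear hcu hu u
  obtain ⟨v, hva, hv⟩ := C.exists_represents hw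
  have hS : ∀ φ : Formula.{u}, φ.IsFormula τ → φ.code ∈ X → C.Correct (graph₂ M (TrueP A)) φ := by
    intro φ hφ hφX w hw v hva hv
    rw [pair_mem_graph₂ hM (hXM hφX) (hVM hw), trueP_iff A hφ hva hv]
  have hr : ∀ a b, ZFSet.pair a b ∈ X → b ∈ X := fun a b h => (mem_of_pair_mem hX h).2
  have hl : ∀ a b, ZFSet.pair a b ∈ X → a ∈ X := fun a b h => (mem_of_pair_mem hX h).1
  have hφS := hS φ hφ hc w hw v hva hv
  cases φ with
  | eq t t' => exact (C.satClause_eq hw hva hv hφ hc).2 hφS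
  | rel r k ts => exact (C.satClause_rel hw hva hv hφ hc).2 hφS
  | neg φ => exact (C.satClause_neg hw hva hv (hS φ hφ (hr _ _ hc))).2 hφS
  | and φ ψ =>
    exact (C.satClause_and hw hva hv (hS φ hφ.1 (hl _ _ (hr _ _ hc)))
      (hS ψ hφ.2 (hr _ _ (hr _ _ hc)))).2 hφS
  | all s n φ =>
    exact (C.satClause_all hw hva hv hφ.1 (hS φ hφ.2 (hr _ _ (hr _ _ (hr _ _ hc))))).2 hφS
  | wf s m n φ =>
    have hφc := hS φ hφ.2.2 (hr _ _ (hr _ _ (hr _ _ (hr _ _ hc))))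
    rw [SatContext.satClause_wf_iff]
    have hcX : ∀ a, ZFSet.pair s a ∈ A.dom → a ∈ X := fun a ha =>
      (mem_of_pair_mem hX (hX _ hd ha)).2
    have htr : ∀ a (ha : ZFSet.pair s a ∈ A.dom),
        tr (equivShrink X ⟨_, hc⟩, equivShrink V ⟨w, hw⟩, equivShrink X ⟨a, hcX a ha⟩) =
          ((φ.wf s m n).code, w, a) := fun a ha => by simp [tr]
    have hG : ∀ a ∈ M, ∀ α ∈ M,
        ZFSet.pair (φ.wf s m n).code (ZFSet.pair w (ZFSet.pair a α)) ∈ G →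
          ∃ x : Ω, tr x = ((φ.wf s m n).code, w, a) ∧ coll hwf x = α := by
      intro a _ α _ h
      obtain ⟨x, hx⟩ := (ZFSet.mem_sep.1 h).2
      simp only [ZFSet.pair_inj] at hx
      exact ⟨x, by rw [hx.1, hx.2.1, hx.2.2.1], hx.2.2.2.symm⟩
    constructor
    · intro hT
      constructor
      · intro a ha has
        let x : Ω := (equivShrink X ⟨_, hc⟩, equivShrink V ⟨w, hw⟩, equivShrink X ⟨a, hcX a has⟩)
        have hx : coll hwf x ∈ M := hNM (ZFSet.mem_range_self (f := coll hwf) x)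
        refine ⟨coll hwf x, hx, ZFSet.mem_sep.2 ⟨?_, x, ?_⟩⟩
        · exact hM.pair (hXM hc) (hM.pair (hVM hw) (hM.pair ha hx))
        · rw [htr a has]
      · intro a ha b hb has hbs α hα β hβ hGa hGb hab
        obtain ⟨x, hx, rfl⟩ := hG a ha α hα hGa
        obtain ⟨y, hy, rfl⟩ := hG b hb β hβ hGb
        rw [← Struc.mem_carrier] at has hbs
        apply coll_mem
        rw [InvImage, hx, hy]
        exact ⟨rfl, rfl, (pair_mem_graph₂ hM (hXM hc) (hVM hw)).1 hT, (relP_iff A hφ hva hv).2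
          ⟨has, hbs, (C.defRel_iff hw hva hv hφ.1 hφc has hbs).1 hab⟩⟩
    · intro hF
      rw [hφS] at hF
      have hD : ∀ a ∈ M, (Tri (graph₃ M (BadP A)) (φ.wf s m n).code w a ↔ _) := fun a ha =>
        (tri_graph₃ hM (hXM hc) (hVM hw) ha).trans (badP_iff A hφ hva hv)
      constructor
      · have : ∃ a : {a : ZFSet.{u} // a ∈ A.carrier s}, ¬ Acc (fun a b :
            {a : ZFSet.{u} // a ∈ A.carrier s} => φ.Sat A ((v.set s m a).set s n b)) a := by
          by_contra! h
          exact hF ⟨h⟩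
        obtain ⟨a, ha⟩ := this
        have haM := C.carrier_mem a.2
        exact ⟨a.1, haM, (hD _ haM).2 ⟨a.2, ha⟩⟩
      · intro a ha hDa
        obtain ⟨has, hna⟩ := (hD a ha).1 hDa
        refine ⟨Struc.mem_carrier.1 has, ?_⟩
        have : ∃ b : {a : ZFSet.{u} // a ∈ A.carrier s}, φ.Sat A ((v.set s m b).set s n a) ∧
            ¬ Acc (fun a b : {a : ZFSet.{u} // a ∈ A.carrier s} =>
              φ.Sat A ((v.set s m a).set s n b)) b := by
          by_contra! h
          exact hna ⟨_, h⟩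
        obtain ⟨b, hba, hb⟩ := this
        have hbM := C.carrier_mem b.2
        exact ⟨b.1, hbM, (hD _ hbM).2 ⟨b.2, hb⟩,
          (C.defRel_iff hw hva hv hφ.1 hφc b.2 has).2 hba⟩

/-! ### The satisfaction relation is `Δ₁^id` -/

/-- `x` is the code of a structure with data `sorts`, ..., `fn`, paired with `c`, and `P` holds. -/
def Decomposes (x : ZFSet.{u})
    (P : ZFSet.{u} → ZFSet.{u} → ZFSet.{u} → ZFSet.{u} → ZFSet.{u} → ZFSet.{u} → ZFSet.{u} → Prop) :
    Prop :=
  ∃ a c, x = ZFSet.pair a c ∧ ∃ t d, a = ZFSet.pair t d ∧ ∃ sorts t', t = ZFSet.pair sorts t' ∧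
    ∃ rels funs, t' = ZFSet.pair rels funs ∧ ∃ dom d', d = ZFSet.pair dom d' ∧
      ∃ rel fn, d' = ZFSet.pair rel fn ∧ P sorts rels funs dom rel fn c

/-- The clauses for satisfaction of the formula `c`. -/
def SatPart (y M Fm sorts dom rel fn c : ZFSet.{u})
    (P : ZFSet.{u} → ZFSet.{u} → Prop) : Prop :=
  ∃ X ∈ y, ∃ V ∈ y, ∃ Vl ∈ y, ∃ ZVl ∈ y, ∃ S ∈ y, ∃ G ∈ y, ∃ D ∈ y,
    X.IsTransitive ∧ X ⊆ M ∧ c ∈ X ∧ AsgSys M sorts dom V ∧ ValSys M fn Vl ZVl ∧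
      SatSys M X Fm sorts dom rel V Vl ZVl S G D ∧ P V S

/-- The clauses that say that `c` is a true sentence of the structure. -/
def TrueBody (y M sorts rels funs dom rel fn c : ZFSet.{u}) : Prop :=
  ∃ TT ∈ y, TypedSys M dom TT ∧ StrucClause M sorts rels funs dom rel fn TT ∧
    ∃ HS ∈ y, ∃ ZHS ∈ y, ∃ Fm ∈ y, SortSys M sorts funs HS ZHS ∧ FmlSys M sorts rels HS ZHS Fm ∧
      (∃ e ∈ M, e = ∅ ∧ ZFSet.pair c e ∈ Fm) ∧
      SatPart y M Fm sorts dom rel fn c fun V S => ∃ w ∈ V, ZFSet.pair c w ∈ S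

/-- The clauses that say that `(sorts, ..., fn)` is not a structure or `c` not a sentence or not
true. -/
def FalseBody (y M sorts rels funs dom rel fn c : ZFSet.{u}) : Prop :=
  ∃ TT ∈ y, TypedSys M dom TT ∧ (¬ StrucClause M sorts rels funs dom rel fn TT ∨
    ∃ HS ∈ y, ∃ ZHS ∈ y, ∃ Fm ∈ y, SortSys M sorts funs HS ZHS ∧ FmlSys M sorts rels HS ZHS Fm ∧
      (¬ (∃ e ∈ M, e = ∅ ∧ ZFSet.pair c e ∈ Fm) ∨
      SatPart y M Fm sorts dom rel fn c fun V S => ¬ ∃ w ∈ V, ZFSet.pair c w ∈ S))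

instance {n : ℕ} (i j k l m o p q r : Fin n) : D0 fun v : Fin n → ZFSet.{u} =>
    TrueBody (v i) (v j) (v k) (v l) (v m) (v o) (v p) (v q) (v r) := by
  unfold TrueBody SatPart; infer_instance

instance {n : ℕ} (i j k l m o p q r : Fin n) : D0 fun v : Fin n → ZFSet.{u} =>
    FalseBody (v i) (v j) (v k) (v l) (v m) (v o) (v p) (v q) (v r) := by
  unfold FalseBody SatPart; infer_instance

theorem Decomposes.code {τ : Vocab.{u}} {A : Struc τ} {c : ZFSet.{u}}
    {P : ZFSet.{u} → ZFSet.{u} → ZFSet.{u} → ZFSet.{u} → ZFSet.{u} → ZFSet.{u} → ZFSet.{u} → Prop} :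
    Decomposes (ZFSet.pair A.code c) P ↔
      P τ.sorts τ.rels τ.funs A.dom A.rel A.fn c := by
  constructor
  · rintro ⟨a, c, h, t, d, rfl, sorts, t', rfl, rels, funs, rfl, dom, d', rfl, rel, fn, rfl, hP⟩
    simp only [Struc.code, Vocab.code, ZFSet.pair_inj] at h
    obtain ⟨⟨⟨rfl, rfl, rfl⟩, rfl, rfl, rfl⟩, rfl⟩ := h
    exact hP
  · exact fun h => ⟨_, _, rfl, _, _, rfl, _, _, rfl, _, _, rfl, _, _, rfl, _, _, rfl, h⟩

/-- All parts of a code in an adequate set belong to this set. -/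
theorem Decomposes.exists_parts {x M : ZFSet.{u}} (hM : Adequate M) (hx : x ∈ M)
    {P : ZFSet.{u} → ZFSet.{u} → ZFSet.{u} → ZFSet.{u} → ZFSet.{u} → ZFSet.{u} → ZFSet.{u} → Prop}
    (h : Decomposes x P) : ∃ sorts ∈ M, ∃ rels ∈ M, ∃ funs ∈ M, ∃ dom ∈ M, ∃ rel ∈ M, ∃ fn ∈ M,
      ∃ c ∈ M, x = ZFSet.pair (ZFSet.pair (ZFSet.pair sorts (ZFSet.pair rels funs))
        (ZFSet.pair dom (ZFSet.pair rel fn))) c ∧ P sorts rels funs dom rel fn c := by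
  obtain ⟨a, c, rfl, t, d, rfl, sorts, t', rfl, rels, funs, rfl, dom, d', rfl, rel, fn, rfl, hP⟩ := h
  have h1 := hM.left hx
  have h2 := hM.left h1
  have h3 := hM.right h1
  exact ⟨_, hM.left h2, _, hM.left (hM.right h2), _, hM.right (hM.right h2), _, hM.left h3,
    _, hM.left (hM.right h3), _, hM.right (hM.right h3), _, hM.right hx, rfl, hP⟩

section

variable {y M c : ZFSet.{u}} {τ : Vocab.{u}} {A : Struc τ}

theorem sentence_iff (hM : Adequate M) (hc : c ∈ M) (hs : τ.sorts ∈ M) (hr : τ.rels ∈ M)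
    (hf : τ.funs ∈ M) {HS ZHS Fm : ZFSet.{u}} (h : SortSys M τ.sorts τ.funs HS ZHS)
    (hF : FmlSys M τ.sorts τ.rels HS ZHS Fm) :
    (∃ e ∈ M, e = ∅ ∧ ZFSet.pair c e ∈ Fm) ↔ ∃ φ : Formula.{u}, φ.IsSentence τ ∧ φ.code = c := by
  rw [← fmlP_empty, ← hF.spec hM hs hr hf h hc hM.empty]
  constructor
  · rintro ⟨e, _, rfl, h⟩; exact h
  · exact fun h => ⟨∅, hM.empty, rfl, h⟩

theorem SatPart.exists_iff (hM : Adequate M) (hs : τ.sorts ∈ M)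
    (hd : A.dom ∈ M) (hfn : A.fn ∈ M) {Fm : ZFSet.{u}}
    (hFm : ∀ c ∈ M, ∀ u ∈ M, (ZFSet.pair c u ∈ Fm ↔ FmlP τ c u)) {φ : Formula.{u}}
    (hφ : φ.IsSentence τ) {P : ZFSet.{u} → ZFSet.{u} → Prop}
    (h : SatPart y M Fm τ.sorts A.dom A.rel A.fn φ.code P) :
    ∃ V S, ((∃ w ∈ V, ZFSet.pair φ.code w ∈ S) ↔ φ.TrueIn A) ∧ P V S := by
  obtain ⟨X, _, V, _, Vl, _, ZVl, _, S, _, G, _, D, _, hX, hXM, hcX, hV, hVl, hS, hP⟩ := h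
  have C : SatContext A M X V Vl ZVl := ⟨hM, hX, hXM, hs, hd, hfn, hV, hVl⟩
  have hsound := C.sound hFm hS φ hφ.1 hcX
  refine ⟨V, S, ?_, hP⟩
  constructor
  · rintro ⟨w, hw, h⟩
    obtain ⟨v, hva, hv⟩ := C.exists_represents hw
    exact (hφ.trueIn_iff A v).2 ((hsound w hw v hva hv).1 h)
  · intro h
    obtain ⟨w, hw, -⟩ := hV.2.1
    obtain ⟨v, hva, hv⟩ := C.exists_represents hw
    exact ⟨w, hw, (hsound w hw v hva hv).2 (h v hva)⟩

end

theorem mem_satRel_iff {τ : Vocab.{u}} {A : Struc τ} {c : ZFSet.{u}} :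
    ZFSet.pair A.code c ∈ LWF.satRel ↔
      ∃ φ : Formula.{u}, φ.IsSentence τ ∧ φ.code = c ∧ φ.TrueIn A := by
  constructor
  · rintro ⟨τ', A', c', _, ⟨φ, hφ, hc, hT⟩, h⟩
    obtain ⟨hA, rfl⟩ := ZFSet.pair_inj.1 h
    obtain rfl : τ = τ' := Vocab.code_injective
      (ZFSet.pair_inj.1 (show ZFSet.pair τ.code _ = ZFSet.pair τ'.code _ from hA)).1
    obtain rfl := Struc.code_injective hA
    exact ⟨φ, hφ, hc, hT⟩
  · rintro ⟨φ, hφ, rfl, hT⟩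
    exact ⟨τ, A, _, ⟨φ, hφ, rfl⟩, ⟨φ, hφ, rfl, hT⟩, rfl⟩

theorem TrueBody.mem_satRel {y M sorts rels funs dom rel fn c : ZFSet.{u}} (hM : Adequate M)
    (hs : sorts ∈ M) (hr : rels ∈ M) (hf : funs ∈ M) (hd : dom ∈ M) (hrel : rel ∈ M) (hfn : fn ∈ M)
    (hc : c ∈ M) (h : TrueBody y M sorts rels funs dom rel fn c) :
    ZFSet.pair (ZFSet.pair (ZFSet.pair sorts (ZFSet.pair rels funs))
        (ZFSet.pair dom (ZFSet.pair rel fn))) c ∈ LWF.satRel := by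
  obtain ⟨TT, _, hTT, hstr, HS, _, ZHS, _, Fm, _, hHS, hFm, hsent, hsat⟩ := h
  obtain ⟨τ, A, rfl, rfl, rfl, rfl, rfl, rfl⟩ :=
    (strucClause_iff hM hr hf hd hrel hfn hTT).1 hstr
  obtain ⟨φ, hφ, rfl⟩ := (sentence_iff hM hc hs hr hf hHS hFm).1 hsent
  obtain ⟨V, S, h1, h2⟩ := hsat.exists_iff hM hs hd hfn
    (fun c hc u hu => hFm.spec hM hs hr hf hHS hc hu) hφ
  exact mem_satRel_iff.2 ⟨φ, hφ, rfl, h1.1 h2⟩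

theorem FalseBody.notMem_satRel {y M c : ZFSet.{u}} {τ : Vocab.{u}} {A : Struc τ} (hM : Adequate M)
    (hs : τ.sorts ∈ M) (hr : τ.rels ∈ M) (hf : τ.funs ∈ M) (hd : A.dom ∈ M) (hrel : A.rel ∈ M)
    (hfn : A.fn ∈ M) (hc : c ∈ M)
    (h : FalseBody y M τ.sorts τ.rels τ.funs A.dom A.rel A.fn c) :
    ZFSet.pair A.code c ∉ LWF.satRel := by
  rw [mem_satRel_iff]
  rintro ⟨φ, hφ, rfl, hT⟩
  obtain ⟨TT, _, hTT, hstr | ⟨HS, _, ZHS, _, Fm, _, hHS, hFm, hsent | hsat⟩⟩ := h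
  · exact hstr ((strucClause_iff hM hr hf hd hrel hfn hTT).2 ⟨τ, A, rfl, rfl, rfl, rfl, rfl, rfl⟩)
  · exact hsent ((sentence_iff hM hc hs hr hf hHS hFm).2 ⟨φ, hφ, rfl⟩)
  · obtain ⟨V, S, h1, h2⟩ := hsat.exists_iff hM hs hd hfn
      (fun c hc u hu => hFm.spec hM hs hr hf hHS hc hu) hφ
    exact h2 (h1.2 hT)

/-- The set with the entries of a list as elements. -/
def listSet (l : List ZFSet.{u}) : ZFSet.{u} := l.foldr insert ∅

@[simp] theorem mem_listSet {l : List ZFSet.{u}} {x : ZFSet.{u}} : x ∈ listSet l ↔ x ∈ l := by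
  induction l with
  | nil => simp [listSet]
  | cons a l ih =>
    have : listSet (a :: l) = insert a (listSet l) := rfl
    rw [this, ZFSet.mem_insert_iff, ih, List.mem_cons]

theorem hrank_listSet_le {M : ZFSet.{u}} (hM : M.IsTransitive) {κ : Cardinal.{u}} (hκ : ℵ₀ ≤ κ)
    (hMκ : M.card ≤ κ) {l : List ZFSet.{u}} (h : ∀ x ∈ l, x ⊆ M) : hrank (listSet l) ≤ κ := by
  refine hrank_le (M := M ∪ listSet l) (fun x hx => ZFSet.mem_union.2 (.inr hx)) ?_ hκ
    (card_union_le_of_infinite hκ hMκ ?_)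
  · intro x hx z hz
    rw [ZFSet.mem_union] at hx ⊢
    exact .inl (hx.elim (fun hx => hM _ hx hz) fun hx => h x (mem_listSet.1 hx) hz)
  · clear h
    induction l with
    | nil => simp [listSet]
    | cons a l ih => exact card_insert_le_of_infinite hκ ih

theorem exists_body (x : ZFSet.{u}) : ∃ y M : ZFSet.{u}, hrank y ≤ hrank x ∧ M ∈ y ∧ Adequate M ∧ x ∈ M ∧
    ∀ sorts rels funs dom rel fn c : ZFSet.{u},
      x = ZFSet.pair (ZFSet.pair (ZFSet.pair sorts (ZFSet.pair rels funs))
        (ZFSet.pair dom (ZFSet.pair rel fn))) c →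
      TrueBody y M sorts rels funs dom rel fn c ∨ FalseBody y M sorts rels funs dom rel fn c := by
  have hκ := aleph0_le_hrank x
  have hX : (trcl {x}).IsTransitive := trcl_transitive _
  have hXκ := card_trcl_singleton_le x
  have hxX : x ∈ trcl {x} := subset_trcl _ (ZFSet.mem_singleton.2 rfl)
  have hl : ∀ a b, ZFSet.pair a b ∈ trcl {x} → a ∈ trcl {x} := fun a b h =>
    (mem_of_pair_mem hX h).1
  have hr : ∀ a b, ZFSet.pair a b ∈ trcl {x} → b ∈ trcl {x} := fun a b h =>
    (mem_of_pair_mem hX h).2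
  have hM₀ := adequate_insClosure hX
  have hM₀κ := card_insClosure_le _ hκ hXκ
  have hXM₀ := subset_insClosure (trcl {x})
  by_cases hx : ∃ sorts rels funs dom rel fn c : ZFSet.{u},
      x = ZFSet.pair (ZFSet.pair (ZFSet.pair sorts (ZFSet.pair rels funs))
        (ZFSet.pair dom (ZFSet.pair rel fn))) c
  · obtain ⟨sorts, rels, funs, dom, rel, fn, c, hx⟩ := hx
    have hxX' := (congrArg (· ∈ trcl {x}) hx).mp hxX
    have hcX := hr _ _ hxX'
    have hsX := hl _ _ (hl _ _ (hl _ _ hxX'))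
    have hrX := hl _ _ (hr _ _ (hl _ _ (hl _ _ hxX')))
    have hfX := hr _ _ (hr _ _ (hl _ _ (hl _ _ hxX')))
    have hdX := hl _ _ (hr _ _ (hl _ _ hxX'))
    have hrelX := hl _ _ (hr _ _ (hr _ _ (hl _ _ hxX')))
    have hfnX := hr _ _ (hr _ _ (hr _ _ (hl _ _ hxX')))
    suffices ∃ y M : ZFSet.{u}, hrank y ≤ hrank x ∧ M ∈ y ∧ Adequate M ∧ x ∈ M ∧
        (TrueBody y M sorts rels funs dom rel fn c ∨
          FalseBody y M sorts rels funs dom rel fn c) by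
      obtain ⟨y, M, h1, h2, h3, h4, h⟩ := this
      refine ⟨y, M, h1, h2, h3, h4, ?_⟩
      intro sorts' rels' funs' dom' rel' fn' c' hx'
      rw [hx] at hx'
      simp only [ZFSet.pair_inj] at hx'
      obtain ⟨⟨⟨rfl, rfl, rfl⟩, rfl, rfl, rfl⟩, rfl⟩ := hx'
      exact h
    by_cases hA : ∃ (τ : Vocab.{u}) (A : Struc τ), τ.sorts = sorts ∧ τ.rels = rels ∧
        τ.funs = funs ∧ A.dom = dom ∧ A.rel = rel ∧ A.fn = fn
    · obtain ⟨τ, A, rfl, rfl, rfl, rfl, rfl, rfl⟩ := hA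
      obtain ⟨M, V, Vl, ZVl, S, G, D, hMκ, C, h1, h2, h3, h4, h5, hS⟩ :=
        exists_satContext A hX hsX hdX hfnX hκ hXκ
      obtain ⟨TT, hTTM, hTT⟩ := exists_typedSys C.hM A.dom
      obtain ⟨HS, ZHS, hHSM, hZHSM, hHS⟩ := exists_sortSys C.hM (C.hXM hfX)
      obtain ⟨Fm, hFmM, hFm⟩ := exists_fmlSys C.hM C.sorts (C.hXM hrX) (C.hXM hfX) hHS
      have hFm' := fun c hc u hu => hFm.spec C.hM C.sorts (C.hXM hrX) (C.hXM hfX) hHS (c := c)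
        (u := u) hc hu
      have hTS := (strucClause_iff C.hM (C.hXM hrX) (C.hXM hfX) C.dom (C.hXM hrelX) C.fn hTT).2
        ⟨τ, A, rfl, rfl, rfl, rfl, rfl, rfl⟩
      refine ⟨listSet [M, TT, HS, ZHS, Fm, trcl {x}, V, Vl, ZVl, S, G, D], M, ?_, by simp, C.hM,
        C.hXM hxX, ?_⟩
      · refine hrank_listSet_le C.hM.trans hκ hMκ ?_
        have hX' := C.hXM
        have hV := C.asg.1
        simp [hTTM, hHSM, hZHSM, hFmM, hX', hV, h1, h2, h3, h4, h5]
      · have hpart : ∀ P : ZFSet.{u} → ZFSet.{u} → Prop, P V S →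
            SatPart (listSet [M, TT, HS, ZHS, Fm, trcl {x}, V, Vl, ZVl, S, G, D]) M Fm τ.sorts A.dom
              A.rel A.fn c P := fun P hP =>
          ⟨trcl {x}, by simp, V, by simp, Vl, by simp, ZVl, by simp, S, by simp, G, by simp, D,
            by simp, hX, C.hXM, hcX, C.asg, C.val, hS Fm hFm', hP⟩
        by_cases hsent : ∃ e ∈ M, e = ∅ ∧ ZFSet.pair c e ∈ Fm
        · by_cases hw : ∃ w ∈ V, ZFSet.pair c w ∈ S
          · exact .inl ⟨TT, by simp, hTT, hTS, HS, by simp, ZHS, by simp, Fm, by simp, hHS, hFm,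
              hsent, hpart _ hw⟩
          · exact .inr ⟨TT, by simp, hTT, .inr ⟨HS, by simp, ZHS, by simp, Fm, by simp, hHS, hFm,
              .inr (hpart _ hw)⟩⟩
        · exact .inr ⟨TT, by simp, hTT, .inr ⟨HS, by simp, ZHS, by simp, Fm, by simp, hHS, hFm,
              .inl hsent⟩⟩
    · obtain ⟨TT, hTTM, hTT⟩ := exists_typedSys hM₀ dom
      refine ⟨listSet [insClosure (trcl {x}), TT], _, hrank_listSet_le hM₀.trans hκ hM₀κ ?_,
        by simp, hM₀, hXM₀ hxX, .inr ⟨TT, by simp, hTT, .inl ?_⟩⟩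
      · simp [hTTM]
      · rw [strucClause_iff hM₀ (hXM₀ hrX) (hXM₀ hfX) (hXM₀ hdX) (hXM₀ hrelX) (hXM₀ hfnX) hTT]
        exact hA
  · refine ⟨listSet [insClosure (trcl {x})], _, hrank_listSet_le hM₀.trans hκ hM₀κ (by simp),
      by simp, hM₀, hXM₀ hxX, fun sorts rels funs dom rel fn c h =>
        absurd ⟨sorts, rels, funs, dom, rel, fn, c, h⟩ hx⟩

theorem isSigma1_of_d0 {P : ZFSet.{u} → ZFSet.{u} → Prop} (hP : D0 fun v : Fin 2 → ZFSet.{u} =>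
      P (v 0) (v 1)) {F : Cardinal.{u} → Cardinal.{u}} {X : Set ZFSet.{u}}
    (h1 : ∀ x y, P x y → x ∈ X) (h2 : ∀ x ∈ X, ∃ y, hrank y ≤ F (hrank x) ∧ P x y) :
    IsSigma1 noPredicates F X := by
  obtain ⟨ψ, hψ⟩ := hP
  refine ⟨ψ, fun x => ⟨fun h => ?_, ?_⟩, fun x hx => ?_⟩
  · obtain ⟨y, _, h⟩ := h2 x h
    exact ⟨y, (hψ _).2 h⟩
  · rintro ⟨y, h⟩
    exact h1 x y ((hψ _).1 h)
  · obtain ⟨y, hy, h⟩ := h2 x hx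
    exact ⟨y, hy, (hψ _).2 h⟩

theorem isDelta1_satRel : IsDelta1 noPredicates.{u} id LWF.{u}.satRel := by
  have hpos : ∀ x y : ZFSet.{u}, (∃ M ∈ y, Adequate M ∧ x ∈ M ∧ Decomposes x (TrueBody y M)) →
      x ∈ LWF.satRel := by
    rintro x y ⟨M, _, hM, hx, h⟩
    obtain ⟨sorts, hs, rels, hr, funs, hf, dom, hd, rel, hrel, fn, hfn, c, hc, rfl, h'⟩ :=
      h.exists_parts hM hx
    exact TrueBody.mem_satRel hM hs hr hf hd hrel hfn hc h'
  have hneg : ∀ x y : ZFSet.{u}, (∃ M ∈ y, Adequate M ∧ x ∈ M ∧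
      ¬ Decomposes x fun s r f d r' f' c => ¬ FalseBody y M s r f d r' f' c) →
      x ∉ LWF.satRel := by
    rintro _ y ⟨M, _, hM, hx, h⟩ ⟨τ, A, c, hc, hAc, rfl⟩
    rw [Decomposes.code, not_not] at h
    have h1 := hM.left hx
    have h2 := hM.left h1
    have h3 := hM.right h1
    exact h.notMem_satRel hM (hM.left h2) (hM.left (hM.right h2)) (hM.right (hM.right h2))
      (hM.left h3) (hM.left (hM.right h3)) (hM.right (hM.right h3)) (hM.right hx)
      ⟨τ, A, c, hc, hAc, rfl⟩
  have key : ∀ x : ZFSet.{u}, ∃ y, hrank y ≤ hrank x ∧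
      ((∃ M ∈ y, Adequate M ∧ x ∈ M ∧ Decomposes x (TrueBody y M)) ∨
       ∃ M ∈ y, Adequate M ∧ x ∈ M ∧
        ¬ Decomposes x fun s r f d r' f' c => ¬ FalseBody y M s r f d r' f' c) := by
    intro x
    obtain ⟨y, M, hy, hMy, hM, hxM, h⟩ := exists_body x
    refine ⟨y, hy, ?_⟩
    by_cases hT : Decomposes x (TrueBody y M)
    · exact .inl ⟨M, hMy, hM, hxM, hT⟩
    · refine .inr ⟨M, hMy, hM, hxM, ?_⟩
      rintro ⟨a, c, rfl, t, d, rfl, s, t', rfl, r, f, rfl, dm, d', rfl, r', f', rfl, hP⟩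
      rcases h s r f dm r' f' c rfl with h | h
      · exact hT ⟨_, c, rfl, _, _, rfl, s, _, rfl, r, f, rfl, dm, _, rfl, r', f', rfl, h⟩
      · exact hP h
  constructor
  · refine isSigma1_of_d0 ?_ hpos fun x hx => ?_
    · unfold Decomposes; infer_instance
    · obtain ⟨y, hy, h | h⟩ := key x
      · exact ⟨y, hy, h⟩
      · exact absurd hx (hneg x y h)
  · refine isSigma1_of_d0 ?_ hneg fun x hx => ?_
    · unfold Decomposes; infer_instance
    · obtain ⟨y, hy, h | h⟩ := key x
      · exact absurd (hpos x y h) hx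
      · exact ⟨y, hy, h⟩

/-! ### Replacement -/

/-- The image of `x` under the functional relation `R`. -/
noncomputable def repl (R : ZFSet.{u} → ZFSet.{u} → Prop) (x : ZFSet.{u}) : ZFSet.{u} :=
  ZFSet.sep (fun y => ∃ q ∈ x, R q y)
    (ofSet (Set.range fun q : x => Classical.epsilon (R q)))

theorem mem_repl {R : ZFSet.{u} → ZFSet.{u} → Prop} {x y : ZFSet.{u}}
    (hR : ∀ q y y', R q y → R q y' → y = y') : y ∈ repl R x ↔ ∃ q ∈ x, R q y := by
  unfold repl
  rw [ZFSet.mem_sep, mem_ofSet]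
  refine ⟨fun h => h.2, fun h => ⟨?_, h⟩⟩
  obtain ⟨q, hq, h⟩ := h
  exact ⟨⟨q, hq⟩, hR q _ _ (Classical.epsilon_spec (p := R q) ⟨y, h⟩) h⟩

theorem Vocab.relSym_sorts (τ : Vocab.{u}) {name : ZFSet.{u}} {k : ℕ} {σ : Fin k → ZFSet.{u}}
    (h : relSym name σ ∈ τ.rels) (i : Fin k) : σ i ∈ τ.sorts := by
  obtain ⟨_, _, _, hs, e⟩ := τ.rels_typed _ h
  obtain ⟨rfl, e'⟩ := relSym_inj.1 e
  obtain rfl := tuple_length e'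
  obtain rfl := tuple_injective e'
  exact hs i

theorem Vocab.funSym_sorts (τ : Vocab.{u}) {name : ZFSet.{u}} {k : ℕ} {σ : Fin k → ZFSet.{u}}
    {s : ZFSet.{u}} (h : funSym name σ s ∈ τ.funs) : (∀ i, σ i ∈ τ.sorts) ∧ s ∈ τ.sorts := by
  obtain ⟨_, _, _, _, hs, hs', e⟩ := τ.funs_typed _ h
  obtain ⟨rfl, e', rfl⟩ := funSym_inj.1 e
  obtain rfl := tuple_length e'
  obtain rfl := tuple_injective e'
  exact ⟨hs, hs'⟩

/-! ### Transport of structures -/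

namespace Struc

variable {τ : Vocab.{u}}

/-- The image of the domains under `e`. -/
noncomputable def imageDom (A : Struc τ) (e : ZFSet.{u} → ZFSet.{u} → ZFSet.{u}) : ZFSet.{u} :=
  repl (fun q y => ∃ s a, q = ZFSet.pair s a ∧ y = ZFSet.pair s (e s a)) A.dom

/-- The image of the relations under `e`. -/
noncomputable def imageRel (A : Struc τ) (e : ZFSet.{u} → ZFSet.{u} → ZFSet.{u}) : ZFSet.{u} :=
  repl (fun q y => ∃ (name : ZFSet.{u}) (k : ℕ) (σ a : Fin k → ZFSet.{u}),
    q = ZFSet.pair (relSym name σ) (tuple a) ∧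
      y = ZFSet.pair (relSym name σ) (tuple fun i => e (σ i) (a i))) A.rel

/-- The image of the functions under `e`. -/
noncomputable def imageFn (A : Struc τ) (e : ZFSet.{u} → ZFSet.{u} → ZFSet.{u}) : ZFSet.{u} :=
  repl (fun q y => ∃ (name : ZFSet.{u}) (k : ℕ) (σ a : Fin k → ZFSet.{u}) (s b : ZFSet.{u}),
    q = ZFSet.pair (funSym name σ s) (ZFSet.pair (tuple a) b) ∧
      y = ZFSet.pair (funSym name σ s) (ZFSet.pair (tuple fun i => e (σ i) (a i)) (e s b))) A.fn

variable {A : Struc τ} {e : ZFSet.{u} → ZFSet.{u} → ZFSet.{u}}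

theorem mem_imageDom {y : ZFSet.{u}} :
    y ∈ A.imageDom e ↔ ∃ s a, a ∈ A.carrier s ∧ y = ZFSet.pair s (e s a) := by
  unfold imageDom
  rw [mem_repl]
  · constructor
    · rintro ⟨_, h, s, a, rfl, rfl⟩; exact ⟨s, a, mem_carrier.2 h, rfl⟩
    · rintro ⟨s, a, h, rfl⟩; exact ⟨_, mem_carrier.1 h, s, a, rfl, rfl⟩
  · rintro _ _ _ ⟨s, a, rfl, rfl⟩ ⟨s', a', h, rfl⟩
    obtain ⟨rfl, rfl⟩ := ZFSet.pair_inj.1 h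
    rfl

theorem mem_imageRel {y : ZFSet.{u}} :
    y ∈ A.imageRel e ↔ ∃ (name : ZFSet.{u}) (k : ℕ) (σ a : Fin k → ZFSet.{u}),
      ZFSet.pair (relSym name σ) (tuple a) ∈ A.rel ∧
        y = ZFSet.pair (relSym name σ) (tuple fun i => e (σ i) (a i)) := by
  unfold imageRel
  rw [mem_repl]
  · constructor
    · rintro ⟨_, h, name, k, σ, a, rfl, rfl⟩; exact ⟨name, k, σ, a, h, rfl⟩
    · rintro ⟨name, k, σ, a, h, rfl⟩; exact ⟨_, h, name, k, σ, a, rfl, rfl⟩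
  · rintro _ _ _ ⟨name, k, σ, a, rfl, rfl⟩ ⟨name', k', σ', a', h, rfl⟩
    simp only [ZFSet.pair_inj, relSym_inj] at h
    obtain ⟨⟨rfl, h⟩, h'⟩ := h
    obtain rfl := tuple_length h'
    obtain rfl := tuple_injective h
    obtain rfl := tuple_injective h'
    rfl

theorem mem_imageFn {y : ZFSet.{u}} :
    y ∈ A.imageFn e ↔ ∃ (name : ZFSet.{u}) (k : ℕ) (σ a : Fin k → ZFSet.{u}) (s b : ZFSet.{u}),
      ZFSet.pair (funSym name σ s) (ZFSet.pair (tuple a) b) ∈ A.fn ∧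
        y = ZFSet.pair (funSym name σ s) (ZFSet.pair (tuple fun i => e (σ i) (a i)) (e s b)) := by
  unfold imageFn
  rw [mem_repl]
  · constructor
    · rintro ⟨_, h, name, k, σ, a, s, b, rfl, rfl⟩; exact ⟨name, k, σ, a, s, b, h, rfl⟩
    · rintro ⟨name, k, σ, a, s, b, h, rfl⟩; exact ⟨_, h, name, k, σ, a, s, b, rfl, rfl⟩
  · rintro _ _ _ ⟨name, k, σ, a, s, b, rfl, rfl⟩ ⟨name', k', σ', a', s', b', h, rfl⟩
    simp only [ZFSet.pair_inj, funSym_inj] at h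
    obtain ⟨⟨rfl, h, rfl⟩, h', rfl⟩ := h
    obtain rfl := tuple_length h'
    obtain rfl := tuple_injective h
    obtain rfl := tuple_injective h'
    rfl

theorem rel_mem {name : ZFSet.{u}} {k : ℕ} {σ a : Fin k → ZFSet.{u}}
    (h : ZFSet.pair (relSym name σ) (tuple a) ∈ A.rel) :
    relSym name σ ∈ τ.rels ∧ ∀ i, a i ∈ A.carrier (σ i) := by
  obtain ⟨name', k', σ', a', h1, h2, h3⟩ := A.rel_typed _ h
  simp only [ZFSet.pair_inj, relSym_inj] at h3
  obtain ⟨⟨rfl, h3⟩, h'⟩ := h3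
  obtain rfl := tuple_length h'
  obtain rfl := tuple_injective h3
  obtain rfl := tuple_injective h'
  exact ⟨h1, fun i => mem_carrier.2 (h2 i)⟩

theorem fn_mem {name : ZFSet.{u}} {k : ℕ} {σ a : Fin k → ZFSet.{u}} {s b : ZFSet.{u}}
    (h : ZFSet.pair (funSym name σ s) (ZFSet.pair (tuple a) b) ∈ A.fn) :
    funSym name σ s ∈ τ.funs ∧ (∀ i, a i ∈ A.carrier (σ i)) ∧ b ∈ A.carrier s := by
  obtain ⟨name', k', σ', s', a', b', h1, h2, h3, h4⟩ := A.fn_typed _ h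
  simp only [ZFSet.pair_inj, funSym_inj] at h4
  obtain ⟨⟨rfl, h4, rfl⟩, h', rfl⟩ := h4
  obtain rfl := tuple_length h'
  obtain rfl := tuple_injective h4
  obtain rfl := tuple_injective h'
  exact ⟨h1, fun i => mem_carrier.2 (h2 i), mem_carrier.2 h3⟩

theorem mem_imageRel_iff (he : ∀ s, Set.InjOn (e s) {a | a ∈ A.carrier s}) {name : ZFSet.{u}}
    {k : ℕ} {σ a : Fin k → ZFSet.{u}} (ha : ∀ i, a i ∈ A.carrier (σ i)) :
    ZFSet.pair (relSym name σ) (tuple fun i => e (σ i) (a i)) ∈ A.imageRel e ↔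
      ZFSet.pair (relSym name σ) (tuple a) ∈ A.rel := by
  rw [mem_imageRel]
  constructor
  · rintro ⟨name', k', σ', a', h, h3⟩
    simp only [ZFSet.pair_inj, relSym_inj] at h3
    obtain ⟨⟨rfl, h3⟩, h'⟩ := h3
    obtain rfl := tuple_length h'
    obtain rfl := tuple_injective h3
    have : a = a' := funext fun i => he _ (ha i) ((rel_mem h).2 i) (congrFun (tuple_injective h') i)
    exact this ▸ h
  · exact fun h => ⟨name, k, σ, a, h, rfl⟩

theorem mem_imageFn_iff (he : ∀ s, Set.InjOn (e s) {a | a ∈ A.carrier s}) {name : ZFSet.{u}}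
    {k : ℕ} {σ a : Fin k → ZFSet.{u}} (ha : ∀ i, a i ∈ A.carrier (σ i)) {s c : ZFSet.{u}} :
    ZFSet.pair (funSym name σ s) (ZFSet.pair (tuple fun i => e (σ i) (a i)) c) ∈ A.imageFn e ↔
      ∃ b, ZFSet.pair (funSym name σ s) (ZFSet.pair (tuple a) b) ∈ A.fn ∧ c = e s b := by
  rw [mem_imageFn]
  constructor
  · rintro ⟨name', k', σ', a', s', b, h, h3⟩
    simp only [ZFSet.pair_inj, funSym_inj] at h3
    obtain ⟨⟨rfl, h3, rfl⟩, h', rfl⟩ := h3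
    obtain rfl := tuple_length h'
    obtain rfl := tuple_injective h3
    have : a = a' :=
      funext fun i => he _ (ha i) ((fn_mem h).2.1 i) (congrFun (tuple_injective h') i)
    exact ⟨b, this ▸ h, rfl⟩
  · rintro ⟨b, h, rfl⟩
    exact ⟨name, k, σ, a, s, b, h, rfl⟩

/-- The isomorphic copy of the structure along `e`. -/
noncomputable def image (A : Struc τ) (e : ZFSet.{u} → ZFSet.{u} → ZFSet.{u})
    (he : ∀ s, Set.InjOn (e s) {a | a ∈ A.carrier s}) : Struc τ where
  dom := A.imageDom e
  rel := A.imageRel e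
  fn := A.imageFn e
  dom_typed p hp := by
    obtain ⟨s, a, h, rfl⟩ := mem_imageDom.1 hp
    obtain ⟨s', hs', a', h'⟩ := A.dom_typed _ (mem_carrier.1 h)
    obtain ⟨rfl, rfl⟩ := ZFSet.pair_inj.1 h'
    exact ⟨s, hs', _, rfl⟩
  dom_nonempty s hs := by
    obtain ⟨a, ha⟩ := A.dom_nonempty s hs
    exact ⟨_, mem_imageDom.2 ⟨s, a, mem_carrier.2 ha, rfl⟩⟩
  rel_typed p hp := by
    obtain ⟨name, k, σ, a, h, rfl⟩ := mem_imageRel.1 hp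
    obtain ⟨h1, h2⟩ := rel_mem h
    exact ⟨name, k, σ, _, h1, fun i => mem_imageDom.2 ⟨_, _, h2 i, rfl⟩, rfl⟩
  fn_typed p hp := by
    obtain ⟨name, k, σ, a, s, b, h, rfl⟩ := mem_imageFn.1 hp
    obtain ⟨h1, h2, h3⟩ := fn_mem h
    exact ⟨name, k, σ, s, _, _, h1, fun i => mem_imageDom.2 ⟨_, _, h2 i, rfl⟩,
      mem_imageDom.2 ⟨_, _, h3, rfl⟩, rfl⟩
  fn_total name k σ s hf a ha := by
    have : ∀ i, ∃ x, x ∈ A.carrier (σ i) ∧ a i = e (σ i) x := fun i => by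
      obtain ⟨s', x, hx, h⟩ := mem_imageDom.1 (ha i)
      obtain ⟨h1, h2⟩ := ZFSet.pair_inj.1 h
      rw [← h1] at hx h2
      exact ⟨x, hx, h2⟩
    choose x hx hax using this
    obtain rfl : a = fun i => e (σ i) (x i) := funext hax
    simp only [mem_imageFn_iff he hx]
    obtain ⟨b, hb, hb'⟩ := A.fn_total name k σ s hf x fun i => mem_carrier.1 (hx i)
    exact ⟨e s b, ⟨b, hb, rfl⟩, by rintro _ ⟨b', h, rfl⟩; rw [hb' b' h]⟩

theorem mem_carrier_image {he : ∀ s, Set.InjOn (e s) {a | a ∈ A.carrier s}} {s x : ZFSet.{u}} :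
    x ∈ (A.image e he).carrier s ↔ ∃ a ∈ A.carrier s, x = e s a := by
  rw [mem_carrier]
  refine mem_imageDom.trans ?_
  constructor
  · rintro ⟨s', a, ha, h⟩
    obtain ⟨rfl, rfl⟩ := ZFSet.pair_inj.1 h
    exact ⟨a, ha, rfl⟩
  · rintro ⟨a, ha, rfl⟩; exact ⟨s, a, ha, rfl⟩

theorem isomorphic_image (he : ∀ s, Set.InjOn (e s) {a | a ∈ A.carrier s}) :
    A.Isomorphic (A.image e he) := by
  refine ⟨e, fun s _ => ⟨fun a ha => mem_carrier_image.2 ⟨a, ha, rfl⟩, he s, fun x hx => ?_⟩,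
    fun name k σ a _ ha => (mem_imageRel_iff he ha).symm, fun name k σ a s b _ ha hb => ?_⟩
  · obtain ⟨a, ha, rfl⟩ := mem_carrier_image.1 hx
    exact ⟨a, ha, rfl⟩
  · refine Iff.trans ?_ (mem_imageFn_iff he ha).symm
    refine ⟨fun h => ⟨b, h, rfl⟩, ?_⟩
    rintro ⟨b', h, h'⟩
    rwa [he s hb (fn_mem h).2.2 h']

theorem card_image (he : ∀ s, Set.InjOn (e s) {a | a ∈ A.carrier s}) :
    A.card ≤ (A.image e he).card := by
  have key : ∀ p ∈ A.dom, ∃ s a, p = ZFSet.pair s a ∧ a ∈ A.carrier s := fun p hp => by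
    obtain ⟨s, _, a, rfl⟩ := A.dom_typed p hp
    exact ⟨s, a, rfl, mem_carrier.2 hp⟩
  refine card_le_of_inj (fun p => Classical.epsilon fun y => ∃ s a, p = ZFSet.pair s a ∧
    y = ZFSet.pair s (e s a)) ?_ ?_
  · intro p hp
    obtain ⟨s, a, rfl, ha⟩ := key p hp
    obtain ⟨s', a', h, h'⟩ := Classical.epsilon_spec (p := fun y => ∃ s' a', ZFSet.pair s a =
      ZFSet.pair s' a' ∧ y = ZFSet.pair s' (e s' a')) ⟨_, s, a, rfl, rfl⟩
    rw [h']
    obtain ⟨rfl, rfl⟩ := ZFSet.pair_inj.1 h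
    exact mem_imageDom.2 ⟨s, a, ha, rfl⟩
  · intro p hp q hq h
    obtain ⟨s, a, rfl, ha⟩ := key p hp
    obtain ⟨t, b, rfl, hb⟩ := key q hq
    obtain ⟨s', a', h1, h1'⟩ := Classical.epsilon_spec (p := fun y => ∃ s' a', ZFSet.pair s a =
      ZFSet.pair s' a' ∧ y = ZFSet.pair s' (e s' a')) ⟨_, s, a, rfl, rfl⟩
    obtain ⟨t', b', h2, h2'⟩ := Classical.epsilon_spec (p := fun y => ∃ s' a', ZFSet.pair t b =
      ZFSet.pair s' a' ∧ y = ZFSet.pair s' (e s' a')) ⟨_, t, b, rfl, rfl⟩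
    beta_reduce at h
    rw [h1', h2'] at h
    obtain ⟨rfl, rfl⟩ := ZFSet.pair_inj.1 h1
    obtain ⟨rfl, rfl⟩ := ZFSet.pair_inj.1 h2
    obtain ⟨rfl, h⟩ := ZFSet.pair_inj.1 h
    rw [he s ha hb h]

theorem Isomorphic.symm {A B : Struc τ} (h : A.Isomorphic B) : B.Isomorphic A := by
  obtain ⟨e, h1, h2, h3⟩ := h
  have hinv : ∀ s ∈ τ.sorts, Set.InvOn (Function.invFunOn (e s) {a | a ∈ A.carrier s}) (e s)
    {a | a ∈ A.carrier s} {b | b ∈ B.carrier s} := fun s hs => (h1 s hs).invOn_invFunOn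
  have hmaps : ∀ s ∈ τ.sorts, ∀ b ∈ B.carrier s,
      Function.invFunOn (e s) {a | a ∈ A.carrier s} b ∈ A.carrier s := fun s hs b hb =>
    Function.invFunOn_mem ((h1 s hs).surjOn hb)
  refine ⟨fun s => Function.invFunOn (e s) {a | a ∈ A.carrier s}, fun s hs => ?_, ?_, ?_⟩
  · exact (hinv s hs).symm.bijOn (hmaps s hs) (h1 s hs).mapsTo
  · intro name k σ b hr hb
    have hσ := τ.relSym_sorts hr
    rw [h2 name k σ _ hr fun i => hmaps _ (hσ i) _ (hb i)]
    have : (fun i => e (σ i) (Function.invFunOn (e (σ i)) {a | a ∈ A.carrier (σ i)} (b i))) = b :=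
      funext fun i => (hinv _ (hσ i)).2 (hb i)
    rw [this]
  · intro name k σ b s c hr hb hc
    obtain ⟨hσ, hs'⟩ := τ.funSym_sorts hr
    rw [h3 name k σ _ _ _ hr (fun i => hmaps _ (hσ i) _ (hb i)) (hmaps _ hs' _ hc)]
    have : (fun i => e (σ i) (Function.invFunOn (e (σ i)) {a | a ∈ A.carrier (σ i)} (b i))) = b :=
      funext fun i => (hinv _ (hσ i)).2 (hb i)
    rw [this, (hinv _ hs').2 hc]

end Struc

/-! ### Isomorphic structures satisfy the same first-order sentences -/

section

variable {τ : Vocab.{u}} {A B : Struc τ} {e : ZFSet.{u} → ZFSet.{u} → ZFSet.{u}}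

theorem Term.val_iso (hfn : ∀ (name : ZFSet.{u}) (k : ℕ) (σ a : Fin k → ZFSet.{u}) (s b : ZFSet.{u}),
      funSym name σ s ∈ τ.funs → (∀ i, a i ∈ A.carrier (σ i)) → b ∈ A.carrier s →
      (ZFSet.pair (funSym name σ s) (ZFSet.pair (tuple a) b) ∈ A.fn ↔
        ZFSet.pair (funSym name σ s) (ZFSet.pair (tuple fun i => e (σ i) (a i)) (e s b)) ∈ B.fn))
    {v : Assignment.{u}} (hv : A.WellSorted v) {t : Term.{u}}
    {s : ZFSet.{u}} (ht : t.HasSort τ s) :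
    t.val B (fun s n => e s (v s n)) = e s (t.val A v) := by
  induction ht with
  | var s n hs => rfl
  | app name k σ s ts hf hts ih =>
    have hA := fun i => (hts i).val_mem hv
    have h1 := (Term.HasSort.val_spec hf hA _).2 rfl
    have h2 := (hfn name k σ _ s _ hf hA (A.fn_value_mem h1)).1 h1
    simp only [← ih] at h2
    exact ((Term.HasSort.val_spec hf (fun i => (Struc.fn_mem h2).2.1 i) _).1 h2).symm

theorem Assignment.set_iso (v : Assignment.{u}) (e : ZFSet.{u} → ZFSet.{u} → ZFSet.{u})
    (s : ZFSet.{u}) (n : ℕ) (a : ZFSet.{u}) :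
    (fun s' n' => e s' (v.set s n a s' n')) = Assignment.set (fun s n => e s (v s n)) s n (e s a) := by
  funext s' n'
  unfold Assignment.set
  split_ifs with h
  · rw [h.1]
  · rfl

theorem Formula.sat_iso (he : ∀ s ∈ τ.sorts, Set.BijOn (e s) {a | a ∈ A.carrier s}
      {b | b ∈ B.carrier s})
    (hrel : ∀ (name : ZFSet.{u}) (k : ℕ) (σ a : Fin k → ZFSet.{u}), relSym name σ ∈ τ.rels →
      (∀ i, a i ∈ A.carrier (σ i)) →
      (ZFSet.pair (relSym name σ) (tuple a) ∈ A.rel ↔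
        ZFSet.pair (relSym name σ) (tuple fun i => e (σ i) (a i)) ∈ B.rel))
    (hfn : ∀ (name : ZFSet.{u}) (k : ℕ) (σ a : Fin k → ZFSet.{u}) (s b : ZFSet.{u}),
      funSym name σ s ∈ τ.funs → (∀ i, a i ∈ A.carrier (σ i)) → b ∈ A.carrier s →
      (ZFSet.pair (funSym name σ s) (ZFSet.pair (tuple a) b) ∈ A.fn ↔
        ZFSet.pair (funSym name σ s) (ZFSet.pair (tuple fun i => e (σ i) (a i)) (e s b)) ∈ B.fn))
    {φ : Formula.{u}} (hφ : φ.IsFormula τ) (hfo : φ.IsFO) {v : Assignment.{u}}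
    (hv : A.WellSorted v) : φ.Sat A v ↔ φ.Sat B fun s n => e s (v s n) := by
  induction φ generalizing v with
  | eq t t' =>
    obtain ⟨s, h, h'⟩ := hφ
    simp only [Formula.Sat]
    rw [Term.val_iso hfn hv h, Term.val_iso hfn hv h']
    exact ((he s h.sort_mem).injOn.eq_iff (h.val_mem hv) (h'.val_mem hv)).symm
  | rel r k ts =>
    obtain ⟨name, σ, rfl, hr, hts⟩ := hφ
    simp only [Formula.Sat]
    rw [hrel name k σ _ hr fun i => (hts i).val_mem hv]
    simp only [fun i => Term.val_iso hfn hv (hts i)]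
  | neg φ ih => exact not_congr (ih hφ hfo hv)
  | and φ ψ ih ih' => exact and_congr (ih hφ.1 hfo.1 hv) (ih' hφ.2 hfo.2 hv)
  | all s n φ ih =>
    simp only [Formula.Sat]
    constructor
    · intro h b hb
      obtain ⟨a, ha, rfl⟩ := (he s hφ.1).surjOn hb
      rw [← Assignment.set_iso]
      exact (ih hφ.2 hfo (hv.set ha n)).1 (h a ha)
    · intro h a ha
      rw [ih hφ.2 hfo (hv.set ha n), Assignment.set_iso]
      exact h _ ((he s hφ.1).mapsTo ha)
  | wf => exact hfo.elim

theorem Struc.Isomorphic.trueIn_iff (h : A.Isomorphic B) {φ : Formula.{u}} (hφ : φ.IsSentence τ)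
    (hfo : φ.IsFO) : φ.TrueIn A ↔ φ.TrueIn B := by
  obtain ⟨e, h1, h2, h3⟩ := h
  obtain ⟨v, hv⟩ := A.exists_assignment
  rw [hφ.trueIn_iff A v, hφ.trueIn_iff B fun s n => e s (v s n)]
  exact Formula.sat_iso h1 h2 h3 hφ.1 hfo hv

end

/-! ### Renaming of symbols -/

/-- The set of the pairs `(a, b)` with `a ∈ S` and `(f a, b) ∈ X`. -/
noncomputable def pullSet (f : ZFSet.{u} → ZFSet.{u}) (S X : ZFSet.{u}) : ZFSet.{u} :=
  ZFSet.sep (fun p => ∃ a b, p = ZFSet.pair a b ∧ ZFSet.pair (f a) b ∈ X)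
    (ZFSet.prod S (ZFSet.sUnion (ZFSet.sUnion X)))

theorem mem_pullSet {f : ZFSet.{u} → ZFSet.{u}} {S X p : ZFSet.{u}} :
    p ∈ pullSet f S X ↔ ∃ a b, p = ZFSet.pair a b ∧ a ∈ S ∧ ZFSet.pair (f a) b ∈ X := by
  unfold pullSet
  rw [ZFSet.mem_sep, ZFSet.mem_prod]
  constructor
  · rintro ⟨⟨a, ha, b, _, rfl⟩, a', b', h, h'⟩
    obtain ⟨rfl, rfl⟩ := ZFSet.pair_inj.1 h
    exact ⟨a, b, rfl, ha, h'⟩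
  · rintro ⟨a, b, rfl, ha, h⟩
    refine ⟨⟨a, ha, b, ?_, rfl⟩, a, b, rfl, h⟩
    refine ZFSet.mem_sUnion.2 ⟨{f a, b}, ZFSet.mem_sUnion.2 ⟨_, h, ?_⟩, ?_⟩
    · simp [ZFSet.pair]
    · simp

theorem pair_mem_pullSet {f : ZFSet.{u} → ZFSet.{u}} {S X a b : ZFSet.{u}} :
    ZFSet.pair a b ∈ pullSet f S X ↔ a ∈ S ∧ ZFSet.pair (f a) b ∈ X := by
  rw [mem_pullSet]
  constructor
  · rintro ⟨a', b', h, h'⟩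
    obtain ⟨rfl, rfl⟩ := ZFSet.pair_inj.1 h
    exact h'
  · exact fun h => ⟨a, b, rfl, h⟩

/-- A renaming of the sorts and symbols of `τ` by those of `τ'`. -/
structure Renaming (τ τ' : Vocab.{u}) where
  s : ZFSet.{u} → ZFSet.{u}
  r : ZFSet.{u} → ZFSet.{u}
  f : ZFSet.{u} → ZFSet.{u}
  s_inj : Function.Injective s
  s_mem : ∀ x ∈ τ.sorts, s x ∈ τ'.sorts
  r_spec : ∀ (name : ZFSet.{u}) (k : ℕ) (σ : Fin k → ZFSet.{u}), relSym name σ ∈ τ.rels →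
    ∃ name', r (relSym name σ) = relSym name' (fun i => s (σ i)) ∧
      relSym name' (fun i => s (σ i)) ∈ τ'.rels
  f_spec : ∀ (name : ZFSet.{u}) (k : ℕ) (σ : Fin k → ZFSet.{u}) (x : ZFSet.{u}),
    funSym name σ x ∈ τ.funs → ∃ name', f (funSym name σ x) =
      funSym name' (fun i => s (σ i)) (s x) ∧ funSym name' (fun i => s (σ i)) (s x) ∈ τ'.funs

/-- The inclusion of a vocabulary in a larger one. -/
def Vocab.Sub.renaming {τ τ' : Vocab.{u}} (h : τ.Sub τ') : Renaming τ τ' where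
  s := id
  r := id
  f := id
  s_inj := Function.injective_id
  s_mem := fun _ hx => h.1 hx
  r_spec := fun name _ _ hr => ⟨name, rfl, h.2.1 hr⟩
  f_spec := fun name _ _ _ hf => ⟨name, rfl, h.2.2 hf⟩

namespace Renaming

variable {τ τ' : Vocab.{u}} (μ : Renaming τ τ')

/-- The `τ`-structure that a `τ'`-structure induces by the renaming. -/
noncomputable def pull (B : Struc τ') : Struc τ where
  dom := pullSet μ.s τ.sorts B.dom
  rel := pullSet μ.r τ.rels B.rel
  fn := pullSet μ.f τ.funs B.fn
  dom_typed p hp := by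
    obtain ⟨s, a, rfl, hs, _⟩ := mem_pullSet.1 hp
    exact ⟨s, hs, a, rfl⟩
  dom_nonempty s hs := by
    obtain ⟨a, ha⟩ := B.dom_nonempty _ (μ.s_mem s hs)
    exact ⟨a, pair_mem_pullSet.2 ⟨hs, ha⟩⟩
  rel_typed p hp := by
    obtain ⟨r, t, rfl, hr, h⟩ := mem_pullSet.1 hp
    obtain ⟨name, k, σ, hσ, rfl⟩ := τ.rels_typed r hr
    obtain ⟨name', h1, _⟩ := μ.r_spec name k σ hr
    rw [h1] at h
    obtain ⟨a, rfl, ha⟩ := B.rel_typed' h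
    exact ⟨name, k, σ, a, hr, fun i => pair_mem_pullSet.2 ⟨hσ i, Struc.mem_carrier.1 (ha i)⟩, rfl⟩
  fn_typed p hp := by
    obtain ⟨r, t, rfl, hr, h⟩ := mem_pullSet.1 hp
    obtain ⟨name, k, σ, s, hσ, hs, rfl⟩ := τ.funs_typed r hr
    obtain ⟨name', h1, _⟩ := μ.f_spec name k σ s hr
    rw [h1] at h
    obtain ⟨a, b, rfl, ha, hb⟩ := B.fn_typed' h
    exact ⟨name, k, σ, s, a, b, hr, fun i => pair_mem_pullSet.2 ⟨hσ i, Struc.mem_carrier.1 (ha i)⟩,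
      pair_mem_pullSet.2 ⟨hs, Struc.mem_carrier.1 hb⟩, rfl⟩
  fn_total name k σ s hf a ha := by
    obtain ⟨name', h1, h2⟩ := μ.f_spec name k σ s hf
    simp only [pair_mem_pullSet, h1, hf, true_and]
    exact B.fn_total name' k _ _ h2 a fun i => (pair_mem_pullSet.1 (ha i)).2

variable {B : Struc τ'}

theorem mem_carrier_pull {s a : ZFSet.{u}} (hs : s ∈ τ.sorts) :
    a ∈ (μ.pull B).carrier s ↔ a ∈ B.carrier (μ.s s) := by
  rw [Struc.mem_carrier, Struc.mem_carrier]
  exact pair_mem_pullSet.trans (and_iff_right hs)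

theorem pair_mem_rel_pull {r t : ZFSet.{u}} (hr : r ∈ τ.rels) :
    ZFSet.pair r t ∈ (μ.pull B).rel ↔ ZFSet.pair (μ.r r) t ∈ B.rel :=
  pair_mem_pullSet.trans (and_iff_right hr)

theorem pair_mem_fn_pull {f t : ZFSet.{u}} (hf : f ∈ τ.funs) :
    ZFSet.pair f t ∈ (μ.pull B).fn ↔ ZFSet.pair (μ.f f) t ∈ B.fn :=
  pair_mem_pullSet.trans (and_iff_right hf)

end Renaming

/-- The reduct. -/
noncomputable def Struc.reduct {τ τ' : Vocab.{u}} (B : Struc τ') (h : τ.Sub τ') : Struc τ :=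
  h.renaming.pull B

theorem Struc.isReduct_reduct {τ τ' : Vocab.{u}} (B : Struc τ') (h : τ.Sub τ') :
    (B.reduct h).IsReduct B :=
  ⟨h, fun _ hs _ => pair_mem_pullSet.trans (and_iff_right hs),
    fun _ hr _ => pair_mem_pullSet.trans (and_iff_right hr),
    fun _ hf _ => pair_mem_pullSet.trans (and_iff_right hf)⟩

theorem Struc.IsReduct.carrier {τ τ' : Vocab.{u}} {A : Struc τ} {B : Struc τ'} (h : A.IsReduct B)
    {s : ZFSet.{u}} (hs : s ∈ τ.sorts) : A.carrier s = B.carrier s :=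
  ZFSet.ext fun a => by rw [Struc.mem_carrier, Struc.mem_carrier, h.2.1 s hs]

theorem Struc.IsReduct.eq_reduct {τ τ' : Vocab.{u}} {A : Struc τ} {B : Struc τ'}
    (h : A.IsReduct B) : A = B.reduct h.1 := by
  obtain ⟨h0, h1, h2, h3⟩ := h
  apply Struc.ext
  · apply ZFSet.ext
    intro p
    constructor
    · intro hp
      obtain ⟨s, hs, a, rfl⟩ := A.dom_typed p hp
      exact pair_mem_pullSet.2 ⟨hs, (h1 s hs a).1 hp⟩
    · intro hp
      obtain ⟨s, a, rfl, hs, h⟩ := mem_pullSet.1 hp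
      exact (h1 s hs a).2 h
  · apply ZFSet.ext
    intro p
    constructor
    · intro hp
      obtain ⟨name, k, σ, a, hr, _, rfl⟩ := A.rel_typed p hp
      exact pair_mem_pullSet.2 ⟨hr, (h2 _ hr _).1 hp⟩
    · intro hp
      obtain ⟨s, a, rfl, hs, h⟩ := mem_pullSet.1 hp
      exact (h2 s hs a).2 h
  · apply ZFSet.ext
    intro p
    constructor
    · intro hp
      obtain ⟨name, k, σ, s, a, b, hr, _, _, rfl⟩ := A.fn_typed p hp
      exact pair_mem_pullSet.2 ⟨hr, (h3 _ hr _).1 hp⟩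
    · intro hp
      obtain ⟨s, a, rfl, hs, h⟩ := mem_pullSet.1 hp
      exact (h3 s hs a).2 h

/-- The term with renamed symbols. -/
def Term.map (s f : ZFSet.{u} → ZFSet.{u}) : Term.{u} → Term.{u}
  | .var x n => .var (s x) n
  | .app F k ts => .app (f F) k fun i => (ts i).map s f

/-- The formula with renamed symbols. -/
def Formula.map (s r f : ZFSet.{u} → ZFSet.{u}) : Formula.{u} → Formula.{u}
  | .eq t t' => .eq (t.map s f) (t'.map s f)
  | .rel R k ts => .rel (r R) k fun i => (ts i).map s f
  | .neg φ => .neg (φ.map s r f)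
  | .and φ ψ => .and (φ.map s r f) (ψ.map s r f)
  | .all x n φ => .all (s x) n (φ.map s r f)
  | .wf x m n φ => .wf (s x) m n (φ.map s r f)

theorem Term.map_id (t : Term.{u}) : t.map id id = t := by
  induction t with
  | var s n => rfl
  | app f k ts ih => simp only [Term.map, ih, id]

theorem Formula.map_id (φ : Formula.{u}) : φ.map id id id = φ := by
  induction φ <;> simp_all [Formula.map, Term.map_id]

theorem Term.vars_map {s f : ZFSet.{u} → ZFSet.{u}} {t : Term.{u}} {z : ZFSet.{u} × ℕ}
    (hz : z ∈ (t.map s f).vars) : ∃ y ∈ t.vars, z = (s y.1, y.2) := by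
  induction t with
  | var x n => exact ⟨(x, n), rfl, hz⟩
  | app F k ts ih =>
    obtain ⟨i, hi⟩ := Set.mem_iUnion.1 hz
    obtain ⟨y, hy, h⟩ := ih i hi
    exact ⟨y, Set.mem_iUnion.2 ⟨i, hy⟩, h⟩

theorem Formula.free_map {s r f : ZFSet.{u} → ZFSet.{u}} {φ : Formula.{u}} {z : ZFSet.{u} × ℕ}
    (hz : z ∈ (φ.map s r f).free) : ∃ y ∈ φ.free, z = (s y.1, y.2) := by
  induction φ with
  | eq t t' =>
    rcases hz with hz | hz
    · obtain ⟨y, hy, h⟩ := Term.vars_map hz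
      exact ⟨y, .inl hy, h⟩
    · obtain ⟨y, hy, h⟩ := Term.vars_map hz
      exact ⟨y, .inr hy, h⟩
  | rel R k ts =>
    obtain ⟨i, hi⟩ := Set.mem_iUnion.1 hz
    obtain ⟨y, hy, h⟩ := Term.vars_map hi
    exact ⟨y, Set.mem_iUnion.2 ⟨i, hy⟩, h⟩
  | neg φ ih => exact ih hz
  | and φ ψ ih ih' =>
    rcases hz with hz | hz
    · obtain ⟨y, hy, h⟩ := ih hz
      exact ⟨y, .inl hy, h⟩
    · obtain ⟨y, hy, h⟩ := ih' hz
      exact ⟨y, .inr hy, h⟩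
  | all x n φ ih =>
    obtain ⟨hz, hz'⟩ := hz
    obtain ⟨y, hy, rfl⟩ := ih hz
    exact ⟨y, ⟨hy, by rintro rfl; exact hz' rfl⟩, rfl⟩
  | wf x m n φ ih =>
    obtain ⟨hz, hz'⟩ := hz
    obtain ⟨y, hy, rfl⟩ := ih hz
    refine ⟨y, ⟨hy, ?_⟩, rfl⟩
    rintro (rfl | rfl)
    · exact hz' (.inl rfl)
    · exact hz' (.inr rfl)

namespace Renaming

variable {τ τ' : Vocab.{u}} (μ : Renaming τ τ') {B : Struc τ'}

theorem hasSort {t : Term.{u}} {s : ZFSet.{u}} (h : t.HasSort τ s) :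
    (t.map μ.s μ.f).HasSort τ' (μ.s s) := by
  induction h with
  | var s n hs => exact .var _ _ (μ.s_mem s hs)
  | app name k σ s ts hf hts ih =>
    obtain ⟨name', h1, h2⟩ := μ.f_spec name k σ s hf
    rw [Term.map, h1]
    exact .app name' k _ _ _ h2 ih

theorem isFormula {φ : Formula.{u}} (h : φ.IsFormula τ) :
    (φ.map μ.s μ.r μ.f).IsFormula τ' := by
  induction φ with
  | eq t t' =>
    obtain ⟨s, h, h'⟩ := h
    exact ⟨_, μ.hasSort h, μ.hasSort h'⟩
  | rel R k ts =>
    obtain ⟨name, σ, rfl, hr, hts⟩ := h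
    obtain ⟨name', h1, h2⟩ := μ.r_spec name k σ hr
    rw [Formula.map, h1]
    exact ⟨name', _, rfl, h2, fun i => μ.hasSort (hts i)⟩
  | neg φ ih => exact ih h
  | and φ ψ ih ih' => exact ⟨ih h.1, ih' h.2⟩
  | all s n φ ih => exact ⟨μ.s_mem _ h.1, ih h.2⟩
  | wf s m n φ ih => exact ⟨μ.s_mem _ h.1, h.2.1, ih h.2.2⟩

theorem isSentence {φ : Formula.{u}} (h : φ.IsSentence τ) :
    (φ.map μ.s μ.r μ.f).IsSentence τ' := by
  refine ⟨μ.isFormula h.1, Set.eq_empty_iff_forall_notMem.2 fun z hz => ?_⟩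
  obtain ⟨y, hy, _⟩ := Formula.free_map hz
  simp [h.2] at hy

theorem val_map {v : Assignment.{u}} {t : Term.{u}} {s : ZFSet.{u}} (h : t.HasSort τ s) :
    (t.map μ.s μ.f).val B v = t.val (μ.pull B) fun x n => v (μ.s x) n := by
  induction h with
  | var s n hs => rfl
  | app name k σ s ts hf hts ih =>
    simp only [Term.map, Term.val, ih, μ.pair_mem_fn_pull hf]

theorem set_map (v : Assignment.{u}) (s : ZFSet.{u}) (n : ℕ) (a : ZFSet.{u}) :
    (fun x k => v.set (μ.s s) n a (μ.s x) k) = Assignment.set (fun x k => v (μ.s x) k) s n a := by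
  funext x k
  by_cases h : x = s
  · simp [Assignment.set, h]
  · simp [Assignment.set, h, μ.s_inj.ne h]

theorem sat_map {φ : Formula.{u}} (h : φ.IsFormula τ) (v : Assignment.{u}) :
    (φ.map μ.s μ.r μ.f).Sat B v ↔ φ.Sat (μ.pull B) fun x n => v (μ.s x) n := by
  induction φ generalizing v with
  | eq t t' =>
    obtain ⟨s, h, h'⟩ := h
    simp only [Formula.map, Formula.Sat, μ.val_map h, μ.val_map h']
  | rel R k ts =>
    obtain ⟨name, σ, rfl, hr, hts⟩ := h
    have : (fun i => ((ts i).map μ.s μ.f).val B v) =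
        fun i => (ts i).val (μ.pull B) fun x n => v (μ.s x) n := funext fun i => μ.val_map (hts i)
    simp only [Formula.map, Formula.Sat, this, μ.pair_mem_rel_pull hr]
  | neg φ ih => exact not_congr (ih h v)
  | and φ ψ ih ih' => exact and_congr (ih h.1 v) (ih' h.2 v)
  | all s n φ ih =>
    simp only [Formula.map, Formula.Sat, ih h.2, μ.mem_carrier_pull h.1, set_map]
  | wf s m n φ ih =>
    have hc : (μ.pull B).carrier s = B.carrier (μ.s s) := ZFSet.ext fun a => μ.mem_carrier_pull h.1
    simp only [Formula.map, Formula.Sat, ih h.2.2, set_map]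
    rw [hc]

theorem trueIn_map {φ : Formula.{u}} (h : φ.IsSentence τ) :
    (φ.map μ.s μ.r μ.f).TrueIn B ↔ φ.TrueIn (μ.pull B) := by
  rw [(μ.isSentence h).trueIn_iff B fun _ _ => ∅, h.trueIn_iff _ fun _ _ => ∅]
  exact μ.sat_map h.1 _

end Renaming

theorem Formula.IsSentence.mono {τ τ' : Vocab.{u}} (h : τ.Sub τ') {φ : Formula.{u}}
    (hφ : φ.IsSentence τ) : φ.IsSentence τ' := by
  have := h.renaming.isSentence hφ
  rwa [show φ.map h.renaming.s h.renaming.r h.renaming.f = φ from φ.map_id] at this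

theorem Formula.IsSentence.trueIn_reduct {τ τ' : Vocab.{u}} (h : τ.Sub τ') {φ : Formula.{u}}
    (hφ : φ.IsSentence τ) (B : Struc τ') : φ.TrueIn B ↔ φ.TrueIn (B.reduct h) := by
  have := h.renaming.trueIn_map (B := B) hφ
  rwa [show φ.map h.renaming.s h.renaming.r h.renaming.f = φ from φ.map_id] at this

/-! ### Predicates defined by formulas -/

/-- On the structures of the class `C`, the predicate `P` of elements of the sorts `σ i` is defined
by a formula, which is first-order if `fo` holds. The variable of index `i` has the number
`i.rev`. -/
def Defines {τ : Vocab.{u}} (C : Set (Struc τ)) (fo : Prop) {n : ℕ} (σ : Fin n → ZFSet.{u})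
    (P : Struc τ → (Fin n → ZFSet.{u}) → Prop) : Prop :=
  (∀ i, σ i ∈ τ.sorts) → ∃ φ : Formula.{u}, φ.IsFormula τ ∧ (fo → φ.IsFO) ∧
    φ.free ⊆ Set.range (fun i => (σ i, (i.rev : ℕ))) ∧
    ∀ A ∈ C, ∀ v : Assignment.{u}, A.WellSorted v → (φ.Sat A v ↔ P A fun i => v (σ i) i.rev)

theorem Assignment.set_same (v : Assignment.{u}) (s : ZFSet.{u}) (n : ℕ) (a : ZFSet.{u}) :
    v.set s n a s n = a := by simp [Assignment.set]

theorem Assignment.set_of_ne (v : Assignment.{u}) (s s' : ZFSet.{u}) {n n' : ℕ} (h : n' ≠ n)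
    (a : ZFSet.{u}) : v.set s n a s' n' = v s' n' := by simp [Assignment.set, h]

namespace Defines

variable {τ : Vocab.{u}} {C : Set (Struc τ)} {fo : Prop} {n : ℕ} {σ : Fin n → ZFSet.{u}}
  {P Q : Struc τ → (Fin n → ZFSet.{u}) → Prop}

theorem congr (h : Defines C fo σ P)
    (hPQ : ∀ A ∈ C, ∀ w, (∀ i, w i ∈ A.carrier (σ i)) → (Q A w ↔ P A w)) : Defines C fo σ Q := by
  intro hσ
  obtain ⟨φ, h1, h2, h3, h4⟩ := h hσ
  exact ⟨φ, h1, h2, h3, fun A hA v hv => (h4 A hA v hv).trans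
    (hPQ A hA _ fun i => hv _ (hσ i) _).symm⟩

theorem mono {C' : Set (Struc τ)} (h : Defines C fo σ P) (hC : C' ⊆ C) : Defines C' fo σ P := by
  intro hσ
  obtain ⟨φ, h1, h2, h3, h4⟩ := h hσ
  exact ⟨φ, h1, h2, h3, fun A hA => h4 A (hC hA)⟩

theorem not (h : Defines C fo σ P) : Defines C fo σ fun A w => ¬ P A w := by
  intro hσ
  obtain ⟨φ, h1, h2, h3, h4⟩ := h hσ
  exact ⟨.neg φ, h1, h2, h3, fun A hA v hv => not_congr (h4 A hA v hv)⟩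

theorem and (h : Defines C fo σ P) (h' : Defines C fo σ Q) :
    Defines C fo σ fun A w => P A w ∧ Q A w := by
  intro hσ
  obtain ⟨φ, h1, h2, h3, h4⟩ := h hσ
  obtain ⟨ψ, h1', h2', h3', h4'⟩ := h' hσ
  exact ⟨.and φ ψ, ⟨h1, h1'⟩, fun hf => ⟨h2 hf, h2' hf⟩, Set.union_subset h3 h3',
    fun A hA v hv => and_congr (h4 A hA v hv) (h4' A hA v hv)⟩

theorem or (h : Defines C fo σ P) (h' : Defines C fo σ Q) :
    Defines C fo σ fun A w => P A w ∨ Q A w :=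
  (h.not.and h'.not).not.congr fun _ _ _ _ => by tauto

theorem imp (h : Defines C fo σ P) (h' : Defines C fo σ Q) :
    Defines C fo σ fun A w => P A w → Q A w :=
  (h.not.or h').congr fun _ _ _ _ => by tauto

theorem iff (h : Defines C fo σ P) (h' : Defines C fo σ Q) :
    Defines C fo σ fun A w => P A w ↔ Q A w :=
  ((h.imp h').and (h'.imp h)).congr fun _ _ _ _ => by tauto

theorem eq (i j : Fin n) (h : σ i = σ j) :
    Defines C fo σ fun _ w => w i = w j := by
  intro hσ
  refine ⟨.eq (.var (σ i) i.rev) (.var (σ j) j.rev), ⟨σ i, .var _ _ (hσ i), by rw [h]; exact .var _ _ (hσ j)⟩,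
    fun _ => trivial, ?_, fun A _ v _ => Iff.rfl⟩
  rintro z (rfl | rfl)
  exacts [⟨i, rfl⟩, ⟨j, rfl⟩]

theorem rel {nm : ZFSet.{u}} {k : ℕ} {ρ : Fin k → ZFSet.{u}} (h : relSym nm ρ ∈ τ.rels)
    (g : Fin k → Fin n) (hg : ∀ i, σ (g i) = ρ i) :
    Defines C fo σ fun A w => ZFSet.pair (relSym nm ρ) (tuple fun i => w (g i)) ∈ A.rel := by
  intro hσ
  refine ⟨.rel (relSym nm ρ) k fun i => .var (σ (g i)) (g i).rev, ⟨nm, ρ, rfl, h, fun i => ?_⟩,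
    fun _ => trivial, ?_, fun A _ v _ => Iff.rfl⟩
  · rw [← hg i]; exact .var _ _ (hσ _)
  · intro z hz
    obtain ⟨i, rfl⟩ := Set.mem_iUnion.1 hz
    exact ⟨g i, rfl⟩

theorem rel₂ {nm s s' : ZFSet.{u}} (h : relSym nm ![s, s'] ∈ τ.rels) (i j : Fin n) (hi : σ i = s)
    (hj : σ j = s') :
    Defines C fo σ fun A w => ZFSet.pair (relSym nm ![s, s']) (tuple ![w i, w j]) ∈ A.rel :=
  (rel h ![i, j] fun k => by fin_cases k <;> assumption).congr fun A _ w _ => by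
    have : (fun k => w ((![i, j] : Fin 2 → Fin n) k)) = ![w i, w j] := by
      funext k; fin_cases k <;> rfl
    rw [this]

theorem fn {nm s : ZFSet.{u}} {k : ℕ} {ρ : Fin k → ZFSet.{u}} (h : funSym nm ρ s ∈ τ.funs)
    (g : Fin k → Fin n) (hg : ∀ i, σ (g i) = ρ i) (j : Fin n) (hj : σ j = s) :
    Defines C fo σ fun A w =>
      ZFSet.pair (funSym nm ρ s) (ZFSet.pair (tuple fun i => w (g i)) (w j)) ∈ A.fn := by
  intro hσ
  have hg' : ∀ i, (Term.var (σ (g i)) (g i).rev).HasSort τ (ρ i) := fun i => by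
    rw [← hg i]; exact .var _ _ (hσ _)
  refine ⟨.eq (.var (σ j) j.rev) (.app (funSym nm ρ s) k fun i => .var (σ (g i)) (g i).rev),
    ⟨s, ?_, .app _ _ _ _ _ h hg'⟩, fun _ => trivial, ?_, fun A _ v hv => ?_⟩
  · rw [← hj]; exact .var _ _ (hσ _)
  · rintro z (rfl | hz)
    · exact ⟨j, rfl⟩
    · obtain ⟨i, rfl⟩ := Set.mem_iUnion.1 hz
      exact ⟨g i, rfl⟩
  · exact (Term.HasSort.val_spec h (fun i => (hg' i).val_mem hv) _).symm

theorem all {s : ZFSet.{u}} (hs : s ∈ τ.sorts)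
    {Q : Struc τ → (Fin n → ZFSet.{u}) → ZFSet.{u} → Prop}
    (h : Defines C fo (Matrix.vecCons s σ) fun A w => Q A (fun i => w i.succ) (w 0)) :
    Defines C fo σ fun A w => ∀ a ∈ A.carrier s, Q A w a := by
  intro hσ
  obtain ⟨φ, h1, h2, h3, h4⟩ := h fun i => by
    cases i using Fin.cases with
    | zero => exact hs
    | succ i => exact hσ i
  refine ⟨.all s n φ, ⟨hs, h1⟩, h2, ?_, fun A hA v hv => ?_⟩
  · rintro z ⟨hz, hz'⟩
    obtain ⟨i, rfl⟩ := h3 hz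
    cases i using Fin.cases with
    | zero => exact absurd (by simp) hz'
    | succ i => exact ⟨i, by simp [Fin.rev_succ]⟩
  · refine forall_congr' fun a => imp_congr_right fun ha => ?_
    refine (h4 A hA _ (hv.set ha n)).trans ?_
    beta_reduce
    have e1 : (fun i : Fin n => v.set s n a (Matrix.vecCons s σ i.succ) i.succ.rev) =
        fun i => v (σ i) i.rev := by
      funext i
      rw [Assignment.set_of_ne]
      · simp [Fin.rev_succ]
      · simp [Fin.rev_succ]; omega
    have e2 : v.set s n a (Matrix.vecCons s σ 0) (Fin.rev 0 : Fin (n + 1)) = a := by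
      simp [Assignment.set_same]
    rw [e1, e2]

theorem ex {s : ZFSet.{u}} (hs : s ∈ τ.sorts)
    {Q : Struc τ → (Fin n → ZFSet.{u}) → ZFSet.{u} → Prop}
    (h : Defines C fo (Matrix.vecCons s σ) fun A w => Q A (fun i => w i.succ) (w 0)) :
    Defines C fo σ fun A w => ∃ a ∈ A.carrier s, Q A w a :=
  (all hs (Q := fun A w a => ¬ Q A w a) h.not).not.congr fun _ _ _ _ => by simp

theorem wf {s : ZFSet.{u}} (hs : s ∈ τ.sorts)
    {Q : Struc τ → (Fin n → ZFSet.{u}) → ZFSet.{u} → ZFSet.{u} → Prop}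
    (h : Defines C False (Matrix.vecCons s (Matrix.vecCons s σ)) fun A w =>
      Q A (fun i => w i.succ.succ) (w 1) (w 0)) :
    Defines C False σ fun A w =>
      WellFounded fun a b : {a : ZFSet.{u} // a ∈ A.carrier s} => Q A w a b := by
  intro hσ
  obtain ⟨φ, h1, h2, h3, h4⟩ := h fun i => by
    cases i using Fin.cases with
    | zero => exact hs
    | succ i =>
      cases i using Fin.cases with
      | zero => exact hs
      | succ i => exact hσ i
  refine ⟨.wf s n (n + 1) φ, ⟨hs, by omega, h1⟩, False.elim, ?_, fun A hA v hv => ?_⟩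
  · rintro z ⟨hz, hz'⟩
    obtain ⟨i, rfl⟩ := h3 hz
    cases i using Fin.cases with
    | zero => exact absurd (by simp) hz'
    | succ i =>
      cases i using Fin.cases with
      | zero => exact absurd (by simp) hz'
      | succ i => exact ⟨i, by simp [Fin.rev_succ]⟩
  · have : (fun a b : {a : ZFSet.{u} // a ∈ A.carrier s} =>
        φ.Sat A ((v.set s n a).set s (n + 1) b)) =
        fun a b : {a : ZFSet.{u} // a ∈ A.carrier s} => Q A (fun i => v (σ i) i.rev) a b := by
      funext a b
      refine (propext (h4 A hA _ ((hv.set a.2 n).set b.2 (n + 1)))).trans ?_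
      beta_reduce
      have e1 : (fun i : Fin n => (v.set s n a).set s (n + 1) b
          (Matrix.vecCons s (Matrix.vecCons s σ) i.succ.succ) i.succ.succ.rev) =
          fun i => v (σ i) i.rev := by
        funext i
        rw [Assignment.set_of_ne, Assignment.set_of_ne]
        · simp [Fin.rev_succ]
        · simp [Fin.rev_succ]; omega
        · simp [Fin.rev_succ]; omega
      have e2 : (v.set s n a).set s (n + 1) b (Matrix.vecCons s (Matrix.vecCons s σ) 0)
          (Fin.rev 0 : Fin (n + 2)) = b := by
        simp [Assignment.set_same]
      have e3 : (v.set s n a).set s (n + 1) b (Matrix.vecCons s (Matrix.vecCons s σ) 1)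
          (Fin.rev 1 : Fin (n + 2)) = a := by
        have : ((Fin.rev 1 : Fin (n + 2)) : ℕ) = n := by
          simp [Fin.val_rev]
        rw [this, Assignment.set_of_ne _ _ _ (by omega)]
        exact Assignment.set_same _ _ _ _
      rw [e1, e2, e3]
    simp only [Formula.Sat]
    rw [this]

theorem trueAt {s : ZFSet.{u}} (hs : s ∈ τ.sorts) : Defines C fo σ fun _ _ => True :=
  (all hs (Q := fun _ _ a => a = a) (eq 0 0 rfl)).congr fun _ _ _ _ => by simp

theorem finite_and {ι : Type*} {s : ZFSet.{u}} (hs : s ∈ τ.sorts) {S : Set ι} (hS : S.Finite)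
    {P : ι → Struc τ → (Fin n → ZFSet.{u}) → Prop} (h : ∀ x ∈ S, Defines C fo σ (P x)) :
    Defines C fo σ fun A w => ∀ x ∈ S, P x A w := by
  induction S, hS using Set.Finite.induction_on with
  | empty => exact (trueAt hs).congr fun _ _ _ _ => by simp
  | insert _ _ ih =>
    exact ((h _ (Set.mem_insert _ _)).and (ih fun x hx => h x (Set.mem_insert_of_mem _ hx))).congr
      fun _ _ _ _ => by simp

theorem finite_or {ι : Type*} {s : ZFSet.{u}} (hs : s ∈ τ.sorts) {S : Set ι} (hS : S.Finite)
    {P : ι → Struc τ → (Fin n → ZFSet.{u}) → Prop} (h : ∀ x ∈ S, Defines C fo σ (P x)) :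
    Defines C fo σ fun A w => ∃ x ∈ S, P x A w :=
  (finite_and hs hS (P := fun x A w => ¬ P x A w) fun x hx => (h x hx).not).not.congr
    fun _ _ _ _ => by simp

/-- Universal quantification over a block of variables. -/
theorem allBlock {k : ℕ} {ρ : Fin k → ZFSet.{u}} (hρ : ∀ i, ρ i ∈ τ.sorts)
    {Q : Struc τ → (Fin n → ZFSet.{u}) → (Fin k → ZFSet.{u}) → Prop}
    (h : ∀ (n' : ℕ) (σ' : Fin n' → ZFSet.{u}) (f : Fin n → Fin n') (g : Fin k → Fin n'),
      (∀ i, σ' (f i) = σ i) → (∀ i, σ' (g i) = ρ i) →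
      Defines C fo σ' fun A w => Q A (fun i => w (f i)) fun i => w (g i)) :
    Defines C fo σ fun A w => ∀ a : Fin k → ZFSet.{u}, (∀ i, a i ∈ A.carrier (ρ i)) → Q A w a := by
  induction k generalizing n σ with
  | zero =>
    let g : Fin 0 → Fin n := fun i => i.elim0
    refine (h n σ (fun i => i) g (fun _ => rfl) fun i => i.elim0).congr fun A _ w _ => ?_
    have : ∀ a : Fin 0 → ZFSet.{u}, a = fun i => w (g i) := fun a => funext fun i => i.elim0
    constructor
    · exact fun h' => h' _ fun i => i.elim0
    · intro h' a _
      rw [this a]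
      exact h'
  | succ k ih =>
    have h1 : Defines C fo (Matrix.vecCons (ρ 0) σ) fun A w => ∀ a : Fin k → ZFSet.{u},
        (∀ i, a i ∈ A.carrier (ρ i.succ)) →
          Q A (fun i => w i.succ) (Matrix.vecCons (w 0) a) := by
      refine ih (fun i => hρ i.succ)
        (Q := fun A w a => Q A (fun i => w i.succ) (Matrix.vecCons (w 0) a)) ?_
      intro n' σ' f g hf hg
      refine (h n' σ' (fun i => f i.succ) (Matrix.vecCons (f 0) g) (fun i => hf i.succ)
        fun i => ?_).congr fun A _ w _ => ?_
      · cases i using Fin.cases with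
        | zero => exact hf 0
        | succ i => exact hg i
      · have : (fun i => w (Matrix.vecCons (f 0) g i)) =
            Matrix.vecCons (w (f 0)) fun i => w (g i) := by
          funext i
          cases i using Fin.cases <;> rfl
        rw [this]
    have h2 : Defines C fo σ fun A w => ∀ a₀ ∈ A.carrier (ρ 0), ∀ a : Fin k → ZFSet.{u},
        (∀ i, a i ∈ A.carrier (ρ i.succ)) → Q A w (Matrix.vecCons a₀ a) := all (hρ 0) h1
    refine h2.congr ?_
    · intro A _ w _
      constructor
      · intro h' a₀ ha₀ a ha
        refine h' _ fun i => ?_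
        cases i using Fin.cases with
        | zero => exact ha₀
        | succ i => exact ha i
      · intro h' a ha
        have := h' (a 0) (ha 0) (fun i => a i.succ) fun i => ha i.succ
        have e : Matrix.vecCons (a 0) (fun i => a i.succ) = a := by
          funext i
          cases i using Fin.cases <;> rfl
        rwa [e] at this

theorem exBlock {k : ℕ} {ρ : Fin k → ZFSet.{u}} (hρ : ∀ i, ρ i ∈ τ.sorts)
    {Q : Struc τ → (Fin n → ZFSet.{u}) → (Fin k → ZFSet.{u}) → Prop}
    (h : ∀ (n' : ℕ) (σ' : Fin n' → ZFSet.{u}) (f : Fin n → Fin n') (g : Fin k → Fin n'),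
      (∀ i, σ' (f i) = σ i) → (∀ i, σ' (g i) = ρ i) →
      Defines C fo σ' fun A w => Q A (fun i => w (f i)) fun i => w (g i)) :
    Defines C fo σ fun A w => ∃ a : Fin k → ZFSet.{u}, (∀ i, a i ∈ A.carrier (ρ i)) ∧ Q A w a :=
  (allBlock hρ (Q := fun A w a => ¬ Q A w a)
    fun n' σ' f g hf hg => (h n' σ' f g hf hg).not).not.congr fun _ _ _ _ => by simp

/-- A conjunction of a predicate with a predicate that is defined only where the first holds. -/
theorem and_of_imp {P Q : Struc τ → Prop} (h : Defines C fo σ fun A _ => P A)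
    (h' : Defines {A | A ∈ C ∧ P A} fo σ fun A _ => Q A) :
    Defines C fo σ fun A _ => P A ∧ Q A := by
  intro hσ
  obtain ⟨φ, h1, h2, h3, h4⟩ := h hσ
  obtain ⟨ψ, h1', h2', h3', h4'⟩ := h' hσ
  refine ⟨.and φ ψ, ⟨h1, h1'⟩, fun hf => ⟨h2 hf, h2' hf⟩, Set.union_subset h3 h3',
    fun A hA v hv => ?_⟩
  exact ⟨fun h => ⟨(h4 A hA v hv).1 h.1, (h4' A ⟨hA, (h4 A hA v hv).1 h.1⟩ v hv).1 h.2⟩,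
    fun h => ⟨(h4 A hA v hv).2 h.1, (h4' A ⟨hA, h.1⟩ v hv).2 h.2⟩⟩

theorem exists_sentence {P : Struc τ → Prop}
    (h : Defines Set.univ fo (![] : Fin 0 → ZFSet.{u}) fun A _ => P A) :
    ∃ φ : Formula.{u}, φ.IsSentence τ ∧ (fo → φ.IsFO) ∧ ∀ A, φ.TrueIn A ↔ P A := by
  obtain ⟨φ, h1, h2, h3, h4⟩ := h fun i => i.elim0
  have hφ : φ.IsSentence τ := ⟨h1, Set.eq_empty_of_subset_empty fun z hz => by
    obtain ⟨i, _⟩ := h3 hz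
    exact i.elim0⟩
  refine ⟨φ, hφ, h2, fun A => ?_⟩
  obtain ⟨v, hv⟩ := A.exists_assignment
  rw [hφ.trueIn_iff A v, h4 A trivial v hv]

end Defines

/-! ### Expansions -/

section

variable {τ τ' : Vocab.{u}}

/-- The new relations of an expansion. -/
noncomputable def newRels (τ τ' : Vocab.{u}) (D : ZFSet.{u})
    (R : ZFSet.{u} → ZFSet.{u} → ZFSet.{u} → ZFSet.{u} → ZFSet.{u} → Prop) : ZFSet.{u} :=
  repl (fun q p => ∃ nm s s' a b,
      q = ZFSet.pair (relSym nm ![s, s']) (ZFSet.pair (ZFSet.pair s a) (ZFSet.pair s' b)) ∧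
      relSym nm ![s, s'] ∉ τ.rels ∧ R nm s s' a b ∧
      p = ZFSet.pair (relSym nm ![s, s']) (tuple ![a, b]))
    (ZFSet.prod τ'.rels (ZFSet.prod D D))

theorem mem_newRels {D : ZFSet.{u}}
    {R : ZFSet.{u} → ZFSet.{u} → ZFSet.{u} → ZFSet.{u} → ZFSet.{u} → Prop} {p : ZFSet.{u}} :
    p ∈ newRels τ τ' D R ↔ ∃ nm s s' a b, relSym nm ![s, s'] ∈ τ'.rels ∧
      relSym nm ![s, s'] ∉ τ.rels ∧ ZFSet.pair s a ∈ D ∧ ZFSet.pair s' b ∈ D ∧ R nm s s' a b ∧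
      p = ZFSet.pair (relSym nm ![s, s']) (tuple ![a, b]) := by
  unfold newRels
  rw [mem_repl]
  · constructor
    · rintro ⟨_, hq, nm, s, s', a, b, rfl, h1, h2, rfl⟩
      simp only [ZFSet.pair_mem_prod] at hq
      exact ⟨nm, s, s', a, b, hq.1, h1, hq.2.1, hq.2.2, h2, rfl⟩
    · rintro ⟨nm, s, s', a, b, h1, h2, h3, h4, h5, rfl⟩
      refine ⟨_, ?_, nm, s, s', a, b, rfl, h2, h5, rfl⟩
      simp only [ZFSet.pair_mem_prod]
      exact ⟨h1, h3, h4⟩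
  · rintro _ _ _ ⟨nm, s, s', a, b, rfl, _, _, rfl⟩ ⟨nm', t, t', a', b', h, _, _, rfl⟩
    simp only [ZFSet.pair_inj] at h
    rw [h.1, h.2.1.2, h.2.2.2]

/-- The expansion of a structure by the domains `D` of new sorts and by new binary relations. -/
noncomputable def Struc.expand (A : Struc τ) (h : τ.Sub τ') (hf : τ'.funs = τ.funs) (D : ZFSet.{u})
    (hD : ∀ p ∈ D, ∃ s ∈ τ'.sorts, ∃ a, p = ZFSet.pair s a)
    (hD' : ∀ s ∈ τ'.sorts, s ∉ τ.sorts → ∃ a, ZFSet.pair s a ∈ D)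
    (hDτ : ∀ s ∈ τ.sorts, ∀ a, ZFSet.pair s a ∉ D)
    (R : ZFSet.{u} → ZFSet.{u} → ZFSet.{u} → ZFSet.{u} → ZFSet.{u} → Prop) : Struc τ' where
  dom := A.dom ∪ D
  rel := A.rel ∪ newRels τ τ' (A.dom ∪ D) R
  fn := A.fn
  dom_typed p hp := by
    rcases ZFSet.mem_union.1 hp with hp | hp
    · obtain ⟨s, hs, a, rfl⟩ := A.dom_typed p hp
      exact ⟨s, h.1 hs, a, rfl⟩
    · exact hD p hp
  dom_nonempty s hs := by
    by_cases hs' : s ∈ τ.sorts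
    · obtain ⟨a, ha⟩ := A.dom_nonempty s hs'
      exact ⟨a, ZFSet.mem_union.2 (.inl ha)⟩
    · obtain ⟨a, ha⟩ := hD' s hs hs'
      exact ⟨a, ZFSet.mem_union.2 (.inr ha)⟩
  rel_typed p hp := by
    rcases ZFSet.mem_union.1 hp with hp | hp
    · obtain ⟨name, k, σ, a, h1, h2, rfl⟩ := A.rel_typed p hp
      exact ⟨name, k, σ, a, h.2.1 h1, fun i => ZFSet.mem_union.2 (.inl (h2 i)), rfl⟩
    · obtain ⟨nm, s, s', a, b, h1, _, h2, h3, _, rfl⟩ := mem_newRels.1 hp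
      exact ⟨nm, 2, ![s, s'], ![a, b], h1, fun i => by fin_cases i <;> assumption, rfl⟩
  fn_typed p hp := by
    obtain ⟨name, k, σ, s, a, b, h1, h2, h3, rfl⟩ := A.fn_typed p hp
    exact ⟨name, k, σ, s, a, b, h.2.2 h1, fun i => ZFSet.mem_union.2 (.inl (h2 i)),
      ZFSet.mem_union.2 (.inl h3), rfl⟩
  fn_total name k σ s hfs a ha := by
    rw [hf] at hfs
    refine A.fn_total name k σ s hfs a fun i => ?_
    exact (ZFSet.mem_union.1 (ha i)).resolve_right (hDτ _ ((τ.funSym_sorts hfs).1 i) _)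

variable {A : Struc τ} {h : τ.Sub τ'} {hf : τ'.funs = τ.funs} {D : ZFSet.{u}}
    {hD : ∀ p ∈ D, ∃ s ∈ τ'.sorts, ∃ a, p = ZFSet.pair s a}
    {hD' : ∀ s ∈ τ'.sorts, s ∉ τ.sorts → ∃ a, ZFSet.pair s a ∈ D}
    {hDτ : ∀ s ∈ τ.sorts, ∀ a, ZFSet.pair s a ∉ D}
    {R : ZFSet.{u} → ZFSet.{u} → ZFSet.{u} → ZFSet.{u} → ZFSet.{u} → Prop}

theorem Struc.isReduct_expand : A.IsReduct (A.expand h hf D hD hD' hDτ R) := by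
  refine ⟨h, fun s hs a => ?_, fun r hr a => ?_, fun f hf a => Iff.rfl⟩
  · refine Iff.trans ?_ ZFSet.mem_union.symm
    exact ⟨.inl, fun h => h.resolve_right (hDτ s hs a)⟩
  · refine Iff.trans ?_ ZFSet.mem_union.symm
    refine ⟨.inl, fun h => h.resolve_right fun h => ?_⟩
    obtain ⟨nm, s, s', a, b, _, h1, _, _, _, h2⟩ := mem_newRels.1 h
    rw [(ZFSet.pair_inj.1 h2).1] at hr
    exact h1 hr

theorem Struc.mem_carrier_expand {s a : ZFSet.{u}} :
    a ∈ (A.expand h hf D hD hD' hDτ R).carrier s ↔ a ∈ A.carrier s ∨ ZFSet.pair s a ∈ D := by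
  rw [Struc.mem_carrier, Struc.mem_carrier]
  exact ZFSet.mem_union

theorem Struc.rel_expand {nm s s' a b : ZFSet.{u}} (h1 : relSym nm ![s, s'] ∈ τ'.rels)
    (h2 : relSym nm ![s, s'] ∉ τ.rels) (ha : a ∈ (A.expand h hf D hD hD' hDτ R).carrier s)
    (hb : b ∈ (A.expand h hf D hD hD' hDτ R).carrier s') :
    ZFSet.pair (relSym nm ![s, s']) (tuple ![a, b]) ∈ (A.expand h hf D hD hD' hDτ R).rel ↔
      R nm s s' a b := by
  refine ZFSet.mem_union.trans ⟨?_, fun hR => .inr (mem_newRels.2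
    ⟨nm, s, s', a, b, h1, h2, Struc.mem_carrier.1 ha, Struc.mem_carrier.1 hb, hR, rfl⟩)⟩
  rintro (h' | h')
  · exact absurd (Struc.rel_mem h').1 h2
  · obtain ⟨nm', t, t', a', b', _, _, _, _, h3, h4⟩ := mem_newRels.1 h'
    simp only [ZFSet.pair_inj, relSym_inj, tuple_inj] at h4
    obtain ⟨⟨rfl, h4⟩, h5⟩ := h4
    obtain rfl : s = t := congrFun h4 0
    obtain rfl : s' = t' := congrFun h4 1
    obtain rfl : a = a' := congrFun h5 0
    obtain rfl : b = b' := congrFun h5 1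
    exact h3

end

/-! ### Well-founded extensional structures -/

theorem mem_QEmpty_iff (A : Struc oneBinary.{u}) : A ∈ QEmpty ↔ A.IsWellFoundedExtensional := by
  constructor
  · rintro ⟨M, hM, e, he, hE⟩
    constructor
    · refine Subrelation.wf ?_ (InvImage.wf
        (fun a : {a : ZFSet.{u} // a ∈ A.carrier (num 0)} => e a) ZFSet.mem_wf)
      intro a b hab
      exact (hE _ a.2 _ b.2).1 hab
    · intro a ha b hb hab
      refine he.injOn ha hb (ZFSet.ext fun z => ?_)
      constructor
      · intro hz
        obtain ⟨c, hc, rfl⟩ := he.surjOn (hM.mem_trans hz (he.mapsTo ha))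
        exact (hE c hc b hb).1 ((hab c hc).1 ((hE c hc a ha).2 hz))
      · intro hz
        obtain ⟨c, hc, rfl⟩ := he.surjOn (hM.mem_trans hz (he.mapsTo hb))
        exact (hE c hc a ha).1 ((hab c hc).2 ((hE c hc b hb).2 hz))
  · rintro ⟨hwf, hext⟩
    classical
    have hext' : ∀ a b : {a : ZFSet.{u} // a ∈ A.carrier (num 0)},
        (∀ z : {a : ZFSet.{u} // a ∈ A.carrier (num 0)}, A.E z a ↔ A.E z b) → a = b :=
      fun a b h => Subtype.ext (hext _ a.2 _ b.2 fun z hz => h ⟨z, hz⟩)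
    let e : ZFSet.{u} → ZFSet.{u} := fun a =>
      if h : a ∈ A.carrier (num 0) then coll hwf ⟨a, h⟩ else ∅
    have he : ∀ a (h : a ∈ A.carrier (num 0)), e a = coll hwf ⟨a, h⟩ := fun a h => dif_pos h
    refine ⟨ZFSet.range (coll hwf), range_coll_transitive hwf, e, ⟨?_, ?_, ?_⟩, ?_⟩
    · intro a (ha : a ∈ A.carrier (num 0))
      exact ZFSet.mem_range.2 ⟨⟨a, ha⟩, (he a ha).symm⟩
    · intro a (ha : a ∈ A.carrier (num 0)) b (hb : b ∈ A.carrier (num 0)) hab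
      rw [he a ha, he b hb] at hab
      exact congrArg Subtype.val (coll_injective hwf hext' hab)
    · intro z hz
      obtain ⟨a, rfl⟩ := ZFSet.mem_range.1 hz
      exact ⟨a, a.2, he _ a.2⟩
    · intro a ha b hb
      rw [he a ha, he b hb]
      exact (coll_mem_iff hwf hext' (a := ⟨a, ha⟩) (b := ⟨b, hb⟩)).symm

theorem axiomatisable_QEmpty : Axiomatisable LWF.{u} QEmpty.{u} := by
  have hr : relSym (num 0) ![num 0, num 0] ∈ oneBinary.{u}.rels := ZFSet.mem_singleton.2 rfl
  have hs : num 0 ∈ oneBinary.{u}.sorts := ZFSet.mem_singleton.2 rfl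
  have h : Defines Set.univ False (![] : Fin 0 → ZFSet.{u}) fun A _ => A.IsWellFoundedExtensional :=
    .and (.wf hs (.rel₂ hr 1 0 rfl rfl)) (.all hs (.all hs (.imp
      (.all hs (.iff (.rel₂ hr 0 2 rfl rfl) (.rel₂ hr 0 1 rfl rfl))) (.eq 1 0 rfl))))
  obtain ⟨φ, hφ, _, h⟩ := h.exists_sentence
  exact ⟨φ.code, ⟨φ, hφ, rfl⟩, fun A => by rw [mem_QEmpty_iff, LWF_models hφ, h]⟩

theorem exists_inj_of_card_le {x y : ZFSet.{u}} (h : x.card ≤ y.card) :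
    ∃ f : ZFSet.{u} → ZFSet.{u}, (∀ a ∈ x, f a ∈ y) ∧ ∀ a ∈ x, ∀ b ∈ x, f a = f b → a = b := by
  classical
  obtain ⟨e⟩ := h
  refine ⟨fun a => if ha : a ∈ x then (equivShrink y).symm (e (equivShrink x ⟨a, ha⟩)) else ∅,
    fun a ha => ?_, fun a ha b hb hab => ?_⟩
  · simp only [dif_pos ha]
    exact Subtype.prop _
  · simp only [dif_pos ha, dif_pos hb] at hab
    have := (equivShrink x).injective (e.injective ((equivShrink y).symm.injective
      (Subtype.ext hab)))
    exact congrArg Subtype.val this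

/-! ### The identity is definably bounding -/

/-- Two sorts and a binary relation from the second to the first. -/
def twoSortsGraph : Vocab.{u} where
  sorts := twoSorts.sorts
  rels := {relSym (num 0) ![num 1, num 0]}
  funs := ∅
  rels_typed := fun r h => ⟨num 0, 2, ![num 1, num 0],
    fun i => by fin_cases i <;> simp [twoSorts], ZFSet.mem_singleton.1 h⟩
  funs_typed := fun _ h => absurd h (ZFSet.notMem_empty _)

theorem definablyBounding_id : DefinablyBounding (id : Cardinal.{u} → Cardinal.{u}) := by
  have hr : relSym (num 0) ![num 1, num 0] ∈ twoSortsGraph.{u}.rels := ZFSet.mem_singleton.2 rfl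
  have h0 : num 0 ∈ twoSortsGraph.{u}.sorts := ZFSet.mem_pair.2 (.inl rfl)
  have h1 : num 1 ∈ twoSortsGraph.{u}.sorts := ZFSet.mem_pair.2 (.inr rfl)
  have hsub : twoSorts.{u}.Sub twoSortsGraph :=
    ⟨fun _ h => h, fun _ h => absurd h (ZFSet.notMem_empty _), fun _ h => h⟩
  have h : Defines Set.univ True (![] : Fin 0 → ZFSet.{u}) fun (B : Struc twoSortsGraph.{u}) _ =>
      (∀ a ∈ B.carrier (num 1), ∃ b ∈ B.carrier (num 0),
        ZFSet.pair (relSym (num 0) ![num 1, num 0]) (tuple ![a, b]) ∈ B.rel) ∧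
      ∀ a ∈ B.carrier (num 1), ∀ a' ∈ B.carrier (num 1), ∀ b ∈ B.carrier (num 0),
        ZFSet.pair (relSym (num 0) ![num 1, num 0]) (tuple ![a, b]) ∈ B.rel →
        ZFSet.pair (relSym (num 0) ![num 1, num 0]) (tuple ![a', b]) ∈ B.rel → a = a' :=
    .and (.all h1 (.ex h0 (.rel₂ hr 1 0 rfl rfl))) (.all h1 (.all h1 (.all h0
      (.imp (.rel₂ hr 2 0 rfl rfl) (.imp (.rel₂ hr 1 0 rfl rfl) (.eq 2 1 rfl))))))
  obtain ⟨φ, hφ, hfo, h⟩ := h.exists_sentence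
  refine ⟨monotone_id, twoSortsGraph, φ.code, hsub, ⟨φ, hfo trivial, hφ, rfl⟩, fun A => ?_,
    fun A => ⟨A.card, fun B _ hAB => ?_⟩⟩
  · constructor
    · intro hA
      have hA : (A.carrier (num 1)).card ≤ (A.carrier (num 0)).card := hA
      obtain ⟨f, hf, hfi⟩ := exists_inj_of_card_le hA
      let B : Struc twoSortsGraph.{u} := A.expand hsub rfl ∅ (fun p hp => absurd hp (by simp))
        (fun s hs hs' => absurd hs hs') (fun _ _ _ => by simp) fun _ _ _ a b => f a = b
      have hc : ∀ s, B.carrier s = A.carrier s := fun s => ZFSet.ext fun a => by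
        refine Struc.mem_carrier_expand.trans ?_
        simp
      have hB : ∀ a ∈ A.carrier (num 1), ∀ b ∈ A.carrier (num 0),
          (ZFSet.pair (relSym (num 0) ![num 1, num 0]) (tuple ![a, b]) ∈ B.rel ↔ f a = b) :=
        fun a ha b hb => Struc.rel_expand hr (ZFSet.notMem_empty _)
          (by rw [hc]; exact ha) (by rw [hc]; exact hb)
      refine ⟨B, (LFO_models hφ (hfo trivial)).2 ((h B).2 ?_), Struc.isReduct_expand⟩
      simp only [hc]
      constructor
      · exact fun a ha => ⟨f a, hf a ha, (hB a ha _ (hf a ha)).2 rfl⟩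
      · intro a ha a' ha' b hb h1 h2
        rw [hB a ha b hb] at h1
        rw [hB a' ha' b hb] at h2
        exact hfi a ha a' ha' (h1.trans h2.symm)
    · rintro ⟨B, hB, hAB⟩
      obtain ⟨h3, h4⟩ := (h B).1 ((LFO_models hφ (hfo trivial)).1 hB)
      show (A.carrier (num 1)).card ≤ (A.carrier (num 0)).card
      rw [hAB.carrier h0, hAB.carrier h1]
      choose! f hf hf' using h3
      exact card_le_of_inj f hf fun a ha a' ha' e =>
        h4 a ha a' ha' _ (hf a ha) (hf' a ha) (e ▸ hf' a' ha')
  · refine ZFSet.card_mono fun p hp => ?_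
    obtain ⟨s, hs, a, rfl⟩ := B.dom_typed p hp
    exact (hAB.2.1 s hs a).2 hp

/-- The set of the pairs `(f a, b)` with `(a, b) ∈ X`. -/
noncomputable def pushSet (f : ZFSet.{u} → ZFSet.{u}) (X : ZFSet.{u}) : ZFSet.{u} :=
  repl (fun q y => ∃ a b, q = ZFSet.pair a b ∧ y = ZFSet.pair (f a) b) X

theorem mem_pushSet {f : ZFSet.{u} → ZFSet.{u}} {X y : ZFSet.{u}} :
    y ∈ pushSet f X ↔ ∃ a b, ZFSet.pair a b ∈ X ∧ y = ZFSet.pair (f a) b := by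
  unfold pushSet
  rw [mem_repl]
  · constructor
    · rintro ⟨_, h, a, b, rfl, rfl⟩; exact ⟨a, b, h, rfl⟩
    · rintro ⟨a, b, h, rfl⟩; exact ⟨_, h, a, b, rfl, rfl⟩
  · rintro _ _ _ ⟨a, b, rfl, rfl⟩ ⟨a', b', h, rfl⟩
    obtain ⟨rfl, rfl⟩ := ZFSet.pair_inj.1 h
    rfl

theorem pair_mem_pushSet {f : ZFSet.{u} → ZFSet.{u}} {X a b : ZFSet.{u}} :
    ZFSet.pair a b ∈ pushSet f X ↔ ∃ x, f x = a ∧ ZFSet.pair x b ∈ X := by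
  rw [mem_pushSet]
  constructor
  · rintro ⟨a', b', h, h'⟩
    obtain ⟨rfl, rfl⟩ := ZFSet.pair_inj.1 h'
    exact ⟨a', rfl, h⟩
  · rintro ⟨x, rfl, h⟩; exact ⟨x, b, h, rfl⟩

theorem card_pushSet_le {f : ZFSet.{u} → ZFSet.{u}} {X : ZFSet.{u}} :
    (pushSet f X).card ≤ X.card := by
  refine card_le_of_surj (fun q => Classical.epsilon fun y => ∃ a b, q = ZFSet.pair a b ∧
    y = ZFSet.pair (f a) b) fun y hy => ?_
  obtain ⟨a, b, h, rfl⟩ := mem_pushSet.1 hy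
  refine ⟨_, h, ?_⟩
  obtain ⟨a', b', h1, h2⟩ := Classical.epsilon_spec (p := fun y => ∃ a' b',
    ZFSet.pair a b = ZFSet.pair a' b' ∧ y = ZFSet.pair (f a') b') ⟨_, a, b, rfl, rfl⟩
  obtain ⟨rfl, rfl⟩ := ZFSet.pair_inj.1 h1
  exact h2

/-- The image of a set under a function. -/
noncomputable def img (f : ZFSet.{u} → ZFSet.{u}) (x : ZFSet.{u}) : ZFSet.{u} :=
  ZFSet.range fun a : x => f a

theorem mem_img {f : ZFSet.{u} → ZFSet.{u}} {x y : ZFSet.{u}} :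
    y ∈ img f x ↔ ∃ a ∈ x, f a = y := by
  simp [img]

/-! ### Renaming a vocabulary apart from another -/

section

open Classical in
/-- New names for sorts. -/
noncomputable def newSort (τ : Vocab.{u}) (n₀ n₁ x : ZFSet.{u}) : ZFSet.{u} :=
  if x = num 0 then n₀ else if x = num 1 then n₁ else ZFSet.pair τ.sorts x

/-- New names for relation symbols. -/
noncomputable def newRel (τ : Vocab.{u}) (s : ZFSet.{u} → ZFSet.{u}) (r : ZFSet.{u}) : ZFSet.{u} :=
  Classical.epsilon fun y => ∃ (name : ZFSet.{u}) (k : ℕ) (σ : Fin k → ZFSet.{u}),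
    r = relSym name σ ∧ y = relSym (ZFSet.pair τ.rels name) fun i => s (σ i)

/-- New names for function symbols. -/
noncomputable def newFun (τ : Vocab.{u}) (s : ZFSet.{u} → ZFSet.{u}) (f : ZFSet.{u}) : ZFSet.{u} :=
  Classical.epsilon fun y => ∃ (name : ZFSet.{u}) (k : ℕ) (σ : Fin k → ZFSet.{u}) (x : ZFSet.{u}),
    f = funSym name σ x ∧ y = funSym (ZFSet.pair τ.funs name) (fun i => s (σ i)) (s x)

variable {τ : Vocab.{u}} {n₀ n₁ : ZFSet.{u}} {s : ZFSet.{u} → ZFSet.{u}}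

theorem newSort_zero : newSort τ n₀ n₁ (num 0) = n₀ := if_pos rfl

theorem newSort_one : newSort τ n₀ n₁ (num 1) = n₁ := by
  unfold newSort
  rw [if_neg (by simp), if_pos rfl]

theorem newSort_mem {x : ZFSet.{u}} (h : newSort τ n₀ n₁ x ∈ τ.sorts) : x = num 0 ∨ x = num 1 := by
  unfold newSort at h
  split_ifs at h with h1 h2
  · exact .inl h1
  · exact .inr h2
  · exact absurd h (notMem_pair_self _ _)

theorem newSort_injective (h₀ : n₀ ∈ τ.sorts) (h₁ : n₁ ∈ τ.sorts) (h : n₀ ≠ n₁) :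
    Function.Injective (newSort τ n₀ n₁) := by
  have h2 : ∀ x, ZFSet.pair τ.sorts x ≠ n₀ := fun x e => notMem_pair_self τ.sorts x (e ▸ h₀)
  have h3 : ∀ x, ZFSet.pair τ.sorts x ≠ n₁ := fun x e => notMem_pair_self τ.sorts x (e ▸ h₁)
  intro x y hxy
  unfold newSort at hxy
  split_ifs at hxy with e1 e2 e3 e4 e5 e6 e7 e8
  · rw [e1, e2]
  · exact absurd hxy h
  · exact absurd hxy.symm (h2 _)
  · exact absurd hxy.symm h
  · rw [e4, e6]
  · exact absurd hxy.symm (h3 _)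
  · exact absurd hxy (h2 _)
  · exact absurd hxy (h3 _)
  · exact (ZFSet.pair_inj.1 hxy).2

theorem newRel_relSym {name : ZFSet.{u}} {k : ℕ} {σ : Fin k → ZFSet.{u}} :
    newRel τ s (relSym name σ) = relSym (ZFSet.pair τ.rels name) fun i => s (σ i) := by
  obtain ⟨name', k', σ', h1, h2⟩ := Classical.epsilon_spec (p := fun y => ∃ (name' : ZFSet.{u})
    (k' : ℕ) (σ' : Fin k' → ZFSet.{u}), relSym name σ = relSym name' σ' ∧
      y = relSym (ZFSet.pair τ.rels name') fun i => s (σ' i)) ⟨_, name, k, σ, rfl, rfl⟩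
  unfold newRel
  rw [h2]
  obtain ⟨rfl, e⟩ := relSym_inj.1 h1
  obtain rfl := tuple_length e
  obtain rfl := tuple_injective e
  rfl

theorem newFun_funSym {name : ZFSet.{u}} {k : ℕ} {σ : Fin k → ZFSet.{u}} {x : ZFSet.{u}} :
    newFun τ s (funSym name σ x) = funSym (ZFSet.pair τ.funs name) (fun i => s (σ i)) (s x) := by
  obtain ⟨name', k', σ', x', h1, h2⟩ := Classical.epsilon_spec (p := fun y => ∃ (name' : ZFSet.{u})
    (k' : ℕ) (σ' : Fin k' → ZFSet.{u}) (x' : ZFSet.{u}), funSym name σ x = funSym name' σ' x' ∧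
      y = funSym (ZFSet.pair τ.funs name') (fun i => s (σ' i)) (s x')) ⟨_, name, k, σ, x, rfl, rfl⟩
  unfold newFun
  rw [h2]
  obtain ⟨rfl, e, rfl⟩ := funSym_inj.1 h1
  obtain rfl := tuple_length e
  obtain rfl := tuple_injective e
  rfl

variable {τ₀ : Vocab.{u}}

theorem newRel_injOn (hs : Function.Injective s) : Set.InjOn (newRel τ s) {r | r ∈ τ₀.rels} := by
  intro r hr r' hr' h
  obtain ⟨name, k, σ, _, rfl⟩ := τ₀.rels_typed r hr
  obtain ⟨name', k', σ', _, rfl⟩ := τ₀.rels_typed r' hr'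
  simp only [newRel_relSym, relSym_inj, ZFSet.pair_inj, true_and] at h
  obtain ⟨rfl, h⟩ := h
  obtain rfl := tuple_length h
  have : σ = σ' := funext fun i => hs (congrFun (tuple_injective h) i)
  rw [this]

theorem newFun_injOn (hs : Function.Injective s) : Set.InjOn (newFun τ s) {r | r ∈ τ₀.funs} := by
  intro r hr r' hr' h
  obtain ⟨name, k, σ, x, _, _, rfl⟩ := τ₀.funs_typed r hr
  obtain ⟨name', k', σ', x', _, _, rfl⟩ := τ₀.funs_typed r' hr'
  simp only [newFun_funSym, funSym_inj, ZFSet.pair_inj, true_and] at h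
  obtain ⟨rfl, h, hx⟩ := h
  obtain rfl := tuple_length h
  have : σ = σ' := funext fun i => hs (congrFun (tuple_injective h) i)
  rw [this, hs hx]

theorem newRel_notMem {r : ZFSet.{u}} (hr : r ∈ τ₀.rels) : newRel τ s r ∉ τ.rels := by
  obtain ⟨name, k, σ, _, rfl⟩ := τ₀.rels_typed r hr
  rw [newRel_relSym]
  intro h
  have h1 := ZFSet.rank_lt_of_mem h
  have h2 : τ.rels.rank < (ZFSet.pair τ.rels name).rank := rank_lt_pair_left _ _
  have h3 := rank_lt_pair_left (ZFSet.pair τ.rels name) (tuple fun i => s (σ i))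
  exact absurd (h2.trans (h3.trans h1)) (lt_irrefl _)

theorem newFun_notMem {r : ZFSet.{u}} (hr : r ∈ τ₀.funs) : newFun τ s r ∉ τ.funs := by
  obtain ⟨name, k, σ, x, _, _, rfl⟩ := τ₀.funs_typed r hr
  rw [newFun_funSym]
  intro h
  have h1 := ZFSet.rank_lt_of_mem h
  have h2 : τ.funs.rank < (ZFSet.pair τ.funs name).rank := rank_lt_pair_left _ _
  have h3 := rank_lt_pair_left (ZFSet.pair τ.funs name)
    (ZFSet.pair (tuple fun i => s (σ i)) (s x))
  exact absurd (h2.trans (h3.trans h1)) (lt_irrefl _)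

/-- The union of `τ` and of a copy of `τ₀` in which the sorts `0`, `1` become `n₀`, `n₁`. -/
noncomputable def amalgam (τ τ₀ : Vocab.{u}) (s : ZFSet.{u} → ZFSet.{u}) : Vocab.{u} where
  sorts := τ.sorts ∪ img s τ₀.sorts
  rels := τ.rels ∪ img (newRel τ s) τ₀.rels
  funs := τ.funs ∪ img (newFun τ s) τ₀.funs
  rels_typed r hr := by
    rcases ZFSet.mem_union.1 hr with hr | hr
    · obtain ⟨name, k, σ, h, rfl⟩ := τ.rels_typed r hr
      exact ⟨name, k, σ, fun i => ZFSet.mem_union.2 (.inl (h i)), rfl⟩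
    · obtain ⟨r, hr', rfl⟩ := mem_img.1 hr
      obtain ⟨name, k, σ, h, rfl⟩ := τ₀.rels_typed r hr'
      exact ⟨_, k, _, fun i => ZFSet.mem_union.2 (.inr (mem_img.2 ⟨_, h i, rfl⟩)), newRel_relSym⟩
  funs_typed r hr := by
    rcases ZFSet.mem_union.1 hr with hr | hr
    · obtain ⟨name, k, σ, x, h, hx, rfl⟩ := τ.funs_typed r hr
      exact ⟨name, k, σ, x, fun i => ZFSet.mem_union.2 (.inl (h i)), ZFSet.mem_union.2 (.inl hx), rfl⟩
    · obtain ⟨r, hr', rfl⟩ := mem_img.1 hr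
      obtain ⟨name, k, σ, x, h, hx, rfl⟩ := τ₀.funs_typed r hr'
      exact ⟨_, k, _, _, fun i => ZFSet.mem_union.2 (.inr (mem_img.2 ⟨_, h i, rfl⟩)),
        ZFSet.mem_union.2 (.inr (mem_img.2 ⟨_, hx, rfl⟩)), newFun_funSym⟩

theorem sub_amalgam : τ.Sub (amalgam τ τ₀ s) :=
  ⟨fun _ h => ZFSet.mem_union.2 (.inl h), fun _ h => ZFSet.mem_union.2 (.inl h),
    fun _ h => ZFSet.mem_union.2 (.inl h)⟩

/-- The renaming of `τ₀` in the amalgam. -/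
noncomputable def amalgamRenaming (τ τ₀ : Vocab.{u}) {s : ZFSet.{u} → ZFSet.{u}}
    (hs : Function.Injective s) : Renaming τ₀ (amalgam τ τ₀ s) where
  s := s
  r := newRel τ s
  f := newFun τ s
  s_inj := hs
  s_mem := fun x hx => ZFSet.mem_union.2 (.inr (mem_img.2 ⟨x, hx, rfl⟩))
  r_spec := fun _ _ _ hr => ⟨_, newRel_relSym, newRel_relSym (τ := τ) (s := s) ▸
    ZFSet.mem_union.2 (.inr (mem_img.2 ⟨_, hr, rfl⟩))⟩
  f_spec := fun _ _ _ _ hr => ⟨_, newFun_funSym, newFun_funSym (τ := τ) (s := s) ▸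
    ZFSet.mem_union.2 (.inr (mem_img.2 ⟨_, hr, rfl⟩))⟩

/-- The pairs with first entry in `S` in the union of `X` and of a push-forward. -/
theorem pair_mem_union_pushSet_left {f : ZFSet.{u} → ZFSet.{u}} {X Y a b : ZFSet.{u}}
    (h : ∀ x, f x = a → ZFSet.pair x b ∈ Y → ZFSet.pair a b ∈ X) :
    ZFSet.pair a b ∈ X ∪ pushSet f Y ↔ ZFSet.pair a b ∈ X := by
  rw [ZFSet.mem_union, pair_mem_pushSet]
  exact ⟨fun h' => h'.elim id fun ⟨x, hx, hx'⟩ => h x hx hx', .inl⟩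

theorem pair_mem_union_pushSet_right {f : ZFSet.{u} → ZFSet.{u}} {X Y a b : ZFSet.{u}}
    (h : ZFSet.pair (f a) b ∈ X → ZFSet.pair a b ∈ Y)
    (hf : ∀ x, ZFSet.pair x b ∈ Y → f x = f a → x = a) :
    ZFSet.pair (f a) b ∈ X ∪ pushSet f Y ↔ ZFSet.pair a b ∈ Y := by
  rw [ZFSet.mem_union, pair_mem_pushSet]
  constructor
  · rintro (h' | ⟨x, hx, hx'⟩)
    · exact h h'
    · exact hf x hx' hx ▸ hx'
  · exact fun h' => .inr ⟨a, rfl, h'⟩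

theorem Struc.sort_mem {τ : Vocab.{u}} {A : Struc τ} {s a : ZFSet.{u}}
    (h : ZFSet.pair s a ∈ A.dom) : s ∈ τ.sorts := by
  obtain ⟨s', hs, a', h⟩ := A.dom_typed _ h
  rwa [(ZFSet.pair_inj.1 h).1]

theorem Struc.rel_sym_mem {τ : Vocab.{u}} {A : Struc τ} {s a : ZFSet.{u}}
    (h : ZFSet.pair s a ∈ A.rel) : s ∈ τ.rels := by
  obtain ⟨_, _, _, _, hr, _, h⟩ := A.rel_typed _ h
  rwa [(ZFSet.pair_inj.1 h).1]

theorem Struc.fn_sym_mem {τ : Vocab.{u}} {A : Struc τ} {s a : ZFSet.{u}}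
    (h : ZFSet.pair s a ∈ A.fn) : s ∈ τ.funs := by
  obtain ⟨_, _, _, _, _, _, hr, _, _, h⟩ := A.fn_typed _ h
  rwa [(ZFSet.pair_inj.1 h).1]

/-- Amalgamation of structures that agree on the common sorts. -/
theorem exists_amalgam_struc (hs : Function.Injective s) (A : Struc τ) (B : Struc τ₀)
    (hAB : ∀ x ∈ τ₀.sorts, s x ∈ τ.sorts → ∀ a, ZFSet.pair (s x) a ∈ A.dom ↔ ZFSet.pair x a ∈ B.dom) :
    ∃ C : Struc (amalgam τ τ₀ s), A.IsReduct C ∧ (amalgamRenaming τ τ₀ hs).pull C = B := by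
  have d1 : ∀ x ∈ τ.sorts, ∀ a, ZFSet.pair x a ∈ A.dom ∪ pushSet s B.dom ↔ ZFSet.pair x a ∈ A.dom :=
    fun x hx a => pair_mem_union_pushSet_left fun y hy h => by
      subst hy
      exact (hAB y (Struc.sort_mem h) hx a).2 h
  have d2 : ∀ x ∈ τ₀.sorts, ∀ a,
      ZFSet.pair (s x) a ∈ A.dom ∪ pushSet s B.dom ↔ ZFSet.pair x a ∈ B.dom := fun x hx a =>
    pair_mem_union_pushSet_right (fun h => (hAB x hx (Struc.sort_mem h) a).1 h) fun y _ h => hs h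
  have r1 : ∀ x ∈ τ.rels, ∀ a,
      ZFSet.pair x a ∈ A.rel ∪ pushSet (newRel τ s) B.rel ↔ ZFSet.pair x a ∈ A.rel := fun x hx a =>
    pair_mem_union_pushSet_left fun y hy h => by
      subst hy
      exact absurd hx (newRel_notMem (Struc.rel_sym_mem h))
  have r2 : ∀ x ∈ τ₀.rels, ∀ a,
      ZFSet.pair (newRel τ s x) a ∈ A.rel ∪ pushSet (newRel τ s) B.rel ↔ ZFSet.pair x a ∈ B.rel :=
    fun x hx a => pair_mem_union_pushSet_right
      (fun h => absurd (Struc.rel_sym_mem h) (newRel_notMem hx))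
      fun y hy h => newRel_injOn hs (Struc.rel_sym_mem hy) hx h
  have f1 : ∀ x ∈ τ.funs, ∀ a,
      ZFSet.pair x a ∈ A.fn ∪ pushSet (newFun τ s) B.fn ↔ ZFSet.pair x a ∈ A.fn := fun x hx a =>
    pair_mem_union_pushSet_left fun y hy h => by
      subst hy
      exact absurd hx (newFun_notMem (Struc.fn_sym_mem h))
  have f2 : ∀ x ∈ τ₀.funs, ∀ a,
      ZFSet.pair (newFun τ s x) a ∈ A.fn ∪ pushSet (newFun τ s) B.fn ↔ ZFSet.pair x a ∈ B.fn :=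
    fun x hx a => pair_mem_union_pushSet_right
      (fun h => absurd (Struc.fn_sym_mem h) (newFun_notMem hx))
      fun y hy h => newFun_injOn hs (Struc.fn_sym_mem hy) hx h
  let C : Struc (amalgam τ τ₀ s) :=
    { dom := A.dom ∪ pushSet s B.dom
      rel := A.rel ∪ pushSet (newRel τ s) B.rel
      fn := A.fn ∪ pushSet (newFun τ s) B.fn
      dom_typed := fun p hp => by
        rcases ZFSet.mem_union.1 hp with hp | hp
        · obtain ⟨x, hx, a, rfl⟩ := A.dom_typed p hp
          exact ⟨x, ZFSet.mem_union.2 (.inl hx), a, rfl⟩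
        · obtain ⟨x, a, hx, rfl⟩ := mem_pushSet.1 hp
          exact ⟨s x, ZFSet.mem_union.2 (.inr (mem_img.2 ⟨x, Struc.sort_mem hx, rfl⟩)), a, rfl⟩
      dom_nonempty := fun x hx => by
        rcases ZFSet.mem_union.1 hx with hx | hx
        · obtain ⟨a, ha⟩ := A.dom_nonempty x hx
          exact ⟨a, (d1 x hx a).2 ha⟩
        · obtain ⟨x, hx', rfl⟩ := mem_img.1 hx
          obtain ⟨a, ha⟩ := B.dom_nonempty x hx'
          exact ⟨a, (d2 x hx' a).2 ha⟩
      rel_typed := fun p hp => by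
        rcases ZFSet.mem_union.1 hp with hp | hp
        · obtain ⟨name, k, σ, a, h1, h2, rfl⟩ := A.rel_typed p hp
          exact ⟨name, k, σ, a, ZFSet.mem_union.2 (.inl h1), fun i => ZFSet.mem_union.2 (.inl (h2 i)),
            rfl⟩
        · obtain ⟨r, t, h, rfl⟩ := mem_pushSet.1 hp
          obtain ⟨name, k, σ, a, h1, h2, h3⟩ := B.rel_typed _ h
          obtain ⟨rfl, rfl⟩ := ZFSet.pair_inj.1 h3
          refine ⟨_, k, _, a, ?_, fun i => (d2 _ (Struc.sort_mem (h2 i)) _).2 (h2 i),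
            by rw [newRel_relSym]⟩
          rw [← newRel_relSym]
          exact ZFSet.mem_union.2 (.inr (mem_img.2 ⟨_, h1, rfl⟩))
      fn_typed := fun p hp => by
        rcases ZFSet.mem_union.1 hp with hp | hp
        · obtain ⟨name, k, σ, x, a, b, h1, h2, h3, rfl⟩ := A.fn_typed p hp
          exact ⟨name, k, σ, x, a, b, ZFSet.mem_union.2 (.inl h1),
            fun i => ZFSet.mem_union.2 (.inl (h2 i)), ZFSet.mem_union.2 (.inl h3), rfl⟩
        · obtain ⟨r, t, h, rfl⟩ := mem_pushSet.1 hp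
          obtain ⟨name, k, σ, x, a, b, h1, h2, h3, h4⟩ := B.fn_typed _ h
          obtain ⟨rfl, rfl⟩ := ZFSet.pair_inj.1 h4
          refine ⟨_, k, _, _, a, b, ?_, fun i => (d2 _ (Struc.sort_mem (h2 i)) _).2 (h2 i),
            (d2 _ (Struc.sort_mem h3) _).2 h3, by rw [newFun_funSym]⟩
          rw [← newFun_funSym]
          exact ZFSet.mem_union.2 (.inr (mem_img.2 ⟨_, h1, rfl⟩))
      fn_total := fun name k σ x hf a ha => by
        rcases ZFSet.mem_union.1 hf with hf | hf
        · simp only [f1 _ hf]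
          exact A.fn_total name k σ x hf a fun i => (d1 _ ((τ.funSym_sorts hf).1 i) _).1 (ha i)
        · obtain ⟨f, hf', h⟩ := mem_img.1 hf
          rw [← h]
          simp only [f2 _ hf']
          obtain ⟨name', k', σ', x', hσ, _, rfl⟩ := τ₀.funs_typed f hf'
          rw [newFun_funSym] at h
          obtain ⟨rfl, e, rfl⟩ := funSym_inj.1 h
          obtain rfl := tuple_length e
          obtain rfl := tuple_injective e
          exact B.fn_total name' _ σ' x' hf' a fun i => (d2 _ (hσ i) _).1 (ha i) }
  refine ⟨C, ⟨sub_amalgam, fun x hx a => (d1 x hx a).symm, fun x hx a => (r1 x hx a).symm,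
    fun x hx a => (f1 x hx a).symm⟩, ?_⟩
  apply Struc.ext
  · apply ZFSet.ext
    intro p
    constructor
    · intro hp
      obtain ⟨x, a, rfl, hx, h⟩ := mem_pullSet.1 hp
      exact (d2 x hx a).1 h
    · intro hp
      obtain ⟨x, hx, a, rfl⟩ := B.dom_typed p hp
      exact pair_mem_pullSet.2 ⟨hx, (d2 x hx a).2 hp⟩
  · apply ZFSet.ext
    intro p
    constructor
    · intro hp
      obtain ⟨x, a, rfl, hx, h⟩ := mem_pullSet.1 hp
      exact (r2 x hx a).1 h
    · intro hp
      obtain ⟨name, k, σ, a, hr, _, rfl⟩ := B.rel_typed p hp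
      exact pair_mem_pullSet.2 ⟨hr, (r2 _ hr _).2 hp⟩
  · apply ZFSet.ext
    intro p
    constructor
    · intro hp
      obtain ⟨x, a, rfl, hx, h⟩ := mem_pullSet.1 hp
      exact (f2 x hx a).1 h
    · intro hp
      obtain ⟨name, k, σ, x, a, b, hr, _, _, rfl⟩ := B.fn_typed p hp
      exact pair_mem_pullSet.2 ⟨hr, (f2 _ hr _).2 hp⟩

end

/-! ### Uniform bounds -/

theorem Struc.twoSorts_ext {A B : Struc twoSorts.{u}} (h : A.dom = B.dom) : A = B := by
  refine Struc.ext h ?_ ?_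
  · apply ZFSet.ext
    intro p
    constructor
    · intro hp
      obtain ⟨_, _, _, _, hr, _⟩ := A.rel_typed p hp
      exact absurd hr (ZFSet.notMem_empty _)
    · intro hp
      obtain ⟨_, _, _, _, hr, _⟩ := B.rel_typed p hp
      exact absurd hr (ZFSet.notMem_empty _)
  · apply ZFSet.ext
    intro p
    constructor
    · intro hp
      obtain ⟨_, _, _, _, _, _, hr, _⟩ := A.fn_typed p hp
      exact absurd hr (ZFSet.notMem_empty _)
    · intro hp
      obtain ⟨_, _, _, _, _, _, hr, _⟩ := B.fn_typed p hp
      exact absurd hr (ZFSet.notMem_empty _)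

theorem exists_uniform_bound {τ₀ : Vocab.{u}} (h : twoSorts.{u}.Sub τ₀) {φ : Formula.{u}}
    (hφ : φ.IsSentence τ₀) (hfo : φ.IsFO)
    (hb : ∀ A : Struc twoSorts.{u}, ∃ μ : Cardinal.{u}, ∀ B : Struc τ₀,
      φ.TrueIn B → A.IsReduct B → B.card ≤ μ) (κ : Cardinal.{u}) :
    ∃ μ : Cardinal.{u}, ∀ B : Struc τ₀, φ.TrueIn B → (B.carrier (num 0)).card ≤ κ →
      (B.carrier (num 1)).card ≤ κ → B.card ≤ μ := by
  classical
  choose μ hμ using hb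
  let T : ZFSet.{u} := κ.ord.toZFSet
  have hT : T.card = κ := by simp [T, Ordinal.card_toZFSet]
  let W : ZFSet.{u} := ZFSet.prod twoSorts.sorts T
  have : Small.{u} {A : Struc twoSorts.{u} | A.dom ⊆ W} :=
    small_of_injective (β := ZFSet.powerset W)
      (f := fun A => ⟨A.1.dom, ZFSet.mem_powerset.2 A.2⟩)
      fun A B e => Subtype.ext (Struc.twoSorts_ext (congrArg Subtype.val e))
  refine ⟨sSup (μ '' {A : Struc twoSorts.{u} | A.dom ⊆ W}), fun B hB h0 h1 => ?_⟩
  rw [← hT] at h0 h1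
  obtain ⟨f, hf, hfi⟩ := exists_inj_of_card_le h0
  obtain ⟨g, hg, hgi⟩ := exists_inj_of_card_le h1
  let e : ZFSet.{u} → ZFSet.{u} → ZFSet.{u} := fun s =>
    if s = num 0 then f else if s = num 1 then g else id
  have e0 : e (num 0) = f := if_pos rfl
  have e1 : e (num 1) = g := by simp [e]
  have he : ∀ s, Set.InjOn (e s) {a | a ∈ B.carrier s} := by
    intro s
    by_cases hs0 : s = num 0
    · rw [hs0, e0]; exact fun a ha b hb hab => hfi a ha b hb hab
    by_cases hs1 : s = num 1
    · rw [hs1, e1]; exact fun a ha b hb hab => hgi a ha b hb hab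
    · simp only [e, if_neg hs0, if_neg hs1]
      exact Function.injective_id.injOn
  have hB' : φ.TrueIn (B.image e he) := ((Struc.isomorphic_image he).trueIn_iff hφ hfo).1 hB
  have hA := (B.image e he).isReduct_reduct h
  refine (Struc.card_image he).trans ((hμ _ _ hB' hA).trans
    (le_csSup Cardinal.bddAbove_of_small ⟨_, ?_, rfl⟩))
  intro p hp
  obtain ⟨s, hs, a, rfl⟩ := ((B.image e he).reduct h).dom_typed p hp
  rw [ZFSet.pair_mem_prod]
  refine ⟨hs, ?_⟩
  have hp' := (hA.2.1 s hs a).1 hp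
  rw [← Struc.mem_carrier, Struc.mem_carrier_image] at hp'
  obtain ⟨b, hb, rfl⟩ := hp'
  rcases ZFSet.mem_pair.1 hs with rfl | rfl
  · rw [e0]; exact hf b hb
  · rw [e1]; exact hg b hb

/-- A definably bounding function on two given sorts of a vocabulary. -/
theorem DefinablyBounding.exists_expansion {F : Cardinal.{u} → Cardinal.{u}}
    (hF : DefinablyBounding F) (τ : Vocab.{u}) {n₀ n₁ : ZFSet.{u}} (h₀ : n₀ ∈ τ.sorts)
    (h₁ : n₁ ∈ τ.sorts) (hne : n₀ ≠ n₁) :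
    ∃ (τ' : Vocab.{u}) (h : τ.Sub τ') (χ : Formula.{u}), χ.IsSentence τ' ∧
      (∀ A : Struc τ, (A.carrier n₁).card ≤ F (A.carrier n₀).card ↔
        ∃ B : Struc τ', χ.TrueIn B ∧ A.IsReduct B) ∧
      ∀ κ : Cardinal.{u}, ∃ μ : Cardinal.{u}, ∀ B : Struc τ', χ.TrueIn B →
        (B.reduct h).card ≤ κ → B.card ≤ μ := by
  obtain ⟨_, τ₀, _, hsub, ⟨φ, hfo, hφ, rfl⟩, hK, hb⟩ := hF
  simp only [LFO_models hφ hfo] at hK hb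
  have hs := newSort_injective h₀ h₁ hne
  let s := newSort τ n₀ n₁
  let μ := amalgamRenaming τ τ₀ hs
  have hx0 : num 0 ∈ twoSorts.{u}.sorts := ZFSet.mem_pair.2 (.inl rfl)
  have hx1 : num 1 ∈ twoSorts.{u}.sorts := ZFSet.mem_pair.2 (.inr rfl)
  have c0 : ∀ B : Struc (amalgam τ τ₀ s), (μ.pull B).carrier (num 0) = B.carrier n₀ := fun B =>
    ZFSet.ext fun a => (μ.mem_carrier_pull (hsub.1 hx0)).trans (by
      rw [show μ.s (num 0) = n₀ from newSort_zero])
  have c1 : ∀ B : Struc (amalgam τ τ₀ s), (μ.pull B).carrier (num 1) = B.carrier n₁ := fun B =>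
    ZFSet.ext fun a => (μ.mem_carrier_pull (hsub.1 hx1)).trans (by
      rw [show μ.s (num 1) = n₁ from newSort_one])
  refine ⟨amalgam τ τ₀ s, sub_amalgam, φ.map μ.s μ.r μ.f, μ.isSentence hφ, fun A => ?_, fun κ => ?_⟩
  · constructor
    · intro hA
      let ν : Renaming twoSorts.{u} τ :=
        { s := s
          r := id
          f := id
          s_inj := hs
          s_mem := fun x hx => by
            rcases ZFSet.mem_pair.1 hx with rfl | rfl
            · rw [show s (num 0) = n₀ from newSort_zero]; exact h₀
            · rw [show s (num 1) = n₁ from newSort_one]; exact h₁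
          r_spec := fun _ _ _ h => absurd h (ZFSet.notMem_empty _)
          f_spec := fun _ _ _ _ h => absurd h (ZFSet.notMem_empty _) }
      have v0 : (ν.pull A).carrier (num 0) = A.carrier n₀ :=
        ZFSet.ext fun a => (ν.mem_carrier_pull hx0).trans (by
          rw [show ν.s (num 0) = n₀ from newSort_zero])
      have v1 : (ν.pull A).carrier (num 1) = A.carrier n₁ :=
        ZFSet.ext fun a => (ν.mem_carrier_pull hx1).trans (by
          rw [show ν.s (num 1) = n₁ from newSort_one])
      rw [← v0, ← v1] at hA
      obtain ⟨B, hB, hAB⟩ := (hK _).1 hA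
      obtain ⟨C, hC, hC'⟩ := exists_amalgam_struc hs A B fun x hx hx' a => by
        have hx2 : x ∈ twoSorts.{u}.sorts := ZFSet.mem_pair.2 (newSort_mem hx')
        exact (pair_mem_pullSet.trans (and_iff_right hx2)).symm.trans (hAB.2.1 x hx2 a)
      exact ⟨C, (μ.trueIn_map hφ).2 (by rw [hC']; exact hB), hC⟩
    · rintro ⟨B, hB, hAB⟩
      have hB := (μ.trueIn_map hφ).1 hB
      have hr := (μ.pull B).isReduct_reduct hsub
      have := (hK _).2 ⟨_, hB, hr⟩
      rw [Set.mem_ofPred_eq, hr.carrier hx0, hr.carrier hx1, c0, c1] at this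
      rwa [hAB.carrier h₀, hAB.carrier h₁]
  · obtain ⟨β, hβ⟩ := exists_uniform_bound hsub hφ hfo hb κ
    refine ⟨κ + β, fun B hB hκ => ?_⟩
    have hr := B.isReduct_reduct (sub_amalgam (τ := τ) (τ₀ := τ₀) (s := s))
    have hc : ∀ x ∈ τ.sorts, (B.carrier x).card ≤ κ := fun x hx => by
      rw [← hr.carrier hx]
      refine (card_le_of_inj (fun a => ZFSet.pair x a) (fun a ha => Struc.mem_carrier.1 ha)
        fun a _ b _ h => (ZFSet.pair_inj.1 h).2).trans hκ
    have h2 := hβ (μ.pull B) ((μ.trueIn_map hφ).1 hB) (by rw [c0]; exact hc _ h₀)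
      (by rw [c1]; exact hc _ h₁)
    have h3 : B.dom ⊆ (B.reduct sub_amalgam).dom ∪ pushSet s (μ.pull B).dom := by
      intro p hp
      obtain ⟨x, hx, a, rfl⟩ := B.dom_typed p hp
      rcases ZFSet.mem_union.1 hx with hx | hx
      · exact ZFSet.mem_union.2 (.inl ((hr.2.1 x hx a).2 hp))
      · obtain ⟨x, hx', rfl⟩ := mem_img.1 hx
        exact ZFSet.mem_union.2 (.inr (pair_mem_pushSet.2 ⟨x, rfl, pair_mem_pullSet.2 ⟨hx', hp⟩⟩))
    exact (ZFSet.card_mono h3).trans (ZFSet.card_union_le.trans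
      (add_le_add hκ (card_pushSet_le.trans h2)))

/-! ### Expansion of a vocabulary by a sort for sets -/

namespace Vocab

variable (τ : Vocab.{u})

/-- The sort for sets. -/
def setSort : ZFSet.{u} := ZFSet.pair τ.sorts (num 0)

/-- The sort for the argument of the bounding function. -/
def argSort : ZFSet.{u} := ZFSet.pair τ.sorts (num 1)

/-- The sort for the value of the bounding function. -/
def valSort : ZFSet.{u} := ZFSet.pair τ.sorts (num 2)

/-- The new sorts. -/
def newSorts : ZFSet.{u} := {τ.setSort, τ.argSort, τ.valSort}

/-- The new relation symbols. -/
noncomputable def setRels : ZFSet.{u} :=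
  repl (fun q y => ∃ c s s', q = ZFSet.pair c (ZFSet.pair s s') ∧ y = relSym c ![s, s'])
    (ZFSet.prod {num 0, num 1} (ZFSet.prod (τ.sorts ∪ τ.newSorts) τ.newSorts))

variable {τ}

theorem setSort_mem : τ.setSort ∈ τ.newSorts := by simp [newSorts]

theorem argSort_mem : τ.argSort ∈ τ.newSorts := by simp [newSorts]

theorem valSort_mem : τ.valSort ∈ τ.newSorts := by simp [newSorts]

theorem newSorts_notMem {s : ZFSet.{u}} (h : s ∈ τ.newSorts) : s ∉ τ.sorts := by
  simp only [newSorts, ZFSet.mem_insert_iff, ZFSet.mem_singleton] at h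
  rcases h with rfl | rfl | rfl <;> exact notMem_pair_self _ _

theorem argSort_ne_valSort : τ.argSort ≠ τ.valSort := fun h =>
  absurd (num_injective (ZFSet.pair_inj.1 h).2) (by decide)

theorem setSort_ne_argSort : τ.setSort ≠ τ.argSort := fun h =>
  absurd (num_injective (ZFSet.pair_inj.1 h).2) (by decide)

theorem setSort_ne_valSort : τ.setSort ≠ τ.valSort := fun h =>
  absurd (num_injective (ZFSet.pair_inj.1 h).2) (by decide)

theorem mem_setRels {r : ZFSet.{u}} : r ∈ τ.setRels ↔ ∃ c s s', (c = num 0 ∨ c = num 1) ∧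
    s ∈ τ.sorts ∪ τ.newSorts ∧ s' ∈ τ.newSorts ∧ r = relSym c ![s, s'] := by
  unfold setRels
  rw [mem_repl]
  · constructor
    · rintro ⟨_, hq, c, s, s', rfl, rfl⟩
      simp only [ZFSet.pair_mem_prod, ZFSet.mem_pair] at hq
      exact ⟨c, s, s', hq.1, hq.2.1, hq.2.2, rfl⟩
    · rintro ⟨c, s, s', h1, h2, h3, rfl⟩
      refine ⟨_, ?_, c, s, s', rfl, rfl⟩
      simp only [ZFSet.pair_mem_prod, ZFSet.mem_pair]
      exact ⟨h1, h2, h3⟩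
  · rintro _ _ _ ⟨c, s, s', rfl, rfl⟩ ⟨c', t, t', h, rfl⟩
    simp only [ZFSet.pair_inj] at h
    rw [h.1, h.2.1, h.2.2]

variable (τ) in
/-- The expansion of `τ` by three sorts and by binary relations. -/
noncomputable def withSets : Vocab.{u} where
  sorts := τ.sorts ∪ τ.newSorts
  rels := τ.rels ∪ τ.setRels
  funs := τ.funs
  rels_typed r hr := by
    rcases ZFSet.mem_union.1 hr with hr | hr
    · obtain ⟨name, k, σ, h, rfl⟩ := τ.rels_typed r hr
      exact ⟨name, k, σ, fun i => ZFSet.mem_union.2 (.inl (h i)), rfl⟩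
    · obtain ⟨c, s, s', _, hs, hs', rfl⟩ := mem_setRels.1 hr
      refine ⟨c, 2, ![s, s'], fun i => ?_, rfl⟩
      fin_cases i
      · exact hs
      · exact ZFSet.mem_union.2 (.inr hs')
  funs_typed f hf := by
    obtain ⟨name, k, σ, s, h, hs, rfl⟩ := τ.funs_typed f hf
    exact ⟨name, k, σ, s, fun i => ZFSet.mem_union.2 (.inl (h i)), ZFSet.mem_union.2 (.inl hs), rfl⟩

theorem sub_withSets : τ.Sub τ.withSets :=
  ⟨fun _ h => ZFSet.mem_union.2 (.inl h), fun _ h => ZFSet.mem_union.2 (.inl h), fun _ h => h⟩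

theorem newSorts_withSets {s : ZFSet.{u}} (h : s ∈ τ.newSorts) : s ∈ τ.withSets.sorts :=
  ZFSet.mem_union.2 (.inr h)

theorem bin_mem {c s s' : ZFSet.{u}} (hc : c = num 0 ∨ c = num 1) (hs : s ∈ τ.withSets.sorts)
    (hs' : s' ∈ τ.newSorts) : relSym c ![s, s'] ∈ τ.withSets.rels :=
  ZFSet.mem_union.2 (.inr (mem_setRels.2 ⟨c, s, s', hc, hs, hs', rfl⟩))

theorem bin_notMem {c s s' : ZFSet.{u}} (hs' : s' ∈ τ.newSorts) : relSym c ![s, s'] ∉ τ.rels :=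
  fun h => newSorts_notMem hs' (τ.relSym_sorts h 1)

end Vocab

/-- The binary relation with the name `c` between the sorts `s` and `s'`. -/
def Struc.bin {τ : Vocab.{u}} (B : Struc τ) (c s s' a b : ZFSet.{u}) : Prop :=
  ZFSet.pair (relSym c ![s, s']) (tuple ![a, b]) ∈ B.rel

theorem Defines.bin {τ : Vocab.{u}} {C : Set (Struc τ)} {fo : Prop} {n : ℕ} {σ : Fin n → ZFSet.{u}}
    {c s s' : ZFSet.{u}} (h : relSym c ![s, s'] ∈ τ.rels) (i j : Fin n) (hi : σ i = s)
    (hj : σ j = s') : Defines C fo σ fun A w => A.bin c s s' (w i) (w j) :=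
  .rel₂ h i j hi hj

/-! ### The collapse of the sort for sets -/

namespace Struc

variable {τ : Vocab.{u}} (B : Struc τ.withSets)

/-- The sort for sets, with its relation, is well-founded and extensional. -/
def SetLike : Prop :=
  (WellFounded fun a b : {a : ZFSet.{u} // a ∈ B.carrier τ.setSort} =>
      B.bin (num 0) τ.setSort τ.setSort a b) ∧
    ∀ a ∈ B.carrier τ.setSort, ∀ b ∈ B.carrier τ.setSort,
      (∀ z ∈ B.carrier τ.setSort, B.bin (num 0) τ.setSort τ.setSort z a ↔
        B.bin (num 0) τ.setSort τ.setSort z b) → a = b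

open Classical in
/-- The collapse of the sort for sets. -/
noncomputable def collapse (a : ZFSet.{u}) : ZFSet.{u} :=
  if h : B.SetLike ∧ a ∈ B.carrier τ.setSort then coll h.1.1 ⟨a, h.2⟩ else ∅

variable {B} (hB : B.SetLike)

include hB

theorem SetLike.collapse_eq {a : ZFSet.{u}} (ha : a ∈ B.carrier τ.setSort) :
    B.collapse a = coll hB.1 ⟨a, ha⟩ := dif_pos ⟨hB, ha⟩

theorem SetLike.ext : ∀ a b : {a : ZFSet.{u} // a ∈ B.carrier τ.setSort},
    (∀ z : {a : ZFSet.{u} // a ∈ B.carrier τ.setSort}, B.bin (num 0) τ.setSort τ.setSort z a ↔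
      B.bin (num 0) τ.setSort τ.setSort z b) → a = b := fun a b h =>
  Subtype.ext (hB.2 a a.2 b b.2 fun z hz => h ⟨z, hz⟩)

theorem SetLike.collapse_inj {a b : ZFSet.{u}} (ha : a ∈ B.carrier τ.setSort)
    (hb : b ∈ B.carrier τ.setSort) : B.collapse a = B.collapse b ↔ a = b := by
  rw [hB.collapse_eq ha, hB.collapse_eq hb, (coll_injective hB.1 hB.ext).eq_iff, Subtype.mk.injEq]

theorem SetLike.collapse_mem_iff {a b : ZFSet.{u}} (ha : a ∈ B.carrier τ.setSort)
    (hb : b ∈ B.carrier τ.setSort) :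
    B.collapse a ∈ B.collapse b ↔ B.bin (num 0) τ.setSort τ.setSort a b := by
  rw [hB.collapse_eq ha, hB.collapse_eq hb]
  exact coll_mem_iff hB.1 hB.ext

theorem SetLike.isTransitive : (img B.collapse (B.carrier τ.setSort)).IsTransitive := by
  intro x hx z hz
  obtain ⟨a, ha, rfl⟩ := mem_img.1 hx
  rw [hB.collapse_eq ha, mem_coll] at hz
  obtain ⟨b, _, rfl⟩ := hz
  exact mem_img.2 ⟨b, b.2, hB.collapse_eq b.2⟩

theorem SetLike.mem_collapse {a z : ZFSet.{u}} (ha : a ∈ B.carrier τ.setSort) :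
    z ∈ B.collapse a ↔ ∃ b ∈ B.carrier τ.setSort, B.bin (num 0) τ.setSort τ.setSort b a ∧
      B.collapse b = z := by
  constructor
  · intro hz
    obtain ⟨b, hb, rfl⟩ := mem_img.1 (hB.isTransitive _ (mem_img.2 ⟨a, ha, rfl⟩) hz)
    exact ⟨b, hb, (hB.collapse_mem_iff hb ha).1 hz, rfl⟩
  · rintro ⟨b, hb, h, rfl⟩
    exact (hB.collapse_mem_iff hb ha).2 h

end Struc

/-! ### Translation of `Δ₀` predicates -/

section

variable {τ : Vocab.{u}} {fo : Prop}

theorem setSort_withSets : τ.setSort ∈ τ.withSets.sorts := Vocab.newSorts_withSets Vocab.setSort_mem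

theorem mem_rel_withSets : relSym (num 0) ![τ.setSort, τ.setSort] ∈ τ.withSets.rels :=
  Vocab.bin_mem (.inl rfl) setSort_withSets Vocab.setSort_mem

theorem defines_setLike {n : ℕ} {σ : Fin n → ZFSet.{u}} :
    Defines Set.univ False σ fun (B : Struc τ.withSets) _ => B.SetLike :=
  .and (.wf setSort_withSets (.bin mem_rel_withSets 1 0 rfl rfl))
    (.all setSort_withSets (.all setSort_withSets (.imp (.all setSort_withSets
      (.iff (.bin mem_rel_withSets 0 2 rfl rfl) (.bin mem_rel_withSets 0 1 rfl rfl)))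
      (.eq 1 0 rfl))))

theorem Delta0.defines {n : ℕ} (φ : Delta0 noPredicates.{u} n) {k : ℕ} {σ : Fin k → ZFSet.{u}}
    (f : Fin n → Fin k) (hf : ∀ i, σ (f i) = τ.setSort) :
    Defines {B : Struc τ.withSets | B.SetLike} fo σ fun B w =>
      φ.Realize fun i => B.collapse (w (f i)) := by
  induction φ generalizing k σ with
  | mem i j =>
    refine (Defines.bin mem_rel_withSets (f i) (f j) (hf i) (hf j)).congr fun B hB w hw => ?_
    exact hB.collapse_mem_iff (hf i ▸ hw (f i)) (hf j ▸ hw (f j))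
  | eq i j =>
    refine (Defines.eq (f i) (f j) ((hf i).trans (hf j).symm)).congr fun B hB w hw => ?_
    exact hB.collapse_inj (hf i ▸ hw (f i)) (hf j ▸ hw (f j))
  | pred p _ => exact Empty.elim p
  | neg φ ih => exact (ih f hf).not
  | and φ ψ ih ih' => exact (ih f hf).and (ih' f hf)
  | @ball n i φ ih =>
    have h1 : Defines {B : Struc τ.withSets | B.SetLike} fo (Matrix.vecCons τ.setSort σ)
        fun B w => B.bin (num 0) τ.setSort τ.setSort (w 0) (w (f i).succ) →
          φ.Realize (Matrix.vecCons (B.collapse (w 0)) fun j => B.collapse (w (f j).succ)) := by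
      refine .imp (.bin mem_rel_withSets 0 (f i).succ rfl (hf i)) ?_
      refine (ih (Matrix.vecCons 0 fun j => (f j).succ) fun j => ?_).congr fun B _ w _ => ?_
      · cases j using Fin.cases with
        | zero => rfl
        | succ j => exact hf j
      · have : (fun j => B.collapse (w (Matrix.vecCons 0 (fun j => (f j).succ) j))) =
            Matrix.vecCons (B.collapse (w 0)) fun j => B.collapse (w (f j).succ) := by
          funext j
          cases j using Fin.cases <;> rfl
        rw [this]
    have h2 : Defines {B : Struc τ.withSets | B.SetLike} fo σ fun B w =>
        ∀ a ∈ B.carrier τ.setSort, B.bin (num 0) τ.setSort τ.setSort a (w (f i)) →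
          φ.Realize (Matrix.vecCons (B.collapse a) fun j => B.collapse (w (f j))) :=
      .all setSort_withSets h1
    refine h2.congr fun B hB w hw => ?_
    simp only [Delta0.Realize, hB.mem_collapse (hf i ▸ hw (f i))]
    constructor
    · exact fun h a ha hE => h _ ⟨a, ha, hE, rfl⟩
    · rintro h _ ⟨a, ha, hE, rfl⟩
      exact h a ha hE

theorem D0.defines_collapse {n : ℕ} {P : (Fin n → ZFSet.{u}) → Prop} (hP : D0 P) {k : ℕ}
    {σ : Fin k → ZFSet.{u}} (f : Fin n → Fin k) (hf : ∀ i, σ (f i) = τ.setSort) :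
    Defines {B : Struc τ.withSets | B.SetLike} fo σ fun B w => P fun i => B.collapse (w (f i)) := by
  obtain ⟨φ, h⟩ := hP
  exact (φ.defines f hf).congr fun B _ w _ => (h _).symm

/-- The elements of the sorts of `τ` are represented by elements of the sort for sets. -/
def Struc.Interprets (B : Struc τ.withSets) : Prop :=
  B.SetLike ∧ (∀ s ∈ insert τ.setSort {s | s ∈ τ.sorts}, ∀ a ∈ B.carrier s,
      ∃ x ∈ B.carrier τ.setSort, B.bin (num 1) s τ.setSort a x) ∧
    (∀ s ∈ insert τ.setSort {s | s ∈ τ.sorts}, ∀ a ∈ B.carrier s, ∀ x ∈ B.carrier τ.setSort,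
      ∀ x' ∈ B.carrier τ.setSort, B.bin (num 1) s τ.setSort a x →
        B.bin (num 1) s τ.setSort a x' → x = x') ∧
    ∀ a ∈ B.carrier τ.setSort, B.bin (num 1) τ.setSort τ.setSort a a

/-- The set that an element of a sort of `τ` represents. -/
noncomputable def Struc.value (B : Struc τ.withSets) (s a : ZFSet.{u}) : ZFSet.{u} :=
  B.collapse (Classical.epsilon fun x => x ∈ B.carrier τ.setSort ∧ B.bin (num 1) s τ.setSort a x)

theorem Struc.Interprets.value_eq {B : Struc τ.withSets} (hB : B.Interprets) {s a x : ZFSet.{u}}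
    (hs : s ∈ insert τ.setSort {s | s ∈ τ.sorts}) (ha : a ∈ B.carrier s)
    (hx : x ∈ B.carrier τ.setSort) (h : B.bin (num 1) s τ.setSort a x) :
    B.value s a = B.collapse x := by
  have h' := Classical.epsilon_spec (p := fun x => x ∈ B.carrier τ.setSort ∧
    B.bin (num 1) s τ.setSort a x) ⟨x, hx, h⟩
  unfold Struc.value
  rw [hB.2.2.1 s hs a ha _ h'.1 x hx h'.2 h]

theorem Struc.Interprets.value_setSort {B : Struc τ.withSets} (hB : B.Interprets) {a : ZFSet.{u}}
    (ha : a ∈ B.carrier τ.setSort) : B.value τ.setSort a = B.collapse a :=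
  hB.value_eq (Set.mem_insert _ _) ha ha (hB.2.2.2 a ha)

theorem sorts_withSets {s : ZFSet.{u}} (hs : s ∈ insert τ.setSort {s | s ∈ τ.sorts}) :
    s ∈ τ.withSets.sorts := by
  rcases hs with rfl | hs
  · exact setSort_withSets
  · exact ZFSet.mem_union.2 (.inl hs)

theorem mem_rel_withSets₁ {s : ZFSet.{u}} (hs : s ∈ insert τ.setSort {s | s ∈ τ.sorts}) :
    relSym (num 1) ![s, τ.setSort] ∈ τ.withSets.rels :=
  Vocab.bin_mem (.inr rfl) (sorts_withSets hs) Vocab.setSort_mem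

theorem defines_interprets (hfin : {s | s ∈ τ.sorts}.Finite) {n : ℕ} {σ : Fin n → ZFSet.{u}} :
    Defines Set.univ False σ fun (B : Struc τ.withSets) _ => B.Interprets := by
  have hfin' := hfin.insert τ.setSort
  refine .and defines_setLike (.and (.finite_and setSort_withSets hfin' fun s hs => ?_)
    (.and (.finite_and setSort_withSets hfin' fun s hs => ?_) ?_))
  · exact .all (sorts_withSets hs) (.ex setSort_withSets (.bin (mem_rel_withSets₁ hs) 1 0 rfl rfl))
  · exact .all (sorts_withSets hs) (.all setSort_withSets (.all setSort_withSets
      (.imp (.bin (mem_rel_withSets₁ hs) 2 1 rfl rfl)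
        (.imp (.bin (mem_rel_withSets₁ hs) 2 0 rfl rfl) (.eq 1 0 rfl)))))
  · exact .all setSort_withSets (.bin (mem_rel_withSets₁ (Set.mem_insert _ _)) 0 0 rfl rfl)

theorem D0.defines {n : ℕ} {P : (Fin n → ZFSet.{u}) → Prop} (hP : D0 P) {k : ℕ}
    {σ : Fin k → ZFSet.{u}} (f : Fin n → Fin k)
    (hf : ∀ i, σ (f i) ∈ insert τ.setSort {s | s ∈ τ.sorts}) :
    Defines {B : Struc τ.withSets | B.Interprets} fo σ fun B w =>
      P fun i => B.value (σ (f i)) (w (f i)) := by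
  have h1 : Defines {B : Struc τ.withSets | B.Interprets} fo σ fun B w =>
      ∃ x : Fin n → ZFSet.{u}, (∀ i, x i ∈ B.carrier τ.setSort) ∧
        ((∀ i ∈ (Set.univ : Set (Fin n)), B.bin (num 1) (σ (f i)) τ.setSort (w (f i)) (x i)) ∧
          P fun i => B.collapse (x i)) := by
    refine .exBlock (fun _ => setSort_withSets) fun n' σ' f' g hf' hg => .and ?_ ?_
    · exact .finite_and setSort_withSets Set.finite_univ fun i _ =>
        .bin (mem_rel_withSets₁ (hf i)) (f' (f i)) (g i) (hf' _) (hg _)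
    · exact (hP.defines_collapse g hg).mono fun B hB => hB.1
  refine h1.congr fun B hB w hw => ?_
  constructor
  · intro h
    choose x hx hx' using fun i => hB.2.1 _ (hf i) _ (hw (f i))
    refine ⟨x, hx, fun i _ => hx' i, ?_⟩
    have : (fun i => B.value (σ (f i)) (w (f i))) = fun i => B.collapse (x i) :=
      funext fun i => hB.value_eq (hf i) (hw _) (hx i) (hx' i)
    rwa [← this]
  · rintro ⟨x, hx, hx', h⟩
    have : (fun i => B.value (σ (f i)) (w (f i))) = fun i => B.collapse (x i) :=
      funext fun i => hB.value_eq (hf i) (hw _) (hx i) (hx' i trivial)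
    rwa [this]

end

/-! ### Definability of tuples -/

theorem D0.eq_tuple {n k : ℕ} (j : Fin n) (g : Fin k → Fin n) :
    D0 fun v : Fin n → ZFSet.{u} => v j = tuple fun i => v (g i) := by
  induction k generalizing n with
  | zero => exact inferInstanceAs (D0 fun v : Fin n → ZFSet.{u} => v j = ∅)
  | succ k ih =>
    have := ih (n := n + 4) 0 fun i => (g i.succ).succ.succ.succ.succ
    refine D0.congr (P := fun v : Fin n → ZFSet.{u} => ∃ a b, v j = ZFSet.pair a b ∧
      (a = v (g 0) ∧ b = tuple fun i => v (g i.succ))) inferInstance fun v => ?_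
    rw [tuple_succ]
    constructor
    · exact fun h => ⟨_, _, h, rfl, rfl⟩
    · rintro ⟨_, _, h, rfl, rfl⟩; exact h

theorem HereditarilyFinite.d0_pair {h : ZFSet.{u}} (hh : HereditarilyFinite h) {n : ℕ}
    (j : Fin n) {f : (Fin n → ZFSet.{u}) → ZFSet.{u}}
    (hf : D0 fun v : Fin (n + 4) → ZFSet.{u} => v 0 = f fun i => v i.succ.succ.succ.succ) :
    D0 fun v : Fin n → ZFSet.{u} => v j = ZFSet.pair h (f v) := by
  have := fun m (i : Fin m) => hh.d0 i
  refine D0.congr (P := fun v : Fin n → ZFSet.{u} => ∃ a b, v j = ZFSet.pair a b ∧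
    (a = h ∧ b = f v)) inferInstance fun v => ?_
  constructor
  · exact fun h => ⟨_, _, h, rfl, rfl⟩
  · rintro ⟨_, _, h, rfl, rfl⟩; exact h

/-! ### Definability of the code of the copy of a structure -/

section

variable {τ : Vocab.{u}}

/-- The class `X B` of sets can be compared with elements of the sort for sets. -/
def Describable (X : Struc τ.withSets → Set ZFSet.{u}) : Prop :=
  ∀ (n : ℕ) (σ : Fin n → ZFSet.{u}) (i : Fin n), σ i = τ.setSort →
    Defines {B : Struc τ.withSets | B.Interprets} False σ (fun B w => B.collapse (w i) ∈ X B) ∧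
      Defines {B : Struc τ.withSets | B.Interprets} False σ
        fun B w => ∀ z ∈ X B, z ∈ B.collapse (w i)

theorem Describable.finite_union {ι : Type*} {S : Set ι} (hS : S.Finite)
    {X : ι → Struc τ.withSets → Set ZFSet.{u}} (h : ∀ j ∈ S, Describable (X j)) :
    Describable fun B => {z | ∃ j ∈ S, z ∈ X j B} := fun n σ i hi =>
  ⟨.finite_or setSort_withSets hS fun j hj => (h j hj n σ i hi).1,
    (Defines.finite_and setSort_withSets hS fun j hj => (h j hj n σ i hi).2).congr
      fun _ _ _ _ => ⟨fun h' j hj z hz => h' z ⟨j, hj, hz⟩, fun h' z ⟨j, hj, hz⟩ => h' j hj z hz⟩⟩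

theorem Describable.defines_eq {X : Struc τ.withSets → ZFSet.{u}}
    (h : Describable fun B => {z | z ∈ X B}) {n : ℕ} {σ : Fin n → ZFSet.{u}} (i : Fin n)
    (hi : σ i = τ.setSort) :
    Defines {B : Struc τ.withSets | B.Interprets} False σ fun B w => B.collapse (w i) = X B := by
  have h1 : Defines {B : Struc τ.withSets | B.Interprets} False σ fun B w =>
      (∀ a ∈ B.carrier τ.setSort, B.bin (num 0) τ.setSort τ.setSort a (w i) →
        B.collapse a ∈ {z | z ∈ X B}) ∧ ∀ z ∈ {z | z ∈ X B}, z ∈ B.collapse (w i) :=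
    .and (.all setSort_withSets (.imp (.bin mem_rel_withSets 0 i.succ rfl hi)
      (h _ (Matrix.vecCons τ.setSort σ) 0 rfl).1)) (h _ σ i hi).2
  refine h1.congr fun B hB w hw => ?_
  have hmem := fun z => hB.1.mem_collapse (z := z) (hi ▸ hw i)
  constructor
  · intro e
    rw [← e]
    exact ⟨fun a ha hE => (hmem _).2 ⟨a, ha, hE, rfl⟩, fun z hz => hz⟩
  · rintro ⟨h1, h2⟩
    apply ZFSet.ext
    intro z
    refine ⟨fun hz => ?_, h2 z⟩
    obtain ⟨a, ha, hE, rfl⟩ := (hmem z).1 hz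
    exact h1 a ha hE

theorem describable_basic {k : ℕ} {ρ : Fin k → ZFSet.{u}} (hρ : ∀ i, ρ i ∈ τ.sorts)
    {G : Struc τ.withSets → (Fin k → ZFSet.{u}) → Prop}
    (hG : ∀ (n : ℕ) (σ : Fin n → ZFSet.{u}) (g : Fin k → Fin n), (∀ i, σ (g i) = ρ i) →
      Defines Set.univ False σ fun B w => G B fun i => w (g i))
    {c : (Fin k → ZFSet.{u}) → ZFSet.{u}}
    (hc : ∀ (n : ℕ) (j : Fin n) (g : Fin k → Fin n),
      D0 fun v : Fin n → ZFSet.{u} => v j = c fun i => v (g i)) :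
    Describable fun B => {z | ∃ a : Fin k → ZFSet.{u}, (∀ i, a i ∈ B.carrier (ρ i)) ∧ G B a ∧
      z = c fun i => B.value (ρ i) (a i)} := by
  have hρ' : ∀ i, ρ i ∈ τ.withSets.sorts := fun i => ZFSet.mem_union.2 (.inl (hρ i))
  intro n σ i hi
  have key : ∀ (P : ZFSet.{u} → ZFSet.{u} → Prop),
      (D0 fun v : Fin (k + 1) → ZFSet.{u} => P (v 0) (c fun j => v j.succ)) →
      ∀ (n' : ℕ) (σ' : Fin n' → ZFSet.{u}) (f : Fin n → Fin n') (g : Fin k → Fin n'),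
      (∀ i, σ' (f i) = σ i) → (∀ i, σ' (g i) = ρ i) →
      Defines {B : Struc τ.withSets | B.Interprets} False σ' fun B w =>
        P (B.collapse (w (f i))) (c fun j => B.value (ρ j) (w (g j))) := by
    intro P hP n' σ' f g hf hg
    refine (hP.defines (Matrix.vecCons (f i) g) fun j => ?_).congr fun B hB w hw => ?_
    · cases j using Fin.cases with
      | zero => exact .inl ((hf i).trans hi)
      | succ j => exact .inr (by rw [Set.mem_ofPred_eq, Matrix.cons_val_succ, hg]; exact hρ j)
    · have e1 : B.collapse (w (f i)) = B.value (σ' (f i)) (w (f i)) := by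
        have e := (hf i).trans hi
        have := hw (f i)
        rw [e] at this ⊢
        exact (hB.value_setSort this).symm
      rw [e1]
      simp only [Matrix.cons_val_zero, Matrix.cons_val_succ, hg]
  constructor
  · refine .exBlock hρ' fun n' σ' f g hf hg => .and ((hG n' σ' g hg).mono (Set.subset_univ _)) ?_
    exact key (fun x y => x = y) (hc _ 0 Fin.succ) n' σ' f g hf hg
  · have hc' := hc (k + 1 + 1) 0 fun j => j.succ.succ
    have hP : D0 fun v : Fin (k + 1) → ZFSet.{u} => (c fun j => v j.succ) ∈ v 0 :=
      D0.congr (P := fun v : Fin (k + 1) → ZFSet.{u} => ∃ z ∈ v 0, z = c fun j => v j.succ)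
        inferInstance fun v => by simp
    have h1 : Defines {B : Struc τ.withSets | B.Interprets} False σ fun B w =>
        ∀ a : Fin k → ZFSet.{u}, (∀ i, a i ∈ B.carrier (ρ i)) → G B a →
          (c fun j => B.value (ρ j) (a j)) ∈ B.collapse (w i) :=
      .allBlock hρ' fun n' σ' f g hf hg => .imp ((hG n' σ' g hg).mono (Set.subset_univ _))
        (key (fun x y => y ∈ x) hP n' σ' f g hf hg)
    refine h1.congr fun B _ w _ => ⟨fun h a ha hG => h _ ⟨a, ha, hG, rfl⟩, ?_⟩
    rintro h z ⟨a, ha, hG, rfl⟩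
    exact h a ha hG

variable (hτ : HereditarilyFinite τ.code)

include hτ

theorem describable_imageDom :
    Describable fun B : Struc τ.withSets =>
      {z | z ∈ (B.reduct Vocab.sub_withSets).imageDom B.value} := by
  have hs := (HereditarilyFinite.of_pair hτ).1
  have h1 : ∀ s ∈ {s | s ∈ τ.sorts}, Describable fun B : Struc τ.withSets =>
      {z | ∃ a : Fin 1 → ZFSet.{u}, (∀ i, a i ∈ B.carrier (![s] i)) ∧ True ∧
        z = ZFSet.pair s (B.value (![s] 0) (a 0))} := fun s hs' =>
    describable_basic (fun i => by fin_cases i; exact hs') (fun _ _ _ _ => .trueAt setSort_withSets)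
      (c := fun x => ZFSet.pair s (x 0)) fun n j g =>
        (hs.mem hs').d0_pair j (f := fun v => v (g 0)) (D0.eq 0 (g 0).succ.succ.succ.succ)
  have h2 := Describable.finite_union hs.finite h1
  convert h2 using 4 with B z
  have hr := B.isReduct_reduct (Vocab.sub_withSets (τ := τ))
  rw [Struc.mem_imageDom]
  constructor
  · rintro ⟨s, a, ha, rfl⟩
    have hs' := Struc.sort_mem (Struc.mem_carrier.1 ha)
    rw [hr.carrier hs'] at ha
    exact ⟨s, hs', ![a], fun i => by fin_cases i; exact ha, trivial, rfl⟩
  · rintro ⟨s, hs', a, ha, _, rfl⟩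
    refine ⟨s, a 0, ?_, rfl⟩
    rw [hr.carrier hs']
    exact ha 0

theorem describable_imageRel :
    Describable fun B : Struc τ.withSets =>
      {z | z ∈ (B.reduct Vocab.sub_withSets).imageRel B.value} := by
  have hs := (HereditarilyFinite.of_pair (HereditarilyFinite.of_pair hτ).2).1
  have h1 : ∀ r ∈ {r | r ∈ τ.rels}, Describable fun B : Struc τ.withSets =>
      {z | ∃ (name : ZFSet.{u}) (k : ℕ) (σ a : Fin k → ZFSet.{u}), r = relSym name σ ∧
        ZFSet.pair r (tuple a) ∈ B.rel ∧
        z = ZFSet.pair r (tuple fun i => B.value (σ i) (a i))} := by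
    intro r hr
    obtain ⟨name, k, σ, hσ, rfl⟩ := τ.rels_typed r hr
    have h := describable_basic (τ := τ) hσ
      (G := fun B a => ZFSet.pair (relSym name σ) (tuple a) ∈ B.rel)
      (fun n σ' g hg => .rel (ZFSet.mem_union.2 (.inl hr)) g hg)
      (c := fun x => ZFSet.pair (relSym name σ) (tuple x)) fun n j g =>
        (hs.mem hr).d0_pair j (f := fun v => tuple fun i => v (g i))
          (D0.eq_tuple 0 fun i => (g i).succ.succ.succ.succ)
    convert h using 4 with B z
    constructor
    · rintro ⟨name', k', σ', a, e, h1, rfl⟩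
      obtain ⟨rfl, e'⟩ := relSym_inj.1 e
      obtain rfl := tuple_length e'
      obtain rfl := tuple_injective e'
      exact ⟨a, (Struc.rel_mem h1).2, h1, rfl⟩
    · rintro ⟨a, _, h1, rfl⟩
      exact ⟨name, k, σ, a, rfl, h1, rfl⟩
  have h2 := Describable.finite_union hs.finite h1
  convert h2 using 4 with B z
  rw [Struc.mem_imageRel]
  constructor
  · rintro ⟨name, k, σ, a, h, rfl⟩
    obtain ⟨hr, h'⟩ := pair_mem_pullSet.1 h
    exact ⟨_, hr, name, k, σ, a, rfl, h', rfl⟩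
  · rintro ⟨_, hr, name, k, σ, a, rfl, h, rfl⟩
    exact ⟨name, k, σ, a, pair_mem_pullSet.2 ⟨hr, h⟩, rfl⟩

theorem describable_imageFn :
    Describable fun B : Struc τ.withSets =>
      {z | z ∈ (B.reduct Vocab.sub_withSets).imageFn B.value} := by
  have hs := (HereditarilyFinite.of_pair (HereditarilyFinite.of_pair hτ).2).2
  have h1 : ∀ r ∈ {r | r ∈ τ.funs}, Describable fun B : Struc τ.withSets =>
      {z | ∃ (name : ZFSet.{u}) (k : ℕ) (σ a : Fin k → ZFSet.{u}) (s b : ZFSet.{u}),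
        r = funSym name σ s ∧ ZFSet.pair r (ZFSet.pair (tuple a) b) ∈ B.fn ∧
        z = ZFSet.pair r (ZFSet.pair (tuple fun i => B.value (σ i) (a i)) (B.value s b))} := by
    intro r hr
    obtain ⟨name, k, σ, s, hσ, hs', rfl⟩ := τ.funs_typed r hr
    have h := describable_basic (τ := τ) (ρ := Matrix.vecCons s σ)
      (fun i => by cases i using Fin.cases with
        | zero => exact hs'
        | succ i => exact hσ i)
      (G := fun B a => ZFSet.pair (funSym name σ s)
        (ZFSet.pair (tuple fun i => a (Fin.succ i)) (a 0)) ∈ B.fn)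
      (fun n σ' g hg => .fn (τ := τ.withSets) (nm := name) (ρ := σ) (s := s) hr (fun i => g i.succ)
        (fun i => hg i.succ) (g 0) (hg 0))
      (c := fun x => ZFSet.pair (funSym name σ s) (ZFSet.pair (tuple fun i => x (Fin.succ i)) (x 0)))
      fun n j g => (hs.mem hr).d0_pair j
          (f := fun v => ZFSet.pair (tuple fun i => v (g (Fin.succ i))) (v (g 0))) (by
        have := D0.eq_tuple.{u} (n := n + 4 + 4) (Fin.succ (Fin.succ 0))
          fun i => (g (Fin.succ i)).succ.succ.succ.succ.succ.succ.succ.succ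
        refine D0.congr (P := fun v : Fin (n + 4) → ZFSet.{u} => ∃ a b, v 0 = ZFSet.pair a b ∧
          ((a = tuple fun i => v (g (Fin.succ i)).succ.succ.succ.succ) ∧
            b = v (g 0).succ.succ.succ.succ)) inferInstance fun v => ?_
        constructor
        · exact fun h => ⟨_, _, h, rfl, rfl⟩
        · rintro ⟨_, _, h, rfl, rfl⟩; exact h)
    convert h using 4 with B z
    constructor
    · rintro ⟨name', k', σ', a, s', b, e, h1, rfl⟩
      obtain ⟨rfl, e', rfl⟩ := funSym_inj.1 e
      obtain rfl := tuple_length e'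
      obtain rfl := tuple_injective e'
      refine ⟨Matrix.vecCons b a, fun i => ?_, h1, rfl⟩
      cases i using Fin.cases with
      | zero => exact (Struc.fn_mem h1).2.2
      | succ i => exact (Struc.fn_mem h1).2.1 i
    · rintro ⟨a, _, h1, rfl⟩
      exact ⟨name, k, σ, _, s, _, rfl, h1, rfl⟩
  have h2 := Describable.finite_union hs.finite h1
  convert h2 using 4 with B z
  rw [Struc.mem_imageFn]
  constructor
  · rintro ⟨name, k, σ, a, s, b, h, rfl⟩
    obtain ⟨hr, h'⟩ := pair_mem_pullSet.1 h
    exact ⟨_, hr, name, k, σ, a, s, b, rfl, h', rfl⟩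
  · rintro ⟨_, hr, name, k, σ, a, s, b, rfl, h, rfl⟩
    exact ⟨name, k, σ, a, s, b, pair_mem_pullSet.2 ⟨hr, h⟩, rfl⟩

omit hτ in
/-- The code of the copy of the `τ`-reduct whose elements are the represented sets. -/
noncomputable def Struc.copyCode (B : Struc τ.withSets) : ZFSet.{u} :=
  ZFSet.pair τ.code (ZFSet.pair ((B.reduct Vocab.sub_withSets).imageDom B.value)
    (ZFSet.pair ((B.reduct Vocab.sub_withSets).imageRel B.value)
      ((B.reduct Vocab.sub_withSets).imageFn B.value)))

theorem defines_copyCode {n : ℕ} {σ : Fin n → ZFSet.{u}} (i : Fin n) (hi : σ i = τ.setSort) :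
    Defines {B : Struc τ.withSets | B.Interprets} False σ
      fun B w => B.collapse (w i) = B.copyCode := by
  have hD : D0 fun v : Fin 4 → ZFSet.{u} =>
      v 3 = ZFSet.pair τ.code (ZFSet.pair (v 2) (ZFSet.pair (v 1) (v 0))) :=
    hτ.d0_pair 3 (f := fun v => ZFSet.pair (v 2) (ZFSet.pair (v 1) (v 0)))
      (D0.congr (P := fun v : Fin 8 → ZFSet.{u} => ∃ a b, v 0 = ZFSet.pair a b ∧
        (a = v 6 ∧ b = ZFSet.pair (v 5) (v 4))) inferInstance fun v => by
      constructor
      · exact fun h => ⟨_, _, h, rfl, rfl⟩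
      · rintro ⟨_, _, h, rfl, rfl⟩; exact h)
  have h1 : Defines {B : Struc τ.withSets | B.Interprets} False σ fun B w =>
      ∃ d ∈ B.carrier τ.setSort, ∃ r ∈ B.carrier τ.setSort, ∃ f ∈ B.carrier τ.setSort,
        B.collapse d = (B.reduct Vocab.sub_withSets).imageDom B.value ∧
        B.collapse r = (B.reduct Vocab.sub_withSets).imageRel B.value ∧
        B.collapse f = (B.reduct Vocab.sub_withSets).imageFn B.value ∧
        B.collapse (w i) = ZFSet.pair τ.code (ZFSet.pair (B.collapse d)
          (ZFSet.pair (B.collapse r) (B.collapse f))) := by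
    refine .ex setSort_withSets (.ex setSort_withSets (.ex setSort_withSets (.and
      ((describable_imageDom hτ).defines_eq 2 rfl) (.and
      ((describable_imageRel hτ).defines_eq 1 rfl) (.and
      ((describable_imageFn hτ).defines_eq 0 rfl) ?_)))))
    exact (hD.defines_collapse ![0, 1, 2, i.succ.succ.succ] fun j => by
      fin_cases j
      exacts [rfl, rfl, rfl, hi]).mono fun B hB => hB.1
  refine h1.congr fun B hB w hw => ?_
  constructor
  · intro e
    have hM := hB.1.isTransitive
    have h2 : B.copyCode ∈ img B.collapse (B.carrier τ.setSort) :=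
      mem_img.2 ⟨w i, hi ▸ hw i, e⟩
    have h3 := (mem_of_pair_mem hM h2).2
    obtain ⟨d, hd, hd'⟩ := mem_img.1 (mem_of_pair_mem hM h3).1
    have h4 := (mem_of_pair_mem hM h3).2
    obtain ⟨r, hr, hr'⟩ := mem_img.1 (mem_of_pair_mem hM h4).1
    obtain ⟨f, hf, hf'⟩ := mem_img.1 (mem_of_pair_mem hM h4).2
    refine ⟨d, hd, r, hr, f, hf, hd', hr', hf', ?_⟩
    rw [e, hd', hr', hf']
    rfl
  · rintro ⟨d, _, r, _, f, _, hd, hr, hf, e⟩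
    rw [e, hd, hr, hf]
    rfl

end

/-! ### Bounded expansions -/

section

variable {τ : Vocab.{u}}

/-- The binary relation with the name `c` is a partial function from the sort `s` to the
sort `s'`. -/
def Struc.Functional (B : Struc τ) (c s s' : ZFSet.{u}) : Prop :=
  ∀ a ∈ B.carrier s, ∀ b ∈ B.carrier s', ∀ b' ∈ B.carrier s',
    B.bin c s s' a b → B.bin c s s' a b' → b = b'

theorem Defines.functional {C : Set (Struc τ)} {fo : Prop} {n : ℕ} {σ : Fin n → ZFSet.{u}}
    {c s s' : ZFSet.{u}} (h : relSym c ![s, s'] ∈ τ.rels) :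
    Defines C fo σ fun A _ => A.Functional c s s' := by
  have hs : s ∈ τ.sorts := τ.relSym_sorts h 0
  have hs' : s' ∈ τ.sorts := τ.relSym_sorts h 1
  exact .all hs (.all hs' (.all hs' (.imp (.bin h 2 1 rfl rfl) (.imp (.bin h 2 0 rfl rfl)
    (.eq 1 0 rfl)))))

theorem Struc.Functional.card_le {B : Struc τ} {c s s' x : ZFSet.{u}} (h : B.Functional c s s')
    (hx : ∀ b ∈ x, b ∈ B.carrier s' ∧ ∃ a ∈ B.carrier s, B.bin c s s' a b) :
    x.card ≤ (B.carrier s).card := by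
  refine card_le_of_surj (fun a => Classical.epsilon fun b => b ∈ B.carrier s' ∧ B.bin c s s' a b)
    fun b hb => ?_
  obtain ⟨hb', a, ha, hab⟩ := hx b hb
  have h1 := Classical.epsilon_spec (p := fun b => b ∈ B.carrier s' ∧ B.bin c s s' a b) ⟨b, hb', hab⟩
  exact ⟨a, ha, h a ha _ h1.1 b hb' h1.2 hab⟩

/-- The argument sort is covered by the sorts of `τ` and by the natural numbers, and the sort for
sets is covered by the argument sort and the value sort. -/
def Struc.Bounded (B : Struc τ.withSets) : Prop :=
  (∀ s ∈ insert τ.setSort {s | s ∈ τ.sorts}, B.Functional (num 0) s τ.argSort) ∧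
  B.Functional (num 0) τ.argSort τ.setSort ∧ B.Functional (num 0) τ.valSort τ.setSort ∧
  (∀ y ∈ B.carrier τ.argSort,
    (∃ s ∈ {s | s ∈ τ.sorts}, ∃ a ∈ B.carrier s, B.bin (num 0) s τ.argSort a y) ∨
    ∃ z ∈ B.carrier τ.setSort, IsNum (B.collapse z) ∧ B.bin (num 0) τ.setSort τ.argSort z y) ∧
  ∀ z ∈ B.carrier τ.setSort,
    (∃ y ∈ B.carrier τ.argSort, B.bin (num 0) τ.argSort τ.setSort y z) ∨
    ∃ y ∈ B.carrier τ.valSort, B.bin (num 0) τ.valSort τ.setSort y z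

theorem argSort_withSets : τ.argSort ∈ τ.withSets.sorts := Vocab.newSorts_withSets Vocab.argSort_mem

theorem valSort_withSets : τ.valSort ∈ τ.withSets.sorts := Vocab.newSorts_withSets Vocab.valSort_mem

theorem defines_bounded (hfin : {s | s ∈ τ.sorts}.Finite) {n : ℕ} {σ : Fin n → ZFSet.{u}} :
    Defines {B : Struc τ.withSets | B.Interprets} False σ fun B _ => B.Bounded := by
  have h1 : ∀ s ∈ insert τ.setSort {s | s ∈ τ.sorts},
      relSym (num 0) ![s, τ.argSort] ∈ τ.withSets.rels := fun s hs =>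
    Vocab.bin_mem (.inl rfl) (sorts_withSets hs) Vocab.argSort_mem
  have h2 := Vocab.bin_mem (τ := τ) (.inl rfl) argSort_withSets Vocab.setSort_mem
  have h3 := Vocab.bin_mem (τ := τ) (.inl rfl) valSort_withSets Vocab.setSort_mem
  refine .and (.finite_and setSort_withSets (hfin.insert _) fun s hs => .functional (h1 s hs))
    (.and (.functional h2) (.and (.functional h3) (.and (.all argSort_withSets (.or ?_ ?_))
      (.all setSort_withSets (.or (.ex argSort_withSets (.bin h2 0 1 rfl rfl))
        (.ex valSort_withSets (.bin h3 0 1 rfl rfl)))))))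
  · exact .finite_or setSort_withSets hfin fun s hs => .ex (sorts_withSets (.inr hs))
      (.bin (h1 s (.inr hs)) 0 1 rfl rfl)
  · refine .ex setSort_withSets (.and ?_ (.bin (h1 _ (.inl rfl)) 0 1 rfl rfl))
    exact ((inferInstance : D0 fun v : Fin 1 → ZFSet.{u} => IsNum (v 0)).defines_collapse ![0]
      fun j => by fin_cases j; rfl).mono fun B hB => hB.1

theorem Struc.Bounded.card_argSort_le {B : Struc τ.withSets} (hB : B.Bounded) (hS : B.SetLike)
    {κ : Cardinal.{u}} (hκ : ℵ₀ ≤ κ) (hA : (B.reduct Vocab.sub_withSets).card ≤ κ) :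
    (B.carrier τ.argSort).card ≤ κ := by
  set P : ZFSet.{u} → Prop := fun y => ∃ s ∈ {s | s ∈ τ.sorts}, ∃ a ∈ B.carrier s,
    B.bin (num 0) s τ.argSort a y
  set Q : ZFSet.{u} → Prop := fun y => ∃ z ∈ B.carrier τ.setSort, IsNum (B.collapse z) ∧
    B.bin (num 0) τ.setSort τ.argSort z y
  have hsub : B.carrier τ.argSort ⊆
      ZFSet.sep P (B.carrier τ.argSort) ∪ ZFSet.sep Q (B.carrier τ.argSort) := fun y hy =>
    ZFSet.mem_union.2 ((hB.2.2.2.1 y hy).imp (fun h => ZFSet.mem_sep.2 ⟨hy, h⟩)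
      fun h => ZFSet.mem_sep.2 ⟨hy, h⟩)
  refine (ZFSet.card_mono hsub).trans (card_union_le_of_infinite hκ ?_ (le_trans ?_ hκ))
  · refine (card_le_of_surj (fun p => Classical.epsilon fun y => y ∈ B.carrier τ.argSort ∧
      ∃ s ∈ τ.sorts, ∃ a ∈ B.carrier s, p = ZFSet.pair s a ∧ B.bin (num 0) s τ.argSort a y)
      fun y hy => ?_).trans hA
    obtain ⟨hy1, s, hs, a, ha, hay⟩ := ZFSet.mem_sep.1 hy
    refine ⟨ZFSet.pair s a, ?_, ?_⟩
    · rw [← mem_carrier, (B.isReduct_reduct Vocab.sub_withSets).carrier hs]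
      exact ha
    · have h1 := Classical.epsilon_spec (p := fun y => y ∈ B.carrier τ.argSort ∧ ∃ t ∈ τ.sorts,
        ∃ b ∈ B.carrier t, ZFSet.pair s a = ZFSet.pair t b ∧ B.bin (num 0) t τ.argSort b y)
        ⟨y, hy1, s, hs, a, ha, rfl, hay⟩
      obtain ⟨h2, t, _, b, _, h3, h4⟩ := h1
      obtain ⟨rfl, rfl⟩ := ZFSet.pair_inj.1 h3
      exact hB.1 s (.inr hs) a ha _ h2 y hy1 h4 hay
  · refine card_num_union_le (fun n => Classical.epsilon fun y => y ∈ B.carrier τ.argSort ∧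
      ∃ z ∈ B.carrier τ.setSort, B.collapse z = num n ∧ B.bin (num 0) τ.setSort τ.argSort z y)
      fun y hy => ?_
    obtain ⟨hy1, z, hz, hzn, hzy⟩ := ZFSet.mem_sep.1 hy
    obtain ⟨n, hn⟩ := isNum_iff.1 hzn
    refine ⟨n, ?_⟩
    obtain ⟨h2, z', hz', h3, h4⟩ := Classical.epsilon_spec (p := fun y => y ∈ B.carrier τ.argSort ∧
      ∃ z ∈ B.carrier τ.setSort, B.collapse z = num n ∧ B.bin (num 0) τ.setSort τ.argSort z y)
      ⟨y, hy1, z, hz, hn, hzy⟩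
    rw [(hS.collapse_inj hz' hz).1 (h3.trans hn.symm)] at h4
    exact hB.1 _ (.inl rfl) z hz _ h2 y hy1 h4 hzy

theorem Struc.Bounded.card_setSort_le {B : Struc τ.withSets} (hB : B.Bounded) {κ : Cardinal.{u}}
    (hκ : ℵ₀ ≤ κ) (h₀ : (B.carrier τ.argSort).card ≤ κ) (h₁ : (B.carrier τ.valSort).card ≤ κ) :
    (B.carrier τ.setSort).card ≤ κ := by
  set P : ZFSet.{u} → ZFSet.{u} → Prop := fun s z => ∃ y ∈ B.carrier s, B.bin (num 0) s τ.setSort y z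
  have hsub : B.carrier τ.setSort ⊆ ZFSet.sep (P τ.argSort) (B.carrier τ.setSort) ∪
      ZFSet.sep (P τ.valSort) (B.carrier τ.setSort) := fun y hy =>
    ZFSet.mem_union.2 ((hB.2.2.2.2 y hy).imp (fun h => ZFSet.mem_sep.2 ⟨hy, h⟩)
      fun h => ZFSet.mem_sep.2 ⟨hy, h⟩)
  exact (ZFSet.card_mono hsub).trans (card_union_le_of_infinite hκ
    ((hB.2.1.card_le fun b hb => ZFSet.mem_sep.1 hb).trans h₀)
    ((hB.2.2.1.card_le fun b hb => ZFSet.mem_sep.1 hb).trans h₁))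

theorem Struc.card_withSets_le {B : Struc τ.withSets} {κ : Cardinal.{u}} (hκ : ℵ₀ ≤ κ)
    (hA : (B.reduct Vocab.sub_withSets).card ≤ κ) (h : ∀ s ∈ τ.newSorts, (B.carrier s).card ≤ κ) :
    B.card ≤ κ := by
  have hsub : B.dom ⊆ (B.reduct Vocab.sub_withSets).dom ∪
      (img (ZFSet.pair τ.setSort) (B.carrier τ.setSort) ∪
        (img (ZFSet.pair τ.argSort) (B.carrier τ.argSort) ∪
          img (ZFSet.pair τ.valSort) (B.carrier τ.valSort))) := by
    intro p hp
    obtain ⟨s, hs, a, rfl⟩ := B.dom_typed p hp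
    have ha := mem_carrier.2 hp
    simp only [ZFSet.mem_union, mem_img]
    rcases ZFSet.mem_union.1 hs with hs | hs
    · exact .inl (((B.isReduct_reduct Vocab.sub_withSets).2.1 s hs a).2 hp)
    · simp only [Vocab.newSorts, ZFSet.mem_insert_iff, ZFSet.mem_singleton] at hs
      rcases hs with rfl | rfl | rfl
      exacts [.inr (.inl ⟨a, ha, rfl⟩), .inr (.inr (.inl ⟨a, ha, rfl⟩)),
        .inr (.inr (.inr ⟨a, ha, rfl⟩))]
  have himg : ∀ s ∈ τ.newSorts, (img (ZFSet.pair s) (B.carrier s)).card ≤ κ := fun s hs =>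
    (card_le_of_surj _ fun _ hb => mem_img.1 hb).trans (h s hs)
  exact (ZFSet.card_mono hsub).trans (card_union_le_of_infinite hκ hA
    (card_union_le_of_infinite hκ (himg _ Vocab.setSort_mem) (card_union_le_of_infinite hκ
      (himg _ Vocab.argSort_mem) (himg _ Vocab.valSort_mem))))

/-! ### Expansions that certify membership in a bounded `Σ₁` class -/

/-- The expansion `B` contains a copy of its `τ`-reduct together with a witness for membership of
the code of the copy in the class defined by `∃ y, ψ(x, y)`. -/
def Struc.Certifies (ψ : Delta0 noPredicates.{u} 2) (B : Struc τ.withSets) : Prop :=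
  B.Interprets ∧ (∀ s ∈ {s | s ∈ τ.sorts}, ∀ a ∈ B.carrier s, ∀ b ∈ B.carrier s,
    B.value s a = B.value s b → a = b) ∧
  (∃ x ∈ B.carrier τ.setSort, ∃ y ∈ B.carrier τ.setSort, B.collapse x = B.copyCode ∧
    ψ.Realize ![B.collapse x, B.collapse y]) ∧ B.Bounded

theorem exists_sentence_certifies (hτ : HereditarilyFinite τ.code) (ψ : Delta0 noPredicates.{u} 2) :
    ∃ φ : Formula.{u}, φ.IsSentence τ.withSets ∧
      ∀ B : Struc τ.withSets, φ.TrueIn B ↔ B.Certifies ψ := by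
  have hfin := (HereditarilyFinite.of_pair hτ).1.finite
  have key : Defines Set.univ False (![] : Fin 0 → ZFSet.{u})
      fun (B : Struc τ.withSets) _ => B.Certifies ψ := by
    refine .and_of_imp (defines_interprets hfin) (.mono (C := {B | B.Interprets}) ?_ fun B hB => hB.2)
    refine .and (.finite_and setSort_withSets hfin fun s hs => ?_) (.and ?_ (defines_bounded hfin))
    · have hs' : s ∈ τ.withSets.sorts := sorts_withSets (.inr hs)
      refine .all hs' (.all hs' (.imp ?_ (.eq 1 0 rfl)))
      have := (D0.eq.{u} (n := 2) 0 1).defines (τ := τ) (fo := False)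
        (σ := Matrix.vecCons s (Matrix.vecCons s (![] : Fin 0 → ZFSet.{u}))) ![1, 0] fun i => by
          fin_cases i
          exacts [.inr hs, .inr hs]
      exact this
    · refine .ex setSort_withSets (.ex setSort_withSets (.and (defines_copyCode hτ 1 rfl) ?_))
      refine ((ψ.defines ![1, 0] fun i => by fin_cases i <;> rfl).mono fun B hB => hB.1).congr
        fun B _ w _ => ?_
      have : (fun i => B.collapse (w ((![1, 0] : Fin 2 → Fin 2) i))) =
          ![B.collapse (w 1), B.collapse (w 0)] := by
        funext i; fin_cases i <;> rfl
      rw [this]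
      rfl
  obtain ⟨φ, h1, _, h2⟩ := key.exists_sentence
  exact ⟨φ, h1, h2⟩

theorem Struc.Certifies.mem {ψ : Delta0 noPredicates.{u} 2} {B : Struc τ.withSets}
    (hB : B.Certifies ψ) {K : Set (Struc τ)} (hK : IsoClosed K)
    (hψ : ∀ A : Struc τ, (∃ y, ψ.Realize ![A.code, y]) → A ∈ K) :
    B.reduct Vocab.sub_withSets ∈ K := by
  obtain ⟨_, h2, ⟨x, _, y, _, h3, h4⟩, _⟩ := hB
  have he : ∀ s, Set.InjOn (B.value s) {a | a ∈ (B.reduct Vocab.sub_withSets).carrier s} := by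
    intro s a ha b hb hab
    have hs := Struc.sort_mem (mem_carrier.1 ha)
    rw [Set.mem_ofPred_eq, (B.isReduct_reduct Vocab.sub_withSets).carrier hs] at ha hb
    exact h2 s hs a ha b hb hab
  rw [h3] at h4
  exact hK _ _ (isomorphic_image he).symm (hψ ((B.reduct Vocab.sub_withSets).image B.value he)
    ⟨_, h4⟩)

theorem Struc.Certifies.card_le {ψ : Delta0 noPredicates.{u} 2} {B : Struc τ.withSets}
    (hB : B.Certifies ψ) {F : Cardinal.{u} → Cardinal.{u}} (hF : Monotone F)
    (hBF : (B.carrier τ.valSort).card ≤ F (B.carrier τ.argSort).card) {κ : Cardinal.{u}}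
    (hκ : ℵ₀ ≤ κ) (hA : (B.reduct Vocab.sub_withSets).card ≤ κ) : B.card ≤ max κ (F κ) := by
  have h1 := hB.2.2.2.card_argSort_le hB.1.1 hκ hA
  have h1' := h1.trans (le_max_left κ (F κ))
  have h2 := (hBF.trans (hF h1)).trans (le_max_right κ (F κ))
  have hκ' := hκ.trans (le_max_left κ (F κ))
  refine card_withSets_le hκ' (hA.trans (le_max_left _ _)) fun s hs => ?_
  simp only [Vocab.newSorts, ZFSet.mem_insert_iff, ZFSet.mem_singleton] at hs
  rcases hs with rfl | rfl | rfl
  exacts [hB.2.2.2.card_setSort_le hκ' h1' h2, h1', h2]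

end

namespace Struc

variable {τ : Vocab.{u}} {A : Struc τ} {e e' : ZFSet.{u} → ZFSet.{u} → ZFSet.{u}}

theorem imageDom_congr (h : ∀ s, ∀ a ∈ A.carrier s, e s a = e' s a) :
    A.imageDom e = A.imageDom e' := by
  apply ZFSet.ext
  intro y
  rw [mem_imageDom, mem_imageDom]
  exact exists_congr fun s => exists_congr fun a => and_congr_right fun ha => by rw [h s a ha]

theorem imageRel_congr (h : ∀ s, ∀ a ∈ A.carrier s, e s a = e' s a) :
    A.imageRel e = A.imageRel e' := by
  apply ZFSet.ext
  intro y
  rw [mem_imageRel, mem_imageRel]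
  refine exists_congr fun _ => exists_congr fun _ => exists_congr fun σ => exists_congr fun a =>
    and_congr_right fun ha => ?_
  rw [show (fun i => e (σ i) (a i)) = fun i => e' (σ i) (a i) from
    funext fun i => h _ _ ((rel_mem ha).2 i)]

theorem imageFn_congr (h : ∀ s, ∀ a ∈ A.carrier s, e s a = e' s a) :
    A.imageFn e = A.imageFn e' := by
  apply ZFSet.ext
  intro y
  rw [mem_imageFn, mem_imageFn]
  refine exists_congr fun _ => exists_congr fun _ => exists_congr fun σ => exists_congr fun a =>
    exists_congr fun s => exists_congr fun b => and_congr_right fun ha => ?_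
  rw [show (fun i => e (σ i) (a i)) = fun i => e' (σ i) (a i) from
    funext fun i => h _ _ ((fn_mem ha).2.1 i), h s b (fn_mem ha).2.2]

theorem card_carrier_le (A : Struc τ) (s : ZFSet.{u}) : (A.carrier s).card ≤ A.card :=
  card_le_of_inj (ZFSet.pair s) (fun _ ha => mem_carrier.1 ha)
    fun _ _ _ _ h => (ZFSet.pair_inj.1 h).2

end Struc

/-- A small structure has a copy whose code belongs to a small adequate set. -/
theorem Struc.exists_small_copy {τ : Vocab.{u}} (hτ : HereditarilyFinite τ.code) (A : Struc τ)
    {κ : Cardinal.{u}} (hκ : ℵ₀ ≤ κ) (hA : A.card ≤ κ) :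
    ∃ (e : ZFSet.{u} → ZFSet.{u} → ZFSet.{u}) (he : ∀ s, Set.InjOn (e s) {a | a ∈ A.carrier s})
      (M : ZFSet.{u}), Adequate M ∧ M.card ≤ κ ∧ (A.image e he).code ∈ M := by
  set T : ZFSet.{u} := κ.ord.toZFSet with hTdef
  have hTc : T.card = κ := by rw [hTdef, Ordinal.card_toZFSet, Cardinal.card_ord]
  have hT : T.IsTransitive := (ZFSet.isOrdinal_toZFSet _).isTransitive
  choose e he he' using fun s => exists_inj_of_card_le (y := T)
    ((A.card_carrier_le s).trans (hA.trans hTc.ge))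
  set U : ZFSet.{u} := T ∪ trcl {τ.code}
  have hU : U.IsTransitive := hT.union (trcl_transitive _)
  have hUc : U.card ≤ κ := by
    refine card_union_le_of_infinite hκ hTc.le ?_
    rw [trcl_singleton]
    exact card_insert_le_of_infinite hκ (hτ.le.trans hκ)
  have hW := adequate_insClosure hU
  have hWc := card_insClosure_le U hκ hUc
  set W := insClosure U
  have hUW : U ⊆ W := subset_insClosure U
  have hcode : τ.code ∈ W := hUW (ZFSet.mem_union.2 (.inr (subset_trcl _ (ZFSet.mem_singleton.2 rfl))))
  have heW : ∀ s, ∀ a ∈ A.carrier s, e s a ∈ W := fun s a ha => hUW (ZFSet.mem_union.2 (.inl (he s a ha)))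
  have hsW : ∀ s ∈ τ.sorts, s ∈ W := fun s hs => hW.trans _ (hW.left hcode) hs
  have hrW : ∀ s ∈ τ.rels, s ∈ W := fun s hs => hW.trans _ (hW.left (hW.right hcode)) hs
  have hfW : ∀ s ∈ τ.funs, s ∈ W := fun s hs => hW.trans _ (hW.right (hW.right hcode)) hs
  have hd : A.imageDom e ⊆ W := by
    intro y hy
    obtain ⟨s, a, ha, rfl⟩ := mem_imageDom.1 hy
    exact hW.pair (hsW s (sort_mem (mem_carrier.1 ha))) (heW s a ha)
  have hr : A.imageRel e ⊆ W := by
    intro y hy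
    obtain ⟨name, k, σ, a, h, rfl⟩ := mem_imageRel.1 hy
    exact hW.pair (hrW _ (rel_mem h).1) (hW.tuple fun i => heW _ _ ((rel_mem h).2 i))
  have hf : A.imageFn e ⊆ W := by
    intro y hy
    obtain ⟨name, k, σ, a, s, b, h, rfl⟩ := mem_imageFn.1 hy
    exact hW.pair (hfW _ (fn_mem h).1) (hW.pair (hW.tuple fun i => heW _ _ ((fn_mem h).2.1 i))
      (heW _ _ (fn_mem h).2.2))
  have hins : ∀ x y : ZFSet.{u}, y ⊆ insert x y := fun x y _ h => ZFSet.mem_insert_of_mem x h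
  have h1 := isTransitive_insert hW.trans hd
  have h2 := isTransitive_insert h1 (hr.trans (hins _ _))
  have h3 := isTransitive_insert h2 ((hf.trans (hins _ _)).trans (hins _ _))
  have hM := adequate_insClosure h3
  refine ⟨e, fun s a ha b hb => he' s a ha b hb, _, hM, card_insClosure_le _ hκ
    (card_insert_le_of_infinite hκ (card_insert_le_of_infinite hκ
      (card_insert_le_of_infinite hκ hWc))), ?_⟩
  have hsub := subset_insClosure
    (insert (A.imageFn e) (insert (A.imageRel e) (insert (A.imageDom e) W)))
  refine hM.pair (hsub ?_) (hM.pair (hsub ?_) (hM.pair (hsub ?_) (hsub ?_)))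
  · exact hins _ _ (hins _ _ (hins _ _ hcode))
  · exact hins _ _ (hins _ _ (ZFSet.mem_insert _ _))
  · exact hins _ _ (ZFSet.mem_insert _ _)
  · exact ZFSet.mem_insert _ _

/-- Membership of a copy of `A` in a bounded `Σ₁` class is certified by an expansion of `A`. -/
theorem Struc.exists_certifies {τ : Vocab.{u}} {A : Struc τ}
    {e : ZFSet.{u} → ZFSet.{u} → ZFSet.{u}} (he : ∀ s, Set.InjOn (e s) {a | a ∈ A.carrier s})
    {M : ZFSet.{u}} (hM : Adequate M) (hMc : M.card ≤ max ℵ₀ A.card) (hcode : (A.image e he).code ∈ M)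
    {ψ : Delta0 noPredicates.{u} 2} {y : ZFSet.{u}} (hψ : ψ.Realize ![(A.image e he).code, y])
    {F : Cardinal.{u} → Cardinal.{u}} (hF : Monotone F)
    (hy : (trcl {y}).card ≤ F (max ℵ₀ A.card)) :
    ∃ B : Struc τ.withSets, A.IsReduct B ∧ B.Certifies ψ ∧
      (B.carrier τ.valSort).card ≤ F (B.carrier τ.argSort).card := by
  classical
  set V : ZFSet.{u} := M ∪ trcl {y}
  set N : ZFSet.{u} := A.dom ∪ ZFSet.sep IsNum M
  have hV : V.IsTransitive := hM.trans.union (trcl_transitive _)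
  have hMV : M ⊆ V := fun _ h => ZFSet.mem_union.2 (.inl h)
  have hyV : y ∈ V := ZFSet.mem_union.2 (.inr (subset_trcl _ (ZFSet.mem_singleton.2 rfl)))
  have hnum : ∀ n, num n ∈ N := fun n =>
    ZFSet.mem_union.2 (.inr (ZFSet.mem_sep.2 ⟨hM.num n, isNum_num n⟩))
  have hNc : max ℵ₀ A.card ≤ N.card := by
    refine max_le ?_ (ZFSet.card_mono fun _ h => ZFSet.mem_union.2 (.inl h))
    have hinj : Function.Injective fun n => equivShrink N ⟨num n, hnum n⟩ := fun m n h =>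
      num_injective (congrArg Subtype.val ((equivShrink N).injective h))
    have := Infinite.of_injective _ hinj
    exact Cardinal.aleph0_le_mk (Shrink N)
  obtain ⟨g, hg, hg'⟩ := exists_surj_of_card_le (hMc.trans hNc) ⟨_, hM.empty⟩
  have ne : ∀ s ∈ τ.sorts, s ≠ τ.setSort ∧ s ≠ τ.argSort ∧ s ≠ τ.valSort := fun s hs =>
    ⟨fun h => Vocab.newSorts_notMem Vocab.setSort_mem (h ▸ hs),
      fun h => Vocab.newSorts_notMem Vocab.argSort_mem (h ▸ hs),
      fun h => Vocab.newSorts_notMem Vocab.valSort_mem (h ▸ hs)⟩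
  let dom : ZFSet.{u} := ZFSet.prod {τ.setSort} V ∪ (ZFSet.prod {τ.argSort} N ∪
    ZFSet.prod {τ.valSort} (trcl {y}))
  have hdom : ∀ s a, ZFSet.pair s a ∈ dom ↔ s = τ.setSort ∧ a ∈ V ∨ s = τ.argSort ∧ a ∈ N ∨
      s = τ.valSort ∧ a ∈ trcl {y} := fun s a => by
    simp only [dom, ZFSet.mem_union, ZFSet.pair_mem_prod, ZFSet.mem_singleton]
  let R : ZFSet.{u} → ZFSet.{u} → ZFSet.{u} → ZFSet.{u} → ZFSet.{u} → Prop := fun c s s' a b =>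
    if s' = τ.setSort then
      if s = τ.setSort then if c = num 0 then a ∈ b else a = b
      else if s = τ.argSort then g a = b else if s = τ.valSort then a = b else e s a = b
    else if s = τ.setSort then a = b else ZFSet.pair s a = b
  let B : Struc τ.withSets := A.expand Vocab.sub_withSets rfl dom
    (fun p hp => by
      rcases ZFSet.mem_union.1 hp with hp | hp
      · obtain ⟨s, hs, a, _, rfl⟩ := ZFSet.mem_prod.1 hp
        obtain rfl := ZFSet.mem_singleton.1 hs
        exact ⟨_, setSort_withSets, a, rfl⟩
      · rcases ZFSet.mem_union.1 hp with hp | hp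
        · obtain ⟨s, hs, a, _, rfl⟩ := ZFSet.mem_prod.1 hp
          obtain rfl := ZFSet.mem_singleton.1 hs
          exact ⟨_, argSort_withSets, a, rfl⟩
        · obtain ⟨s, hs, a, _, rfl⟩ := ZFSet.mem_prod.1 hp
          obtain rfl := ZFSet.mem_singleton.1 hs
          exact ⟨_, valSort_withSets, a, rfl⟩)
    (fun s hs hs' => by
      have hs := (ZFSet.mem_union.1 hs).resolve_left hs'
      simp only [Vocab.newSorts, ZFSet.mem_insert_iff, ZFSet.mem_singleton] at hs
      rcases hs with rfl | rfl | rfl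
      · exact ⟨y, (hdom _ _).2 (.inl ⟨rfl, hyV⟩)⟩
      · exact ⟨num 0, (hdom _ _).2 (.inr (.inl ⟨rfl, hnum 0⟩))⟩
      · exact ⟨y, (hdom _ _).2 (.inr (.inr ⟨rfl, subset_trcl _ (ZFSet.mem_singleton.2 rfl)⟩))⟩)
    (fun s hs a h => by
      have := ne s hs
      rcases (hdom _ _).1 h with h | h | h
      exacts [this.1 h.1, this.2.1 h.1, this.2.2 h.1]) R
  have hAB : A.IsReduct B := Struc.isReduct_expand
  have hnew : ∀ s ∈ τ.newSorts, A.carrier s = ∅ := fun s hs =>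
    (ZFSet.eq_empty _).2 fun a ha => Vocab.newSorts_notMem hs (sort_mem (mem_carrier.1 ha))
  have cS : B.carrier τ.setSort = V := ZFSet.ext fun a => by
    refine Struc.mem_carrier_expand.trans ?_
    rw [hnew _ Vocab.setSort_mem, hdom]
    simp [Vocab.setSort_ne_argSort, Vocab.setSort_ne_valSort]
  have cN : B.carrier τ.argSort = N := ZFSet.ext fun a => by
    refine Struc.mem_carrier_expand.trans ?_
    rw [hnew _ Vocab.argSort_mem, hdom]
    simp [Vocab.setSort_ne_argSort.symm, Vocab.argSort_ne_valSort]
  have cY : B.carrier τ.valSort = trcl {y} := ZFSet.ext fun a => by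
    refine Struc.mem_carrier_expand.trans ?_
    rw [hnew _ Vocab.valSort_mem, hdom]
    simp [Vocab.setSort_ne_valSort.symm, Vocab.argSort_ne_valSort.symm]
  have cA : ∀ s ∈ τ.sorts, B.carrier s = A.carrier s := fun s hs => (hAB.carrier hs).symm
  have hbin : ∀ c s s', (c = num 0 ∨ c = num 1) → s ∈ τ.withSets.sorts → s' ∈ τ.newSorts →
      ∀ a ∈ B.carrier s, ∀ b ∈ B.carrier s', (B.bin c s s' a b ↔ R c s s' a b) :=
    fun c s s' hc hs hs' a ha b hb =>
      Struc.rel_expand (Vocab.bin_mem hc hs hs') (Vocab.bin_notMem hs') ha hb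
  have bE : ∀ a ∈ V, ∀ b ∈ V, (B.bin (num 0) τ.setSort τ.setSort a b ↔ a ∈ b) := fun a ha b hb =>
    (hbin _ _ _ (.inl rfl) setSort_withSets Vocab.setSort_mem a (cS ▸ ha) b (cS ▸ hb)).trans
      (by simp [R])
  have bI : ∀ a ∈ V, ∀ b ∈ V, (B.bin (num 1) τ.setSort τ.setSort a b ↔ a = b) := fun a ha b hb =>
    (hbin _ _ _ (.inr rfl) setSort_withSets Vocab.setSort_mem a (cS ▸ ha) b (cS ▸ hb)).trans
      (by simp [R])
  have bV : ∀ s ∈ τ.sorts, ∀ a ∈ A.carrier s, ∀ b ∈ V,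
      (B.bin (num 1) s τ.setSort a b ↔ e s a = b) := fun s hs a ha b hb =>
    (hbin _ _ _ (.inr rfl) (sorts_withSets (.inr hs)) Vocab.setSort_mem a (cA s hs ▸ ha) b
      (cS ▸ hb)).trans (by simp [R, ne s hs])
  have bA : ∀ s ∈ τ.sorts, ∀ a ∈ A.carrier s, ∀ b ∈ N,
      (B.bin (num 0) s τ.argSort a b ↔ ZFSet.pair s a = b) := fun s hs a ha b hb =>
    (hbin _ _ _ (.inl rfl) (sorts_withSets (.inr hs)) Vocab.argSort_mem a (cA s hs ▸ ha) b
      (cN ▸ hb)).trans (by simp [R, ne s hs, Vocab.setSort_ne_argSort.symm])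
  have bN : ∀ a ∈ V, ∀ b ∈ N, (B.bin (num 0) τ.setSort τ.argSort a b ↔ a = b) := fun a ha b hb =>
    (hbin _ _ _ (.inl rfl) setSort_withSets Vocab.argSort_mem a (cS ▸ ha) b (cN ▸ hb)).trans
      (by simp [R, Vocab.setSort_ne_argSort.symm])
  have bG : ∀ a ∈ N, ∀ b ∈ V, (B.bin (num 0) τ.argSort τ.setSort a b ↔ g a = b) := fun a ha b hb =>
    (hbin _ _ _ (.inl rfl) argSort_withSets Vocab.setSort_mem a (cN ▸ ha) b (cS ▸ hb)).trans
      (by simp [R, Vocab.setSort_ne_argSort.symm])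
  have bY : ∀ a ∈ trcl {y}, ∀ b ∈ V, (B.bin (num 0) τ.valSort τ.setSort a b ↔ a = b) :=
    fun a ha b hb =>
      (hbin _ _ _ (.inl rfl) valSort_withSets Vocab.setSort_mem a (cY ▸ ha) b (cS ▸ hb)).trans
        (by simp [R, Vocab.setSort_ne_valSort.symm, Vocab.argSort_ne_valSort.symm])
  have hS : B.SetLike := by
    rw [SetLike, cS]
    refine ⟨Subrelation.wf (r := InvImage (· ∈ ·) Subtype.val)
      (fun {a b} h => (bE a a.2 b b.2).1 h) (InvImage.wf _ ZFSet.mem_wf), fun a ha b hb h => ?_⟩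
    apply ZFSet.ext
    intro z
    constructor
    · exact fun hz => (bE z (hV _ ha hz) b hb).1 ((h z (hV _ ha hz)).1 ((bE z (hV _ ha hz) a ha).2 hz))
    · exact fun hz => (bE z (hV _ hb hz) a ha).1 ((h z (hV _ hb hz)).2 ((bE z (hV _ hb hz) b hb).2 hz))
  have hcol : ∀ a ∈ V, B.collapse a = a := by
    intro a
    induction a using ZFSet.inductionOn with
    | _ a ih =>
      intro ha
      apply ZFSet.ext
      intro z
      rw [hS.mem_collapse (by rw [cS]; exact ha), cS]
      constructor
      · rintro ⟨b, hb, hE, rfl⟩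
        have hba := (bE b hb a ha).1 hE
        rwa [ih b hba hb]
      · intro hz
        have hzV := hV _ ha hz
        exact ⟨z, hzV, (bE z hzV a ha).2 hz, ih z hz hzV⟩
  have heM : ∀ s, ∀ a ∈ A.carrier s, e s a ∈ V := fun s a ha => by
    have h1 : A.imageDom e ∈ M := hM.left (hM.right hcode)
    exact hMV (hM.right (hM.trans _ h1 (mem_imageDom.2 ⟨s, a, ha, rfl⟩)))
  have hI : B.Interprets := by
    refine ⟨hS, ?_, ?_, ?_⟩
    · rintro s (rfl | hs) a ha
      · rw [cS] at ha ⊢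
        exact ⟨a, ha, (bI a ha a ha).2 rfl⟩
      · rw [cA s hs] at ha
        rw [cS]
        exact ⟨_, heM s a ha, (bV s hs a ha _ (heM s a ha)).2 rfl⟩
    · rintro s (rfl | hs) a ha x hx x' hx' h h'
      · rw [cS] at ha hx hx'
        exact ((bI a ha x hx).1 h).symm.trans ((bI a ha x' hx').1 h')
      · rw [cA s hs] at ha
        rw [cS] at hx hx'
        exact ((bV s hs a ha x hx).1 h).symm.trans ((bV s hs a ha x' hx').1 h')
    · intro a ha
      rw [cS] at ha
      exact (bI a ha a ha).2 rfl
  have hval : ∀ s, ∀ a ∈ A.carrier s, B.value s a = e s a := fun s a ha => by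
    have hs := sort_mem (mem_carrier.1 ha)
    have h1 := heM s a ha
    rw [hI.value_eq (.inr hs) (by rw [cA s hs]; exact ha) (by rw [cS]; exact h1)
      ((bV s hs a ha _ h1).2 rfl), hcol _ h1]
  have hcopy : B.copyCode = (A.image e he).code := by
    have h1 : B.reduct Vocab.sub_withSets = A := hAB.eq_reduct.symm
    unfold copyCode
    rw [h1, imageDom_congr hval, imageRel_congr hval, imageFn_congr hval]
    rfl
  refine ⟨B, hAB, ⟨hI, ?_, ?_, ?_⟩, ?_⟩
  · intro s hs a ha b hb h
    rw [cA s hs] at ha hb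
    rw [hval s a ha, hval s b hb] at h
    exact he s ha hb h
  · refine ⟨_, by rw [cS]; exact hMV hcode, y, by rw [cS]; exact hyV, ?_, ?_⟩
    · rw [hcol _ (hMV hcode), hcopy]
    · rwa [hcol _ (hMV hcode), hcol _ hyV]
  · refine ⟨?_, ?_, ?_, ?_, ?_⟩
    · rintro s (rfl | hs) a ha b hb b' hb' h h'
      · rw [cS] at ha
        rw [cN] at hb hb'
        exact ((bN a ha b hb).1 h).symm.trans ((bN a ha b' hb').1 h')
      · rw [cA s hs] at ha
        rw [cN] at hb hb'
        exact ((bA s hs a ha b hb).1 h).symm.trans ((bA s hs a ha b' hb').1 h')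
    · intro a ha b hb b' hb' h h'
      rw [cN] at ha
      rw [cS] at hb hb'
      exact ((bG a ha b hb).1 h).symm.trans ((bG a ha b' hb').1 h')
    · intro a ha b hb b' hb' h h'
      rw [cY] at ha
      rw [cS] at hb hb'
      exact ((bY a ha b hb).1 h).symm.trans ((bY a ha b' hb').1 h')
    · intro z hz
      rw [cN] at hz
      rcases ZFSet.mem_union.1 hz with hz' | hz'
      · obtain ⟨s, hs, a, rfl⟩ := A.dom_typed _ hz'
        have ha := mem_carrier.2 hz'
        exact .inl ⟨s, hs, a, by rw [cA s hs]; exact ha, (bA s hs a ha _ hz).2 rfl⟩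
      · obtain ⟨h1, h2⟩ := ZFSet.mem_sep.1 hz'
        have h3 := hMV h1
        exact .inr ⟨z, by rw [cS]; exact h3, by rwa [hcol z h3], (bN z h3 z hz).2 rfl⟩
    · intro z hz
      rw [cS] at hz
      rcases ZFSet.mem_union.1 hz with hz' | hz'
      · obtain ⟨a, ha, hag⟩ := hg' z hz'
        exact .inl ⟨a, by rw [cN]; exact ha, (bG a ha z hz).2 hag⟩
      · exact .inr ⟨z, by rw [cY]; exact hz', (bY z hz' z hz).2 rfl⟩
  · rw [cY, cN]
    exact hy.trans (hF hNc)

theorem sigmaB_of_isSigma1 {F : Cardinal.{u} → Cardinal.{u}} (hF : DefinablyBounding F)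
    {τ : Vocab.{u}} (hτ : HereditarilyFinite τ.code) {K : Set (Struc τ)} (hK : IsoClosed K)
    {X : Set ZFSet.{u}} (hX : IsSigma1 noPredicates F X) (hKX : ∀ A : Struc τ, A ∈ K ↔ A.code ∈ X) :
    SigmaB LWF K := by
  obtain ⟨ψ, hψ, hψ'⟩ := hX
  obtain ⟨φ, hφ, hφ'⟩ := exists_sentence_certifies hτ ψ
  obtain ⟨τ', h, χ, hχ, hχ', hbd⟩ := hF.exists_expansion τ.withSets argSort_withSets
    valSort_withSets Vocab.argSort_ne_valSort
  have hsent : (φ.and χ).IsSentence τ' := by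
    have h1 := hφ.mono h
    refine ⟨⟨h1.1, hχ.1⟩, ?_⟩
    simp only [Formula.free, h1.2, hχ.2, Set.union_empty]
  have htrue : ∀ B : Struc τ', LWF.Models B (φ.and χ).code ↔
      (B.reduct h).Certifies ψ ∧ χ.TrueIn B := fun B => by
    rw [LWF_models hsent, ← hφ', ← hφ.trueIn_reduct h]
    obtain ⟨v, _⟩ := B.exists_assignment
    rw [hsent.trueIn_iff B v, (hφ.mono h).trueIn_iff B v, hχ.trueIn_iff B v]
    rfl
  have hred : ∀ (A : Struc τ) (B : Struc τ'), A.IsReduct B ↔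
      A = (B.reduct h).reduct Vocab.sub_withSets := by
    intro A B
    have h1 := (B.reduct h).isReduct_reduct (Vocab.sub_withSets (τ := τ))
    have h2 := B.isReduct_reduct h
    have h3 : ((B.reduct h).reduct Vocab.sub_withSets).IsReduct B :=
      ⟨⟨h1.1.1.trans h.1, h1.1.2.1.trans h.2.1, h1.1.2.2.trans h.2.2⟩,
        fun s hs a => (h1.2.1 s hs a).trans (h2.2.1 s (h1.1.1 hs) a),
        fun r hr a => (h1.2.2.1 r hr a).trans (h2.2.2.1 r (h1.1.2.1 hr) a),
        fun f hf a => (h1.2.2.2 f hf a).trans (h2.2.2.2 f (h1.1.2.2 hf) a)⟩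
    exact ⟨fun hA => hA.eq_reduct.trans h3.eq_reduct.symm, fun e => e ▸ h3⟩
  refine ⟨τ', (φ.and χ).code, ?_, ⟨_, hsent, rfl⟩, fun A => ⟨fun hA => ?_, ?_⟩, fun A => ?_⟩
  · exact ⟨Vocab.sub_withSets.1.trans h.1, Vocab.sub_withSets.2.1.trans h.2.1,
      Vocab.sub_withSets.2.2.trans h.2.2⟩
  · have hκ : ℵ₀ ≤ max ℵ₀ A.card := le_max_left _ _
    obtain ⟨e, he, M, hM, hMc, hcode⟩ := A.exists_small_copy hτ hκ (le_max_right _ _)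
    have hA' := (hKX _).1 (hK _ _ (Struc.isomorphic_image he) hA)
    obtain ⟨y, hy, hy'⟩ := hψ' _ hA'
    obtain ⟨B, hB1, hB2, hB3⟩ := Struc.exists_certifies he hM hMc hcode hy' hF.1
      ((card_trcl_singleton_le y).trans (hy.trans (hF.1 (hrank_le (hM.trans _ hcode) hM.trans hκ hMc))))
    obtain ⟨C, hC, hBC⟩ := (hχ' B).1 hB3
    have e1 : B = C.reduct h := hBC.eq_reduct
    refine ⟨C, (htrue C).2 ⟨e1 ▸ hB2, hC⟩, (hred A C).2 ?_⟩
    rw [← e1]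
    exact hB1.eq_reduct
  · rintro ⟨B, hB, hAB⟩
    obtain rfl := (hred A B).1 hAB
    exact ((htrue B).1 hB).1.mem hK fun A hA => (hKX A).2 ((hψ _).2 hA)
  · have hκ : ℵ₀ ≤ max ℵ₀ A.card := le_max_left _ _
    obtain ⟨μ, hμ⟩ := hbd (max (max ℵ₀ A.card) (F (max ℵ₀ A.card)))
    refine ⟨μ, fun B hB hAB => ?_⟩
    obtain rfl := (hred A B).1 hAB
    obtain ⟨h1, h2⟩ := (htrue B).1 hB
    exact hμ B h2 (h1.card_le hF.1 ((hχ' _).2 ⟨B, h2, B.isReduct_reduct h⟩) hκ (le_max_right _ _))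

theorem deltaB_of_isDelta1 {F : Cardinal.{u} → Cardinal.{u}} (hF : DefinablyBounding F)
    {τ : Vocab.{u}} (hτ : HereditarilyFinite τ.code) {K : Set (Struc τ)} (hK : IsoClosed K)
    (h : IsDelta1 noPredicates F (Struc.code '' K)) : DeltaB LWF K := by
  have hKX : ∀ A : Struc τ, A ∈ K ↔ A.code ∈ Struc.code '' K := fun A =>
    (Struc.code_injective.mem_set_image).symm
  exact ⟨sigmaB_of_isSigma1 hF hτ hK h.1 hKX, sigmaB_of_isSigma1 hF hτ
    (fun A B hAB hA hB => hA (hK B A hAB.symm hB)) h.2 fun A => not_congr (hKX A)⟩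

end Symbiosis

theorem proposition5p1 :
    BoundedlySymbiotic LWF.{u} noPredicates.{u} ∧
    (DefinablyBounding (id : Cardinal.{u} → Cardinal.{u}) ∧
      IsDelta1 noPredicates.{u} id LWF.{u}.satRel) ∧
    (∀ A : Struc oneBinary.{u}, A ∈ QEmpty ↔ A.IsWellFoundedExtensional) ∧
    Axiomatisable LWF.{u} QEmpty.{u} :=
  ⟨⟨⟨id, definablyBounding_id, isDelta1_satRel⟩,
    fun _ hF _ hτ _ hK h => deltaB_of_isDelta1 hF hτ hK h⟩,
    ⟨definablyBounding_id, isDelta1_satRel⟩, mem_QEmpty_iff, axiomatisable_QEmpty⟩
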